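/- **Setting.** Let $\Lambda<0$, $T,R>0$, $k\ge 2$. On $[0,T]\times[0,\frac1R]\times S^2$ with coordinates $(x^0,x^1,x^2,x^3)=(\tau,z,x_2,x_3)$ let $$g=-z^2V\,d\tau^2+2\,d\tau\,dz+e^{-2\eta}h_{AB}(dx^A-U^Ad\tau)(dx^B-U^Bd\tau)$$ be a metric that is $C^k$ up to $z=0$ (the conformal metric of an asymptotically anti-de Sitter metric in Bondi–Sachs form, $z=1/r$). Here $(h_{AB})$ is a Riemannian metric on $S^2$ with the area element of the round metric, and at $z=0$: $z^2V=-\Lambda/3$, $\eta=0$, $h_{AB}$ is the round metric, and $z^{-1}U^A\to0$ as $z\to 0$. On $S^2$ we use the two stereographic coordinate systems; norms and integrals of coordinate derivatives are sums over the two closed hemispheres, each in the chart that maps it to the unit disk. Let $N_1=\nabla\tau$, $N_2=-(\nabla z-\frac12z^2V\nabla\tau)$. Let $\mathcal I=\{z=0,\ 0<\tau<T\}$ and $\Omega_T=\{0<\tau<T,\ 0<z<\frac1R\}$. Let $\mathcal H$ be the ingoing null cone generated by the null geodesics through the sphere $\{\tau=z=0\}$ with tangent $N_2$ there. Assume that for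 $0\le\tau\le T$ it is, within $\{0\le z\le\frac1R\}$, a regular null hypersurface nowhere tangent to $\{\tau=\mathrm{const}\}$: a graph $z=Z(\tau,y)$, $y\in S^2$, with $Z\in C^2$ and $Z(0,\cdot)=0$. Let $\mathcal M_2\cap\Omega_T$ be the part of $\Omega_T$ with $0<z<Z(\tau,y)$, between $\mathcal I$ and $\mathcal H$. Take the null normal $N_{\mathcal H}=\nabla(Z-z)=l_1N_1+l_2N_2+l_3e_3+l_4e_4$ (so $l_2=1$), with $e_3,e_4$ an orthonormal frame of the spheres $\tau,z=\mathrm{const}$, and let $d\mathcal H$ be the volume element with $d\Omega=|d(Z-z)\wedge d\mathcal H|$, where $d\Omega$ is the volume element of $g$. Put $E_1=\frac{l_3}{l_2}N_1+e_3$, $E_2=\frac{l_4}{l_2}N_1+e_4$, $E_3=N_2+\frac{l_3}{2l_2}e_3+\frac{l_4}{2l_2}e_4$ and $$E_{\mathcal H}[\phi,b_1,b_2]=\tfrac{b_1l_2}{2}\big[(E_1\phi)^2+(E_2\phi)^2\big]+b_2l_2(E_3\phi)^2+\tfrac{b_2l_2}{4}\big(\tfrac{l_3}{l_2}E_2\phi-\tfrac{l_4}{l_2}E_1\phi\big)^2+(b_2l_1+b_1l_2)\phi^2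 .$$ For a positive function $h$ put $\|u\|_{H^p_h}=\sum_{i=0}^p\|h^{1/2}\nabla^iu\|_{L^2}$, where $|\nabla^iu|^2=\sum_{|\alpha|=i}|\partial^\alpha u|^2$ with coordinate derivatives, $L^2_h=H^0_h$, only derivatives along $\mathcal I$ are used on $\mathcal I$, and integrals over $\mathcal M_2\cap\Omega_T$ and $\mathcal I$ are taken with $d\Omega=|\det g|^{1/2}d\tau\,dz\,dx_2dx_3$ and $|\det g|^{1/2}d\tau\,dx_2dx_3$. Here the weight $h$ is not to be confused with $h_{AB}$. **Theorem.** Let $a^i$ and $\omega$ be a vector field and a function of class $C^{k-1}$ up to the boundary of $\mathcal M_2\cap\Omega_T$, let $v$ be of class $C^{k+1}$ up to that boundary, and suppose $$\Box_gv+a^i\partial_iv+\omega v=f\ \text{ in }\mathcal M_2\cap\Omega_T,\qquad v|_{\mathcal I}=\psi_2 .$$ Then there are $l>0$, $q_0>0$ and $C>0$ such that for all $q\ge q_0$ and $h=e^{-ql\tau+qz}$, $$\begin{aligned}&\sum_{|\alpha|=k-1}q^{\frac12}\|\partial^\alpha v\|_{H^1_h(\mathcal M_2\cap\Omega_T)}+\sum_{|\alpha|=k}\|\partial^\alpha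 v\|_{L^2_h(\mathcal I)}\\ &\quad\le C\Big\{\sum_{|\alpha|\le k-1}\Big(\int_{\mathcal H}h\,E_{\mathcal H}[\partial^\alpha v,1,1]\,d\mathcal H\Big)^{\frac12}+\|\psi_2\|_{H^k_h(\mathcal I)}+\|f\|_{H^{k-1}_h(\mathcal M_2\cap\Omega_T)}\Big\}.\end{aligned}$$ With all norms taken over $\mathcal M_2\cap\Omega_T$, $l$ depends only on $\Lambda$, on bounds for $|g^{ij}|_{C^1}$, $|a^i|_{L^\infty}$, $|\omega|_{L^\infty}$, and on a positive lower bound for the eigenvalues of $(g^{AB})_{A,B=2,3}$; $q_0$ depends only on these and on $k$; $C$ depends only on these, on $k$, and on bounds for $|g^{ij}|_{C^k}$, $|a^i|_{C^{k-1}}$, $|\omega|_{C^{k-1}}$. In particular $l,q_0,C$ do not depend on $v,f,\psi_2,T,R$, and $C$ does not depend on $q$. -/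

import Mathlib

open Set Filter Topology MeasureTheory

noncomputable section

namespace NullTimelike

/-! ### The manifold and its coordinates -/

/-- Euclidean three-space, in which the sphere sits. -/
abbrev E3 : Type := EuclideanSpace ℝ (Fin 3)

/-- The unit two-sphere. -/
abbrev S2 : Type := Metric.sphere (0 : EuclideanSpace ℝ (Fin 3)) 1

/-- Points `(τ, z, y)` of `ℝ × ℝ × S²`. -/
abbrev ST : Type := ℝ × ℝ × S2

/-- Coordinates `(X 0, X 1, X 2, X 3) = (τ, z, x₂, x₃)`. -/
abbrev Coord : Type := Fin 4 → ℝ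

/-- The sign of the pole that a stereographic chart leaves out. -/
def poleSign : Bool → ℝ
  | true => 1
  | false => -1

theorem stereo_mem (s x y : ℝ) (hs : s ^ 2 = 1) :
    (!₂[2 * x / (1 + x ^ 2 + y ^ 2), 2 * y / (1 + x ^ 2 + y ^ 2),
      s * (x ^ 2 + y ^ 2 - 1) / (1 + x ^ 2 + y ^ 2)] : E3) ∈
      Metric.sphere (0 : EuclideanSpace ℝ (Fin 3)) 1 := by
  have hpos : (1 + x ^ 2 + y ^ 2) ≠ 0 := by positivity
  have hn : s ^ 2 * (x ^ 2 + y ^ 2 - 1) ^ 2 = (x ^ 2 + y ^ 2 - 1) ^ 2 := by rw [hs, one_mul]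
  rw [mem_sphere_zero_iff_norm, EuclideanSpace.norm_eq, Real.sqrt_eq_one]
  simp only [Fin.sum_univ_three, Real.norm_eq_abs, sq_abs]
  simp only [Matrix.cons_val_zero, Matrix.cons_val_one, Matrix.cons_val]
  field_simp
  rw [hn]
  ring

theorem poleSign_sq (ε : Bool) : poleSign ε ^ 2 = 1 := by
  cases ε <;> norm_num [poleSign]

/-- Inverse stereographic projection from the pole `(0, 0, ±1)`. The two closed unit disks are
mapped onto the two closed hemispheres. -/
def stereo (ε : Bool) (x y : ℝ) : S2 :=
  ⟨_, stereo_mem (poleSign ε) x y (poleSign_sq ε)⟩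

/-- The two local coordinate systems `(τ, z, x₂, x₃)` of `ℝ × ℝ × S²`. -/
def chart (ε : Bool) (X : Coord) : ST := (X 0, X 1, stereo ε (X 2) (X 3))

/-- The `S²`-part of the coordinate vector `∂_j` (it vanishes for `j = 0, 1`). -/
def sphVec (ε : Bool) (X : Coord) (j : Fin 4) : E3 :=
  fderiv ℝ (fun Y : Coord => ((stereo ε (Y 2) (Y 3) : S2) : E3)) X (Pi.single j 1)

/-- The coordinate derivative `∂_j u`. -/
def pd (j : Fin 4) (u : Coord → ℝ) : Coord → ℝ := fun X => fderiv ℝ u X (Pi.single j 1)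

/-- The coordinate derivative `∂^α u` for a multi-index `α = (α₀, α₁, α₂, α₃)`. -/
def mpd (α : Fin 4 → ℕ) (u : Coord → ℝ) : Coord → ℝ :=
  (pd 0)^[α 0] ((pd 1)^[α 1] ((pd 2)^[α 2] ((pd 3)^[α 3] u)))

/-- The multi-indices with `|α| = n`. -/
def multi (n : ℕ) : Finset (Fin 4 → ℕ) := Finset.piAntidiag Finset.univ n

/-- The multi-indices with `|α| = n` without `z`-derivatives. -/
def multiTan (n : ℕ) : Finset (Fin 4 → ℕ) := (multi n).filter fun α => α 1 = 0

/-- The closed slab `0 ≤ τ ≤ T`, `0 ≤ z ≤ 1/R`. -/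
def slab (T R : ℝ) : Set ST :=
  {p | 0 ≤ p.1 ∧ p.1 ≤ T ∧ 0 ≤ p.2.1 ∧ p.2.1 ≤ 1 / R}

/-- `Ω_T`. -/
def OmegaT (T R : ℝ) : Set ST :=
  {p | 0 < p.1 ∧ p.1 < T ∧ 0 < p.2.1 ∧ p.2.1 < 1 / R}

/-! ### The conformal metric -/

/-- The functions and tensors in the Bondi-Sachs form of the conformal metric:
`W = z² V`, `η`, the vector `U` tangent to the sphere and the metric `h` on the sphere. -/
structure BondiData where
  W : ST → ℝ
  η : ST → ℝ
  U : ST → E3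
  h : ST → E3 →ₗ[ℝ] E3 →ₗ[ℝ] ℝ

/-- The components of
`ĝ = - z² V dτ² + 2 dτ dz + e^{-2η} h_{AB} (dx^A - U^A dτ) (dx^B - U^B dτ)`. -/
def gLow (G : BondiData) (ε : Bool) (X : Coord) : Matrix (Fin 4) (Fin 4) ℝ :=
  Matrix.of fun i j =>
    let dτ : Fin 4 → ℝ := fun a => if a = 0 then 1 else 0
    let dz : Fin 4 → ℝ := fun a => if a = 1 then 1 else 0
    let θ : Fin 4 → E3 := fun a => sphVec ε X a - dτ a • G.U (chart ε X)
    (dτ i * dz j + dz i * dτ j) - G.W (chart ε X) * dτ i * dτ j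
      + Real.exp (-2 * G.η (chart ε X)) * G.h (chart ε X) (θ i) (θ j)

/-- The components `g^{ij}` of the inverse metric. -/
def gUp (G : BondiData) (ε : Bool) (X : Coord) : Matrix (Fin 4) (Fin 4) ℝ := (gLow G ε X)⁻¹

/-- The density `|det g|^{1/2}` of the volume element. -/
def volDensity (G : BondiData) (ε : Bool) (X : Coord) : ℝ := Real.sqrt |(gLow G ε X).det|

/-- `g(v, w)` for vectors at the point with coordinates `X`. -/
def ip (G : BondiData) (ε : Bool) (X : Coord) (v w : Fin 4 → ℝ) : ℝ :=
  ∑ i, ∑ j, gLow G ε X i j * v i * w j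

/-- The derivative of `φ` along the vector `v` at `X`. -/
def along (v : Fin 4 → ℝ) (φ : Coord → ℝ) (X : Coord) : ℝ := ∑ i, v i * pd i φ X

/-- The wave operator `|g|^{-1/2} ∂_i (|g|^{1/2} g^{ij} ∂_j u)`. -/
def box (G : BondiData) (ε : Bool) (u : Coord → ℝ) (X : Coord) : ℝ :=
  (volDensity G ε X)⁻¹ *
    ∑ i, ∑ j, pd i (fun Y => volDensity G ε Y * gUp G ε Y i j * pd j u Y) X

/-- The metric is asymptotically anti-de Sitter with cosmological constant `Λ` and satisfies the
conformal `C^k` condition: the conformal metric is `C^k` up to `z = 0` on the slab. -/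
structure IsAsymptoticallyAdS (G : BondiData) (Λ T R : ℝ) (k : ℕ) : Prop where
  U_tangent : ∀ p ∈ slab T R, inner ℝ (G.U p) (p.2.2 : E3) = 0
  h_symm : ∀ p ∈ slab T R, ∀ ξ ζ : E3, inner ℝ ξ (p.2.2 : E3) = 0 → inner ℝ ζ (p.2.2 : E3) = 0 →
    G.h p ξ ζ = G.h p ζ ξ
  h_pos : ∀ p ∈ slab T R, ∀ ξ : E3, inner ℝ ξ (p.2.2 : E3) = 0 → ξ ≠ 0 → 0 < G.h p ξ ξ
  /-- `h` has the area element of the round sphere. -/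
  h_det : ∀ ε X, chart ε X ∈ slab T R →
    G.h (chart ε X) (sphVec ε X 2) (sphVec ε X 2) * G.h (chart ε X) (sphVec ε X 3) (sphVec ε X 3)
        - G.h (chart ε X) (sphVec ε X 2) (sphVec ε X 3) ^ 2
      = inner ℝ (sphVec ε X 2) (sphVec ε X 2) * inner ℝ (sphVec ε X 3) (sphVec ε X 3)
        - inner ℝ (sphVec ε X 2) (sphVec ε X 3) ^ 2
  smooth : ∀ ε X, chart ε X ∈ slab T R → ∀ i j, ContDiffAt ℝ k (fun Y => gLow G ε Y i j) X
  W_infty : ∀ τ ∈ Icc 0 T, ∀ y : S2, G.W (τ, 0, y) = - Λ / 3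
  η_infty : ∀ τ ∈ Icc 0 T, ∀ y : S2, G.η (τ, 0, y) = 0
  /-- `r U → 0` at infinity, where `r = 1 / z`. -/
  U_infty : ∀ τ ∈ Icc 0 T, ∀ y : S2,
    Tendsto (fun z : ℝ => z⁻¹ • G.U (τ, z, y)) (𝓝[>] 0) (𝓝 0)
  /-- `h` tends to the round metric. -/
  h_infty : ∀ τ ∈ Icc 0 T, ∀ y : S2, ∀ ξ ζ : E3,
    inner ℝ ξ (y : E3) = 0 → inner ℝ ζ (y : E3) = 0 → G.h (τ, 0, y) ξ ζ = inner ℝ ξ ζ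

/-! ### Null vectors, null cones, and the null hypersurface `𝓗` -/

/-- `N₁ = ∇τ`. -/
def N1 (G : BondiData) (ε : Bool) (X : Coord) : Fin 4 → ℝ := fun i => gUp G ε X i 0

/-- `N₂ = -(∇z - ½ z² V ∇τ)`. -/
def N2 (G : BondiData) (ε : Bool) (X : Coord) : Fin 4 → ℝ := fun i =>
  -(gUp G ε X i 1 - 1 / 2 * G.W (chart ε X) * gUp G ε X i 0)

/-- The Christoffel symbols `Γ^a_{bc}`. -/
def christoffel (G : BondiData) (ε : Bool) (X : Coord) (a b c : Fin 4) : ℝ :=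
  1 / 2 * ∑ d, gUp G ε X a d *
    (pd b (fun Y => gLow G ε Y d c) X + pd c (fun Y => gLow G ε Y d b) X
      - pd d (fun Y => gLow G ε Y b c) X)

/-- The curve `γ` satisfies the geodesic equation at the parameter `t`. -/
def IsGeodesicAt (G : BondiData) (γ : ℝ → ST) (t : ℝ) : Prop :=
  ∃ (ε : Bool) (c : ℝ → Coord), ContDiffAt ℝ 2 c t ∧ (∀ᶠ s in 𝓝 t, chart ε (c s) = γ s) ∧
    ∀ a, deriv (deriv c) t a
      + ∑ b, ∑ d, christoffel G ε (c t) a b d * deriv c t b * deriv c t d = 0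

/-- The curve `γ` has velocity `N₂` at the parameter `t`. -/
def HasVelocityN2 (G : BondiData) (γ : ℝ → ST) (t : ℝ) : Prop :=
  ∃ (ε : Bool) (c : ℝ → Coord), (∀ᶠ s in 𝓝 t, chart ε (c s) = γ s) ∧
    HasDerivAt c (N2 G ε (c t)) t

/-- The part in the slab of the ingoing null cone generated by the null geodesics that start on
the sphere `S_{0,0} = {τ = 0, z = 0}` with velocity `N₂`. The parameter runs in both directions,
so the orientation of `N₂` is immaterial. -/
def nullCone (G : BondiData) (T R : ℝ) : Set ST :=
  {p | ∃ (γ : ℝ → ST) (b : ℝ), γ b = p ∧ (∃ y : S2, γ 0 = (0, 0, y)) ∧ HasVelocityN2 G γ 0 ∧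
    ∀ t ∈ uIcc 0 b, γ t ∈ slab T R ∧ IsGeodesicAt G γ t}

/-- The function `Z - z`, which vanishes on the graph `z = Z(τ, y)`. -/
def graphFun (Z : ℝ → S2 → ℝ) (ε : Bool) (X : Coord) : ℝ := Z (X 0) (stereo ε (X 2) (X 3)) - X 1

/-- Up to time `T`, the null cone `𝓗` is a regular null hypersurface inside `{0 ≤ z ≤ 1/R}` that is
nowhere tangent to the hypersurfaces `τ = const`: it is the graph of a `C²` function
`z = Z(τ, y)`. -/
structure IsRegularNullCone (G : BondiData) (T R : ℝ) (Z : ℝ → S2 → ℝ) : Prop where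
  eq_graph : nullCone G T R = {p | p.1 ∈ Icc 0 T ∧ p.2.1 = Z p.1 p.2.2}
  start : ∀ y, Z 0 y = 0
  smooth : ∀ ε X, X 0 ∈ Icc 0 T → ContDiffAt ℝ 2 (graphFun Z ε) X
  null : ∀ ε X, X 0 ∈ Icc 0 T → graphFun Z ε X = 0 →
    ∑ i, ∑ j, gUp G ε X i j * pd i (graphFun Z ε) X * pd j (graphFun Z ε) X = 0

/-- `𝓜₂ ∩ Ω_T`: the points of `Ω_T` between `𝓘 = {z = 0}` and `𝓗 = {z = Z}`. -/
def M2 (T R : ℝ) (Z : ℝ → S2 → ℝ) : Set ST := OmegaT T R ∩ {p | p.2.1 < Z p.1 p.2.2}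

/-- The closed region between `𝓘` and `𝓗` for `0 ≤ τ ≤ T`. -/
def M2closed (T R : ℝ) (Z : ℝ → S2 → ℝ) : Set ST := slab T R ∩ {p | p.2.1 ≤ Z p.1 p.2.2}

/-- The null normal `N_𝓗 = ∇(Z - z)` of `𝓗`, normalized by `g(N_𝓗, N₁) = -1`. -/
def NH (G : BondiData) (Z : ℝ → S2 → ℝ) (ε : Bool) (X : Coord) : Fin 4 → ℝ := fun i =>
  ∑ j, gUp G ε X i j * pd j (graphFun Z ε) X

/-- The first vector of an orthonormal frame of the spheres `τ, z = const`. -/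
def e3 (G : BondiData) (ε : Bool) (X : Coord) : Fin 4 → ℝ :=
  (Real.sqrt (gLow G ε X 2 2))⁻¹ • (Pi.single 2 1 : Fin 4 → ℝ)

/-- The second vector of that orthonormal frame (Gram-Schmidt). -/
def e4 (G : BondiData) (ε : Bool) (X : Coord) : Fin 4 → ℝ :=
  let w : Fin 4 → ℝ := (Pi.single 3 1 : Fin 4 → ℝ)
    - (gLow G ε X 2 3 / gLow G ε X 2 2) • (Pi.single 2 1 : Fin 4 → ℝ)
  (Real.sqrt (ip G ε X w w))⁻¹ • w

/-- The energy density `E_𝓗[φ, b₁, b₂]`, where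
`N_𝓗 = l₁ N₁ + l₂ N₂ + l₃ e₃ + l₄ e₄`. -/
def energyH (G : BondiData) (Z : ℝ → S2 → ℝ) (ε : Bool) (φ : Coord → ℝ) (b₁ b₂ : ℝ)
    (X : Coord) : ℝ :=
  let l₁ := - ip G ε X (NH G Z ε X) (N2 G ε X)
  let l₂ := - ip G ε X (NH G Z ε X) (N1 G ε X)
  let l₃ := ip G ε X (NH G Z ε X) (e3 G ε X)
  let l₄ := ip G ε X (NH G Z ε X) (e4 G ε X)
  let D₁ := along ((l₃ / l₂) • N1 G ε X + e3 G ε X) φ X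
  let D₂ := along ((l₄ / l₂) • N1 G ε X + e4 G ε X) φ X
  let D₃ := along (N2 G ε X + (l₃ / (2 * l₂)) • e3 G ε X + (l₄ / (2 * l₂)) • e4 G ε X) φ X
  b₁ * l₂ / 2 * (D₁ ^ 2 + D₂ ^ 2) + b₂ * l₂ * D₃ ^ 2
    + b₂ * l₂ / 4 * (l₃ / l₂ * D₂ - l₄ / l₂ * D₁) ^ 2 + (b₂ * l₁ + b₁ * l₂) * φ X ^ 2

/-! ### Weighted norms

Functions and their coordinate derivatives are families `u ε` of functions in the two charts; an
integral over the sphere is the sum of the integrals over the two hemispheres. -/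

/-- The weight `h = e^{-qlτ + qz}`. -/
def wt (q l : ℝ) (X : Coord) : ℝ := Real.exp (-q * l * X 0 + q * X 1)

/-- `∫_{𝓜₂ ∩ Ω_T} F dΩ`. -/
def intM2 (G : BondiData) (T R : ℝ) (Z : ℝ → S2 → ℝ) (F : Bool → Coord → ℝ) : ℝ :=
  ∑ ε, ∫ X in {X : Coord | chart ε X ∈ M2 T R Z ∧ X 2 ^ 2 + X 3 ^ 2 ≤ 1},
    F ε X * volDensity G ε X

/-- The set of `(τ, x₂, x₃)` with `0 < τ < T` and `(x₂, x₃)` in the unit disk. -/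
def tanCell (T : ℝ) : Set (Fin 3 → ℝ) := {Y | 0 < Y 0 ∧ Y 0 < T ∧ Y 1 ^ 2 + Y 2 ^ 2 ≤ 1}

/-- The integral over `𝓘`, for `0 < τ < T`; at `z = 0` the density is that of `dτ dΣ`. -/
def intI (G : BondiData) (T : ℝ) (F : Bool → Coord → ℝ) : ℝ :=
  ∑ ε, ∫ Y in tanCell T,
    F ε ![Y 0, 0, Y 1, Y 2] * volDensity G ε ![Y 0, 0, Y 1, Y 2]

/-- The integral `∫_𝓗 F d𝓗`, for `0 < τ < T`, with the volume element that belongs to the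
normal `N_𝓗 = ∇(Z - z)`, that is, `dΩ = |d(Z - z) ∧ d𝓗|`. -/
def intH (G : BondiData) (T : ℝ) (Z : ℝ → S2 → ℝ) (F : Bool → Coord → ℝ) : ℝ :=
  ∑ ε, ∫ Y in tanCell T,
    F ε ![Y 0, Z (Y 0) (stereo ε (Y 1) (Y 2)), Y 1, Y 2]
      * volDensity G ε ![Y 0, Z (Y 0) (stereo ε (Y 1) (Y 2)), Y 1, Y 2]

/-- `‖u‖_{H^p_h(𝓜₂ ∩ Ω_T)} = ∑_{i ≤ p} ‖h^{1/2} ∇^i u‖_{L²}`. -/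
def normM2 (G : BondiData) (T R : ℝ) (Z : ℝ → S2 → ℝ) (q l : ℝ) (p : ℕ)
    (u : Bool → Coord → ℝ) : ℝ :=
  ∑ i ∈ Finset.range (p + 1), Real.sqrt (intM2 G T R Z fun ε X =>
    wt q l X * ∑ α ∈ multi i, mpd α (u ε) X ^ 2)

/-- `‖u‖_{H^p_h(𝓘)}`, with derivatives along `𝓘` only. -/
def normI (G : BondiData) (T q l : ℝ) (p : ℕ) (u : Bool → Coord → ℝ) : ℝ :=
  ∑ i ∈ Finset.range (p + 1), Real.sqrt (intI G T fun ε X =>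
    wt q l X * ∑ α ∈ multiTan i, mpd α (u ε) X ^ 2)

/-- `(∫_𝓗 h E_𝓗[φ, 1, 1] d𝓗)^{1/2}`. -/
def nullEnergy (G : BondiData) (T : ℝ) (Z : ℝ → S2 → ℝ) (q l : ℝ) (φ : Bool → Coord → ℝ) : ℝ :=
  Real.sqrt (intH G T Z fun ε X => wt q l X * energyH G Z ε (φ ε) 1 1 X)

/-- The scalar function `u` in the two charts. -/
def pull (u : ST → ℝ) : Bool → Coord → ℝ := fun ε X => u (chart ε X)

/-- `∂^α u` in the two charts. -/
def pullD (α : Fin 4 → ℕ) (u : ST → ℝ) : Bool → Coord → ℝ := fun ε => mpd α (pull u ε)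

/-- A function of `(τ, y)`, as a function in the two charts. -/
def pullI (ψ : ℝ → S2 → ℝ) : Bool → Coord → ℝ := fun ε X => ψ (X 0) (stereo ε (X 2) (X 3))

/-! ### The equation and the bounds for its coefficients -/

/-- A vector field, given by its components along `∂_τ`, `∂_z`, and along the sphere. -/
structure VField where
  t : ST → ℝ
  z : ST → ℝ
  s : ST → E3

/-- The coordinate components `a^i`. The vectors `∂_2`, `∂_3` of a stereographic chart are
orthogonal for the round metric. -/
def VField.comp (a : VField) (ε : Bool) (X : Coord) (i : Fin 4) : ℝ :=
  if i = 0 then a.t (chart ε X) else if i = 1 then a.z (chart ε X)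
  else inner ℝ (a.s (chart ε X)) (sphVec ε X i) / inner ℝ (sphVec ε X i) (sphVec ε X i)

/-- `|u|_{C^m(𝓜₂ ∩ Ω_T)} ≤ A`. -/
def CBound (T R : ℝ) (Z : ℝ → S2 → ℝ) (m : ℕ) (A : ℝ) (u : Bool → Coord → ℝ) : Prop :=
  ∀ ε X, chart ε X ∈ M2 T R Z → X 2 ^ 2 + X 3 ^ 2 ≤ 1 →
    ∀ n ≤ m, ∀ α ∈ multi n, |mpd α (u ε) X| ≤ A

/-- The eigenvalues of the angular part `(g^{AB})` are at least `lam` on `𝓜₂ ∩ Ω_T`. -/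
def IsElliptic (G : BondiData) (T R : ℝ) (Z : ℝ → S2 → ℝ) (lam : ℝ) : Prop :=
  ∀ ε X, chart ε X ∈ M2 T R Z → X 2 ^ 2 + X 3 ^ 2 ≤ 1 → ∀ ξ ζ : ℝ,
    lam * (ξ ^ 2 + ζ ^ 2) ≤
      gUp G ε X 2 2 * ξ ^ 2 + 2 * gUp G ε X 2 3 * ξ * ζ + gUp G ε X 3 3 * ζ ^ 2

/-- `u` is of class `C^m` up to the boundary of `𝓜₂ ∩ Ω_T`. -/
def IsCUpTo (T R : ℝ) (Z : ℝ → S2 → ℝ) (m : ℕ) (u : Bool → Coord → ℝ) : Prop :=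
  ∀ ε X, chart ε X ∈ M2closed T R Z → ContDiffAt ℝ m (u ε) X

/-- `□_g v + a^i ∂_i v + ω v = f` in `𝓜₂ ∩ Ω_T`. -/
def SolvesWave (G : BondiData) (T R : ℝ) (Z : ℝ → S2 → ℝ) (a : VField) (ω v f : ST → ℝ) : Prop :=
  ∀ ε X, chart ε X ∈ M2 T R Z →
    box G ε (pull v ε) X + along (a.comp ε X) (pull v ε) X + ω (chart ε X) * v (chart ε X)
      = f (chart ε X)

end NullTimelike

end

noncomputable section

namespace NullTimelike

/-! ### Iterated integrals and the divergence theorem on a product of an interval and a disk -/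

/-! The proof is a weighted energy estimate, applied not to v alone but to its derivatives along a
global frame.

Basic estimate. For a scalar φ, contract the energy-momentum tensor with the multiplier K = n - b
∂_z, where W = z²V, n = ∂_τ + ½ W ∂_z + U and b = -Λ/12. Multiply this current J by the weight
e^{-qlτ+qz}, add the weighted vector φ² ∂_z, and integrate the divergence over the region between 𝓘
and 𝓗 (`sum_integral_div_le`). Differentiation of the weight produces q (-l J⁰ + J¹ + φ²). For l ≥ A
+ 1 this dominates q (|∂φ|² + φ²) up to a constant (`IsBondiInv.coercive`), so for large q it
absorbs every other interior term except the square of the source. At τ = 0 the region has shrunk to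
a sphere. At τ = T the flux has a favourable sign. Through 𝓗 the flux is bounded by E_𝓗
(`IsAsymptoticallyAdS.energyH_eq_flux`). At 𝓘 one has W = -Λ/3 and g^{1A} = 0, and since b < W/2 the
flux controls (∂_zφ)² up to derivatives tangential to 𝓘 (`IsSetting.flux_infty_ge`). The result is
`basic_estimate`.

Global frame. The integrals are taken over two disks, and the boundary terms on the equator cancel
only when φ is a scalar on the sphere (`IsAsymptoticallyAdS.current_circle`). The coordinate
derivatives of v are not scalars. The estimate is therefore applied to derivatives of v along words
in five global vector fields: ∂_τ, ∂_z and the gradients of the three Cartesian coordinates of the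
sphere. On the disks these derivatives are comparable with the coordinate derivatives
(`exists_op_frs`, `exists_pdl_le_fs`).

Three terms have to be controlled for a word of length m. (1) Source: the commutator of the wave
operator with the word has order m + 1, and its leading coefficients involve only g and its first
derivatives. Hence the constant in front of the energy of order m depends on the C¹ bound A but not
on higher norms (`exists_op_commutator`, `exists_source_le`). (2) Tangential derivatives at 𝓘:
without the letter ∂_z they are derivatives of the Dirichlet data. With it, since ∂_z commutes with
the frame, they are z-derivatives of words with one ∂_z fewer, and an induction on the number of
letters ∂_z closes (`exists_word_bound`). (3) Energy on 𝓗: no bound on the slope of 𝓗 is assumed,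
yet E_𝓗 of a frame derivative is bounded by E_𝓗 of coordinate derivatives. The reason is that the
coefficients of the form are controlled by the coefficient l₁ + l₂ of φ² (`quadE_mul_le`,
`energyH_form`).

Dependence of constants. The energy of order m on the right is absorbed by taking q large in terms
of A, B, D, Λ, lam and the order only. Lower orders, whose constants depend on the higher norms of
the coefficients, are already bounded by the data and are substituted, not absorbed
(`exists_frame_estimate`). Therefore q₀ does not depend on the higher norms. -/

theorem setIntegral_insertNth {n : ℕ} (i : Fin (n + 1)) {A : Set (Fin n → ℝ)}
    (hA : MeasurableSet A) {Ω : Set (Fin (n + 1) → ℝ)} (hΩ : MeasurableSet Ω)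
    {I : (Fin n → ℝ) → Set ℝ}
    (hmem : ∀ (z : ℝ) (Y : Fin n → ℝ), i.insertNth (α := fun _ => ℝ) z Y ∈ Ω ↔ Y ∈ A ∧ z ∈ I Y)
    {F : (Fin (n + 1) → ℝ) → ℝ} (hF : IntegrableOn F Ω) :
    ∫ X in Ω, F X = ∫ Y in A, ∫ z in I Y, F (i.insertNth (α := fun _ => ℝ) z Y) := by
  have hmp := (volume_preserving_piFinSuccAbove (fun _ : Fin (n + 1) => ℝ) i).symm
  rw [← integral_indicator hΩ]
  rw [← integrable_indicator_iff hΩ] at hF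
  rw [← hmp.integral_comp' (Ω.indicator F), Measure.volume_eq_prod, integral_prod_symm]
  · rw [← integral_indicator hA]
    congr 1
    ext Y
    by_cases hY : Y ∈ A
    · rw [indicator_of_mem hY]
      have hI : MeasurableSet (I Y) := by
        have hm : Measurable fun z : ℝ => i.insertNth (α := fun _ => ℝ) z Y := by
          refine measurable_pi_iff.2 (i.forall_iff_succAbove.2 ⟨by simpa using measurable_id', ?_⟩)
          intro j
          simp
        have : I Y = (fun z : ℝ => i.insertNth (α := fun _ => ℝ) z Y) ⁻¹' Ω := by
          ext z; simp [hmem, hY]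
        rw [this]; exact hm hΩ
      rw [← integral_indicator hI]
      congr 1
      ext z
      by_cases hz : z ∈ I Y
      · rw [indicator_of_mem hz]
        exact indicator_of_mem ((hmem z Y).2 ⟨hY, hz⟩) F
      · rw [indicator_of_notMem hz]
        exact indicator_of_notMem (fun h => hz ((hmem z Y).1 h).2) F
    · rw [indicator_of_notMem hY]
      have : ∀ z : ℝ, Ω.indicator F (i.insertNth (α := fun _ => ℝ) z Y) = 0 := fun z =>
        indicator_of_notMem (fun h => hY ((hmem z Y).1 h).1) F
      exact (integral_congr_ae (Eventually.of_forall this)).trans (by simp)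
  · exact (hmp.integrable_comp_emb (MeasurableEquiv.measurableEmbedding _)).2 hF

theorem hasDerivAt_comp_insertNth (i : Fin 4) {u : Coord → ℝ} {z : ℝ} {Y : Fin 3 → ℝ}
    (hu : DifferentiableAt ℝ u (i.insertNth (α := fun _ => ℝ) z Y)) :
    HasDerivAt (fun s : ℝ => u (i.insertNth (α := fun _ => ℝ) s Y))
      (pd i u (i.insertNth (α := fun _ => ℝ) z Y)) z := by
  have h1 : HasDerivAt (fun s : ℝ => (i.insertNth (α := fun _ => ℝ) s Y : Coord))
      (Pi.single i 1) z := by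
    have h := hasDerivAt_update (𝕜 := ℝ) (i.insertNth (α := fun _ => ℝ) z Y : Coord) i z
    have e : (fun s : ℝ => (i.insertNth (α := fun _ => ℝ) s Y : Coord))
        = Function.update (i.insertNth (α := fun _ => ℝ) z Y : Coord) i := by
      ext s j
      rcases Fin.eq_self_or_eq_succAbove i j with rfl | ⟨j, rfl⟩ <;> simp
    rw [e]; exact h
  exact hu.hasFDerivAt.comp_hasDerivAt z h1

theorem continuousAt_pd {u : Coord → ℝ} {X : Coord} (hu : ContDiffAt ℝ 1 u X) (i : Fin 4) :
    ContinuousAt (pd i u) X := by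
  have h : ContDiffAt ℝ 0 (fderiv ℝ u) X := hu.fderiv_right (by norm_num)
  exact (h.continuousAt).clm_apply continuousAt_const

theorem continuous_insertNth_left (i : Fin 4) (Y : Fin 3 → ℝ) :
    Continuous fun s : ℝ => (i.insertNth (α := fun _ => ℝ) s Y : Coord) := by
  refine continuous_pi (i.forall_iff_succAbove.2 ⟨by simpa using continuous_id', ?_⟩)
  intro j
  simpa using continuous_const

/-- The fundamental theorem of calculus in the `i`-th variable over a set with interval fibers. -/
theorem setIntegral_pd_eq (i : Fin 4) {A : Set (Fin 3 → ℝ)}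
    (hA : MeasurableSet A) {Ω : Set Coord} (hΩ : MeasurableSet Ω)
    {I : (Fin 3 → ℝ) → Set ℝ} {lo hi : (Fin 3 → ℝ) → ℝ}
    (hmem : ∀ (z : ℝ) (Y : Fin 3 → ℝ), i.insertNth (α := fun _ => ℝ) z Y ∈ Ω ↔ Y ∈ A ∧ z ∈ I Y)
    (hI : ∀ Y ∈ A, I Y =ᵐ[volume] Ioc (lo Y) (hi Y)) (hle : ∀ Y ∈ A, lo Y ≤ hi Y)
    {u : Coord → ℝ} (hint : IntegrableOn (pd i u) Ω)
    (hu : ∀ Y ∈ A, ∀ z ∈ Icc (lo Y) (hi Y), ContDiffAt ℝ 1 u (i.insertNth (α := fun _ => ℝ) z Y)) :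
    ∫ X in Ω, pd i u X
      = ∫ Y in A, (u (i.insertNth (α := fun _ => ℝ) (hi Y) Y)
          - u (i.insertNth (α := fun _ => ℝ) (lo Y) Y)) := by
  rw [setIntegral_insertNth i hA hΩ hmem hint]
  refine setIntegral_congr_fun hA fun Y hY => ?_
  rw [setIntegral_congr_set (hI Y hY), ← intervalIntegral.integral_of_le (hle Y hY)]
  apply intervalIntegral.integral_eq_sub_of_hasDerivAt
    (f := fun z => u (i.insertNth (α := fun _ => ℝ) z Y))
  · intro z hz
    rw [uIcc_of_le (hle Y hY)] at hz
    exact hasDerivAt_comp_insertNth i ((hu Y hY z hz).differentiableAt (by norm_num))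
  · apply ContinuousOn.intervalIntegrable
    rw [uIcc_of_le (hle Y hY)]
    intro z hz
    exact (ContinuousAt.comp (f := fun s : ℝ => (i.insertNth (α := fun _ => ℝ) s Y : Coord))
      (continuousAt_pd (hu Y hY z hz) i)
      (continuous_insertNth_left i Y).continuousAt).continuousWithinAt

theorem insertNth_zero_eq (z : ℝ) (Y : Fin 3 → ℝ) :
    (0 : Fin 4).insertNth (α := fun _ => ℝ) z Y = ![z, Y 0, Y 1, Y 2] := by
  ext j; fin_cases j <;> rfl
theorem insertNth_one_eq (z : ℝ) (Y : Fin 3 → ℝ) :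
    (1 : Fin 4).insertNth (α := fun _ => ℝ) z Y = ![Y 0, z, Y 1, Y 2] := by
  ext j; fin_cases j <;> rfl
theorem insertNth_two_eq (z : ℝ) (Y : Fin 3 → ℝ) :
    (2 : Fin 4).insertNth (α := fun _ => ℝ) z Y = ![Y 0, Y 1, z, Y 2] := by
  ext j; fin_cases j <;> rfl
theorem insertNth_three_eq (z : ℝ) (Y : Fin 3 → ℝ) :
    (3 : Fin 4).insertNth (α := fun _ => ℝ) z Y = ![Y 0, Y 1, Y 2, z] := by
  ext j; fin_cases j <;> rfl

/-- The coordinate box over which the region between `𝓘` and `𝓗` is parametrized. -/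
def box₀ (T : ℝ) : Set Coord :=
  {X | (0 < X 0 ∧ X 0 < T) ∧ (0 < X 1 ∧ X 1 < 1) ∧ X 2 ^ 2 + X 3 ^ 2 ≤ 1}

/-- The closed box. -/
def boxc (T : ℝ) : Set Coord :=
  {X | (0 ≤ X 0 ∧ X 0 ≤ T) ∧ (0 ≤ X 1 ∧ X 1 ≤ 1) ∧ X 2 ^ 2 + X 3 ^ 2 ≤ 1}

theorem measurableSet_box₀ (T : ℝ) : MeasurableSet (box₀ T) := by
  unfold box₀; measurability

theorem box₀_subset_boxc (T : ℝ) : box₀ T ⊆ boxc T := fun _ hX =>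
  ⟨⟨hX.1.1.le, hX.1.2.le⟩, ⟨hX.2.1.1.le, hX.2.1.2.le⟩, hX.2.2⟩

theorem isCompact_boxc (T : ℝ) : IsCompact (boxc T) := by
  apply (isCompact_univ_pi (fun _ : Fin 4 => isCompact_Icc (a := -(|T| + 1)) (b := |T| + 1))).of_isClosed_subset
  · have e : boxc T = {X : Coord | 0 ≤ X 0} ∩ {X | X 0 ≤ T} ∩ ({X | 0 ≤ X 1} ∩ {X | X 1 ≤ 1})
        ∩ {X | X 2 ^ 2 + X 3 ^ 2 ≤ 1} := by
      ext X; simp [boxc, and_assoc]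
    rw [e]
    refine ((IsClosed.inter ?_ ?_).inter (IsClosed.inter ?_ ?_)).inter ?_ <;>
      apply isClosed_le <;> fun_prop
  · intro X hX i _
    obtain ⟨⟨h0, h1⟩, ⟨h2, h3⟩, h4⟩ := hX
    have hT := le_abs_self T
    have hT' := abs_nonneg T
    have h5 : |X 2| ≤ 1 := by rw [← sq_le_one_iff_abs_le_one]; nlinarith [sq_nonneg (X 3)]
    have h6 : |X 3| ≤ 1 := by rw [← sq_le_one_iff_abs_le_one]; nlinarith [sq_nonneg (X 2)]
    rw [abs_le] at h5 h6
    fin_cases i <;> simp <;> constructor <;> linarith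

theorem convex_boxc (T : ℝ) : Convex ℝ (boxc T) := by
  have hd : ConvexOn ℝ univ fun X : Coord => X 2 ^ 2 + X 3 ^ 2 := by
    have h : ∀ i : Fin 4, ConvexOn ℝ univ fun X : Coord => X i ^ 2 := fun i => by
      have := (even_two.convexOn_pow (𝕜 := ℝ)).comp_linearMap (LinearMap.proj (R := ℝ) (φ := fun _ : Fin 4 => ℝ) i)
      exact this
    exact (h 2).add (h 3)
  intro X hX Y hY a b ha hb hab
  obtain ⟨⟨h0, h1⟩, ⟨h2, h3⟩, h4⟩ := hX
  obtain ⟨⟨g0, g1⟩, ⟨g2, g3⟩, g4⟩ := hY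
  have hb' : b = 1 - a := by linarith
  refine ⟨⟨?_, ?_⟩, ⟨?_, ?_⟩, ?_⟩
  · simp only [Pi.add_apply, Pi.smul_apply, smul_eq_mul]; positivity
  · simp only [Pi.add_apply, Pi.smul_apply, smul_eq_mul]; nlinarith
  · simp only [Pi.add_apply, Pi.smul_apply, smul_eq_mul]; positivity
  · simp only [Pi.add_apply, Pi.smul_apply, smul_eq_mul]; nlinarith
  · have := hd.2 (mem_univ X) (mem_univ Y) ha hb hab
    simp only [smul_eq_mul] at this
    exact this.trans (by nlinarith)

theorem integrableOn_box₀ {T : ℝ} {F : Coord → ℝ} (hF : ∀ X ∈ boxc T, ContinuousAt F X) :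
    IntegrableOn F (box₀ T) :=
  ((ContinuousOn.integrableOn_compact (isCompact_boxc T)
    fun _ hX => (hF _ hX).continuousWithinAt)).mono_set (box₀_subset_boxc T)

/-- Lines in the x₂-direction meet the circle in at most two points, so Fubini gives measure zero.
The powers of r = x₂² + x₃² tend to zero only off the circle. -/
theorem ae_box₀_lt_one (T : ℝ) : ∀ᵐ X ∂(volume.restrict (box₀ T)), X 2 ^ 2 + X 3 ^ 2 < 1 := by
  have hms : MeasurableSet {X : Coord | X 2 ^ 2 + X 3 ^ 2 = 1} := by measurability
  have hm : MeasurableSet (box₀ T ∩ {X | X 2 ^ 2 + X 3 ^ 2 = 1}) := (measurableSet_box₀ T).inter hms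
  have hfin : IntegrableOn (fun _ : Coord => (1 : ℝ)) (box₀ T ∩ {X | X 2 ^ 2 + X 3 ^ 2 = 1}) :=
    (integrableOn_box₀ fun X _ => continuousAt_const).mono_set inter_subset_left
  have h := setIntegral_insertNth (2 : Fin 4) (A := univ) MeasurableSet.univ hm
    (I := fun Y => {z | (2 : Fin 4).insertNth (α := fun _ => ℝ) z Y
      ∈ box₀ T ∩ {X | X 2 ^ 2 + X 3 ^ 2 = 1}}) (by intro z Y; simp) hfin
  have hz : ∀ Y : Fin 3 → ℝ, volume {z | (2 : Fin 4).insertNth (α := fun _ => ℝ) z Y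
      ∈ box₀ T ∩ {X | X 2 ^ 2 + X 3 ^ 2 = 1}} = 0 := by
    intro Y
    refine measure_mono_null (t := {√(1 - Y 2 ^ 2), -√(1 - Y 2 ^ 2)}) ?_ ((Set.toFinite _).measure_zero _)
    intro z hz
    rw [mem_ofPred_eq, insertNth_two_eq] at hz
    have h1 : z ^ 2 = 1 - Y 2 ^ 2 := by have := hz.2; simp at this; linarith
    have h2 : √(1 - Y 2 ^ 2) = |z| := by rw [← h1, Real.sqrt_sq_eq_abs]
    rw [h2]
    rcases abs_choice z with h | h <;> rw [h] <;> simp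
  have h0 : volume.real (box₀ T ∩ {X | X 2 ^ 2 + X 3 ^ 2 = 1}) = 0 := by
    have : ∀ Y : Fin 3 → ℝ, ∫ z in {z | (2 : Fin 4).insertNth (α := fun _ => ℝ) z Y
      ∈ box₀ T ∩ {X | X 2 ^ 2 + X 3 ^ 2 = 1}}, (1 : ℝ) = 0 := fun Y => by
      rw [Measure.restrict_eq_zero.2 (hz Y)]; simp
    simp only [this] at h
    simpa using h
  have h1 : volume (box₀ T ∩ {X | X 2 ^ 2 + X 3 ^ 2 = 1}) = 0 := by
    have hlt : volume (box₀ T) < ⊤ := (measure_mono (box₀_subset_boxc T)).trans_lt (isCompact_boxc T).measure_lt_top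
    rw [measureReal_def, ENNReal.toReal_eq_zero_iff] at h0
    rcases h0 with h0 | h0
    · exact h0
    · exact absurd h0 ((measure_mono inter_subset_left).trans_lt hlt).ne
  rw [ae_restrict_iff' (measurableSet_box₀ T)]
  rw [← compl_mem_ae_iff] at h1
  filter_upwards [h1] with X hX hX'
  exact lt_of_le_of_ne hX'.2.2 fun h => hX ⟨hX', h⟩

theorem measurableSet_tanCell (T : ℝ) : MeasurableSet (tanCell T) := by
  unfold tanCell; measurability

theorem box_integral_pd_one {T : ℝ} {u : Coord → ℝ} (hu : ∀ X ∈ boxc T, ContDiffAt ℝ 1 u X) :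
    ∫ X in box₀ T, pd 1 u X
      = ∫ Y in tanCell T, (u ![Y 0, 1, Y 1, Y 2] - u ![Y 0, 0, Y 1, Y 2]) := by
  have h := setIntegral_pd_eq (1 : Fin 4) (measurableSet_tanCell T) (measurableSet_box₀ T)
    (I := fun _ => Ioo 0 1) (lo := fun _ => 0) (hi := fun _ => 1) (u := u)
    (by intro z Y; rw [insertNth_one_eq]; simp [box₀, tanCell]; tauto)
    (fun _ _ => Ioo_ae_eq_Ioc) (fun _ _ => zero_le_one)
    (integrableOn_box₀ fun X hX => continuousAt_pd (hu X hX) 1)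
    (by
      intro Y hY z hz
      apply hu
      rw [insertNth_one_eq]
      exact ⟨⟨hY.1.le, hY.2.1.le⟩, hz, hY.2.2⟩)
  simpa only [insertNth_one_eq] using h

/-- Only the sign of the flux at the final time is used, so no bound of the solution at τ = T
enters. -/
theorem box_integral_pd_zero_nonpos {T : ℝ} (hT : 0 ≤ T) {u : Coord → ℝ}
    (hu : ∀ X ∈ boxc T, ContDiffAt ℝ 1 u X)
    (h0 : ∀ X ∈ boxc T, X 0 = 0 → u X = 0) (h1 : ∀ X ∈ boxc T, X 0 = T → u X ≤ 0) :
    ∫ X in box₀ T, pd 0 u X ≤ 0 := by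
  have hA : MeasurableSet {Y : Fin 3 → ℝ | (0 < Y 0 ∧ Y 0 < 1) ∧ Y 1 ^ 2 + Y 2 ^ 2 ≤ 1} := by
    measurability
  have h := setIntegral_pd_eq (0 : Fin 4) hA (measurableSet_box₀ T)
    (I := fun _ => Ioo 0 T) (lo := fun _ => 0) (hi := fun _ => T) (u := u)
    (by intro z Y; rw [insertNth_zero_eq]; simp [box₀]; tauto)
    (fun _ _ => Ioo_ae_eq_Ioc) (fun _ _ => hT)
    (integrableOn_box₀ fun X hX => continuousAt_pd (hu X hX) 0)
    (by
      intro Y hY z hz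
      apply hu
      rw [insertNth_zero_eq]
      exact ⟨hz, ⟨hY.1.1.le, hY.1.2.le⟩, hY.2⟩)
  rw [h]
  refine setIntegral_nonpos hA fun Y hY => ?_
  have m : ∀ t ∈ Icc 0 T, (![t, Y 0, Y 1, Y 2] : Coord) ∈ boxc T := fun t ht =>
    ⟨ht, ⟨hY.1.1.le, hY.1.2.le⟩, hY.2⟩
  rw [insertNth_zero_eq, insertNth_zero_eq, h0 _ (m 0 (left_mem_Icc.2 hT)) rfl, sub_zero]
  exact h1 _ (m T (right_mem_Icc.2 hT)) rfl

/-- The fibres of the disk are chords with both ends on the circle, where u vanishes. -/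
theorem box_integral_pd_two_eq_zero {T : ℝ} {u : Coord → ℝ}
    (hu : ∀ X ∈ boxc T, ContDiffAt ℝ 1 u X)
    (h0 : ∀ X ∈ boxc T, X 2 ^ 2 + X 3 ^ 2 = 1 → u X = 0) :
    ∫ X in box₀ T, pd 2 u X = 0 := by
  have hA : MeasurableSet {Y : Fin 3 → ℝ | (0 < Y 0 ∧ Y 0 < T) ∧ (0 < Y 1 ∧ Y 1 < 1) ∧
      Y 2 ^ 2 ≤ 1} := by measurability
  have h := setIntegral_pd_eq (2 : Fin 4) hA (measurableSet_box₀ T)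
    (I := fun Y => Icc (-√(1 - Y 2 ^ 2)) (√(1 - Y 2 ^ 2))) (lo := fun Y => -√(1 - Y 2 ^ 2))
    (hi := fun Y => √(1 - Y 2 ^ 2)) (u := u)
    (by
      intro z Y; rw [insertNth_two_eq]
      simp only [box₀, mem_ofPred_eq, mem_Icc, Matrix.cons_val]
      constructor
      · rintro ⟨a, b, c⟩
        exact ⟨⟨a, b, by nlinarith [sq_nonneg z]⟩, abs_le.1 (Real.abs_le_sqrt (by linarith))⟩
      · rintro ⟨⟨a, b, c⟩, d⟩
        have := (Real.le_sqrt (abs_nonneg z) (by linarith)).1 (abs_le.2 d)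
        rw [sq_abs] at this
        exact ⟨a, b, by linarith⟩)
    (fun _ _ => Ioc_ae_eq_Icc.symm) (fun Y _ => by linarith [Real.sqrt_nonneg (1 - Y 2 ^ 2)])
    (integrableOn_box₀ fun X hX => continuousAt_pd (hu X hX) 2)
    (by
      intro Y hY z hz
      apply hu
      rw [insertNth_two_eq]
      have := (Real.le_sqrt (abs_nonneg z) (by linarith [hY.2.2])).1 (abs_le.2 hz)
      rw [sq_abs] at this
      exact ⟨⟨hY.1.1.le, hY.1.2.le⟩, ⟨hY.2.1.1.le, hY.2.1.2.le⟩,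
        by simp only [Matrix.cons_val]; linarith⟩)
  rw [h]
  refine (setIntegral_congr_fun (g := fun _ => (0 : ℝ)) hA fun Y hY => ?_).trans (by simp)
  have e : (√(1 - Y 2 ^ 2)) ^ 2 = 1 - Y 2 ^ 2 := Real.sq_sqrt (by linarith [hY.2.2])
  have m : ∀ z, z ^ 2 = 1 - Y 2 ^ 2 → u ((2 : Fin 4).insertNth (α := fun _ => ℝ) z Y) = 0 := by
    intro z hz
    rw [insertNth_two_eq]
    refine h0 _ ⟨⟨hY.1.1.le, hY.1.2.le⟩, ⟨hY.2.1.1.le, hY.2.1.2.le⟩, ?_⟩ ?_ <;>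
      simp only [Matrix.cons_val] <;> linarith
  beta_reduce
  rw [m _ e, m _ (by rw [neg_sq]; exact e), sub_zero]

theorem box_integral_pd_three_eq_zero {T : ℝ} {u : Coord → ℝ}
    (hu : ∀ X ∈ boxc T, ContDiffAt ℝ 1 u X)
    (h0 : ∀ X ∈ boxc T, X 2 ^ 2 + X 3 ^ 2 = 1 → u X = 0) :
    ∫ X in box₀ T, pd 3 u X = 0 := by
  have hA : MeasurableSet {Y : Fin 3 → ℝ | (0 < Y 0 ∧ Y 0 < T) ∧ (0 < Y 1 ∧ Y 1 < 1) ∧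
      Y 2 ^ 2 ≤ 1} := by measurability
  have h := setIntegral_pd_eq (3 : Fin 4) hA (measurableSet_box₀ T)
    (I := fun Y => Icc (-√(1 - Y 2 ^ 2)) (√(1 - Y 2 ^ 2))) (lo := fun Y => -√(1 - Y 2 ^ 2))
    (hi := fun Y => √(1 - Y 2 ^ 2)) (u := u)
    (by
      intro z Y; rw [insertNth_three_eq]
      simp only [box₀, mem_ofPred_eq, mem_Icc, Matrix.cons_val]
      constructor
      · rintro ⟨a, b, c⟩
        exact ⟨⟨a, b, by nlinarith [sq_nonneg z]⟩, abs_le.1 (Real.abs_le_sqrt (by linarith))⟩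
      · rintro ⟨⟨a, b, c⟩, d⟩
        have := (Real.le_sqrt (abs_nonneg z) (by linarith)).1 (abs_le.2 d)
        rw [sq_abs] at this
        exact ⟨a, b, by linarith⟩)
    (fun _ _ => Ioc_ae_eq_Icc.symm) (fun Y _ => by linarith [Real.sqrt_nonneg (1 - Y 2 ^ 2)])
    (integrableOn_box₀ fun X hX => continuousAt_pd (hu X hX) 3)
    (by
      intro Y hY z hz
      apply hu
      rw [insertNth_three_eq]
      have := (Real.le_sqrt (abs_nonneg z) (by linarith [hY.2.2])).1 (abs_le.2 hz)
      rw [sq_abs] at this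
      exact ⟨⟨hY.1.1.le, hY.1.2.le⟩, ⟨hY.2.1.1.le, hY.2.1.2.le⟩,
        by simp only [Matrix.cons_val]; linarith⟩)
  rw [h]
  refine (setIntegral_congr_fun (g := fun _ => (0 : ℝ)) hA fun Y hY => ?_).trans (by simp)
  have e : (√(1 - Y 2 ^ 2)) ^ 2 = 1 - Y 2 ^ 2 := Real.sq_sqrt (by linarith [hY.2.2])
  have m : ∀ z, z ^ 2 = 1 - Y 2 ^ 2 → u ((3 : Fin 4).insertNth (α := fun _ => ℝ) z Y) = 0 := by
    intro z hz
    rw [insertNth_three_eq]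
    refine h0 _ ⟨⟨hY.1.1.le, hY.1.2.le⟩, ⟨hY.2.1.1.le, hY.2.1.2.le⟩, ?_⟩ ?_ <;>
      simp only [Matrix.cons_val] <;> linarith
  beta_reduce
  rw [m _ e, m _ (by rw [neg_sq]; exact e), sub_zero]

/-! ### Rules for coordinate derivatives -/

theorem pd_mul {u v : Coord → ℝ} {X : Coord} (i : Fin 4) (hu : DifferentiableAt ℝ u X)
    (hv : DifferentiableAt ℝ v X) :
    pd i (fun Y => u Y * v Y) X = pd i u X * v X + u X * pd i v X := by
  simp only [pd]
  rw [fderiv_fun_mul hu hv]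
  simp only [add_apply, smul_apply, smul_eq_mul]
  ring

theorem pd_add {u v : Coord → ℝ} {X : Coord} (i : Fin 4) (hu : DifferentiableAt ℝ u X)
    (hv : DifferentiableAt ℝ v X) :
    pd i (fun Y => u Y + v Y) X = pd i u X + pd i v X := by
  simp only [pd]
  rw [fderiv_fun_add hu hv]
  rfl

theorem pd_sub {u v : Coord → ℝ} {X : Coord} (i : Fin 4) (hu : DifferentiableAt ℝ u X)
    (hv : DifferentiableAt ℝ v X) :
    pd i (fun Y => u Y - v Y) X = pd i u X - pd i v X := by
  simp only [pd]
  rw [fderiv_fun_sub hu hv]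
  rfl

theorem pd_sum {ι : Type*} (s : Finset ι) {u : ι → Coord → ℝ} {X : Coord} (i : Fin 4)
    (hu : ∀ a ∈ s, DifferentiableAt ℝ (u a) X) :
    pd i (fun Y => ∑ a ∈ s, u a Y) X = ∑ a ∈ s, pd i (u a) X := by
  simp only [pd]
  rw [fderiv_fun_sum hu]
  simp

theorem pd_const (i : Fin 4) (c : ℝ) : pd i (fun _ => c) = fun _ => 0 := by
  ext X; simp [pd]

theorem pd_coord (i j : Fin 4) (X : Coord) : pd i (fun Y => Y j) X = if j = i then 1 else 0 := by
  simp only [pd]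
  rw [(hasFDerivAt_apply j X).fderiv]
  simp [Pi.single_apply]

theorem pd_comp {f : ℝ → ℝ} {u : Coord → ℝ} {X : Coord} {f' : ℝ} (i : Fin 4)
    (hf : HasDerivAt f f' (u X)) (hu : DifferentiableAt ℝ u X) :
    pd i (fun Y => f (u Y)) X = f' * pd i u X := by
  simp only [pd]
  rw [show (fun Y => f (u Y)) = f ∘ u from rfl, (hf.comp_hasFDerivAt X hu.hasFDerivAt).fderiv]
  simp

theorem pd_congr {u v : Coord → ℝ} {X : Coord} (h : u =ᶠ[𝓝 X] v) (i : Fin 4) :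
    pd i u X = pd i v X := by
  simp only [pd, h.fderiv_eq]

theorem pd_pow {u : Coord → ℝ} {X : Coord} (i : Fin 4) (n : ℕ) (hu : DifferentiableAt ℝ u X) :
    pd i (fun Y => u Y ^ n) X = n * u X ^ (n - 1) * pd i u X :=
  pd_comp i (hasDerivAt_pow n (u X)) hu

/-! ### The divergence on the disk of a field tangent to the boundary circle -/

theorem exists_lipschitz_boxc {T : ℝ} {g : Coord → ℝ} (hg : ∀ X ∈ boxc T, ContDiffAt ℝ 1 g X) :
    ∃ C : ℝ, 0 ≤ C ∧ ∀ X ∈ boxc T, ∀ X' ∈ boxc T, |g X - g X'| ≤ C * ‖X - X'‖ := by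
  have hc : ContinuousOn (fun X => ‖fderiv ℝ g X‖) (boxc T) := fun X hX =>
    (((hg X hX).fderiv_right (m := 0) (by norm_num)).continuousAt.norm).continuousWithinAt
  obtain ⟨C, hC⟩ := (isCompact_boxc T).bddAbove_image hc
  refine ⟨max C 0, le_max_right _ _, fun X hX X' hX' => ?_⟩
  have := (convex_boxc T).norm_image_sub_le_of_norm_hasFDerivWithin_le (f := g) (C := max C 0)
    (f' := fun X => fderiv ℝ g X)
    (fun X hX => ((hg X hX).differentiableAt (by norm_num)).hasFDerivAt.hasFDerivWithinAt)
    (fun X hX => (hC ⟨X, hX, rfl⟩).trans (le_max_left _ _)) hX' hX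
  simpa using this

/-- Lipschitz continuity, combined with a point of the circle at distance at most 1 - r, where r is
the square of the radius. -/
theorem exists_bound_of_zero_on_circle {T : ℝ} {g : Coord → ℝ}
    (hg : ∀ X ∈ boxc T, ContDiffAt ℝ 1 g X)
    (h0 : ∀ X ∈ box₀ T, X 2 ^ 2 + X 3 ^ 2 = 1 → g X = 0) :
    ∃ C : ℝ, 0 ≤ C ∧ ∀ X ∈ box₀ T, |g X| ≤ C * (1 - (X 2 ^ 2 + X 3 ^ 2)) := by
  obtain ⟨C, hC, h⟩ := exists_lipschitz_boxc hg
  refine ⟨C, hC, fun X hX => ?_⟩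
  have key : ∃ a b : ℝ, a ^ 2 + b ^ 2 = 1 ∧ |X 2 - a| ≤ 1 - (X 2 ^ 2 + X 3 ^ 2)
      ∧ |X 3 - b| ≤ 1 - (X 2 ^ 2 + X 3 ^ 2) := by
    have hr1 := hX.2.2
    set r := X 2 ^ 2 + X 3 ^ 2 with hr
    -- At the centre any point of the circle will do. Elsewhere the radial projection moves each
    -- coordinate by at most 1 - √r ≤ 1 - r.
    rcases eq_or_ne r 0 with h0 | h0
    · have h2 : X 2 = 0 := by nlinarith [sq_nonneg (X 2), sq_nonneg (X 3)]
      have h3 : X 3 = 0 := by nlinarith [sq_nonneg (X 2), sq_nonneg (X 3)]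
      exact ⟨1, 0, by norm_num, by rw [h2, h0]; norm_num, by rw [h3, h0]; norm_num⟩
    · have hr0 : 0 < r := lt_of_le_of_ne (by positivity) h0.symm
      have hs := Real.sqrt_pos.2 hr0
      have hss := Real.sq_sqrt hr0.le
      have hs1 : √r ≤ 1 := Real.sqrt_le_one.2 hr1
      have aux : ∀ x : ℝ, |x| ≤ √r → |x - x / √r| ≤ 1 - r := by
        intro x hx
        have e : x - x / √r = -((x / √r) * (1 - √r)) := by field_simp; ring
        rw [e, abs_neg, abs_mul, abs_div, abs_of_pos hs, abs_of_nonneg (by linarith : 0 ≤ 1 - √r)]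
        have : |x| / √r ≤ 1 := (div_le_one hs).2 hx
        nlinarith
      refine ⟨X 2 / √r, X 3 / √r, ?_, aux _ (Real.abs_le_sqrt ?_), aux _ (Real.abs_le_sqrt ?_)⟩
      · rw [div_pow, div_pow, hss, ← add_div, ← hr, div_self h0]
      · nlinarith [sq_nonneg (X 3)]
      · nlinarith [sq_nonneg (X 2)]
  obtain ⟨a, b, hab, ha, hb⟩ := key
  have hm : (![X 0, X 1, a, b] : Coord) ∈ box₀ T := ⟨hX.1, hX.2.1, hab.le⟩
  have h1 := h X (box₀_subset_boxc T hX) _ (box₀_subset_boxc T hm)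
  rw [h0 _ hm hab, sub_zero] at h1
  refine h1.trans (mul_le_mul_of_nonneg_left ?_ hC)
  rw [pi_norm_le_iff_of_nonneg (by linarith [hX.2.2])]
  have : 0 ≤ 1 - (X 2 ^ 2 + X 3 ^ 2) := by linarith [hX.2.2]
  intro i
  fin_cases i
  · simpa using this
  · simpa using this
  · exact ha
  · exact hb

/-- The product (n + 1) rⁿ is at most the geometric sum, which telescopes against 1 - r. This is the
uniform bound for the gradient of the cut-off functions below. -/
theorem mul_pow_mul_one_sub_le {r : ℝ} (h0 : 0 ≤ r) (h1 : r ≤ 1) (n : ℕ) :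
    ((n : ℝ) + 1) * r ^ n * (1 - r) ≤ 1 := by
  have h : ((n : ℝ) + 1) * r ^ n ≤ ∑ j ∈ Finset.range (n + 1), r ^ j := by
    have : ∑ j ∈ Finset.range (n + 1), r ^ n ≤ ∑ j ∈ Finset.range (n + 1), r ^ j :=
      Finset.sum_le_sum fun j hj => pow_le_pow_of_le_one h0 h1
        (Nat.lt_succ_iff.1 (Finset.mem_range.1 hj))
    simpa using this
  have h2 := mul_le_mul_of_nonneg_right h (sub_nonneg.2 h1)
  rw [geom_sum_mul_neg] at h2
  linarith [pow_nonneg h0 (n + 1)]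

/-- Without boundary terms on the sides: the angular part of the divergence of a vector field that
is tangent to the boundary circle of the disk integrates to zero. -/
theorem box_integral_angular_eq_zero {T : ℝ} {P Q : Coord → ℝ}
    (hP : ∀ X ∈ boxc T, ContDiffAt ℝ 1 P X) (hQ : ∀ X ∈ boxc T, ContDiffAt ℝ 1 Q X)
    (h0 : ∀ X ∈ box₀ T, X 2 ^ 2 + X 3 ^ 2 = 1 → X 2 * P X + X 3 * Q X = 0) :
    ∫ X in box₀ T, (pd 2 P X + pd 3 Q X) = 0 := by
  set r : Coord → ℝ := fun X => X 2 ^ 2 + X 3 ^ 2 with hr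
  have hrC : ContDiff ℝ 1 r := by fun_prop
  set g : Coord → ℝ := fun X => X 2 * P X + X 3 * Q X with hgdef
  have hx : ∀ i : Fin 4, ContDiff ℝ 1 fun X : Coord => X i := fun i => by fun_prop
  have hg : ∀ X ∈ boxc T, ContDiffAt ℝ 1 g X := fun X hX =>
    ((hx 2).contDiffAt.mul (hP X hX)).add ((hx 3).contDiffAt.mul (hQ X hX))
  obtain ⟨C, hC, hb⟩ := exists_bound_of_zero_on_circle hg h0
  -- Cut-off functions that vanish on the circle and increase to 1 inside. With them the divergence
  -- theorem on the disk reduces to one-dimensional integrals without boundary terms.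
  set w : ℕ → Coord → ℝ := fun n X => 1 - r X ^ (n + 1) with hw
  have hwC : ∀ n, ContDiff ℝ 1 (w n) := fun n => by fun_prop
  have hwd : ∀ n i X, pd i (w n) X = -(((n : ℝ) + 1) * r X ^ n * pd i r X) := fun n i X => by
    have hrd : DifferentiableAt ℝ r X := hrC.differentiable (by norm_num) X
    rw [hw]
    simp only
    rw [pd_sub i (differentiableAt_const _) (hrd.fun_pow _), pd_const, pd_pow i _ hrd]
    simp
  have hr2 : ∀ X, pd 2 r X = 2 * X 2 := fun X => by
    rw [hr, pd_add 2 (by fun_prop) (by fun_prop), pd_pow 2 2 (by fun_prop), pd_pow 2 2 (by fun_prop),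
      pd_coord, pd_coord]
    simp
  have hr3 : ∀ X, pd 3 r X = 2 * X 3 := fun X => by
    rw [hr, pd_add 3 (by fun_prop) (by fun_prop), pd_pow 3 2 (by fun_prop), pd_pow 3 2 (by fun_prop),
      pd_coord, pd_coord]
    simp
  -- The divergence of w_n (P, Q). The gradient of w_n is radial, so it sees the field only through
  -- its radial part g, which vanishes on the circle.
  set F : ℕ → Coord → ℝ := fun n X =>
    w n X * (pd 2 P X + pd 3 Q X) - 2 * ((((n : ℝ) + 1) * r X ^ n) * g X) with hF
  have hzero : ∀ n, ∫ X in box₀ T, F n X = 0 := by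
    intro n
    have hwP : ∀ X ∈ boxc T, ContDiffAt ℝ 1 (fun X => w n X * P X) X := fun X hX =>
      (hwC n).contDiffAt.mul (hP X hX)
    have hwQ : ∀ X ∈ boxc T, ContDiffAt ℝ 1 (fun X => w n X * Q X) X := fun X hX =>
      (hwC n).contDiffAt.mul (hQ X hX)
    have e1 := box_integral_pd_two_eq_zero hwP (fun X _ h => by
      have : w n X = 0 := by simp [hw, hr, h]
      rw [this, zero_mul])
    have e2 := box_integral_pd_three_eq_zero hwQ (fun X _ h => by
      have : w n X = 0 := by simp [hw, hr, h]
      rw [this, zero_mul])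
    rw [show (0 : ℝ) = 0 + 0 by norm_num]
    nth_rewrite 1 [← e1]
    nth_rewrite 1 [← e2]
    rw [← integral_add (integrableOn_box₀ fun X hX => continuousAt_pd (hwP X hX) 2)
      (integrableOn_box₀ fun X hX => continuousAt_pd (hwQ X hX) 3)]
    refine setIntegral_congr_fun (measurableSet_box₀ T) fun X hX => ?_
    have hX' := box₀_subset_boxc T hX
    have hwn := (hwC n).differentiable (by norm_num) X
    rw [pd_mul 2 hwn ((hP X hX').differentiableAt (by norm_num)),
      pd_mul 3 hwn ((hQ X hX').differentiableAt (by norm_num)), hwd, hwd, hr2, hr3]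
    simp only [hF, hgdef]
    ring
  have hdc : ∀ X ∈ boxc T, ContinuousAt (fun X => pd 2 P X + pd 3 Q X) X := fun X hX =>
    (continuousAt_pd (hP X hX) 2).add (continuousAt_pd (hQ X hX) 3)
  -- Dominated convergence: (n + 1) rⁿ |g| ≤ C (n + 1) rⁿ (1 - r) ≤ C, and this term tends to zero
  -- wherever r < 1.
  have hlim : Tendsto (fun n => ∫ X in box₀ T, F n X) atTop
      (𝓝 (∫ X in box₀ T, (pd 2 P X + pd 3 Q X))) := by
    apply tendsto_integral_of_dominated_convergence
      (fun X => |pd 2 P X + pd 3 Q X| + 2 * C)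
    · intro n
      refine Integrable.aestronglyMeasurable (integrableOn_box₀ ?_)
      intro X hX
      have h1 := hdc X hX
      have h2 := (hg X hX).continuousAt
      have h3 := ((hwC n).continuous.continuousAt (x := X))
      have h4 := (hrC.continuous.continuousAt (x := X))
      simp only [hF]
      exact (h3.mul h1).sub (continuousAt_const.mul ((continuousAt_const.mul (h4.pow n)).mul h2))
    · exact integrableOn_box₀ fun X hX => (hdc X hX).abs.add continuousAt_const
    · intro n
      refine (ae_restrict_iff' (measurableSet_box₀ T)).2 (Eventually.of_forall fun X hX => ?_)
      have hr0 : 0 ≤ r X := by positivity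
      have hr1 : r X ≤ 1 := hX.2.2
      have hp := pow_le_one₀ (n := n + 1) hr0 hr1
      have hp0 := pow_nonneg hr0 (n + 1)
      have h1 : |w n X * (pd 2 P X + pd 3 Q X)| ≤ |pd 2 P X + pd 3 Q X| := by
        rw [abs_mul]
        refine mul_le_of_le_one_left (abs_nonneg _) ?_
        rw [abs_le]; constructor <;> simp only [hw] <;> linarith
      have h2 : |2 * ((((n : ℝ) + 1) * r X ^ n) * g X)| ≤ 2 * C := by
        have hn : 0 ≤ ((n : ℝ) + 1) * r X ^ n := by positivity
        rw [abs_mul, abs_mul, abs_of_nonneg hn, abs_two]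
        have := mul_le_mul_of_nonneg_left (hb X hX) hn
        have h3 := mul_le_mul_of_nonneg_left (mul_pow_mul_one_sub_le hr0 hr1 n) hC
        nlinarith
      calc ‖F n X‖ ≤ _ := norm_sub_le _ _
        _ ≤ _ := add_le_add h1 h2
    · filter_upwards [ae_box₀_lt_one T] with X hX
      have hr0 : 0 ≤ r X := by positivity
      have t1 : Tendsto (fun n : ℕ => r X ^ (n + 1)) atTop (𝓝 0) :=
        (tendsto_pow_atTop_nhds_zero_of_lt_one hr0 hX).comp (tendsto_add_atTop_nat 1)
      have t2 : Tendsto (fun n : ℕ => ((n : ℝ) + 1) * r X ^ n) atTop (𝓝 0) := by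
        have a := tendsto_self_mul_const_pow_of_lt_one hr0 hX
        have b := tendsto_pow_atTop_nhds_zero_of_lt_one hr0 hX
        simpa [add_mul] using a.add b
      have t3 : Tendsto (fun n => F n X) atTop
          (𝓝 ((1 - 0) * (pd 2 P X + pd 3 Q X) - 2 * (0 * g X))) :=
        ((tendsto_const_nhds.sub t1).mul_const _).sub ((t2.mul_const _).const_mul 2)
      simpa using t3
  simp only [hzero] at hlim
  exact (tendsto_nhds_unique hlim tendsto_const_nhds)

/-! ### The divergence theorem on the region below a graph -/

theorem pd_comm {u : Coord → ℝ} {X : Coord} (hu : ContDiffAt ℝ 2 u X) (a b : Fin 4) :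
    pd a (pd b u) X = pd b (pd a u) X := by
  have hd : DifferentiableAt ℝ (fderiv ℝ u) X :=
    (hu.fderiv_right (m := 1) (by norm_num)).differentiableAt (by norm_num)
  have hpp : ∀ a b, pd a (pd b u) X
      = fderiv ℝ (fderiv ℝ u) X (Pi.single a 1) (Pi.single b 1) := by
    intro a b
    change fderiv ℝ (fun Y => fderiv ℝ u Y (Pi.single b 1)) X (Pi.single a 1) = _
    rw [fderiv_clm_apply hd (differentiableAt_const _)]
    simp
  rw [hpp, hpp]
  exact (hu.isSymmSndFDerivAt (by simp)).eq _ _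

theorem pd_comp_coord {u : Coord → ℝ} {σ : Coord → Coord} {X : Coord} (i : Fin 4)
    (hu : DifferentiableAt ℝ u (σ X)) (hσ : ∀ j, DifferentiableAt ℝ (fun Y => σ Y j) X) :
    pd i (fun Y => u (σ Y)) X = ∑ j, pd j u (σ X) * pd i (fun Y => σ Y j) X := by
  have h1 : HasFDerivAt σ (ContinuousLinearMap.pi fun j => fderiv ℝ (fun Y => σ Y j) X) X :=
    hasFDerivAt_pi.2 fun j => (hσ j).hasFDerivAt
  have h2 := (hu.hasFDerivAt.comp X h1).fderiv
  simp only [pd]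
  rw [show (fun Y => u (σ Y)) = u ∘ σ from rfl, h2]
  simp only [ContinuousLinearMap.comp_apply]
  set V := (ContinuousLinearMap.pi fun j => fderiv ℝ (fun Y => σ Y j) X) (Pi.single i 1) with hV
  have h3 : V = ∑ j, V j • (Pi.single j (1 : ℝ) : Coord) := by
    ext k; simp [Finset.sum_apply, Pi.single_apply]
  conv_lhs => rw [h3, map_sum]
  refine Finset.sum_congr rfl fun j _ => ?_
  rw [map_smul, smul_eq_mul, mul_comm]
  rfl

/-- A nonnegative graph function over the sphere at the times `0 ≤ τ ≤ T`, in one chart. -/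
structure IsGraph (T : ℝ) (ζ : Coord → ℝ) : Prop where
  smooth : ∀ X, X 0 ∈ Icc 0 T → ContDiffAt ℝ 2 ζ X
  indep : ∀ X s, ζ (Function.update X 1 s) = ζ X
  nonneg : ∀ X, X 0 ∈ Icc 0 T → 0 ≤ ζ X
  start : ∀ X, X 0 = 0 → ζ X = 0

/-- The region below the graph of `ζ`. -/
def under (T : ℝ) (ζ : Coord → ℝ) : Set Coord :=
  {X | (0 < X 0 ∧ X 0 < T) ∧ (0 < X 1 ∧ X 1 < ζ X) ∧ X 2 ^ 2 + X 3 ^ 2 ≤ 1}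

/-- The closed region below the graph of `ζ`. -/
def underc (T : ℝ) (ζ : Coord → ℝ) : Set Coord :=
  {X | (0 ≤ X 0 ∧ X 0 ≤ T) ∧ (0 ≤ X 1 ∧ X 1 ≤ ζ X) ∧ X 2 ^ 2 + X 3 ^ 2 ≤ 1}

/-- The map that stretches the box in the `z`-direction to the region below the graph. -/
def stretch (ζ : Coord → ℝ) (X : Coord) : Coord := ![X 0, X 1 * ζ X, X 2, X 3]

theorem under_subset_underc (T : ℝ) (ζ : Coord → ℝ) : under T ζ ⊆ underc T ζ := fun _ hX =>
  ⟨⟨hX.1.1.le, hX.1.2.le⟩, ⟨hX.2.1.1.le, hX.2.1.2.le⟩, hX.2.2⟩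

section

variable {T : ℝ} {ζ : Coord → ℝ}

theorem IsGraph.congr_of (hζ : IsGraph T ζ) {X X' : Coord} (h0 : X 0 = X' 0) (h2 : X 2 = X' 2)
    (h3 : X 3 = X' 3) : ζ X = ζ X' := by
  rw [← hζ.indep X (X' 1)]
  congr 1
  ext i
  fin_cases i <;> simp [h0, h2, h3]

theorem IsGraph.stretch_eq (hζ : IsGraph T ζ) (X : Coord) : ζ (stretch ζ X) = ζ X :=
  hζ.congr_of rfl rfl rfl

theorem IsGraph.stretch_mem (hζ : IsGraph T ζ) {X : Coord} (hX : X ∈ boxc T) :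
    stretch ζ X ∈ underc T ζ := by
  refine ⟨hX.1, ?_, hX.2.2⟩
  rw [hζ.stretch_eq]
  have := hζ.nonneg X hX.1
  exact ⟨mul_nonneg hX.2.1.1 this, mul_le_of_le_one_left this hX.2.1.2⟩

theorem IsGraph.differentiableAt (hζ : IsGraph T ζ) {X : Coord} (hX : X 0 ∈ Icc 0 T) :
    DifferentiableAt ℝ ζ X := (hζ.smooth X hX).differentiableAt (by norm_num)

theorem IsGraph.contDiffAt_stretch (hζ : IsGraph T ζ) {X : Coord} (hX : X 0 ∈ Icc 0 T) :
    ContDiffAt ℝ 2 (stretch ζ) X := by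
  have h := hζ.smooth X hX
  have hc : ∀ i : Fin 4, ContDiffAt ℝ 2 (fun X : Coord => X i) X := fun i => by fun_prop
  rw [contDiffAt_pi]
  intro i
  fin_cases i
  · exact hc 0
  · exact (hc 1).mul h
  · exact hc 2
  · exact hc 3

theorem IsGraph.under_subset_image (hζ : IsGraph T ζ) : under T ζ ⊆ stretch ζ '' boxc T := by
  intro X hX
  have hpos : 0 < ζ X := hX.2.1.1.trans hX.2.1.2
  refine ⟨![X 0, X 1 / ζ X, X 2, X 3], ⟨⟨hX.1.1.le, hX.1.2.le⟩,
    ⟨div_nonneg hX.2.1.1.le hpos.le, (div_le_one hpos).2 hX.2.1.2.le⟩, hX.2.2⟩, ?_⟩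
  have e : ζ ![X 0, X 1 / ζ X, X 2, X 3] = ζ X := hζ.congr_of rfl rfl rfl
  ext i
  fin_cases i <;> simp [stretch, e]
  field_simp

theorem IsGraph.isCompact_image (hζ : IsGraph T ζ) : IsCompact (stretch ζ '' boxc T) :=
  (isCompact_boxc T).image_of_continuousOn fun _ hX =>
    (hζ.contDiffAt_stretch hX.1).continuousAt.continuousWithinAt

/-- Compactness is taken from the image of the closed box under the stretching map. -/
theorem IsGraph.integrableOn_under (hζ : IsGraph T ζ) {F : Coord → ℝ}
    (hF : ∀ X ∈ underc T ζ, ContinuousAt F X) : IntegrableOn F (under T ζ) := by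
  refine (ContinuousOn.integrableOn_compact hζ.isCompact_image ?_).mono_set hζ.under_subset_image
  rintro _ ⟨X, hX, rfl⟩
  exact (hF _ (hζ.stretch_mem hX)).continuousWithinAt

theorem IsGraph.measurableSet_under (hζ : IsGraph T ζ) : MeasurableSet (under T ζ) := by
  have hU : IsOpen {X : Coord | 0 < X 0 ∧ X 0 < T} :=
    (isOpen_lt continuous_const (continuous_apply 0)).inter
      (isOpen_lt (continuous_apply 0) continuous_const)
  have hc : ContinuousOn (fun X => ζ X - X 1) {X : Coord | 0 < X 0 ∧ X 0 < T} := fun X hX =>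
    ((hζ.smooth X ⟨hX.1.le, hX.2.le⟩).continuousAt.sub
      (continuous_apply 1).continuousAt).continuousWithinAt
  have h1 := hc.isOpen_inter_preimage hU (isOpen_Ioi (a := (0 : ℝ)))
  have e : under T ζ = ({X : Coord | 0 < X 0 ∧ X 0 < T} ∩ (fun X => ζ X - X 1) ⁻¹' Ioi 0) ∩
      ({X | 0 < X 1} ∩ {X | X 2 ^ 2 + X 3 ^ 2 ≤ 1}) := by
    ext X
    simp only [under, mem_ofPred_eq, mem_inter_iff, mem_preimage, mem_Ioi, sub_pos]
    tauto
  rw [e]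
  refine h1.measurableSet.inter (MeasurableSet.inter ?_ ?_) <;> measurability

/-- Substitution in the z-fibres, where the stretching has Jacobian ζ. Fibres with ζ = 0 contribute
zero on both sides. -/
theorem IsGraph.integral_under (hζ : IsGraph T ζ) {F : Coord → ℝ}
    (hF : ∀ X ∈ underc T ζ, ContinuousAt F X) :
    ∫ X in under T ζ, F X = ∫ X in box₀ T, ζ X * F (stretch ζ X) := by
  have hcF : ∀ X ∈ boxc T, ContinuousAt (fun X => ζ X * F (stretch ζ X)) X := fun X hX =>
    (hζ.smooth X hX.1).continuousAt.mul
      (ContinuousAt.comp (hF _ (hζ.stretch_mem hX)) (hζ.contDiffAt_stretch hX.1).continuousAt)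
  have hA := measurableSet_tanCell T
  have i1 : ∀ z Y, (1 : Fin 4).insertNth (α := fun _ => ℝ) z Y = ![Y 0, z, Y 1, Y 2] :=
    insertNth_one_eq
  rw [setIntegral_insertNth (1 : Fin 4) hA (measurableSet_box₀ T) (I := fun _ => Ioo 0 1)
      (by intro z Y; rw [i1]; simp [box₀, tanCell]; tauto) (integrableOn_box₀ hcF),
    setIntegral_insertNth (1 : Fin 4) hA hζ.measurableSet_under
      (I := fun Y => Ioo 0 (ζ ![Y 0, 0, Y 1, Y 2]))
      (by
        intro z Y
        rw [i1]
        have e : ζ ![Y 0, z, Y 1, Y 2] = ζ ![Y 0, 0, Y 1, Y 2] := hζ.congr_of rfl rfl rfl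
        simp [under, tanCell, e]; tauto) (hζ.integrableOn_under hF)]
  refine setIntegral_congr_fun hA fun Y hY => ?_
  have h0 : 0 ≤ ζ ![Y 0, 0, Y 1, Y 2] := hζ.nonneg _ ⟨hY.1.le, hY.2.1.le⟩
  rw [setIntegral_congr_set Ioo_ae_eq_Ioc, setIntegral_congr_set Ioo_ae_eq_Ioc,
    ← intervalIntegral.integral_of_le h0, ← intervalIntegral.integral_of_le zero_le_one]
  have h := intervalIntegral.smul_integral_comp_mul_right
    (a := 0) (b := 1) (fun z => F ((1 : Fin 4).insertNth (α := fun _ => ℝ) z Y)) (ζ ![Y 0, 0, Y 1, Y 2])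
  rw [zero_mul, one_mul] at h
  rw [← h, smul_eq_mul, ← intervalIntegral.integral_const_mul]
  refine intervalIntegral.integral_congr fun z _ => ?_
  have e : ζ ![Y 0, z, Y 1, Y 2] = ζ ![Y 0, 0, Y 1, Y 2] := hζ.congr_of rfl rfl rfl
  simp only [i1, stretch, e, Matrix.cons_val]

theorem IsGraph.pd_one_of_differentiableAt (hζ : IsGraph T ζ) {X : Coord}
    (hX : DifferentiableAt ℝ ζ X) : pd 1 ζ X = 0 := by
  have h2 : HasDerivAt (fun s => Function.update X 1 s) (Pi.single (1 : Fin 4) (1 : ℝ)) (X 1) :=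
    hasDerivAt_update X 1 (X 1)
  have h3 : HasDerivAt (fun s => ζ (Function.update X 1 s)) (pd 1 ζ X) (X 1) := by
    have : HasFDerivAt ζ (fderiv ℝ ζ X) (Function.update X 1 (X 1)) := by
      rw [Function.update_eq_self]; exact hX.hasFDerivAt
    exact this.comp_hasDerivAt _ h2
  simp only [hζ.indep] at h3
  exact h3.unique (hasDerivAt_const _ _)

theorem IsGraph.pd_one (hζ : IsGraph T ζ) {X : Coord} (hX : X 0 ∈ Icc 0 T) : pd 1 ζ X = 0 :=
  hζ.pd_one_of_differentiableAt (hζ.differentiableAt hX)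

/-- The vector field on the box that corresponds to `J`. -/
def boxField (ζ : Coord → ℝ) (J : Fin 4 → Coord → ℝ) (i : Fin 4) (X : Coord) : ℝ :=
  if i = 1 then
    J 1 (stretch ζ X) - X 1 * (pd 0 ζ X * J 0 (stretch ζ X) + pd 2 ζ X * J 2 (stretch ζ X)
      + pd 3 ζ X * J 3 (stretch ζ X))
  else ζ X * J i (stretch ζ X)

theorem contDiffAt_pd {u : Coord → ℝ} {X : Coord} {n : ℕ} (hu : ContDiffAt ℝ (n + 1 : ℕ) u X)
    (i : Fin 4) : ContDiffAt ℝ n (pd i u) X := by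
  have h : ContDiffAt ℝ n (fderiv ℝ u) X := hu.fderiv_right (by push_cast; exact le_rfl)
  exact h.clm_apply contDiffAt_const

theorem IsGraph.contDiffAt_boxField (hζ : IsGraph T ζ) {J : Fin 4 → Coord → ℝ}
    (hJ : ∀ i, ∀ X ∈ underc T ζ, ContDiffAt ℝ 1 (J i) X) (i : Fin 4) {X : Coord}
    (hX : X ∈ boxc T) : ContDiffAt ℝ 1 (boxField ζ J i) X := by
  have hs : ContDiffAt ℝ 1 (stretch ζ) X := (hζ.contDiffAt_stretch hX.1).of_le (by norm_num)
  have hJs : ∀ i, ContDiffAt ℝ 1 (fun X => J i (stretch ζ X)) X := fun i =>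
    (hJ i _ (hζ.stretch_mem hX)).comp X hs
  have hp : ∀ i, ContDiffAt ℝ 1 (pd i ζ) X := fun i =>
    contDiffAt_pd (n := 1) (by exact_mod_cast hζ.smooth X hX.1) i
  have hz : ContDiffAt ℝ 1 ζ X := (hζ.smooth X hX.1).of_le (by norm_num)
  have hc : ContDiffAt ℝ 1 (fun X : Coord => X 1) X := by fun_prop
  unfold boxField
  by_cases h : i = 1
  · simp only [h, if_true]
    exact (hJs 1).sub (hc.mul ((((hp 0).mul (hJs 0)).add ((hp 2).mul (hJs 2))).add
      ((hp 3).mul (hJs 3))))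
  · simp only [h, if_false]
    exact hz.mul (hJs i)

theorem IsGraph.pd_comp_stretch (hζ : IsGraph T ζ) {u : Coord → ℝ} {X : Coord} (hX : X ∈ boxc T)
    (hu : DifferentiableAt ℝ u (stretch ζ X)) (i : Fin 4) :
    pd i (fun Y => u (stretch ζ Y)) X
      = if i = 1 then pd 1 u (stretch ζ X) * ζ X
        else pd i u (stretch ζ X) + pd 1 u (stretch ζ X) * (X 1 * pd i ζ X) := by
  have hd := hζ.differentiableAt hX.1
  have e0 : (fun Y => stretch ζ Y 0) = fun Y => Y 0 := rfl
  have e1 : (fun Y => stretch ζ Y 1) = fun Y => Y 1 * ζ Y := rfl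
  have e2 : (fun Y => stretch ζ Y 2) = fun Y => Y 2 := rfl
  have e3 : (fun Y => stretch ζ Y 3) = fun Y => Y 3 := rfl
  have hdiff : ∀ j, DifferentiableAt ℝ (fun Y => stretch ζ Y j) X := by
    intro j
    exact (differentiableAt_pi.1 ((hζ.contDiffAt_stretch hX.1).differentiableAt (by norm_num)) j)
  rw [pd_comp_coord i hu hdiff, Fin.sum_univ_four, e0, e1, e2, e3,
    pd_mul i (by fun_prop) hd, pd_coord, pd_coord, pd_coord, pd_coord]
  have := hζ.pd_one hX.1
  fin_cases i <;> simp [this, add_comm]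

/-- `boxField` is the Piola transform of J under the stretching, and such a transform multiplies the
divergence by the Jacobian ζ. It contains first derivatives of ζ, which is why ζ has to be of class
C². -/
theorem IsGraph.div_boxField (hζ : IsGraph T ζ) {J : Fin 4 → Coord → ℝ}
    (hJ : ∀ i, ∀ X ∈ underc T ζ, ContDiffAt ℝ 1 (J i) X) {X : Coord} (hX : X ∈ boxc T) :
    ∑ i, pd i (boxField ζ J i) X = ζ X * ∑ i, pd i (J i) (stretch ζ X) := by
  have hs : ContDiffAt ℝ 1 (stretch ζ) X := (hζ.contDiffAt_stretch hX.1).of_le (by norm_num)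
  have hJs : ∀ i, DifferentiableAt ℝ (fun X => J i (stretch ζ X)) X := fun i =>
    ((hJ i _ (hζ.stretch_mem hX)).comp X hs).differentiableAt (by norm_num)
  have hJd : ∀ i, DifferentiableAt ℝ (J i) (stretch ζ X) := fun i =>
    (hJ i _ (hζ.stretch_mem hX)).differentiableAt (by norm_num)
  have hp : ∀ i, DifferentiableAt ℝ (pd i ζ) X := fun i =>
    (contDiffAt_pd (n := 1) (by exact_mod_cast hζ.smooth X hX.1) i).differentiableAt (by norm_num)
  have hz := hζ.differentiableAt hX.1
  have hc : DifferentiableAt ℝ (fun X : Coord => X 1) X := by fun_prop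
  have f0 : boxField ζ J 0 = fun X => ζ X * J 0 (stretch ζ X) := by ext; simp [boxField]
  have f2 : boxField ζ J 2 = fun X => ζ X * J 2 (stretch ζ X) := by ext; simp [boxField]
  have f3 : boxField ζ J 3 = fun X => ζ X * J 3 (stretch ζ X) := by ext; simp [boxField]
  have f1 : boxField ζ J 1 = fun X => J 1 (stretch ζ X) - X 1 * (pd 0 ζ X * J 0 (stretch ζ X)
      + pd 2 ζ X * J 2 (stretch ζ X) + pd 3 ζ X * J 3 (stretch ζ X)) := by ext; simp [boxField]
  -- The only second derivatives of ζ that occur are mixed with z. They vanish because ζ does not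
  -- depend on z.
  have hsym : ∀ i, pd 1 (pd i ζ) X = 0 := by
    intro i
    have hev : ∀ᶠ Y in 𝓝 X, ContDiffAt ℝ 2 ζ Y := (hζ.smooth X hX.1).eventually (by simp)
    rw [pd_comm (hζ.smooth X hX.1)]
    have : pd 1 ζ =ᶠ[𝓝 X] fun _ => 0 :=
      hev.mono fun Y hY => hζ.pd_one_of_differentiableAt (hY.differentiableAt (by norm_num))
    rw [pd_congr this, pd_const]
  have hz1 := hζ.pd_one hX.1
  have m : ∀ i, DifferentiableAt ℝ (fun Y => pd i ζ Y * J i (stretch ζ Y)) X := fun i =>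
    (hp i).mul (hJs i)
  rw [Fin.sum_univ_four, Fin.sum_univ_four, f0, f1, f2, f3, pd_mul 0 hz (hJs 0),
    pd_mul 2 hz (hJs 2), pd_mul 3 hz (hJs 3),
    pd_sub 1 (hJs 1) (hc.fun_mul (((m 0).fun_add (m 2)).fun_add (m 3))),
    pd_mul 1 hc (((m 0).fun_add (m 2)).fun_add (m 3)), pd_add 1 ((m 0).fun_add (m 2)) (m 3),
    pd_add 1 (m 0) (m 2), pd_mul 1 (hp 0) (hJs 0), pd_mul 1 (hp 2) (hJs 2),
    pd_mul 1 (hp 3) (hJs 3), hsym, hsym, hsym, pd_coord,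
    hζ.pd_comp_stretch hX (hJd 0), hζ.pd_comp_stretch hX (hJd 2), hζ.pd_comp_stretch hX (hJd 3),
    hζ.pd_comp_stretch hX (hJd 0), hζ.pd_comp_stretch hX (hJd 1), hζ.pd_comp_stretch hX (hJd 2),
    hζ.pd_comp_stretch hX (hJd 3)]
  simp
  ring

end

/-- The divergence theorem on the region below a graph, on the whole sphere. -/
theorem sum_integral_div_le {T : ℝ} (hT : 0 ≤ T) {ζ : Bool → Coord → ℝ}
    (hζ : ∀ ε, IsGraph T (ζ ε)) {J : Bool → Fin 4 → Coord → ℝ}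
    (hJ : ∀ ε i, ∀ X ∈ underc T (ζ ε), ContDiffAt ℝ 1 (J ε i) X)
    (hend : ∀ ε, ∀ X ∈ underc T (ζ ε), J ε 0 X ≤ 0)
    (hζeq : ∀ X : Coord, X 2 ^ 2 + X 3 ^ 2 = 1 → ζ true X = ζ false X)
    (heq : ∀ X ∈ under T (ζ true), X 2 ^ 2 + X 3 ^ 2 = 1 →
      X 2 * J true 2 X + X 3 * J true 3 X + (X 2 * J false 2 X + X 3 * J false 3 X) = 0) :
    ∑ ε, ∫ X in under T (ζ ε), ∑ i, pd i (J ε i) X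
      ≤ ∑ ε, ∫ Y in tanCell T,
        ((J ε 1 ![Y 0, ζ ε ![Y 0, 0, Y 1, Y 2], Y 1, Y 2]
          - (pd 0 (ζ ε) ![Y 0, 0, Y 1, Y 2] * J ε 0 ![Y 0, ζ ε ![Y 0, 0, Y 1, Y 2], Y 1, Y 2]
            + pd 2 (ζ ε) ![Y 0, 0, Y 1, Y 2] * J ε 2 ![Y 0, ζ ε ![Y 0, 0, Y 1, Y 2], Y 1, Y 2]
            + pd 3 (ζ ε) ![Y 0, 0, Y 1, Y 2] * J ε 3 ![Y 0, ζ ε ![Y 0, 0, Y 1, Y 2], Y 1, Y 2]))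
          - J ε 1 ![Y 0, 0, Y 1, Y 2]) := by
  have hB : ∀ ε i, ∀ X ∈ boxc T, ContDiffAt ℝ 1 (boxField (ζ ε) (J ε) i) X := fun ε i X hX =>
    (hζ ε).contDiffAt_boxField (hJ ε) i hX
  have hint : ∀ ε i, IntegrableOn (pd i (boxField (ζ ε) (J ε) i)) (box₀ T) := fun ε i =>
    integrableOn_box₀ fun X hX => continuousAt_pd (hB ε i X hX) i
  have hint2 : ∀ ε i j, IntegrableOn (fun X => pd i (boxField (ζ ε) (J ε) i) X
      + pd j (boxField (ζ ε) (J ε) j) X) (box₀ T) := fun ε i j => (hint ε i).add (hint ε j)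
  have h1 : ∀ ε, ∫ X in under T (ζ ε), ∑ i, pd i (J ε i) X
      = (∫ X in box₀ T, pd 0 (boxField (ζ ε) (J ε) 0) X)
        + (∫ X in box₀ T, pd 1 (boxField (ζ ε) (J ε) 1) X)
        + ∫ X in box₀ T, (pd 2 (boxField (ζ ε) (J ε) 2) X + pd 3 (boxField (ζ ε) (J ε) 3) X) := by
    intro ε
    rw [(hζ ε).integral_under fun X hX => tendsto_finsetSum _ fun i _ =>
        continuousAt_pd (hJ ε i X hX) i, ← integral_add (hint ε 0) (hint ε 1),
      ← integral_add (hint2 ε 0 1) (hint2 ε 2 3)]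
    refine setIntegral_congr_fun (measurableSet_box₀ T) fun X hX => ?_
    have := (hζ ε).div_boxField (hJ ε) (box₀_subset_boxc T hX)
    rw [Fin.sum_univ_four] at this
    rw [← this]
    ring
  -- At τ = 0 the factor ζ is zero. At τ = T the sign of J⁰ allows the flux to be dropped.
  have h2 : ∀ ε, ∫ X in box₀ T, pd 0 (boxField (ζ ε) (J ε) 0) X ≤ 0 := by
    intro ε
    refine box_integral_pd_zero_nonpos hT (hB ε 0) (fun X _ h => ?_) fun X hX _ => ?_
    · simp [boxField, (hζ ε).start X h]
    · simp only [boxField]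
      exact mul_nonpos_of_nonneg_of_nonpos ((hζ ε).nonneg X hX.1)
        (hend ε _ ((hζ ε).stretch_mem hX))
  have h3 : (∫ X in box₀ T, (pd 2 (boxField (ζ true) (J true) 2) X
        + pd 3 (boxField (ζ true) (J true) 3) X))
      + ∫ X in box₀ T, (pd 2 (boxField (ζ false) (J false) 2) X
        + pd 3 (boxField (ζ false) (J false) 3) X) = 0 := by
    rw [← integral_add (hint2 true 2 3) (hint2 false 2 3)]
    have := box_integral_angular_eq_zero (T := T)
      (P := fun X => boxField (ζ true) (J true) 2 X + boxField (ζ false) (J false) 2 X)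
      (Q := fun X => boxField (ζ true) (J true) 3 X + boxField (ζ false) (J false) 3 X)
      (fun X hX => (hB true 2 X hX).add (hB false 2 X hX))
      (fun X hX => (hB true 3 X hX).add (hB false 3 X hX)) ?_
    · rw [← this]
      refine setIntegral_congr_fun (measurableSet_box₀ T) fun X hX => ?_
      have d : ∀ ε i, DifferentiableAt ℝ (boxField (ζ ε) (J ε) i) X := fun ε i =>
        (hB ε i X (box₀_subset_boxc T hX)).differentiableAt (by norm_num)
      rw [pd_add 2 (d _ _) (d _ _), pd_add 3 (d _ _) (d _ _)]
      ring
    · intro X hX hr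
      have hX' := box₀_subset_boxc T hX
      have e := hζeq X hr
      have es : stretch (ζ false) X = stretch (ζ true) X := by simp [stretch, e]
      -- The cancellation is assumed on the open region only. Where ζ = 0 that region has no points
      -- over X, but there the angular part of the box field is zero as well.
      rcases ((hζ true).nonneg X hX'.1).eq_or_lt with h | h
      · simp [boxField, ← e, ← h]
      · have hm : stretch (ζ true) X ∈ under T (ζ true) := by
          refine ⟨hX.1, ?_, hX.2.2⟩
          rw [(hζ true).stretch_eq]
          exact ⟨mul_pos hX.2.1.1 h, mul_lt_of_lt_one_left h hX.2.1.2⟩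
        have := heq _ hm hr
        have a2 : stretch (ζ true) X 2 = X 2 := rfl
        have a3 : stretch (ζ true) X 3 = X 3 := rfl
        rw [a2, a3] at this
        simp only [boxField, es, ← e]
        simp only [show (2 : Fin 4) ≠ 1 by decide, show (3 : Fin 4) ≠ 1 by decide, if_false]
        linear_combination (ζ true X) * this
  have h4 : ∀ ε (Y : Fin 3 → ℝ),
      boxField (ζ ε) (J ε) 1 ![Y 0, 1, Y 1, Y 2] - boxField (ζ ε) (J ε) 1 ![Y 0, 0, Y 1, Y 2] = _ :=
    fun ε Y => rfl
  calc ∑ ε, ∫ X in under T (ζ ε), ∑ i, pd i (J ε i) X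
      ≤ ∑ ε, ∫ X in box₀ T, pd 1 (boxField (ζ ε) (J ε) 1) X := by
        simp only [Fintype.sum_bool, h1]
        linarith [h2 true, h2 false]
    _ = _ := by
        refine Finset.sum_congr rfl fun ε _ => ?_
        rw [box_integral_pd_one (hB ε 1)]
        refine setIntegral_congr_fun (measurableSet_tanCell T) fun Y hY => ?_
        have hz : ∀ s, ζ ε ![Y 0, s, Y 1, Y 2] = ζ ε ![Y 0, 0, Y 1, Y 2] := fun s =>
          (hζ ε).congr_of rfl rfl rfl
        -- The function ζ is invariant under translation in z, and so are its derivatives.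
        have hp : ∀ i, pd i (ζ ε) ![Y 0, 1, Y 1, Y 2] = pd i (ζ ε) ![Y 0, 0, Y 1, Y 2] := by
          intro i
          have e : ζ ε = fun X => ζ ε (X + Pi.single 1 1) := by
            ext X
            exact (hζ ε).congr_of (by simp) (by simp) (by simp)
          have e2 : (![Y 0, 1, Y 1, Y 2] : Coord) = ![Y 0, 0, Y 1, Y 2] + Pi.single 1 1 := by
            ext j; fin_cases j <;> simp
          simp only [pd]
          conv_rhs => rw [e, fderiv_comp_add_right]
          rw [e2]
        simp only [boxField, stretch, if_true, Matrix.cons_val, one_mul, zero_mul, sub_zero, hz, hp]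

/-! ### The stereographic coordinate vectors -/

/-- The value of `∂_j` of the inverse stereographic projection. -/
def sphVecVal (s x y : ℝ) (j : Fin 4) : E3 :=
  if j = 2 then !₂[(2 * (1 + x ^ 2 + y ^ 2) - 4 * x ^ 2) / (1 + x ^ 2 + y ^ 2) ^ 2,
    -4 * x * y / (1 + x ^ 2 + y ^ 2) ^ 2, 4 * s * x / (1 + x ^ 2 + y ^ 2) ^ 2]
  else if j = 3 then !₂[-4 * x * y / (1 + x ^ 2 + y ^ 2) ^ 2,
    (2 * (1 + x ^ 2 + y ^ 2) - 4 * y ^ 2) / (1 + x ^ 2 + y ^ 2) ^ 2,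
    4 * s * y / (1 + x ^ 2 + y ^ 2) ^ 2]
  else 0

theorem pd_div {u v : Coord → ℝ} {X : Coord} (i : Fin 4) (hu : DifferentiableAt ℝ u X)
    (hv : DifferentiableAt ℝ v X) (h0 : v X ≠ 0) :
    pd i (fun Y => u Y / v Y) X = (pd i u X * v X - u X * pd i v X) / v X ^ 2 := by
  simp only [div_eq_mul_inv]
  rw [pd_mul i hu (hv.fun_inv h0), pd_comp i (hasDerivAt_inv h0) hv]
  field_simp
  ring

theorem contDiff_stereo (ε : Bool) {n : WithTop ℕ∞} :
    ContDiff ℝ n fun X : Coord => ((stereo ε (X 2) (X 3) : S2) : E3) := by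
  have hne : ∀ X : Coord, 1 + X 2 ^ 2 + X 3 ^ 2 ≠ 0 := fun X => by positivity
  rw [contDiff_euclidean]
  intro i
  fin_cases i <;> simp [stereo] <;> refine ContDiff.div (by fun_prop) (by fun_prop) hne

theorem sphVec_apply (ε : Bool) (X : Coord) (j : Fin 4) (i : Fin 3) :
    sphVec ε X j i = pd j (fun Y => ((stereo ε (Y 2) (Y 3) : S2) : E3) i) X := by
  have hd : DifferentiableAt ℝ (fun X : Coord => ((stereo ε (X 2) (X 3) : S2) : E3)) X :=
    (contDiff_stereo (n := 1) ε).differentiable (by norm_num) X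
  have h := (EuclideanSpace.proj (𝕜 := ℝ) i).hasFDerivAt.comp X hd.hasFDerivAt
  simp only [pd, sphVec]
  have h2 := h.fderiv
  rw [show (fun Y : Coord => ((stereo ε (Y 2) (Y 3) : S2) : E3) i)
    = (EuclideanSpace.proj (𝕜 := ℝ) i) ∘ (fun X : Coord => ((stereo ε (X 2) (X 3) : S2) : E3)) from rfl, h2]
  rfl

theorem sphVec_eq (ε : Bool) (X : Coord) (j : Fin 4) :
    sphVec ε X j = sphVecVal (poleSign ε) (X 2) (X 3) j := by
  have hne : 1 + X 2 ^ 2 + X 3 ^ 2 ≠ 0 := by positivity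
  have hD : DifferentiableAt ℝ (fun Y : Coord => 1 + Y 2 ^ 2 + Y 3 ^ 2) X := by fun_prop
  have pD : pd j (fun Y : Coord => 1 + Y 2 ^ 2 + Y 3 ^ 2) X
      = 2 * X 2 * (if 2 = j then 1 else 0) + 2 * X 3 * (if 3 = j then 1 else 0) := by
    rw [pd_add j (by fun_prop) (by fun_prop), pd_add j (by fun_prop) (by fun_prop), pd_const,
      pd_pow j 2 (by fun_prop), pd_pow j 2 (by fun_prop), pd_coord, pd_coord]
    simp
  ext i
  rw [sphVec_apply]
  fin_cases i
  · change pd j (fun Y : Coord => 2 * Y 2 / (1 + Y 2 ^ 2 + Y 3 ^ 2)) X = _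
    rw [pd_div j (by fun_prop) hD hne, pD, pd_mul j (by fun_prop) (by fun_prop), pd_const, pd_coord]
    fin_cases j <;> simp [sphVecVal] <;> ring
  · change pd j (fun Y : Coord => 2 * Y 3 / (1 + Y 2 ^ 2 + Y 3 ^ 2)) X = _
    rw [pd_div j (by fun_prop) hD hne, pD, pd_mul j (by fun_prop) (by fun_prop), pd_const, pd_coord]
    fin_cases j <;> simp [sphVecVal] <;> ring
  · change pd j (fun Y : Coord => poleSign ε * (Y 2 ^ 2 + Y 3 ^ 2 - 1) / (1 + Y 2 ^ 2 + Y 3 ^ 2)) X = _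
    rw [pd_div j (by fun_prop) hD hne, pD, pd_mul j (by fun_prop) (by fun_prop), pd_const,
      pd_sub j (by fun_prop) (by fun_prop), pd_add j (by fun_prop) (by fun_prop), pd_const,
      pd_pow j 2 (by fun_prop), pd_pow j 2 (by fun_prop), pd_coord, pd_coord]
    fin_cases j <;> simp [sphVecVal] <;> ring

theorem sphVec_zero (ε : Bool) (X : Coord) : sphVec ε X 0 = 0 := by
  rw [sphVec_eq]; simp [sphVecVal]

theorem sphVec_one (ε : Bool) (X : Coord) : sphVec ε X 1 = 0 := by
  rw [sphVec_eq]; simp [sphVecVal]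

theorem inner_E3 (a b : E3) : inner ℝ a b = a 0 * b 0 + a 1 * b 1 + a 2 * b 2 := by
  rw [PiLp.inner_apply, Fin.sum_univ_three]
  simp only [RCLike.inner_apply, conj_trivial]
  ring

/-- The conformal factor of the stereographic coordinates. -/
def conf (X : Coord) : ℝ := 1 + X 2 ^ 2 + X 3 ^ 2

theorem conf_pos (X : Coord) : 0 < conf X := by unfold conf; positivity

theorem inner_sphVec_two (ε : Bool) (X : Coord) :
    inner ℝ (sphVec ε X 2) (sphVec ε X 2) = 4 / conf X ^ 2 := by
  have hne : 1 + X 2 ^ 2 + X 3 ^ 2 ≠ 0 := by positivity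
  have hs := poleSign_sq ε
  rw [inner_E3, sphVec_eq]
  simp [sphVecVal, conf]
  field_simp
  rw [hs]
  ring

theorem inner_sphVec_three (ε : Bool) (X : Coord) :
    inner ℝ (sphVec ε X 3) (sphVec ε X 3) = 4 / conf X ^ 2 := by
  have hne : 1 + X 2 ^ 2 + X 3 ^ 2 ≠ 0 := by positivity
  have hs := poleSign_sq ε
  rw [inner_E3, sphVec_eq]
  simp [sphVecVal, conf]
  field_simp
  rw [hs]
  ring

theorem inner_sphVec_two_three (ε : Bool) (X : Coord) :
    inner ℝ (sphVec ε X 2) (sphVec ε X 3) = 0 := by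
  have hne : 1 + X 2 ^ 2 + X 3 ^ 2 ≠ 0 := by positivity
  have hs := poleSign_sq ε
  rw [inner_E3, sphVec_eq, sphVec_eq]
  simp [sphVecVal]
  field_simp
  rw [hs]
  ring

theorem inner_sphVec_stereo (ε : Bool) (X : Coord) (j : Fin 4) :
    inner ℝ (sphVec ε X j) ((stereo ε (X 2) (X 3) : S2) : E3) = 0 := by
  have hne : 1 + X 2 ^ 2 + X 3 ^ 2 ≠ 0 := by positivity
  have hs := poleSign_sq ε
  rw [inner_E3, sphVec_eq]
  fin_cases j <;> simp [sphVecVal, stereo]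
  · field_simp
    rw [hs]
    ring
  · field_simp
    rw [hs]
    ring

/-- The angular component of a vector of `E3`. -/
def angComp (ε : Bool) (X : Coord) (ξ : E3) (j : Fin 4) : ℝ :=
  conf X ^ 2 / 4 * inner ℝ ξ (sphVec ε X j)

/-- The position vector and the two coordinate vectors form an orthogonal basis of Euclidean space,
and the latter two have square length 4 / conf². -/
theorem eq_angComp (ε : Bool) (X : Coord) (ξ : E3)
    (h : inner ℝ ξ ((stereo ε (X 2) (X 3) : S2) : E3) = 0) :
    ξ = angComp ε X ξ 2 • sphVec ε X 2 + angComp ε X ξ 3 • sphVec ε X 3 := by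
  have hne : 1 + X 2 ^ 2 + X 3 ^ 2 ≠ 0 := by positivity
  have hs := poleSign_sq ε
  -- The expansion of an arbitrary vector in this orthogonal basis, checked component by component.
  -- Tangency then removes the first term.
  have h2 : ξ = (inner ℝ ξ ((stereo ε (X 2) (X 3) : S2) : E3)) • ((stereo ε (X 2) (X 3) : S2) : E3)
      + (angComp ε X ξ 2 • sphVec ε X 2 + angComp ε X ξ 3 • sphVec ε X 3) := by
    have hs3 : poleSign ε ^ 3 = poleSign ε := by rw [pow_succ, hs, one_mul]
    ext i
    simp only [angComp, sphVec_eq, inner_E3]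
    fin_cases i <;> simp [sphVecVal, stereo, conf]
    · field_simp
      ring_nf
    · field_simp
      ring_nf
    · field_simp
      ring_nf
      simp only [hs]
      ring
  rw [h, zero_smul, zero_add] at h2
  exact h2

/-! ### The conformal metric and its inverse -/

/-- The components of the angular part of the metric. -/
def angMet (G : BondiData) (ε : Bool) (X : Coord) (i j : Fin 4) : ℝ :=
  Real.exp (-2 * G.η (chart ε X)) * G.h (chart ε X) (sphVec ε X i) (sphVec ε X j)

/-- The determinant of the angular part of the metric. -/
def angDet (G : BondiData) (ε : Bool) (X : Coord) : ℝ :=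
  angMet G ε X 2 2 * angMet G ε X 3 3 - angMet G ε X 2 3 ^ 2

section

variable {G : BondiData} {Λ T R : ℝ} {k : ℕ} {ε : Bool} {X : Coord}

theorem IsAsymptoticallyAdS.angDet_eq (hG : IsAsymptoticallyAdS G Λ T R k)
    (hX : chart ε X ∈ slab T R) :
    angDet G ε X = Real.exp (-2 * G.η (chart ε X)) ^ 2 * (4 / conf X ^ 2) ^ 2 := by
  have h := hG.h_det ε X hX
  rw [inner_sphVec_two, inner_sphVec_three, inner_sphVec_two_three] at h
  unfold angDet angMet
  linear_combination Real.exp (-2 * G.η (chart ε X)) ^ 2 * h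

theorem IsAsymptoticallyAdS.angDet_pos (hG : IsAsymptoticallyAdS G Λ T R k)
    (hX : chart ε X ∈ slab T R) : 0 < angDet G ε X := by
  rw [hG.angDet_eq hX]
  have := conf_pos X
  positivity

theorem IsAsymptoticallyAdS.angMet_pos (hG : IsAsymptoticallyAdS G Λ T R k)
    (hX : chart ε X ∈ slab T R) : 0 < angMet G ε X 2 2 := by
  refine mul_pos (Real.exp_pos _) (hG.h_pos _ hX _ (inner_sphVec_stereo ε X 2) ?_)
  intro h
  have h2 := inner_sphVec_two ε X
  rw [h, inner_zero_left] at h2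
  have := conf_pos X
  have : 0 < 4 / conf X ^ 2 := by positivity
  linarith

theorem IsAsymptoticallyAdS.gLow_eq (hG : IsAsymptoticallyAdS G Λ T R k)
    (hX : chart ε X ∈ slab T R) :
    gLow G ε X =
      let u := angComp ε X (G.U (chart ε X))
      let p := angMet G ε X
      !![-G.W (chart ε X) + u 2 * u 2 * p 2 2 + 2 * u 2 * u 3 * p 2 3 + u 3 * u 3 * p 3 3, 1,
          -(u 2 * p 2 2 + u 3 * p 2 3), -(u 2 * p 2 3 + u 3 * p 3 3);
        1, 0, 0, 0;
        -(u 2 * p 2 2 + u 3 * p 2 3), 0, p 2 2, p 2 3;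
        -(u 2 * p 2 3 + u 3 * p 3 3), 0, p 2 3, p 3 3] := by
  have hU := eq_angComp ε X (G.U (chart ε X)) (hG.U_tangent _ hX)
  have hs : G.h (chart ε X) (sphVec ε X 3) (sphVec ε X 2)
      = G.h (chart ε X) (sphVec ε X 2) (sphVec ε X 3) :=
    hG.h_symm _ hX _ _ (inner_sphVec_stereo ε X 3) (inner_sphVec_stereo ε X 2)
  set u := angComp ε X (G.U (chart ε X)) with hu
  simp only [angMet]
  ext i j
  unfold gLow
  rw [hU]
  generalize Real.exp (-2 * G.η (chart ε X)) = e
  fin_cases i <;> fin_cases j <;> simp [sphVec_zero, sphVec_one, hs] <;> ring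

theorem angMet_symm (hG : IsAsymptoticallyAdS G Λ T R k) (hX : chart ε X ∈ slab T R) :
    angMet G ε X 3 2 = angMet G ε X 2 3 := by
  unfold angMet
  rw [hG.h_symm _ hX _ _ (inner_sphVec_stereo ε X 3) (inner_sphVec_stereo ε X 2)]

/-- The Bondi form makes the inverse explicit: g^{00} = g^{0A} = 0, g^{01} = 1, g^{11} = W, g^{1A} =
U^A, and g^{AB} is the inverse of the angular block. In particular the hypersurfaces τ = const are
null. -/
theorem IsAsymptoticallyAdS.gLow_mul_inv (hG : IsAsymptoticallyAdS G Λ T R k)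
    (hX : chart ε X ∈ slab T R) :
    gLow G ε X *
      (let u := angComp ε X (G.U (chart ε X))
      let p := angMet G ε X
      !![0, 1, 0, 0;
        1, G.W (chart ε X), u 2, u 3;
        0, u 2, p 3 3 / angDet G ε X, -p 2 3 / angDet G ε X;
        0, u 3, -p 2 3 / angDet G ε X, p 2 2 / angDet G ε X]) = 1 := by
  have hd := (hG.angDet_pos hX).ne'
  rw [hG.gLow_eq hX]
  have hdd : angDet G ε X = angMet G ε X 2 2 * angMet G ε X 3 3 - angMet G ε X 2 3 ^ 2 := rfl
  dsimp only
  generalize angDet G ε X = d at hd hdd ⊢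
  generalize angMet G ε X = p at hdd ⊢
  generalize angComp ε X (G.U (chart ε X)) = u
  ext i j
  fin_cases i <;> fin_cases j <;>
    simp [Matrix.mul_apply, Fin.sum_univ_four] <;> field_simp <;> (try rw [hdd]) <;> ring

theorem IsAsymptoticallyAdS.gUp_eq (hG : IsAsymptoticallyAdS G Λ T R k)
    (hX : chart ε X ∈ slab T R) :
    gUp G ε X =
      let u := angComp ε X (G.U (chart ε X))
      let p := angMet G ε X
      !![0, 1, 0, 0;
        1, G.W (chart ε X), u 2, u 3;
        0, u 2, p 3 3 / angDet G ε X, -p 2 3 / angDet G ε X;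
        0, u 3, -p 2 3 / angDet G ε X, p 2 2 / angDet G ε X] :=
  Matrix.inv_eq_right_inv (hG.gLow_mul_inv hX)

theorem IsAsymptoticallyAdS.det_gLow (hG : IsAsymptoticallyAdS G Λ T R k)
    (hX : chart ε X ∈ slab T R) : (gLow G ε X).det = -angDet G ε X := by
  rw [hG.gLow_eq hX]
  simp [Matrix.det_succ_row_zero, Fin.sum_univ_succ, Fin.succAbove, angDet]
  ring

theorem IsAsymptoticallyAdS.volDensity_eq (hG : IsAsymptoticallyAdS G Λ T R k)
    (hX : chart ε X ∈ slab T R) : volDensity G ε X = √(angDet G ε X) := by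
  rw [volDensity, hG.det_gLow hX, abs_neg, abs_of_pos (hG.angDet_pos hX)]

theorem IsAsymptoticallyAdS.volDensity_pos (hG : IsAsymptoticallyAdS G Λ T R k)
    (hX : chart ε X ∈ slab T R) : 0 < volDensity G ε X := by
  rw [hG.volDensity_eq hX]
  exact Real.sqrt_pos.2 (hG.angDet_pos hX)

end

/-- The algebraic properties of the inverse metric in Bondi-Sachs coordinates. -/
structure IsBondiInv (N : Matrix (Fin 4) (Fin 4) ℝ) : Prop where
  n00 : N 0 0 = 0
  n01 : N 0 1 = 1
  n10 : N 1 0 = 1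
  n02 : N 0 2 = 0
  n20 : N 2 0 = 0
  n03 : N 0 3 = 0
  n30 : N 3 0 = 0
  n21 : N 2 1 = N 1 2
  n31 : N 3 1 = N 1 3
  n32 : N 3 2 = N 2 3
  pos : 0 < N 2 2
  det : 0 < N 2 2 * N 3 3 - N 2 3 ^ 2

theorem IsBondiInv.symm {N : Matrix (Fin 4) (Fin 4) ℝ} (h : IsBondiInv N) (i j : Fin 4) :
    N i j = N j i := by
  have := h.n00; have := h.n01; have := h.n10; have := h.n02; have := h.n20; have := h.n03
  have := h.n30; have := h.n21; have := h.n31; have := h.n32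
  fin_cases i <;> fin_cases j <;> simp_all

theorem IsBondiInv.angular_nonneg {N : Matrix (Fin 4) (Fin 4) ℝ} (h : IsBondiInv N) (a b : ℝ) :
    0 ≤ N 2 2 * a ^ 2 + 2 * N 2 3 * a * b + N 3 3 * b ^ 2 := by
  have h1 := h.pos
  have h2 := h.det
  have e : N 2 2 * (N 2 2 * a ^ 2 + 2 * N 2 3 * a * b + N 3 3 * b ^ 2)
      = (N 2 2 * a + N 2 3 * b) ^ 2 + (N 2 2 * N 3 3 - N 2 3 ^ 2) * b ^ 2 := by ring
  have h3 : 0 ≤ N 2 2 * (N 2 2 * a ^ 2 + 2 * N 2 3 * a * b + N 3 3 * b ^ 2) := by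
    rw [e]; positivity
  exact nonneg_of_mul_nonneg_right h3 h1

theorem IsAsymptoticallyAdS.isBondiInv {G : BondiData} {Λ T R : ℝ} {k : ℕ} {ε : Bool} {X : Coord}
    (hG : IsAsymptoticallyAdS G Λ T R k) (hX : chart ε X ∈ slab T R) :
    IsBondiInv (gUp G ε X) := by
  have hd := hG.angDet_pos hX
  have hp := hG.angMet_pos hX
  have h33 : 0 < angMet G ε X 3 3 := by
    have : 0 < angMet G ε X 2 2 * angMet G ε X 3 3 := by
      unfold angDet at hd; nlinarith [sq_nonneg (angMet G ε X 2 3)]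
    exact pos_of_mul_pos_right this hp.le |> fun h => h
  rw [hG.gUp_eq hX]
  constructor <;> simp
  · positivity
  · have e : (-angMet G ε X 2 3 / angDet G ε X) ^ 2 = angMet G ε X 2 3 ^ 2 / angDet G ε X ^ 2 := by
      ring
    have e2 : angMet G ε X 3 3 / angDet G ε X * (angMet G ε X 2 2 / angDet G ε X)
        - angMet G ε X 2 3 ^ 2 / angDet G ε X ^ 2 = 1 / angDet G ε X := by
      field_simp
      unfold angDet
      ring
    have : 0 < 1 / angDet G ε X := by positivity
    linarith

theorem IsAsymptoticallyAdS.gUp_one_one {G : BondiData} {Λ T R : ℝ} {k : ℕ} {ε : Bool} {X : Coord}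
    (hG : IsAsymptoticallyAdS G Λ T R k) (hX : chart ε X ∈ slab T R) :
    gUp G ε X 1 1 = G.W (chart ε X) := by
  rw [hG.gUp_eq hX]; simp

/-- The determinant of the angular part of the inverse metric. -/
def upDet (G : BondiData) (ε : Bool) (X : Coord) : ℝ :=
  gUp G ε X 2 2 * gUp G ε X 3 3 - gUp G ε X 2 3 ^ 2

/-- The density is thus a function of the g^{AB} alone. Its logarithmic derivatives are bounded
through g^{ij} and the ellipticity constant, without any bound for the g_{ij}. -/
theorem IsAsymptoticallyAdS.upDet_mul_sq {G : BondiData} {Λ T R : ℝ} {k : ℕ} {ε : Bool} {X : Coord}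
    (hG : IsAsymptoticallyAdS G Λ T R k) (hX : chart ε X ∈ slab T R) :
    upDet G ε X * volDensity G ε X ^ 2 = 1 := by
  have hd := hG.angDet_pos hX
  rw [hG.volDensity_eq hX, Real.sq_sqrt hd.le, upDet, hG.gUp_eq hX]
  simp
  field_simp
  unfold angDet
  ring

/-! ### The energy current and its flux through the null hypersurface -/

/-- The components of the multiplier `K = b₂ n - b₁ ∂_z`, where `n = ∂_τ + ½ W ∂_z + U`. -/
def mult (N : Matrix (Fin 4) (Fin 4) ℝ) (b₁ b₂ : ℝ) (i : Fin 4) : ℝ :=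
  b₂ * (N i 1 - 1 / 2 * N 1 1 * N i 0) - b₁ * N i 0

/-- The energy current `T^i_j K^j` of a function with differential `p`. -/
def current (N : Matrix (Fin 4) (Fin 4) ℝ) (b₁ b₂ : ℝ) (p : Fin 4 → ℝ) (i : Fin 4) : ℝ :=
  (∑ j, N i j * p j) * (∑ j, mult N b₁ b₂ j * p j)
    - 1 / 2 * mult N b₁ b₂ i * ∑ a, ∑ b, N a b * p a * p b

/-- Lowering undoes raising. The coefficients l_i of the null normal thereby become contractions of
d(Z - z) with the frame vectors. -/
theorem IsAsymptoticallyAdS.ip_raise {G : BondiData} {Λ T R : ℝ} {k : ℕ} {ε : Bool} {X : Coord}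
    (hG : IsAsymptoticallyAdS G Λ T R k) (hX : chart ε X ∈ slab T R) (c v : Fin 4 → ℝ) :
    ip G ε X (fun i => ∑ j, gUp G ε X i j * c j) v = ∑ j, c j * v j := by
  have h1 : gUp G ε X * gLow G ε X = 1 := by
    rw [mul_eq_one_comm, hG.gUp_eq hX]
    exact hG.gLow_mul_inv hX
  have h2 : ∀ a b, ∑ i, gUp G ε X i a * gLow G ε X i b = if a = b then 1 else 0 := by
    intro a b
    have := congrFun (congrFun h1 a) b
    rw [Matrix.mul_apply, Matrix.one_apply] at this
    rw [← this]
    exact Finset.sum_congr rfl fun i _ => by rw [(hG.isBondiInv hX).symm]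
  calc ip G ε X (fun i => ∑ j, gUp G ε X i j * c j) v
      = ∑ b, ∑ a, (∑ i, gUp G ε X i a * gLow G ε X i b) * (c a * v b) := by
        unfold ip
        rw [Finset.sum_comm]
        refine Finset.sum_congr rfl fun b _ => ?_
        simp only [Finset.mul_sum, Finset.sum_mul]
        rw [Finset.sum_comm]
        exact Finset.sum_congr rfl fun a _ => Finset.sum_congr rfl fun i _ => by ring
    _ = ∑ j, c j * v j := by simp [h2]

/-- Gram-Schmidt factorizes the inverse angular metric as g^{AB} = e₃^A e₃^B + e₄^A e₄^B, with a
triangular factor. -/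
theorem IsAsymptoticallyAdS.exists_frame {G : BondiData} {Λ T R : ℝ} {k : ℕ} {ε : Bool} {X : Coord}
    (hG : IsAsymptoticallyAdS G Λ T R k) (hX : chart ε X ∈ slab T R) :
    ∃ α β γ : ℝ, e3 G ε X = ![0, 0, α, 0] ∧ e4 G ε X = ![0, 0, β, γ] ∧
      gUp G ε X 2 2 = α ^ 2 + β ^ 2 ∧ gUp G ε X 2 3 = β * γ ∧ gUp G ε X 3 3 = γ ^ 2 := by
  have hd := hG.angDet_pos hX
  have hp := hG.angMet_pos hX
  have h22 : gLow G ε X 2 2 = angMet G ε X 2 2 := by rw [hG.gLow_eq hX]; simp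
  have h23 : gLow G ε X 2 3 = angMet G ε X 2 3 := by rw [hG.gLow_eq hX]; simp
  have h32 : gLow G ε X 3 2 = angMet G ε X 2 3 := by rw [hG.gLow_eq hX]; simp
  have h33 : gLow G ε X 3 3 = angMet G ε X 3 3 := by rw [hG.gLow_eq hX]; simp
  have hw : ip G ε X ((Pi.single 3 1 : Fin 4 → ℝ)
      - (gLow G ε X 2 3 / gLow G ε X 2 2) • (Pi.single 2 1 : Fin 4 → ℝ))
      ((Pi.single 3 1 : Fin 4 → ℝ)
      - (gLow G ε X 2 3 / gLow G ε X 2 2) • (Pi.single 2 1 : Fin 4 → ℝ))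
      = angDet G ε X / angMet G ε X 2 2 := by
    unfold ip
    simp only [Fin.sum_univ_four, Pi.sub_apply, Pi.smul_apply, Pi.single_apply, smul_eq_mul]
    simp [h22, h23, h32, h33]
    field_simp
    unfold angDet
    ring
  have hr : 0 < angDet G ε X / angMet G ε X 2 2 := by positivity
  have s1 := Real.sq_sqrt hp.le
  have s2 := Real.sq_sqrt hr.le
  refine ⟨(√(angMet G ε X 2 2))⁻¹,
    -(√(angDet G ε X / angMet G ε X 2 2))⁻¹ * (angMet G ε X 2 3 / angMet G ε X 2 2),
    (√(angDet G ε X / angMet G ε X 2 2))⁻¹, ?_, ?_, ?_, ?_, ?_⟩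
  · unfold e3
    rw [h22]
    ext i; fin_cases i <;> simp
  · unfold e4
    simp only
    rw [hw, h22, h23]
    ext i; fin_cases i <;> simp
  · rw [hG.gUp_eq hX, mul_pow, neg_sq, inv_pow, inv_pow, s1, s2]
    simp
    field_simp
    unfold angDet
    ring
  · rw [hG.gUp_eq hX]
    rw [show ∀ a b : ℝ, -a⁻¹ * b * a⁻¹ = -(a ^ 2)⁻¹ * b by intros; ring, s2]
    simp
    field_simp
  · rw [hG.gUp_eq hX, inv_pow, s2]
    simp

/-! ### The null normal and the energy density on the null hypersurface -/

theorem pd_one_graphFun {Z : ℝ → S2 → ℝ} {ε : Bool} {X : Coord}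
    (h : DifferentiableAt ℝ (graphFun Z ε) X) : pd 1 (graphFun Z ε) X = -1 := by
  have h2 : HasDerivAt (fun s => Function.update X 1 s) (Pi.single (1 : Fin 4) (1 : ℝ)) (X 1) :=
    hasDerivAt_update X 1 (X 1)
  have h3 : HasDerivAt (fun s => graphFun Z ε (Function.update X 1 s)) (pd 1 (graphFun Z ε) X)
      (X 1) := by
    have : HasFDerivAt (graphFun Z ε) (fderiv ℝ (graphFun Z ε) X) (Function.update X 1 (X 1)) := by
      rw [Function.update_eq_self]; exact h.hasFDerivAt
    exact this.comp_hasDerivAt _ h2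
  have h4 : HasDerivAt (fun s => graphFun Z ε (Function.update X 1 s)) (-1) (X 1) := by
    simp only [graphFun]
    simpa using (hasDerivAt_id (X 1)).const_sub (Z (X 0) (stereo ε (X 2) (X 3)))
  exact h3.unique h4

/-- The coefficient `l₁` of the null normal. -/
def normalCoeff (N : Matrix (Fin 4) (Fin 4) ℝ) (c : Fin 4 → ℝ) : ℝ :=
  c 0 - 1 / 2 * N 1 1 + N 1 2 * c 2 + N 1 3 * c 3

/-- The explicit form of the energy density on the null hypersurface. -/
theorem IsAsymptoticallyAdS.energyH_explicit {G : BondiData} {Λ T R : ℝ} {k : ℕ} {ε : Bool}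
    {X : Coord} {Z : ℝ → S2 → ℝ} (hG : IsAsymptoticallyAdS G Λ T R k) (hX : chart ε X ∈ slab T R)
    (hZ : DifferentiableAt ℝ (graphFun Z ε) X)
    (hnull : ∑ i, ∑ j, gUp G ε X i j * pd i (graphFun Z ε) X * pd j (graphFun Z ε) X = 0) :
    ∃ α β γ l₃ l₄ : ℝ, gUp G ε X 2 2 = α ^ 2 + β ^ 2 ∧ gUp G ε X 2 3 = β * γ ∧
      gUp G ε X 3 3 = γ ^ 2 ∧
      l₃ = α * pd 2 (graphFun Z ε) X ∧
      l₄ = β * pd 2 (graphFun Z ε) X + γ * pd 3 (graphFun Z ε) X ∧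
      normalCoeff (gUp G ε X) (fun i => pd i (graphFun Z ε) X) = (l₃ ^ 2 + l₄ ^ 2) / 2 ∧
      ∀ (φ : Coord → ℝ) (b₁ b₂ : ℝ), energyH G Z ε φ b₁ b₂ X =
        b₁ / 2 * ((l₃ * pd 1 φ X + α * pd 2 φ X) ^ 2
            + (l₄ * pd 1 φ X + β * pd 2 φ X + γ * pd 3 φ X) ^ 2)
          + b₂ * (pd 0 φ X + 1 / 2 * gUp G ε X 1 1 * pd 1 φ X + gUp G ε X 1 2 * pd 2 φ X
              + gUp G ε X 1 3 * pd 3 φ X - l₃ / 2 * α * pd 2 φ X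
              - l₄ / 2 * (β * pd 2 φ X + γ * pd 3 φ X)) ^ 2
          + b₂ / 4 * (l₃ * (β * pd 2 φ X + γ * pd 3 φ X) - l₄ * α * pd 2 φ X) ^ 2
          + (b₂ * normalCoeff (gUp G ε X) (fun i => pd i (graphFun Z ε) X) + b₁) * φ X ^ 2 := by
  obtain ⟨α, β, γ, h3, h4, n22, n23, n33⟩ := hG.exists_frame hX
  have hN := hG.isBondiInv hX
  have hW := (hG.gUp_one_one hX).symm
  have hc1 := pd_one_graphFun hZ
  set c := fun i => pd i (graphFun Z ε) X with hc
  have hc1' : c 1 = -1 := hc1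
  set N := gUp G ε X with hNdef
  have r := hG.ip_raise hX c
  have hNH : NH G Z ε X = fun i => ∑ j, gUp G ε X i j * c j := rfl
  have i2 : -ip G ε X (NH G Z ε X) (N1 G ε X) = 1 := by
    rw [hNH, r]
    simp only [N1, ← hNdef, Fin.sum_univ_four, hN.n00, hN.n10, hN.n20, hN.n30, hc1']
    ring
  have i1 : -ip G ε X (NH G Z ε X) (N2 G ε X) = normalCoeff N c := by
    rw [hNH, r]
    simp only [N2, normalCoeff, ← hNdef, hW, Fin.sum_univ_four, hN.n00, hN.n10, hN.n20, hN.n30,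
      hN.n01, hN.n21, hN.n31, hc1']
    ring
  have i3 : ip G ε X (NH G Z ε X) (e3 G ε X) = α * c 2 := by
    rw [hNH, r, h3]
    simp [Fin.sum_univ_four]; ring
  have i4 : ip G ε X (NH G Z ε X) (e4 G ε X) = β * c 2 + γ * c 3 := by
    rw [hNH, r, h4]
    simp [Fin.sum_univ_four]; ring
  -- The null condition for N_𝓗 in the null frame reads 2 l₁ l₂ = l₃² + l₄², with l₂ = 1. Hence l₁ ≥
  -- 0, and every term of the energy density is nonnegative.
  have hn : normalCoeff N c = ((α * c 2) ^ 2 + (β * c 2 + γ * c 3) ^ 2) / 2 := by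
    have h : ∑ i, ∑ j, N i j * c i * c j = 0 := hnull
    simp only [Fin.sum_univ_four, hN.n00, hN.n10, hN.n20, hN.n30,
      hN.n01, hN.n02, hN.n03, hN.n21, hN.n31, hN.n32, hc1', n22, n23, n33] at h
    unfold normalCoeff
    linear_combination (-1 / 2) * h
  refine ⟨α, β, γ, α * c 2, β * c 2 + γ * c 3, n22, n23, n33, rfl, rfl, hn, fun φ b₁ b₂ => ?_⟩
  unfold energyH
  simp only [i1, i2, i3, i4, div_one, mul_one]
  simp only [along, N1, N2, h3, h4, ← hNdef, hW, Fin.sum_univ_four, Pi.add_apply, Pi.smul_apply,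
    smul_eq_mul, hN.n00, hN.n10, hN.n20, hN.n30, hN.n01, hN.n21, hN.n31, Matrix.cons_val]
  ring

/-- The energy density is the flux of the energy current. -/
theorem IsAsymptoticallyAdS.energyH_eq_flux {G : BondiData} {Λ T R : ℝ} {k : ℕ} {ε : Bool}
    {X : Coord} {Z : ℝ → S2 → ℝ} (hG : IsAsymptoticallyAdS G Λ T R k) (hX : chart ε X ∈ slab T R)
    (hZ : DifferentiableAt ℝ (graphFun Z ε) X)
    (hnull : ∑ i, ∑ j, gUp G ε X i j * pd i (graphFun Z ε) X * pd j (graphFun Z ε) X = 0)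
    (φ : Coord → ℝ) (b₁ b₂ : ℝ) :
    energyH G Z ε φ b₁ b₂ X =
      -(∑ i, pd i (graphFun Z ε) X * current (gUp G ε X) b₁ b₂ (fun j => pd j φ X) i)
        + (b₂ * normalCoeff (gUp G ε X) (fun i => pd i (graphFun Z ε) X) + b₁) * φ X ^ 2 := by
  obtain ⟨α, β, γ, l₃, l₄, n22, n23, n33, hl3, hl4, hn, hE⟩ := hG.energyH_explicit hX hZ hnull
  have hN := hG.isBondiInv hX
  have hc1 := pd_one_graphFun hZ
  rw [hE]
  set N := gUp G ε X with hNdef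
  -- The null condition solved for ∂_τ Z. After this substitution the claim is a polynomial
  -- identity.
  have hc0 : pd 0 (graphFun Z ε) X = (l₃ ^ 2 + l₄ ^ 2) / 2 + 1 / 2 * N 1 1
      - N 1 2 * pd 2 (graphFun Z ε) X - N 1 3 * pd 3 (graphFun Z ε) X := by
    rw [← hn]; unfold normalCoeff; ring
  simp only [current, mult, Fin.sum_univ_four, hN.n00, hN.n10, hN.n20, hN.n30,
    hN.n01, hN.n02, hN.n03, hN.n21, hN.n31, hN.n32, hc1, n22, n23, n33, hc0, hl3, hl4]
  ring

/-! ### Regularity of the inverse metric and of the null hypersurface -/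

section

variable {G : BondiData} {Λ T R : ℝ} {k : ℕ} {Z : ℝ → S2 → ℝ} {ε : Bool} {X : Coord}

theorem contDiffAt_matrix_det {n : ℕ} {m : WithTop ℕ∞} {M : Coord → Matrix (Fin n) (Fin n) ℝ}
    (h : ∀ i j, ContDiffAt ℝ m (fun Y => M Y i j) X) : ContDiffAt ℝ m (fun Y => (M Y).det) X := by
  simp only [Matrix.det_apply']
  exact ContDiffAt.sum fun σ _ => contDiffAt_const.mul (contDiffAt_prod fun i _ => h _ _)

/-- Cramer's rule: the inverse is the adjugate divided by the determinant, which does not vanish on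
the slab. -/
theorem IsAsymptoticallyAdS.contDiffAt_gUp (hG : IsAsymptoticallyAdS G Λ T R k)
    (hX : chart ε X ∈ slab T R) (i j : Fin 4) :
    ContDiffAt ℝ k (fun Y => gUp G ε Y i j) X := by
  have hs := hG.smooth ε X hX
  have hdet := contDiffAt_matrix_det hs
  have hne : (gLow G ε X).det ≠ 0 := by
    rw [hG.det_gLow hX]; exact neg_ne_zero.2 (hG.angDet_pos hX).ne'
  have hadj : ContDiffAt ℝ k (fun Y => (gLow G ε Y).adjugate i j) X := by
    simp only [Matrix.adjugate_apply]
    refine contDiffAt_matrix_det fun a b => ?_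
    by_cases h : a = j
    · subst h
      simp only [Matrix.updateRow_self]
      exact contDiffAt_const
    · simp only [Matrix.updateRow_ne h]
      exact hs a b
  have e : (fun Y => gUp G ε Y i j) = fun Y => (gLow G ε Y).det⁻¹ * (gLow G ε Y).adjugate i j := by
    ext Y
    rw [gUp, Matrix.inv_def, Ring.inverse_eq_inv']
    rfl
  rw [e]
  exact (hdet.inv hne).mul hadj

theorem IsAsymptoticallyAdS.contDiffAt_volDensity (hG : IsAsymptoticallyAdS G Λ T R k)
    (hX : chart ε X ∈ slab T R) : ContDiffAt ℝ k (volDensity G ε) X := by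
  have hdet := contDiffAt_matrix_det (hG.smooth ε X hX)
  have hne : (gLow G ε X).det ≠ 0 := by
    rw [hG.det_gLow hX]; exact neg_ne_zero.2 (hG.angDet_pos hX).ne'
  exact (hdet.abs hne).sqrt (abs_ne_zero.2 hne)

/-- Points of the graph are end points of generators that stay in the slab. Of the geodesics nothing
else is needed than the bound 0 ≤ Z ≤ 1/R. -/
theorem IsRegularNullCone.mem_slab (hZ : IsRegularNullCone G T R Z) {τ : ℝ} (hτ : τ ∈ Icc 0 T)
    (y : S2) : (τ, Z τ y, y) ∈ slab T R := by
  have h : (τ, Z τ y, y) ∈ nullCone G T R := by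
    rw [hZ.eq_graph]; exact ⟨hτ, rfl⟩
  obtain ⟨γ, b, h1, _, _, h2⟩ := h
  rw [← h1]
  exact (h2 b right_mem_uIcc).1

theorem pullI_eq (ε : Bool) : pullI Z ε = fun X => graphFun Z ε X + X 1 := by
  ext X; simp [pullI, graphFun]

theorem IsRegularNullCone.isGraph (hZ : IsRegularNullCone G T R Z) (ε : Bool) :
    IsGraph T (pullI Z ε) where
  smooth X hX := by
    rw [pullI_eq]
    exact (hZ.smooth ε X hX).add (by fun_prop)
  indep X s := by simp [pullI]
  nonneg X hX := (hZ.mem_slab hX _).2.2.1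
  start X hX := by simp [pullI, hX, hZ.start]

theorem IsRegularNullCone.pd_pullI (hZ : IsRegularNullCone G T R Z) (hX : X 0 ∈ Icc 0 T)
    (i : Fin 4) : pd i (pullI Z ε) X = pd i (graphFun Z ε) X + if i = 1 then 1 else 0 := by
  rw [pullI_eq, pd_add i ((hZ.smooth ε X hX).differentiableAt (by norm_num)) (by fun_prop), pd_coord]
  simp [eq_comm]

theorem chart_zero_mem_slab (hR : 0 < R) (h0 : X 0 ∈ Icc 0 T) (h1 : X 1 = 0) :
    chart ε X ∈ slab T R := by
  refine ⟨h0.1, h0.2, ?_, ?_⟩ <;> simp only [chart, h1]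
  · exact le_rfl
  · positivity

/-- A zero of Z at an interior time would be a minimum, so d(Z - z) would equal -dz there. Then the
null condition would give g^{11} = W = -Λ/3 = 0, contrary to Λ < 0. -/
theorem IsRegularNullCone.pos (hG : IsAsymptoticallyAdS G Λ T R k) (hΛ : Λ < 0) (hR : 0 < R)
    (hZ : IsRegularNullCone G T R Z) (hX : X 0 ∈ Ioo 0 T) : 0 < pullI Z ε X := by
  have hX' : X 0 ∈ Icc 0 T := Ioo_subset_Icc_self hX
  have hgr := hZ.isGraph ε
  refine lt_of_le_of_ne (hgr.nonneg X hX') fun h0 => ?_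
  -- The null condition is available only on the graph, so the argument is carried out at height z =
  -- 0 = Z.
  set X' : Coord := Function.update X 1 0 with hX'def
  have e0 : X' 0 = X 0 := by simp [hX'def]
  have e1 : X' 1 = 0 := by simp [hX'def]
  have ez : pullI Z ε X' = 0 := by rw [hX'def, hgr.indep, ← h0]
  have hmin : IsLocalMin (pullI Z ε) X' := by
    have : ∀ᶠ Y : Coord in 𝓝 X', Y 0 ∈ Ioo 0 T :=
      (continuous_apply 0).continuousAt.eventually (isOpen_Ioo.mem_nhds (by
        change X' 0 ∈ _; rw [e0]; exact hX))
    filter_upwards [this] with Y hY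
    rw [ez]
    exact hgr.nonneg Y (Ioo_subset_Icc_self hY)
  have hd : ∀ i, pd i (pullI Z ε) X' = 0 := fun i => by simp [pd, hmin.fderiv_eq_zero]
  have hm : X' 0 ∈ Icc 0 T := by rw [e0]; exact hX'
  have hc : ∀ i, pd i (graphFun Z ε) X' = if i = 1 then -1 else 0 := fun i => by
    have := hZ.pd_pullI (ε := ε) hm i
    rw [hd i] at this
    split_ifs at this ⊢ <;> linarith
  have hsl : chart ε X' ∈ slab T R := chart_zero_mem_slab hR hm e1
  have hn := hZ.null ε X' hm (by rw [graphFun, e1]; simpa [pullI] using ez)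
  simp only [hc] at hn
  simp [hG.gUp_one_one hsl] at hn
  have hW := hG.W_infty (X' 0) hm (stereo ε (X' 2) (X' 3))
  rw [chart, e1, hW] at hn
  linarith

/-- The restriction z < 1/R follows from z < Z ≤ 1/R. -/
theorem setOf_chart_mem_M2 (hZ : IsRegularNullCone G T R Z) (ε : Bool) :
    {X : Coord | chart ε X ∈ M2 T R Z ∧ X 2 ^ 2 + X 3 ^ 2 ≤ 1} = under T (pullI Z ε) := by
  ext X
  simp only [M2, OmegaT, chart, under, pullI, mem_inter_iff, mem_ofPred_eq]
  constructor
  · rintro ⟨⟨⟨a, b, c, d⟩, e⟩, f⟩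
    exact ⟨⟨a, b⟩, ⟨c, e⟩, f⟩
  · rintro ⟨⟨a, b⟩, ⟨c, d⟩, f⟩
    exact ⟨⟨⟨a, b, c, d.trans_le (hZ.mem_slab ⟨a.le, b.le⟩ _).2.2.2⟩, d⟩, f⟩

theorem IsRegularNullCone.intM2_eq (hZ : IsRegularNullCone G T R Z) (F : Bool → Coord → ℝ) :
    intM2 G T R Z F = ∑ ε, ∫ X in under T (pullI Z ε), F ε X * volDensity G ε X := by
  unfold intM2
  simp only [setOf_chart_mem_M2 hZ]

theorem IsRegularNullCone.underc_subset (hZ : IsRegularNullCone G T R Z)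
    (hX : X ∈ underc T (pullI Z ε)) : chart ε X ∈ M2closed T R Z := by
  obtain ⟨h0, ⟨h1, h2⟩, h3⟩ := hX
  exact ⟨⟨h0.1, h0.2, h1, h2.trans (hZ.mem_slab h0 _).2.2.2⟩, h2⟩

theorem IsRegularNullCone.underc_slab (hZ : IsRegularNullCone G T R Z)
    (hX : X ∈ underc T (pullI Z ε)) : chart ε X ∈ slab T R := (hZ.underc_subset hX).1

/-- Vertical approach. The coefficient bounds are assumed in the open region and are carried in this
way to the null hypersurface. -/
theorem IsGraph.mem_closure_under {ζ : Coord → ℝ} (hζ : IsGraph T ζ) (hX : X ∈ underc T ζ)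
    (h0 : X 0 ∈ Ioo 0 T) (hpos : 0 < ζ X) : X ∈ closure (under T ζ) := by
  have h1 : X 1 ∈ closure (Ioo 0 (ζ X)) := by
    rw [closure_Ioo hpos.ne]; exact hX.2.1
  have hc : Continuous fun s : ℝ => Function.update X 1 s := by fun_prop
  have := image_closure_subset_closure_image hc (s := Ioo 0 (ζ X)) ⟨X 1, h1, rfl⟩
  simp only [Function.update_eq_self] at this
  refine closure_mono ?_ this
  rintro _ ⟨s, hs, rfl⟩
  refine ⟨?_, ?_, ?_⟩
  · simpa using h0
  · rw [hζ.indep]; simpa using hs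
  · simpa using hX.2.2

theorem le_of_mem_closure {s : Set Coord} (hX : X ∈ closure s) {F : Coord → ℝ} {C : ℝ}
    (hF : ContinuousAt F X) (h : ∀ Y ∈ s, F Y ≤ C) : F X ≤ C := by
  have := mem_closure_iff_nhdsWithin_neBot.1 hX
  exact le_of_tendsto (hF.mono_left nhdsWithin_le_nhds) (eventually_nhdsWithin_of_forall h)

/-! ### The metric at infinity -/

theorem IsAsymptoticallyAdS.gUp_infty (hG : IsAsymptoticallyAdS G Λ T R k) (hR : 0 < R)
    (h0 : X 0 ∈ Icc 0 T) (h1 : X 1 = 0) :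
    gUp G ε X 1 1 = -Λ / 3 ∧ gUp G ε X 1 2 = 0 ∧ gUp G ε X 1 3 = 0 ∧ gUp G ε X 2 3 = 0 ∧
      gUp G ε X 2 2 = conf X ^ 2 / 4 ∧ gUp G ε X 3 3 = conf X ^ 2 / 4 := by
  have hsl : chart ε X ∈ slab T R := chart_zero_mem_slab hR h0 h1
  have hch : chart ε X = (X 0, 0, stereo ε (X 2) (X 3)) := by rw [chart, h1]
  have hc := conf_pos X
  have hp : ∀ i j, angMet G ε X i j = inner ℝ (sphVec ε X i) (sphVec ε X j) := by
    intro i j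
    unfold angMet
    rw [hch, hG.η_infty _ h0, hG.h_infty _ h0 _ _ _ (inner_sphVec_stereo ε X i)
      (inner_sphVec_stereo ε X j)]
    simp
  have hd : angDet G ε X = (4 / conf X ^ 2) ^ 2 := by
    unfold angDet
    rw [hp, hp, hp, inner_sphVec_two, inner_sphVec_three, inner_sphVec_two_three]
    ring
  -- The value of U at z = 0 is not prescribed. The limit z⁻¹ U → 0 gives U^A → 0 along z → 0⁺, and
  -- continuity of g^{1A} identifies the value at z = 0.
  have hu : ∀ j : Fin 4, (j = 2 ∨ j = 3) → gUp G ε X 1 j = 0 := by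
    intro j hj
    have hcont : ContinuousAt (fun Y => gUp G ε Y 1 j) X := (hG.contDiffAt_gUp hsl 1 j).continuousAt
    have hcu : Tendsto (fun s : ℝ => Function.update X 1 s) (𝓝[>] 0) (𝓝 X) := by
      have : Continuous fun s : ℝ => Function.update X 1 s := by fun_prop
      have h := this.tendsto 0
      rw [show Function.update X 1 0 = X by rw [← h1, Function.update_eq_self]] at h
      exact h.mono_left nhdsWithin_le_nhds
    have t1 := hcont.tendsto.comp hcu
    have hU := hG.U_infty _ h0 (stereo ε (X 2) (X 3))
    have hz : Tendsto (fun z : ℝ => z) (𝓝[>] 0) (𝓝 0) := tendsto_id.mono_left nhdsWithin_le_nhds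
    have hU2 : Tendsto (fun z : ℝ => conf X ^ 2 / 4 *
        inner ℝ (z • (z⁻¹ • G.U (X 0, z, stereo ε (X 2) (X 3)))) (sphVec ε X j)) (𝓝[>] 0) (𝓝 0) := by
      have := (((hz.smul hU).inner (tendsto_const_nhds (x := sphVec ε X j)))).const_mul
        (conf X ^ 2 / 4)
      simpa using this
    refine tendsto_nhds_unique t1 (hU2.congr' ?_)
    have hle : ∀ᶠ z : ℝ in 𝓝[>] 0, z ∈ Ioc 0 (1 / R) := Ioc_mem_nhdsGT (by positivity)
    filter_upwards [hle] with z hz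
    have hs : chart ε (Function.update X 1 z) ∈ slab T R := by
      refine ⟨?_, ?_, ?_, ?_⟩ <;> simp only [chart]
      · simpa using h0.1
      · simpa using h0.2
      · simpa using hz.1.le
      · simpa using hz.2
    have hsp : sphVec ε (Function.update X 1 z) j = sphVec ε X j := by
      rw [sphVec_eq, sphVec_eq]; simp
    have hcf : conf (Function.update X 1 z) = conf X := by simp [conf]
    have hch2 : chart ε (Function.update X 1 z) = (X 0, z, stereo ε (X 2) (X 3)) := by simp [chart]
    rw [smul_inv_smul₀ hz.1.ne']
    simp only [Function.comp_apply]
    rw [hG.gUp_eq hs]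
    rcases hj with rfl | rfl <;> simp [angComp, hsp, hcf, hch2]
  refine ⟨?_, hu 2 (Or.inl rfl), hu 3 (Or.inr rfl), ?_, ?_, ?_⟩
  · rw [hG.gUp_one_one hsl, hch, hG.W_infty _ h0]
  · rw [hG.gUp_eq hsl]; simp [hp, inner_sphVec_two_three]
  · rw [hG.gUp_eq hsl]; simp [hp, hd]; field_simp
    rw [← real_inner_self_eq_norm_sq, inner_sphVec_three]; field_simp
  · rw [hG.gUp_eq hsl]; simp [hp, hd]; field_simp
    rw [← real_inner_self_eq_norm_sq, inner_sphVec_two]; field_simp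

end

/-! ### The two charts on the equator -/

/-- The change of the stereographic coordinates, the inversion in the unit circle. -/
def inversion (X : Coord) : Coord :=
  ![X 0, X 1, X 2 / (X 2 ^ 2 + X 3 ^ 2), X 3 / (X 2 ^ 2 + X 3 ^ 2)]

/-- The two local expressions of a scalar function on `ℝ × ℝ × S²`. -/
def Compat (u : Bool → Coord → ℝ) : Prop :=
  ∀ ε X, X 2 ^ 2 + X 3 ^ 2 ≠ 0 → u ε X = u (!ε) (inversion X)

theorem stereo_inversion (ε : Bool) {x y : ℝ} (h : x ^ 2 + y ^ 2 ≠ 0) :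
    stereo ε x y = stereo (!ε) (x / (x ^ 2 + y ^ 2)) (y / (x ^ 2 + y ^ 2)) := by
  have h1 : 1 + x ^ 2 + y ^ 2 ≠ 0 := by positivity
  have e : (x / (x ^ 2 + y ^ 2)) ^ 2 + (y / (x ^ 2 + y ^ 2)) ^ 2 = 1 / (x ^ 2 + y ^ 2) := by
    field_simp
  have e1 : 1 + (x / (x ^ 2 + y ^ 2)) ^ 2 + (y / (x ^ 2 + y ^ 2)) ^ 2
      = (1 + x ^ 2 + y ^ 2) / (x ^ 2 + y ^ 2) := by
    rw [add_assoc, e]; field_simp; ring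
  have hs : poleSign (!ε) = -poleSign ε := by cases ε <;> simp [poleSign]
  apply Subtype.ext
  ext i
  fin_cases i <;> simp only [stereo, e1, e, hs] <;> simp <;> field_simp
  ring

theorem chart_inversion (ε : Bool) {X : Coord} (h : X 2 ^ 2 + X 3 ^ 2 ≠ 0) :
    chart ε X = chart (!ε) (inversion X) := by
  simp only [chart, inversion, Matrix.cons_val]
  rw [stereo_inversion ε h]

theorem compat_pull (v : ST → ℝ) : Compat (pull v) := fun ε X h => by
  simp only [pull, chart_inversion ε h]

theorem inversion_of_circle {X : Coord} (h : X 2 ^ 2 + X 3 ^ 2 = 1) : inversion X = X := by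
  ext i
  fin_cases i <;> simp [inversion, h]

theorem Compat.eq_on_circle {u : Bool → Coord → ℝ} (hu : Compat u) {X : Coord}
    (h : X 2 ^ 2 + X 3 ^ 2 = 1) : u true X = u false X := by
  have := hu true X (by rw [h]; norm_num)
  rwa [inversion_of_circle h] at this

theorem contDiffAt_inversion {X : Coord} (h : X 2 ^ 2 + X 3 ^ 2 ≠ 0) {n : WithTop ℕ∞} (j : Fin 4) :
    ContDiffAt ℝ n (fun Y => inversion Y j) X := by
  have hr : ContDiffAt ℝ n (fun Y : Coord => Y 2 ^ 2 + Y 3 ^ 2) X := by fun_prop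
  fin_cases j
  · change ContDiffAt ℝ n (fun Y : Coord => Y 0) X; fun_prop
  · change ContDiffAt ℝ n (fun Y : Coord => Y 1) X; fun_prop
  · exact ContDiffAt.div (by fun_prop) hr h
  · exact ContDiffAt.div (by fun_prop) hr h

theorem pd_inversion {X : Coord} (h : X 2 ^ 2 + X 3 ^ 2 ≠ 0) (i j : Fin 4) :
    pd i (fun Y => inversion Y j) X =
      let r := X 2 ^ 2 + X 3 ^ 2
      if j = 0 ∨ j = 1 then (if j = i then 1 else 0)
      else ((if j = i then r else 0)
        - X j * (2 * X 2 * (if 2 = i then 1 else 0) + 2 * X 3 * (if 3 = i then 1 else 0))) / r ^ 2 := by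
  have pr : pd i (fun Y : Coord => Y 2 ^ 2 + Y 3 ^ 2) X
      = 2 * X 2 * (if 2 = i then 1 else 0) + 2 * X 3 * (if 3 = i then 1 else 0) := by
    rw [pd_add i (by fun_prop) (by fun_prop), pd_pow i 2 (by fun_prop), pd_pow i 2 (by fun_prop),
      pd_coord, pd_coord]
    simp
  fin_cases j
  · change pd i (fun Y : Coord => Y 0) X = _
    rw [pd_coord]; simp
  · change pd i (fun Y : Coord => Y 1) X = _
    rw [pd_coord]; simp
  · change pd i (fun Y : Coord => Y 2 / (Y 2 ^ 2 + Y 3 ^ 2)) X = _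
    rw [pd_div i (by fun_prop) (by fun_prop) h, pr, pd_coord]
    simp
  · change pd i (fun Y : Coord => Y 3 / (Y 2 ^ 2 + Y 3 ^ 2)) X = _
    rw [pd_div i (by fun_prop) (by fun_prop) h, pr, pd_coord]
    simp

/-- Differentiation of the transformation law of a scalar. -/
theorem Compat.pd_eq {u : Bool → Coord → ℝ} (hu : Compat u) (ε : Bool) {X : Coord}
    (h : X 2 ^ 2 + X 3 ^ 2 ≠ 0) (hd : DifferentiableAt ℝ (u (!ε)) (inversion X)) (i : Fin 4) :
    pd i (u ε) X = ∑ j, pd j (u (!ε)) (inversion X) * pd i (fun Y => inversion Y j) X := by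
  have hev : u ε =ᶠ[𝓝 X] fun Y => u (!ε) (inversion Y) := by
    have : ∀ᶠ Y : Coord in 𝓝 X, Y 2 ^ 2 + Y 3 ^ 2 ≠ 0 := by
      have hc : Continuous fun Y : Coord => Y 2 ^ 2 + Y 3 ^ 2 := by fun_prop
      exact hc.continuousAt.eventually_ne h
    filter_upwards [this] with Y hY using hu ε Y hY
  rw [pd_congr hev]
  exact pd_comp_coord i hd fun j => (contDiffAt_inversion (n := 1) h j).differentiableAt (by norm_num)

/-- The charts are related by the inversion in the unit circle. On the circle its differential is
the reflection that reverses the radial direction, so the radial components of a vector field in the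
two charts are opposite. The density is the same because the reflection has determinant -1. -/
theorem IsAsymptoticallyAdS.current_circle {G : BondiData} {Λ T R : ℝ} {k : ℕ} {X : Coord}
    (hG : IsAsymptoticallyAdS G Λ T R k) (hX : chart true X ∈ slab T R)
    (hr : X 2 ^ 2 + X 3 ^ 2 = 1) {u : Bool → Coord → ℝ} (hu : Compat u)
    (hd : DifferentiableAt ℝ (u true) X) (b₁ b₂ : ℝ) :
    X 2 * current (gUp G true X) b₁ b₂ (fun j => pd j (u true) X) 2
      + X 3 * current (gUp G true X) b₁ b₂ (fun j => pd j (u true) X) 3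
      + (X 2 * current (gUp G false X) b₁ b₂ (fun j => pd j (u false) X) 2
        + X 3 * current (gUp G false X) b₁ b₂ (fun j => pd j (u false) X) 3) = 0
    ∧ volDensity G true X = volDensity G false X := by
  have hne : X 2 ^ 2 + X 3 ^ 2 ≠ 0 := by rw [hr]; norm_num
  have hch : chart true X = chart false X := by
    have := chart_inversion true hne
    rwa [inversion_of_circle hr] at this
  have hXf : chart false X ∈ slab T R := hch ▸ hX
  have y2 : X 3 ^ 2 = 1 - X 2 ^ 2 := by linarith
  -- The matrix of the reflection is (a, b; b, -a). First derivatives, coordinate vectors and the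
  -- metric all transform with it.
  set a : ℝ := 1 - 2 * X 2 ^ 2 with ha
  set b : ℝ := -2 * X 2 * X 3 with hb
  have hp : ∀ i, pd i (u false) X = ∑ j, pd j (u true) X * pd i (fun Y => inversion Y j) X := by
    intro i
    have := hu.pd_eq false hne (by rw [inversion_of_circle hr]; exact hd) i
    rwa [inversion_of_circle hr] at this
  have p0 : pd 0 (u false) X = pd 0 (u true) X := by
    rw [hp, Fin.sum_univ_four]; simp [pd_inversion hne]
  have p1 : pd 1 (u false) X = pd 1 (u true) X := by
    rw [hp, Fin.sum_univ_four]; simp [pd_inversion hne]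
  have p2 : pd 2 (u false) X = a * pd 2 (u true) X + b * pd 3 (u true) X := by
    rw [hp, Fin.sum_univ_four]; simp [pd_inversion hne, hr, ha, hb]; ring
  have p3 : pd 3 (u false) X = b * pd 2 (u true) X + -a * pd 3 (u true) X := by
    rw [hp, Fin.sum_univ_four]; simp [pd_inversion hne, hr, ha, hb]; linear_combination (-2 * pd 3 (u true) X) * y2
  have hconf : conf X = 2 := by unfold conf; linarith
  have s2 : sphVec true X 2 = a • sphVec false X 2 + b • sphVec false X 3 := by
    ext i
    simp only [sphVec_eq]
    have e : 1 + X 2 ^ 2 + X 3 ^ 2 = 2 := hconf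
    fin_cases i <;> simp [sphVecVal, e, poleSign, ha, hb] <;> ring_nf <;>
      simp only [y2, show X 3 ^ 3 = X 3 * (1 - X 2 ^ 2) by rw [← y2]; ring] <;> ring
  have s3 : sphVec true X 3 = b • sphVec false X 2 + (-a) • sphVec false X 3 := by
    ext i
    simp only [sphVec_eq]
    have e : 1 + X 2 ^ 2 + X 3 ^ 2 = 2 := hconf
    fin_cases i <;> simp [sphVecVal, e, poleSign, ha, hb] <;> ring_nf
    simp only [y2]
    ring
  have hdet : angDet G true X = angDet G false X := by
    rw [hG.angDet_eq hX, hG.angDet_eq hXf, hch]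
  have hvol : volDensity G true X = volDensity G false X := by
    rw [hG.volDensity_eq hX, hG.volDensity_eq hXf, hdet]
  refine ⟨?_, hvol⟩
  have hsym := angMet_symm hG hXf
  have m22 : angMet G true X 2 2 = a ^ 2 * angMet G false X 2 2 + 2 * a * b * angMet G false X 2 3
      + b ^ 2 * angMet G false X 3 3 := by
    have : angMet G true X 2 2 = a ^ 2 * angMet G false X 2 2 + a * b * angMet G false X 2 3
      + a * b * angMet G false X 3 2 + b ^ 2 * angMet G false X 3 3 := by
      simp only [angMet, s2, hch, map_add, map_smul, LinearMap.add_apply, LinearMap.smul_apply, smul_eq_mul]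
      ring
    rw [this, hsym]; ring
  have m23 : angMet G true X 2 3 = a * b * angMet G false X 2 2
      + (b ^ 2 - a ^ 2) * angMet G false X 2 3 - a * b * angMet G false X 3 3 := by
    have : angMet G true X 2 3 = a * b * angMet G false X 2 2 - a ^ 2 * angMet G false X 2 3
      + b ^ 2 * angMet G false X 3 2 - a * b * angMet G false X 3 3 := by
      simp only [angMet, s2, s3, hch, map_add, map_smul, LinearMap.add_apply, LinearMap.smul_apply, smul_eq_mul]
      ring
    rw [this, hsym]; ring
  have m33 : angMet G true X 3 3 = b ^ 2 * angMet G false X 2 2 - 2 * a * b * angMet G false X 2 3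
      + a ^ 2 * angMet G false X 3 3 := by
    have : angMet G true X 3 3 = b ^ 2 * angMet G false X 2 2 - a * b * angMet G false X 2 3
      - a * b * angMet G false X 3 2 + a ^ 2 * angMet G false X 3 3 := by
      simp only [angMet, s3, hch, map_add, map_smul, LinearMap.add_apply, LinearMap.smul_apply, smul_eq_mul]
      ring
    rw [this, hsym]; ring
  have c2 : angComp true X (G.U (chart true X)) 2 = a * angComp false X (G.U (chart false X)) 2
      + b * angComp false X (G.U (chart false X)) 3 := by
    simp only [angComp, s2, hch, inner_add_right, inner_smul_right]; ring
  have c3 : angComp true X (G.U (chart true X)) 3 = b * angComp false X (G.U (chart false X)) 2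
      - a * angComp false X (G.U (chart false X)) 3 := by
    simp only [angComp, s3, hch, inner_add_right, inner_smul_right]; ring
  have hNt := hG.gUp_eq hX
  have hNf := hG.gUp_eq hXf
  have hB := hG.isBondiInv hX
  have hBf := hG.isBondiInv hXf
  have n11 : gUp G true X 1 1 = gUp G false X 1 1 := by
    rw [hG.gUp_one_one hX, hG.gUp_one_one hXf, hch]
  have n12 : gUp G true X 1 2 = a * gUp G false X 1 2 + b * gUp G false X 1 3 := by
    rw [hNt, hNf]; simpa using c2
  have n13 : gUp G true X 1 3 = b * gUp G false X 1 2 - a * gUp G false X 1 3 := by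
    rw [hNt, hNf]; simpa using c3
  have n22 : gUp G true X 2 2 = a ^ 2 * gUp G false X 2 2 + 2 * a * b * gUp G false X 2 3
      + b ^ 2 * gUp G false X 3 3 := by
    rw [hNt, hNf]; simp [m33, hdet]; ring
  have n23 : gUp G true X 2 3 = a * b * gUp G false X 2 2
      + (b ^ 2 - a ^ 2) * gUp G false X 2 3 - a * b * gUp G false X 3 3 := by
    rw [hNt, hNf]; simp [m23, hdet]; ring
  have n33 : gUp G true X 3 3 = b ^ 2 * gUp G false X 2 2 - 2 * a * b * gUp G false X 2 3
      + a ^ 2 * gUp G false X 3 3 := by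
    rw [hNt, hNf]; simp [m22, hdet]; ring
  -- The reflection maps the radial vector to its negative.
  have x1 : X 2 * a + X 3 * b = -X 2 := by rw [ha, hb]; linear_combination (-2 * X 2) * y2
  have x2 : X 2 * b - X 3 * a = -X 3 := by rw [ha, hb]; ring
  have k2 : current (gUp G true X) b₁ b₂ (fun j => pd j (u true) X) 2
      = a * current (gUp G false X) b₁ b₂ (fun j => pd j (u false) X) 2
        + b * current (gUp G false X) b₁ b₂ (fun j => pd j (u false) X) 3 := by
    simp only [current, mult, Fin.sum_univ_four, hB.n00, hB.n10, hB.n20, hB.n30, hB.n01, hB.n02,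
      hB.n03, hB.n21, hB.n31, hB.n32, hBf.n00, hBf.n10, hBf.n20, hBf.n30, hBf.n01, hBf.n02,
      hBf.n03, hBf.n21, hBf.n31, hBf.n32, p0, p1, p2, p3, n11, n12, n13, n22, n23, n33]
    ring
  have k3 : current (gUp G true X) b₁ b₂ (fun j => pd j (u true) X) 3
      = b * current (gUp G false X) b₁ b₂ (fun j => pd j (u false) X) 2
        - a * current (gUp G false X) b₁ b₂ (fun j => pd j (u false) X) 3 := by
    simp only [current, mult, Fin.sum_univ_four, hB.n00, hB.n10, hB.n20, hB.n30, hB.n01, hB.n02,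
      hB.n03, hB.n21, hB.n31, hB.n32, hBf.n00, hBf.n10, hBf.n20, hBf.n30, hBf.n01, hBf.n02,
      hBf.n03, hBf.n21, hBf.n31, hBf.n32, p0, p1, p2, p3, n11, n12, n13, n22, n23, n33]
    ring
  rw [k2, k3]
  linear_combination (current (gUp G false X) b₁ b₂ (fun j => pd j (u false) X) 2) * x1
    + (current (gUp G false X) b₁ b₂ (fun j => pd j (u false) X) 3) * x2

/-! ### The divergence of the energy current -/

theorem ContDiffAt.differentiableAt_pd {u : Coord → ℝ} {X : Coord} (hu : ContDiffAt ℝ 2 u X)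
    (i : Fin 4) : DifferentiableAt ℝ (pd i u) X :=
  (contDiffAt_pd (n := 1) (by exact_mod_cast hu) i).differentiableAt (by norm_num)

/-- Bookkeeping for the next theorem: E₂ and F₂ are the parts with second derivatives of φ, which
drop out by the hypothesis `hc`. -/
theorem sum_current_aux (D q h' E₁ E₂ μ' K dK F₁ F₂ : Fin 4 → ℝ) (μ h κ s : ℝ)
    (hc : ∑ i, q i * E₂ i = 1 / 2 * ∑ i, K i * F₂ i) :
    ∑ i, (D i * (h * κ) + μ * q i * (h' i * κ + h * (E₁ i + E₂ i))
        - 1 / 2 * (((μ' i * h + μ * h' i) * K i + μ * h * dK i) * s + μ * h * K i * (F₁ i + F₂ i)))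
      = h * κ * (∑ i, D i) + μ * ∑ i, h' i * (q i * κ - 1 / 2 * K i * s)
        + h * (μ * (∑ i, q i * E₁ i) - 1 / 2 * (∑ i, (μ' i * K i + μ * dK i)) * s
          - 1 / 2 * μ * ∑ i, K i * F₁ i) := by
  simp only [Fin.sum_univ_four] at hc ⊢
  linear_combination (μ * h) * hc

/-- The divergence is the multiplier applied to φ times the wave operator, plus the derivative of
the weight along the current, plus terms quadratic in ∂φ with first derivatives of the coefficients.
-/
theorem sum_pd_current {N : Coord → Matrix (Fin 4) (Fin 4) ℝ} {μ h φ : Coord → ℝ} {X : Coord}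
    (hN : ∀ i j, DifferentiableAt ℝ (fun Y => N Y i j) X) (hsym : ∀ i j, N X i j = N X j i)
    (hμ : DifferentiableAt ℝ μ X) (hh : DifferentiableAt ℝ h X) (hφ : ContDiffAt ℝ 2 φ X)
    (b₁ b₂ : ℝ) :
    ∑ i, pd i (fun Y => μ Y * h Y * current (N Y) b₁ b₂ (fun j => pd j φ Y) i) X
      = h X * (∑ c, mult (N X) b₁ b₂ c * pd c φ X) *
          (∑ i, ∑ j, pd i (fun Y => μ Y * N Y i j * pd j φ Y) X)
        + μ X * ∑ i, pd i h X * current (N X) b₁ b₂ (fun j => pd j φ X) i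
        + h X * (μ X * (∑ i, ∑ j, ∑ c, N X i j * pd j φ X *
              (pd i (fun Y => mult (N Y) b₁ b₂ c) X * pd c φ X))
            - 1 / 2 * (∑ i, (pd i μ X * mult (N X) b₁ b₂ i
              + μ X * pd i (fun Y => mult (N Y) b₁ b₂ i) X))
                * (∑ a, ∑ b, N X a b * pd a φ X * pd b φ X)
            - 1 / 2 * μ X * ∑ i, ∑ a, ∑ b, mult (N X) b₁ b₂ i *
                (pd i (fun Y => N Y a b) X * pd a φ X * pd b φ X)) := by
  have hp : ∀ i, DifferentiableAt ℝ (pd i φ) X := fun i => ContDiffAt.differentiableAt_pd hφ i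
  have hK : ∀ i, DifferentiableAt ℝ (fun Y => mult (N Y) b₁ b₂ i) X := fun i => by
    unfold mult
    exact (((hN i 1).fun_sub (((hN 1 1).const_mul _).fun_mul (hN i 0))).const_mul _).fun_sub
      ((hN i 0).const_mul _)
  have hκ : DifferentiableAt ℝ (fun Y => ∑ c, mult (N Y) b₁ b₂ c * pd c φ Y) X :=
    DifferentiableAt.fun_sum fun c _ => (hK c).fun_mul (hp c)
  have hNp : ∀ i j, DifferentiableAt ℝ (fun Y => μ Y * N Y i j * pd j φ Y) X := fun i j =>
    (hμ.fun_mul (hN i j)).fun_mul (hp j)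
  have hq : ∀ i, DifferentiableAt ℝ (fun Y => ∑ j, μ Y * N Y i j * pd j φ Y) X := fun i =>
    DifferentiableAt.fun_sum fun j _ => hNp i j
  have hab : ∀ a b, DifferentiableAt ℝ (fun Y => N Y a b * pd a φ Y * pd b φ Y) X := fun a b =>
    ((hN a b).fun_mul (hp a)).fun_mul (hp b)
  have hs : DifferentiableAt ℝ (fun Y => ∑ a, ∑ b, N Y a b * pd a φ Y * pd b φ Y) X :=
    DifferentiableAt.fun_sum fun a _ => DifferentiableAt.fun_sum fun b _ => hab a b
  have pκ : ∀ i, pd i (fun Y => ∑ c, mult (N Y) b₁ b₂ c * pd c φ Y) X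
      = ∑ c, (pd i (fun Y => mult (N Y) b₁ b₂ c) X * pd c φ X
        + mult (N X) b₁ b₂ c * pd i (pd c φ) X) := fun i => by
    rw [pd_sum _ i fun c _ => (hK c).fun_mul (hp c)]
    exact Finset.sum_congr rfl fun c _ => pd_mul i (hK c) (hp c)
  have pq : ∀ i, pd i (fun Y => ∑ j, μ Y * N Y i j * pd j φ Y) X
      = ∑ j, pd i (fun Y => μ Y * N Y i j * pd j φ Y) X := fun i => by
    rw [pd_sum _ i fun j _ => hNp i j]
  have ps : ∀ i, pd i (fun Y => ∑ a, ∑ b, N Y a b * pd a φ Y * pd b φ Y) X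
      = ∑ a, ∑ b, (pd i (fun Y => N Y a b) X * pd a φ X * pd b φ X
        + N X a b * pd i (pd a φ) X * pd b φ X + N X a b * pd a φ X * pd i (pd b φ) X) := fun i => by
    rw [pd_sum _ i fun a _ => DifferentiableAt.fun_sum fun b _ => hab a b]
    refine Finset.sum_congr rfl fun a _ => ?_
    rw [pd_sum _ i fun b _ => hab a b]
    refine Finset.sum_congr rfl fun b _ => ?_
    rw [pd_mul i ((hN a b).fun_mul (hp a)) (hp b), pd_mul i (hN a b) (hp a)]
    ring
  have key : ∀ i, pd i (fun Y => μ Y * h Y * current (N Y) b₁ b₂ (fun j => pd j φ Y) i) X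
      = (∑ j, pd i (fun Y => μ Y * N Y i j * pd j φ Y) X)
          * (h X * ∑ c, mult (N X) b₁ b₂ c * pd c φ X)
        + (∑ j, μ X * N X i j * pd j φ X) * (pd i h X * (∑ c, mult (N X) b₁ b₂ c * pd c φ X)
          + h X * ∑ c, (pd i (fun Y => mult (N Y) b₁ b₂ c) X * pd c φ X
            + mult (N X) b₁ b₂ c * pd i (pd c φ) X))
        - 1 / 2 * (((pd i μ X * h X + μ X * pd i h X) * mult (N X) b₁ b₂ i
            + μ X * h X * pd i (fun Y => mult (N Y) b₁ b₂ i) X)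
              * (∑ a, ∑ b, N X a b * pd a φ X * pd b φ X)
          + μ X * h X * mult (N X) b₁ b₂ i * ∑ a, ∑ b, (pd i (fun Y => N Y a b) X * pd a φ X * pd b φ X
            + N X a b * pd i (pd a φ) X * pd b φ X + N X a b * pd a φ X * pd i (pd b φ) X)) := by
    intro i
    have e : (fun Y => μ Y * h Y * current (N Y) b₁ b₂ (fun j => pd j φ Y) i)
        = fun Y => (∑ j, μ Y * N Y i j * pd j φ Y) * (h Y * ∑ c, mult (N Y) b₁ b₂ c * pd c φ Y)
          - 1 / 2 * (μ Y * h Y * mult (N Y) b₁ b₂ i * ∑ a, ∑ b, N Y a b * pd a φ Y * pd b φ Y) := by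
      ext Y
      unfold current
      have : ∑ j, μ Y * N Y i j * pd j φ Y = μ Y * ∑ j, N Y i j * pd j φ Y := by
        rw [Finset.mul_sum]; exact Finset.sum_congr rfl fun j _ => by ring
      rw [this]; ring
    have d1 := (hμ.fun_mul hh).fun_mul (hK i)
    rw [e, pd_sub i ((hq i).fun_mul (hh.fun_mul hκ)) ((d1.fun_mul hs).const_mul _),
      pd_mul i (hq i) (hh.fun_mul hκ), pd_mul i hh hκ,
      pd_mul i (differentiableAt_const _) (d1.fun_mul hs), pd_const, pd_mul i d1 hs,
      pd_mul i (hμ.fun_mul hh) (hK i), pd_mul i hμ hh, pκ, pq, ps]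
    ring
  -- The second derivatives of φ outside the wave operator cancel by the symmetry of the inverse
  -- metric and of the Hessian. This is the conservation property of the energy-momentum tensor.
  have cancel : ∑ i, ((∑ j, N X i j * pd j φ X) * ∑ c, mult (N X) b₁ b₂ c * pd i (pd c φ) X)
      = 1 / 2 * ∑ i, mult (N X) b₁ b₂ i * ∑ a, ∑ b, (N X a b * pd i (pd a φ) X * pd b φ X
        + N X a b * pd a φ X * pd i (pd b φ) X) := by
    have hc := pd_comm hφ
    have e10 := hc 1 0; have e20 := hc 2 0; have e30 := hc 3 0
    have e21 := hc 2 1; have e31 := hc 3 1; have e32 := hc 3 2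
    simp only [Fin.sum_univ_four, hsym 1 0, hsym 2 0, hsym 3 0, hsym 2 1, hsym 3 1, hsym 3 2,
      e10, e20, e30, e21, e31, e32]
    ring
  simp only [key]
  have l1 : ∀ i, ∑ j, μ X * N X i j * pd j φ X = μ X * ∑ j, N X i j * pd j φ X := fun i => by
    rw [Finset.mul_sum]; exact Finset.sum_congr rfl fun j _ => by ring
  have l3 : ∀ i, ∑ j, ∑ c, N X i j * pd j φ X * (pd i (fun Y => mult (N Y) b₁ b₂ c) X * pd c φ X)
      = (∑ j, N X i j * pd j φ X) * ∑ c, pd i (fun Y => mult (N Y) b₁ b₂ c) X * pd c φ X := fun i => by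
    rw [Finset.sum_mul_sum]
  have l4 : ∀ i, ∑ a, ∑ b, mult (N X) b₁ b₂ i * (pd i (fun Y => N Y a b) X * pd a φ X * pd b φ X)
      = mult (N X) b₁ b₂ i * ∑ a, ∑ b, pd i (fun Y => N Y a b) X * pd a φ X * pd b φ X := fun i => by
    simp only [Finset.mul_sum]
  have l5 : ∀ i, ∑ a, ∑ b, (pd i (fun Y => N Y a b) X * pd a φ X * pd b φ X
        + N X a b * pd i (pd a φ) X * pd b φ X + N X a b * pd a φ X * pd i (pd b φ) X)
      = (∑ a, ∑ b, pd i (fun Y => N Y a b) X * pd a φ X * pd b φ X)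
        + ∑ a, ∑ b, (N X a b * pd i (pd a φ) X * pd b φ X
        + N X a b * pd a φ X * pd i (pd b φ) X) := fun i => by
    simp only [Finset.sum_add_distrib]; ring
  have l6 : ∀ i, ∑ c, (pd i (fun Y => mult (N Y) b₁ b₂ c) X * pd c φ X
            + mult (N X) b₁ b₂ c * pd i (pd c φ) X)
      = (∑ c, pd i (fun Y => mult (N Y) b₁ b₂ c) X * pd c φ X)
        + ∑ c, mult (N X) b₁ b₂ c * pd i (pd c φ) X := fun i => Finset.sum_add_distrib
  simp only [l1, l3, l4, l5, l6, current]
  exact sum_current_aux _ _ _ _ _ _ _ _ _ _ _ _ _ _ cancel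

/-! ### Pointwise bounds -/

theorem IsBondiInv.current_zero {N : Matrix (Fin 4) (Fin 4) ℝ} (hN : IsBondiInv N) (b : ℝ)
    (p : Fin 4 → ℝ) :
    current N b 1 p 0 = -(b * p 1 ^ 2
      + (N 2 2 * p 2 ^ 2 + 2 * N 2 3 * p 2 * p 3 + N 3 3 * p 3 ^ 2) / 2) := by
  simp only [current, mult, Fin.sum_univ_four, hN.n00, hN.n10, hN.n20, hN.n30, hN.n01, hN.n02,
    hN.n03, hN.n21, hN.n31, hN.n32]
  ring

/-- The first square is the derivative along n, and ∂_τφ occurs only in it. The other squares come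
with unfavourable or undetermined signs and are compensated in the interior by the component J⁰. -/
theorem IsBondiInv.current_one {N : Matrix (Fin 4) (Fin 4) ℝ} (hN : IsBondiInv N) (b : ℝ)
    (p : Fin 4 → ℝ) :
    current N b 1 p 1 = (p 0 + 1 / 2 * N 1 1 * p 1 + N 1 2 * p 2 + N 1 3 * p 3) ^ 2
      - 1 / 2 * N 1 1 * b * p 1 ^ 2
      - 1 / 2 * (1 / 2 * N 1 1 - b)
        * (N 2 2 * p 2 ^ 2 + 2 * N 2 3 * p 2 * p 3 + N 3 3 * p 3 ^ 2) := by
  simp only [current, mult, Fin.sum_univ_four, hN.n00, hN.n10, hN.n20, hN.n30, hN.n01, hN.n02,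
    hN.n03, hN.n21, hN.n31, hN.n32]
  ring

/-- The part of the divergence that comes from the weight is positive definite. -/
theorem IsBondiInv.coercive {N : Matrix (Fin 4) (Fin 4) ℝ} (hN : IsBondiInv N) {A lam b l : ℝ}
    (hA : ∀ i j, |N i j| ≤ A) (hlam : 0 < lam) (hb : 0 < b) (hl : A + 1 ≤ l)
    (hell : ∀ x y : ℝ, lam * (x ^ 2 + y ^ 2) ≤ N 2 2 * x ^ 2 + 2 * N 2 3 * x * y + N 3 3 * y ^ 2)
    (p : Fin 4 → ℝ) :
    ∑ i, p i ^ 2 ≤ (4 + (1 + 4 * A ^ 2) * (1 / b + 2 / lam))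
      * (-l * current N b 1 p 0 + current N b 1 p 1) := by
  have hA0 : 0 ≤ A := (abs_nonneg _).trans (hA 0 0)
  set s := N 2 2 * p 2 ^ 2 + 2 * N 2 3 * p 2 * p 3 + N 3 3 * p 3 ^ 2 with hs
  set ν := p 0 + 1 / 2 * N 1 1 * p 1 + N 1 2 * p 2 + N 1 3 * p 3 with hν
  -- A large l makes the coefficients of (∂_zφ)² and of the angular part positive. Since W ≤ A, the
  -- choice l ≥ A + 1 is enough.
  have hT : -l * current N b 1 p 0 + current N b 1 p 1
      = ν ^ 2 + (l - N 1 1 / 2) * b * p 1 ^ 2 + 1 / 2 * (l - N 1 1 / 2 + b) * s := by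
    rw [hN.current_zero, hN.current_one]; ring
  have hP : 1 ≤ l - N 1 1 / 2 := by
    have := (abs_le.1 (hA 1 1)).2; linarith
  have hs0 : lam * (p 2 ^ 2 + p 3 ^ 2) ≤ s := hell _ _
  have hs1 : 0 ≤ s := le_trans (by positivity) hs0
  have h1 : ν ^ 2 + b * p 1 ^ 2 + 1 / 2 * s ≤ -l * current N b 1 p 0 + current N b 1 p 1 := by
    rw [hT]
    have : b * p 1 ^ 2 ≤ (l - N 1 1 / 2) * (b * p 1 ^ 2) := le_mul_of_one_le_left (by positivity) hP
    have : s ≤ (l - N 1 1 / 2 + b) * s := le_mul_of_one_le_left hs1 (by linarith)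
    linarith
  have sqA : ∀ i j, N i j ^ 2 ≤ A ^ 2 := fun i j => by
    rw [← sq_abs]; exact pow_le_pow_left₀ (abs_nonneg _) (hA i j) 2
  -- The derivative ∂_τφ is recovered from the derivative along n and the remaining derivatives.
  have h0 : p 0 ^ 2 ≤ 4 * ν ^ 2 + 4 * A ^ 2 * (p 1 ^ 2 + p 2 ^ 2 + p 3 ^ 2) := by
    have e : p 0 = ν - 1 / 2 * N 1 1 * p 1 - N 1 2 * p 2 - N 1 3 * p 3 := by rw [hν]; ring
    have four : ∀ x y z w : ℝ, (x - y - z - w) ^ 2 ≤ 4 * (x ^ 2 + y ^ 2 + z ^ 2 + w ^ 2) := by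
      intro x y z w
      nlinarith [sq_nonneg (x + y), sq_nonneg (x + z), sq_nonneg (x + w), sq_nonneg (y - z),
        sq_nonneg (y - w), sq_nonneg (z - w)]
    have h := four ν (1 / 2 * N 1 1 * p 1) (N 1 2 * p 2) (N 1 3 * p 3)
    rw [← e] at h
    have a1 := mul_le_mul_of_nonneg_right (sqA 1 1) (sq_nonneg (p 1))
    have a2 := mul_le_mul_of_nonneg_right (sqA 1 2) (sq_nonneg (p 2))
    have a3 := mul_le_mul_of_nonneg_right (sqA 1 3) (sq_nonneg (p 3))
    have a4 : 0 ≤ N 1 1 ^ 2 * p 1 ^ 2 := by positivity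
    linarith
  have hb1 : p 1 ^ 2 = 1 / b * (b * p 1 ^ 2) := by field_simp
  have hl1 : p 2 ^ 2 + p 3 ^ 2 ≤ 2 / lam * (1 / 2 * s) := by
    have : p 2 ^ 2 + p 3 ^ 2 = 1 / lam * (lam * (p 2 ^ 2 + p 3 ^ 2)) := by field_simp
    rw [this]
    calc 1 / lam * (lam * (p 2 ^ 2 + p 3 ^ 2)) ≤ 1 / lam * s := by gcongr
      _ = _ := by ring
  have hsum : p 1 ^ 2 + p 2 ^ 2 + p 3 ^ 2
      ≤ (1 / b + 2 / lam) * (ν ^ 2 + b * p 1 ^ 2 + 1 / 2 * s) := by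
    have t1 : 0 ≤ 1 / b := by positivity
    have t2 : 0 ≤ 2 / lam := by positivity
    have u1 : 0 ≤ b * p 1 ^ 2 := by positivity
    have u2 : 0 ≤ ν ^ 2 := by positivity
    have w1 : 0 ≤ 1 / b * (ν ^ 2 + 1 / 2 * s) := by positivity
    have w2 : 0 ≤ 2 / lam * (ν ^ 2 + b * p 1 ^ 2) := by positivity
    have e : (1 / b + 2 / lam) * (ν ^ 2 + b * p 1 ^ 2 + 1 / 2 * s)
        = 1 / b * (b * p 1 ^ 2) + 2 / lam * (1 / 2 * s) + 1 / b * (ν ^ 2 + 1 / 2 * s)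
          + 2 / lam * (ν ^ 2 + b * p 1 ^ 2) := by ring
    rw [e, ← hb1]
    linarith
  have hX : 0 ≤ b * p 1 ^ 2 + 1 / 2 * s := by positivity
  calc ∑ i, p i ^ 2 = p 0 ^ 2 + (p 1 ^ 2 + p 2 ^ 2 + p 3 ^ 2) := by
        rw [Fin.sum_univ_four]; ring
    _ ≤ 4 * ν ^ 2 + (1 + 4 * A ^ 2) * (p 1 ^ 2 + p 2 ^ 2 + p 3 ^ 2) := by linarith
    _ ≤ 4 * (ν ^ 2 + b * p 1 ^ 2 + 1 / 2 * s) + (1 + 4 * A ^ 2) * ((1 / b + 2 / lam)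
        * (ν ^ 2 + b * p 1 ^ 2 + 1 / 2 * s)) := by
        gcongr
        linarith
    _ = (4 + (1 + 4 * A ^ 2) * (1 / b + 2 / lam)) * (ν ^ 2 + b * p 1 ^ 2 + 1 / 2 * s) := by ring
    _ ≤ _ := by gcongr

theorem abs_mul_le_sum_sq (p : Fin 4 → ℝ) (i j : Fin 4) : |p i * p j| ≤ ∑ a, p a ^ 2 := by
  have h : ∀ i, p i ^ 2 ≤ ∑ a, p a ^ 2 := fun i =>
    Finset.single_le_sum (f := fun a => p a ^ 2) (fun a _ => sq_nonneg _) (Finset.mem_univ i)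
  have h1 := h i
  have h2 := h j
  rw [abs_le]
  constructor <;> linarith [sq_nonneg (p i + p j), sq_nonneg (p i - p j)]

theorem abs_sum_two_le {x : Fin 4 → Fin 4 → ℝ} {M : ℝ} (hM : ∀ i j, |x i j| ≤ M) :
    |∑ i, ∑ j, x i j| ≤ 16 * M := by
  refine (Finset.abs_sum_le_sum_abs _ _).trans ?_
  have : ∀ i : Fin 4, |∑ j, x i j| ≤ 4 * M := fun i =>
    (Finset.abs_sum_le_sum_abs _ _).trans
      ((Finset.sum_le_sum fun j _ => hM i j).trans (by simp))
  exact (Finset.sum_le_sum fun i _ => this i).trans (by simp; linarith)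

theorem abs_sum_three_le {x : Fin 4 → Fin 4 → Fin 4 → ℝ} {M : ℝ} (hM : ∀ i j c, |x i j c| ≤ M) :
    |∑ i, ∑ j, ∑ c, x i j c| ≤ 64 * M := by
  refine (Finset.abs_sum_le_sum_abs _ _).trans ?_
  exact (Finset.sum_le_sum fun i _ => abs_sum_two_le (hM i)).trans (by simp; linarith)

/-- The part of the divergence that does not come from the weight is bounded. -/
theorem divergence_error_bound {A B D b m : ℝ} (hA0 : 0 ≤ A) (hb : 0 ≤ b) (hm : 0 ≤ m)
    {N : Matrix (Fin 4) (Fin 4) ℝ} (hA : ∀ i j, |N i j| ≤ A)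
    {dN : Fin 4 → Fin 4 → Fin 4 → ℝ} (hdN : ∀ i j c, |dN i j c| ≤ A)
    {dK : Fin 4 → Fin 4 → ℝ} (hdK : ∀ i c, |dK i c| ≤ A + A ^ 2 + b * A)
    {dμ : Fin 4 → ℝ} (hdμ : ∀ i, |dμ i| ≤ m)
    {a : Fin 4 → ℝ} (ha : ∀ i, |a i| ≤ B) {ω : ℝ} (hω : |ω| ≤ D) (p : Fin 4 → ℝ) (φ bx F : ℝ)
    (hF : bx + (∑ i, a i * p i) + ω * φ = F) :
    -F ^ 2 - (8 * (A + A ^ 2 + b * A) ^ 2 + 128 * (A + A ^ 2 + b * A) * A * (2 + m) + 2 * B ^ 2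
        + D ^ 2 + 2 + m) * ((∑ i, p i ^ 2) + φ ^ 2)
      ≤ (∑ c, mult N b 1 c * p c) * bx
        + ((∑ i, ∑ j, ∑ c, N i j * p j * (dK i c * p c))
          - 1 / 2 * (∑ i, (dμ i * mult N b 1 i + dK i i)) * (∑ x, ∑ y, N x y * p x * p y)
          - 1 / 2 * ∑ i, ∑ x, ∑ y, mult N b 1 i * (dN i x y * p x * p y))
        + (2 * φ * p 1 + dμ 1 * φ ^ 2) := by
  set κ := A + A ^ 2 + b * A with hκ
  have hκ0 : 0 ≤ κ := by positivity
  set P := ∑ i, p i ^ 2 with hP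
  have hP0 : 0 ≤ P := Finset.sum_nonneg fun i _ => sq_nonneg _
  have hpp := abs_mul_le_sum_sq p
  have hK : ∀ i, |mult N b 1 i| ≤ κ := by
    intro i
    have h1 : |N i 1| ≤ A := hA i 1
    have h2 : |N 1 1 * N i 0| ≤ A * A := by
      rw [abs_mul]; exact mul_le_mul (hA 1 1) (hA i 0) (abs_nonneg _) hA0
    have h3 : |b * N i 0| ≤ b * A := by
      rw [abs_mul, abs_of_nonneg hb]; exact mul_le_mul_of_nonneg_left (hA i 0) hb
    rw [abs_le] at h1 h2 h3 ⊢
    unfold mult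
    have hAA : A * A = A ^ 2 := by ring
    constructor <;> linarith
  have e1 : |∑ i, ∑ j, ∑ c, N i j * p j * (dK i c * p c)| ≤ 64 * (A * κ * P) := by
    refine abs_sum_three_le fun i j c => ?_
    have : N i j * p j * (dK i c * p c) = (N i j * dK i c) * (p j * p c) := by ring
    rw [this, abs_mul, abs_mul]
    exact mul_le_mul (mul_le_mul (hA i j) (hdK i c) (abs_nonneg _) hA0) (hpp j c) (abs_nonneg _)
      (by positivity)
  have e2 : |∑ x, ∑ y, N x y * p x * p y| ≤ 16 * (A * P) := by
    refine abs_sum_two_le fun x y => ?_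
    rw [mul_assoc, abs_mul]
    exact mul_le_mul (hA x y) (hpp x y) (abs_nonneg _) hA0
  have e3 : |∑ i, (dμ i * mult N b 1 i + dK i i)| ≤ 4 * (m * κ + κ) := by
    refine (Finset.abs_sum_le_sum_abs _ _).trans ?_
    have : ∀ i : Fin 4, |dμ i * mult N b 1 i + dK i i| ≤ m * κ + κ := fun i => by
      refine (abs_add_le _ _).trans (add_le_add ?_ (hdK i i))
      rw [abs_mul]
      exact mul_le_mul (hdμ i) (hK i) (abs_nonneg _) hm
    exact (Finset.sum_le_sum fun i _ => this i).trans (by simp; linarith)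
  have e4 : |∑ i, ∑ x, ∑ y, mult N b 1 i * (dN i x y * p x * p y)| ≤ 64 * (κ * A * P) := by
    refine abs_sum_three_le fun i x y => ?_
    have : mult N b 1 i * (dN i x y * p x * p y) = (mult N b 1 i * dN i x y) * (p x * p y) := by ring
    rw [this, abs_mul, abs_mul]
    exact mul_le_mul (mul_le_mul (hK i) (hdN i x y) (abs_nonneg _) hκ0) (hpp x y) (abs_nonneg _)
      (by positivity)
  have e23 : |(∑ i, (dμ i * mult N b 1 i + dK i i)) * ∑ x, ∑ y, N x y * p x * p y|
      ≤ 4 * (m * κ + κ) * (16 * (A * P)) := by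
    rw [abs_mul]
    exact mul_le_mul e3 e2 (abs_nonneg _) (by positivity)
  have sq4 : ∀ (x : Fin 4 → ℝ) (M : ℝ), (∀ i, |x i| ≤ M) → (∑ i, x i * p i) ^ 2 ≤ 4 * M ^ 2 * P := by
    intro x M hx
    refine (Finset.sum_mul_sq_le_sq_mul_sq _ _ _).trans ?_
    refine mul_le_mul_of_nonneg_right ?_ hP0
    have : ∀ i : Fin 4, x i ^ 2 ≤ M ^ 2 := fun i => by
      rw [← sq_abs]; exact pow_le_pow_left₀ (abs_nonneg _) (hx i) 2
    exact (Finset.sum_le_sum fun i _ => this i).trans (by simp)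
  have k1 := sq4 _ _ hK
  have k2 := sq4 _ _ ha
  set κp := ∑ c, mult N b 1 c * p c with hκp
  set ap := ∑ i, a i * p i with hap
  have k3 : (ω * φ) ^ 2 ≤ D ^ 2 * φ ^ 2 := by
    rw [mul_pow]
    refine mul_le_mul_of_nonneg_right ?_ (sq_nonneg _)
    rw [← sq_abs]; exact pow_le_pow_left₀ (abs_nonneg _) hω 2
  have hbx : bx = F - ap - ω * φ := by linarith
  -- The wave operator is eliminated by means of the equation, and Young's inequality is applied to
  -- the three products with the multiplier term.
  have k4 : -F ^ 2 - 2 * κp ^ 2 - ap ^ 2 / 2 - (ω * φ) ^ 2 / 2 ≤ κp * bx := by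
    rw [hbx]
    linarith [sq_nonneg (κp + F), sq_nonneg (κp - ap), sq_nonneg (κp - ω * φ), sq_nonneg κp,
      sq_nonneg F]
  have k5 : -P - (1 + m) * φ ^ 2 ≤ 2 * φ * p 1 + dμ 1 * φ ^ 2 := by
    have h1 := (abs_le.1 (hdμ 1)).1
    have h2 : p 1 ^ 2 ≤ P := by
      have := hpp 1 1
      rw [← sq, abs_of_nonneg (sq_nonneg _)] at this; exact this
    linarith [sq_nonneg (φ + p 1), mul_le_mul_of_nonneg_right h1 (sq_nonneg φ)]
  have e1' := (abs_le.1 e1).1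
  have e4' := (abs_le.1 e4).2
  have e23' := (abs_le.1 e23).2
  refine le_trans ?_ (add_le_add (add_le_add k4 (sub_le_sub (sub_le_sub e1'
    (?_ : _ ≤ 1 / 2 * (4 * (m * κ + κ) * (16 * (A * P))))) (?_ : _ ≤ 1 / 2 * (64 * (κ * A * P))))) k5)
  · have hκA : 0 ≤ κ * A := by positivity
    have r1 : 0 ≤ κ * A * m * φ ^ 2 := by positivity
    have r2 : 0 ≤ κ * A * φ ^ 2 := by positivity
    have r3 : 0 ≤ κ ^ 2 * φ ^ 2 := by positivity
    have r4 : 0 ≤ B ^ 2 * φ ^ 2 := by positivity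
    have r5 : 0 ≤ D ^ 2 * P := by positivity
    have r6 : 0 ≤ m * P := by positivity
    have r7 : 0 ≤ κ * A * m * P := by positivity
    have r8 : 0 ≤ D ^ 2 * φ ^ 2 := by positivity
    have r9 : 0 ≤ κ * A * P := by positivity
    have r10 : 0 ≤ φ ^ 2 := by positivity
    have r11 : 0 ≤ κ ^ 2 * P := by positivity
    clear_value κp ap P κ
    clear e1 e4 e23 e1' e4' e23' hK hpp sq4 e2 e3
    linarith
  · rw [mul_assoc]
    exact mul_le_mul_of_nonneg_left e23' (by norm_num)
  · exact mul_le_mul_of_nonneg_left e4' (by norm_num)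

/-! ### The divergence of the weighted current -/

/-- The geometric hypotheses that remain fixed. -/
structure IsSetting (Λ lam A T R : ℝ) (k : ℕ) (G : BondiData) (Z : ℝ → S2 → ℝ) : Prop where
  Λ_neg : Λ < 0
  lam_pos : 0 < lam
  T_pos : 0 < T
  R_pos : 0 < R
  two_le : 2 ≤ k
  ads : IsAsymptoticallyAdS G Λ T R k
  cone : IsRegularNullCone G T R Z
  elliptic : IsElliptic G T R Z lam
  bound : ∀ i j, CBound T R Z 1 A (fun ε X => gUp G ε X i j)

/-! ### Multi-indices of order at most one, the determinant bound, and the weight -/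

theorem multi_zero : multi 0 = {0} := by
  simp [multi]

theorem mpd_zero (u : Coord → ℝ) : mpd 0 u = u := rfl

theorem single_mem_multi (i : Fin 4) : Pi.single i 1 ∈ multi 1 := by
  simp [multi]

theorem mpd_single (i : Fin 4) (u : Coord → ℝ) : mpd (Pi.single i 1) u = pd i u := by
  fin_cases i <;> simp [mpd]

/-- The form minus lam times the identity is nonnegative, so its discriminant is not positive. With
both diagonal entries at least lam the determinant is at least lam². -/
theorem upDet_ge {N : Matrix (Fin 4) (Fin 4) ℝ} {lam : ℝ} (hlam : 0 < lam)
    (hell : ∀ x y : ℝ, lam * (x ^ 2 + y ^ 2) ≤ N 2 2 * x ^ 2 + 2 * N 2 3 * x * y + N 3 3 * y ^ 2) :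
    lam ^ 2 ≤ N 2 2 * N 3 3 - N 2 3 ^ 2 := by
  have h := discrim_le_zero (a := N 2 2 - lam) (b := 2 * N 2 3) (c := N 3 3 - lam)
    (fun x => by have := hell x 1; nlinarith)
  unfold discrim at h
  have h2 := hell 1 0
  have h3 := hell 0 1
  nlinarith

theorem differentiableAt_wt (q l : ℝ) (X : Coord) : DifferentiableAt ℝ (wt q l) X := by
  unfold wt
  fun_prop

theorem pd_wt (q l : ℝ) (i : Fin 4) (X : Coord) :
    pd i (wt q l) X = q * ((if i = 0 then -l else 0) + if i = 1 then 1 else 0) * wt q l X := by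
  have h : DifferentiableAt ℝ (fun Y : Coord => -q * l * Y 0 + q * Y 1) X := by fun_prop
  have e : wt q l = fun Y => Real.exp (-q * l * Y 0 + q * Y 1) := rfl
  have c0 : DifferentiableAt ℝ (fun Y : Coord => Y 0) X := by fun_prop
  have c1 : DifferentiableAt ℝ (fun Y : Coord => Y 1) X := by fun_prop
  rw [e, pd_comp i (Real.hasDerivAt_exp _) h, pd_add i (c0.const_mul _) (c1.const_mul _),
    pd_mul i (differentiableAt_const _) c0, pd_mul i (differentiableAt_const _) c1,
    pd_const, pd_const, pd_coord, pd_coord]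
  fin_cases i <;> simp <;> ring

/-- The coordinates of the points of `𝓜₂ ∩ Ω_T`. -/
def region (T R : ℝ) (Z : ℝ → S2 → ℝ) (ε : Bool) : Set Coord := {X | chart ε X ∈ M2 T R Z}

theorem region_slab {T R : ℝ} {Z : ℝ → S2 → ℝ} {ε : Bool} {X : Coord} (hX : X ∈ region T R Z ε) :
    chart ε X ∈ slab T R :=
  ⟨hX.1.1.le, hX.1.2.1.le, hX.1.2.2.1.le, hX.1.2.2.2.le⟩

/-- Identities are differentiated on this open set. The quantitative bounds hold only on its subset
`under`, where the point also lies in the closed disk. -/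
theorem IsRegularNullCone.isOpen_region {T R : ℝ} {G : BondiData} {Z : ℝ → S2 → ℝ}
    (hZ : IsRegularNullCone G T R Z) (ε : Bool) : IsOpen (region T R Z ε) := by
  rw [isOpen_iff_mem_nhds]
  rintro X ⟨⟨h1, h2, h3, h4⟩, h5⟩
  have c0 : Continuous fun Y : Coord => Y 0 := continuous_apply 0
  have c1 : Continuous fun Y : Coord => Y 1 := continuous_apply 1
  have h1' : 0 < X 0 := h1
  have h2' : X 0 < T := h2
  have h6 : 0 < graphFun Z ε X := sub_pos.2 h5
  filter_upwards [c0.continuousAt.eventually (lt_mem_nhds h1'),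
    c0.continuousAt.eventually (gt_mem_nhds h2'),
    c1.continuousAt.eventually (lt_mem_nhds (h3 : 0 < X 1)),
    c1.continuousAt.eventually (gt_mem_nhds (h4 : X 1 < 1 / R)),
    (hZ.smooth ε X ⟨h1'.le, h2'.le⟩).continuousAt.eventually (lt_mem_nhds h6)] with Y a1 a2 a3 a4 a5
  exact ⟨⟨a1, a2, a3, a4⟩, sub_pos.1 a5⟩

theorem IsRegularNullCone.under_subset_region {T R : ℝ} {G : BondiData} {Z : ℝ → S2 → ℝ}
    (hZ : IsRegularNullCone G T R Z) (ε : Bool) : under T (pullI Z ε) ⊆ region T R Z ε :=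
  fun X hX => by
    rw [← setOf_chart_mem_M2 hZ ε] at hX
    exact hX.1

section

variable {Λ lam A T R : ℝ} {k : ℕ} {G : BondiData} {Z : ℝ → S2 → ℝ}
  (hS : IsSetting Λ lam A T R k G Z) {ε : Bool} {X : Coord}
include hS

theorem IsSetting.abs_gUp_le (hX : X ∈ under T (pullI Z ε)) (i j : Fin 4) :
    |gUp G ε X i j| ≤ A := by
  rw [← setOf_chart_mem_M2 hS.cone ε] at hX
  have := hS.bound i j ε X hX.1 hX.2 0 (by norm_num) 0 (by simp [multi_zero])
  rwa [mpd_zero] at this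

theorem IsSetting.abs_pd_gUp_le (hX : X ∈ under T (pullI Z ε)) (i j c : Fin 4) :
    |pd c (fun Y => gUp G ε Y i j) X| ≤ A := by
  rw [← setOf_chart_mem_M2 hS.cone ε] at hX
  have := hS.bound i j ε X hX.1 hX.2 1 le_rfl _ (single_mem_multi c)
  rwa [mpd_single] at this

theorem IsSetting.elliptic_under (hX : X ∈ under T (pullI Z ε)) (x y : ℝ) :
    lam * (x ^ 2 + y ^ 2) ≤
      gUp G ε X 2 2 * x ^ 2 + 2 * gUp G ε X 2 3 * x * y + gUp G ε X 3 3 * y ^ 2 := by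
  rw [← setOf_chart_mem_M2 hS.cone ε] at hX
  exact hS.elliptic ε X hX.1 hX.2 x y

theorem IsSetting.slab_of_under (hX : X ∈ under T (pullI Z ε)) : chart ε X ∈ slab T R :=
  hS.cone.underc_slab (under_subset_underc _ _ hX)

theorem IsSetting.contDiffAt_gUp_two (hX : chart ε X ∈ slab T R) (i j : Fin 4) :
    ContDiffAt ℝ 2 (fun Y => gUp G ε Y i j) X :=
  (hS.ads.contDiffAt_gUp hX i j).of_le (by exact_mod_cast hS.two_le)

theorem IsSetting.contDiffAt_volDensity_two (hX : chart ε X ∈ slab T R) :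
    ContDiffAt ℝ 2 (volDensity G ε) X :=
  (hS.ads.contDiffAt_volDensity hX).of_le (by exact_mod_cast hS.two_le)

theorem IsSetting.differentiableAt_gUp (hX : chart ε X ∈ slab T R) (i j : Fin 4) :
    DifferentiableAt ℝ (fun Y => gUp G ε Y i j) X :=
  (hS.contDiffAt_gUp_two hX i j).differentiableAt (by norm_num)

theorem IsSetting.differentiableAt_volDensity (hX : chart ε X ∈ slab T R) :
    DifferentiableAt ℝ (volDensity G ε) X :=
  (hS.contDiffAt_volDensity_two hX).differentiableAt (by norm_num)

theorem IsSetting.upDet_pos (hX : chart ε X ∈ slab T R) : 0 < upDet G ε X := by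
  have h := hS.ads.upDet_mul_sq hX
  have hμ := hS.ads.volDensity_pos hX
  by_contra h0
  have : upDet G ε X * volDensity G ε X ^ 2 ≤ 0 :=
    mul_nonpos_of_nonpos_of_nonneg (not_lt.1 h0) (sq_nonneg _)
  linarith

theorem IsSetting.differentiableAt_upDet (hX : chart ε X ∈ slab T R) :
    DifferentiableAt ℝ (upDet G ε) X :=
  ((hS.differentiableAt_gUp hX 2 2).fun_mul (hS.differentiableAt_gUp hX 3 3)).fun_sub
    ((hS.differentiableAt_gUp hX 2 3).fun_pow 2)

/-- Logarithmic differentiation of `upDet` times the square of the density, which is constant on an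
open set. -/
theorem IsSetting.pd_volDensity_div (hX : X ∈ region T R Z ε) (i : Fin 4) :
    pd i (volDensity G ε) X / volDensity G ε X
      = -(pd i (upDet G ε) X) / (2 * upDet G ε X) := by
  have hs := region_slab hX
  have hμ' := (hS.ads.volDensity_pos hs).ne'
  have hu' := (hS.upDet_pos hs).ne'
  have dμ := hS.differentiableAt_volDensity hs
  have e : (fun Y => upDet G ε Y * volDensity G ε Y ^ 2) =ᶠ[𝓝 X] fun _ => 1 := by
    filter_upwards [(hS.cone.isOpen_region ε).mem_nhds hX] with Y hY
    exact hS.ads.upDet_mul_sq (region_slab hY)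
  have h0 := pd_congr e i
  rw [pd_const, pd_mul i (hS.differentiableAt_upDet hs) (dμ.fun_pow 2), pd_pow i 2 dμ] at h0
  norm_num at h0
  field_simp
  have h3 : volDensity G ε X * (pd i (upDet G ε) X * volDensity G ε X
    + upDet G ε X * (2 * pd i (volDensity G ε) X)) = 0 := by linarith
  rcases mul_eq_zero.1 h3 with h | h
  · exact absurd h hμ'
  · linarith

theorem IsSetting.le_upDet (hX : X ∈ under T (pullI Z ε)) : lam ^ 2 ≤ upDet G ε X :=
  upDet_ge hS.lam_pos (hS.elliptic_under hX)

theorem IsSetting.abs_pd_volDensity_le (hX : X ∈ under T (pullI Z ε)) (i : Fin 4) :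
    |pd i (volDensity G ε) X / volDensity G ε X| ≤ 2 * A ^ 2 / lam ^ 2 := by
  have hs := hS.slab_of_under hX
  have dN := hS.differentiableAt_gUp hs
  have hl := hS.le_upDet hX
  have hlam2 : 0 < lam ^ 2 := by have := hS.lam_pos; positivity
  have hu := hS.upDet_pos hs
  have hpu : |pd i (upDet G ε) X| ≤ 4 * A ^ 2 := by
    have eu : upDet G ε = fun Y => gUp G ε Y 2 2 * gUp G ε Y 3 3 - gUp G ε Y 2 3 ^ 2 := rfl
    rw [eu, pd_sub i ((dN 2 2).fun_mul (dN 3 3)) ((dN 2 3).fun_pow 2),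
      pd_mul i (dN 2 2) (dN 3 3), pd_pow i 2 (dN 2 3)]
    have hA0 : 0 ≤ A := (abs_nonneg _).trans (hS.abs_gUp_le hX 0 0)
    have b : ∀ x y : ℝ, |x| ≤ A → |y| ≤ A → |x * y| ≤ A ^ 2 := fun x y hx hy => by
      rw [abs_mul, sq]; exact mul_le_mul hx hy (abs_nonneg _) hA0
    have b1 := abs_le.1 (b _ _ (hS.abs_pd_gUp_le hX 2 2 i) (hS.abs_gUp_le hX 3 3))
    have b2 := abs_le.1 (b _ _ (hS.abs_gUp_le hX 2 2) (hS.abs_pd_gUp_le hX 3 3 i))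
    have b3 := abs_le.1 (b _ _ (hS.abs_gUp_le hX 2 3) (hS.abs_pd_gUp_le hX 2 3 i))
    rw [abs_le]
    push_cast
    constructor <;> norm_num <;> linarith
  rw [hS.pd_volDensity_div (hS.cone.under_subset_region ε hX), abs_div, abs_neg, abs_of_pos (by positivity : 0 < 2 * upDet G ε X),
    div_le_div_iff₀ (by positivity) hlam2]
  calc |pd i (upDet G ε) X| * lam ^ 2 ≤ 4 * A ^ 2 * upDet G ε X := by gcongr
    _ = _ := by ring

theorem IsSetting.abs_pd_mult_le (hX : X ∈ under T (pullI Z ε)) {b : ℝ} (hb : 0 ≤ b)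
    (i c : Fin 4) :
    |pd i (fun Y => mult (gUp G ε Y) b 1 c) X| ≤ A + A ^ 2 + b * A := by
  have hs := hS.slab_of_under hX
  have dN : ∀ i j, DifferentiableAt ℝ (fun Y => gUp G ε Y i j) X := fun i j =>
    (hS.contDiffAt_gUp_two hs i j).differentiableAt (by norm_num)
  have hA0 : 0 ≤ A := (abs_nonneg _).trans (hS.abs_gUp_le hX 0 0)
  have e : (fun Y => mult (gUp G ε Y) b 1 c) = fun Y => gUp G ε Y c 1
      - 1 / 2 * (gUp G ε Y 1 1 * gUp G ε Y c 0) - b * gUp G ε Y c 0 := by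
    ext Y; unfold mult; ring
  rw [e, pd_sub i ((dN c 1).fun_sub (((dN 1 1).fun_mul (dN c 0)).const_mul _))
      ((dN c 0).const_mul _), pd_sub i (dN c 1) (((dN 1 1).fun_mul (dN c 0)).const_mul _),
    pd_mul i (differentiableAt_const _) ((dN 1 1).fun_mul (dN c 0)),
    pd_mul i (dN 1 1) (dN c 0), pd_mul i (differentiableAt_const _) (dN c 0), pd_const, pd_const]
  have m : ∀ x y : ℝ, |x| ≤ A → |y| ≤ A → |x * y| ≤ A ^ 2 := fun x y hx hy => by
    rw [abs_mul, sq]; exact mul_le_mul hx hy (abs_nonneg _) hA0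
  have b1 := abs_le.1 (m _ _ (hS.abs_pd_gUp_le hX 1 1 i) (hS.abs_gUp_le hX c 0))
  have b2 := abs_le.1 (m _ _ (hS.abs_gUp_le hX 1 1) (hS.abs_pd_gUp_le hX c 0 i))
  have b3 := abs_le.1 (hS.abs_pd_gUp_le hX c 1 i)
  have b4 : |b * pd i (fun Y => gUp G ε Y c 0) X| ≤ b * A := by
    rw [abs_mul, abs_of_nonneg hb]
    exact mul_le_mul_of_nonneg_left (hS.abs_pd_gUp_le hX c 0 i) hb
  have b5 := abs_le.1 b4
  rw [abs_le]
  constructor <;> norm_num <;> linarith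

end

/-- The weighted energy current of `φ`, corrected by a term that controls `φ` itself. -/
def weightedCurrent (G : BondiData) (q l b : ℝ) (ε : Bool) (φ : Coord → ℝ) (i : Fin 4)
    (X : Coord) : ℝ :=
  volDensity G ε X * wt q l X * current (gUp G ε X) b 1 (fun j => pd j φ X) i
    + if i = 1 then volDensity G ε X * (wt q l X * φ X ^ 2) else 0

/-- The constant in the coercivity of the divergence. -/
def coerConst (lam A b : ℝ) : ℝ := 4 + (1 + 4 * A ^ 2) * (1 / b + 2 / lam)

/-- The constant in the error of the divergence. -/
def errConst (lam A B D b : ℝ) : ℝ :=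
  8 * (A + A ^ 2 + b * A) ^ 2 + 128 * (A + A ^ 2 + b * A) * A * (2 + 2 * A ^ 2 / lam ^ 2)
    + 2 * B ^ 2 + D ^ 2 + 2 + 2 * A ^ 2 / lam ^ 2

theorem wt_pos (q l : ℝ) (X : Coord) : 0 < wt q l X := Real.exp_pos _

theorem contDiff_wt (q l : ℝ) : ContDiff ℝ 1 (wt q l) := by
  unfold wt; fun_prop

section

variable {Λ lam A T R : ℝ} {k : ℕ} {G : BondiData} {Z : ℝ → S2 → ℝ}
  (hS : IsSetting Λ lam A T R k G Z) {ε : Bool} {X : Coord}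
include hS

theorem IsSetting.contDiffAt_current (hX : chart ε X ∈ slab T R) {φ : Coord → ℝ}
    (hφ : ContDiffAt ℝ 2 φ X) (b₁ b₂ : ℝ) (i : Fin 4) :
    ContDiffAt ℝ 1 (fun Y => current (gUp G ε Y) b₁ b₂ (fun j => pd j φ Y) i) X := by
  have hN : ∀ i j, ContDiffAt ℝ 1 (fun Y => gUp G ε Y i j) X := fun i j =>
    (hS.contDiffAt_gUp_two hX i j).of_le (by norm_num)
  have hp : ∀ i, ContDiffAt ℝ 1 (fun Y => pd i φ Y) X := fun i =>
    contDiffAt_pd (n := 1) (by exact_mod_cast hφ) i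
  have hK : ∀ i, ContDiffAt ℝ 1 (fun Y => mult (gUp G ε Y) b₁ b₂ i) X := fun i => by
    unfold mult
    exact (contDiffAt_const.mul ((hN i 1).sub ((contDiffAt_const.mul (hN 1 1)).mul (hN i 0)))).sub
      (contDiffAt_const.mul (hN i 0))
  unfold current
  exact ((ContDiffAt.sum fun j _ => (hN i j).mul (hp j)).mul
    (ContDiffAt.sum fun j _ => (hK j).mul (hp j))).sub ((contDiffAt_const.mul (hK i)).mul
      (ContDiffAt.sum fun a _ => ContDiffAt.sum fun b _ => ((hN a b).mul (hp a)).mul (hp b)))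

theorem IsSetting.contDiffAt_weightedCurrent (hX : chart ε X ∈ slab T R) {φ : Coord → ℝ}
    (hφ : ContDiffAt ℝ 2 φ X) (q l b : ℝ) (i : Fin 4) :
    ContDiffAt ℝ 1 (weightedCurrent G q l b ε φ i) X := by
  have hμ : ContDiffAt ℝ 1 (volDensity G ε) X :=
    (hS.contDiffAt_volDensity_two hX).of_le (by norm_num)
  have hw : ContDiffAt ℝ 1 (wt q l) X := (contDiff_wt q l).contDiffAt
  unfold weightedCurrent
  refine ((hμ.mul hw).mul (hS.contDiffAt_current hX hφ b 1 i)).add ?_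
  split_ifs
  · exact hμ.mul (hw.mul ((hφ.of_le (by norm_num)).pow 2))
  · exact contDiffAt_const

/-- Coercivity of the part with the derivative of the weight against the error bound for the rest.
The correction term in the current supplies q φ², without which φ itself would not be controlled. -/
theorem IsSetting.div_weightedCurrent_ge (hX : X ∈ under T (pullI Z ε)) {φ : Coord → ℝ}
    (hφ : ContDiffAt ℝ 2 φ X) {B D b l q : ℝ} (hb : 0 < b) (hl : A + 1 ≤ l) (hq : 0 ≤ q)
    {a : Fin 4 → ℝ} (ha : ∀ i, |a i| ≤ B) {ω : ℝ} (hω : |ω| ≤ D) :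
    volDensity G ε X * wt q l X * ((q / coerConst lam A b - errConst lam A B D b)
        * ((∑ i, pd i φ X ^ 2) + φ X ^ 2)
        - (box G ε φ X + (∑ i, a i * pd i φ X) + ω * φ X) ^ 2)
      ≤ ∑ i, pd i (weightedCurrent G q l b ε φ i) X := by
  have hs := hS.slab_of_under hX
  have hμ := hS.ads.volDensity_pos hs
  have hlam := hS.lam_pos
  have dμ : DifferentiableAt ℝ (volDensity G ε) X :=
    (hS.contDiffAt_volDensity_two hs).differentiableAt (by norm_num)
  have dN : ∀ i j, DifferentiableAt ℝ (fun Y => gUp G ε Y i j) X := fun i j =>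
    (hS.contDiffAt_gUp_two hs i j).differentiableAt (by norm_num)
  have dw := differentiableAt_wt q l X
  have dφ : DifferentiableAt ℝ φ X := hφ.differentiableAt (by norm_num)
  have hN := hS.ads.isBondiInv hs
  have hA0 : 0 ≤ A := (abs_nonneg _).trans (hS.abs_gUp_le hX 0 0)
  have dcur : ∀ i, DifferentiableAt ℝ (fun Y => volDensity G ε Y * wt q l Y
      * current (gUp G ε Y) b 1 (fun j => pd j φ Y) i) X := fun i =>
    (dμ.fun_mul dw).fun_mul ((hS.contDiffAt_current hs hφ b 1 i).differentiableAt (by norm_num))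
  have dB : DifferentiableAt ℝ (fun Y => volDensity G ε Y * (wt q l Y * φ Y ^ 2)) X :=
    dμ.fun_mul (dw.fun_mul (dφ.fun_pow 2))
  have h1 : ∀ i, pd i (weightedCurrent G q l b ε φ i) X
      = pd i (fun Y => volDensity G ε Y * wt q l Y
        * current (gUp G ε Y) b 1 (fun j => pd j φ Y) i) X
        + if i = 1 then pd 1 (fun Y => volDensity G ε Y * (wt q l Y * φ Y ^ 2)) X else 0 := by
    intro i
    unfold weightedCurrent
    by_cases hi : i = 1
    · subst hi
      simp only [if_true]
      exact pd_add 1 (dcur 1) dB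
    · simp only [if_neg hi, add_zero]
  have hbox : ∑ i, ∑ j, pd i (fun Y => volDensity G ε Y * gUp G ε Y i j * pd j φ Y) X
      = volDensity G ε X * box G ε φ X := by
    unfold box; field_simp
  have hsum : ∑ i, pd i (weightedCurrent G q l b ε φ i) X = volDensity G ε X * wt q l X *
      (q * (-l * current (gUp G ε X) b 1 (fun j => pd j φ X) 0
          + current (gUp G ε X) b 1 (fun j => pd j φ X) 1) + q * φ X ^ 2
        + ((∑ c, mult (gUp G ε X) b 1 c * pd c φ X) * box G ε φ X
        + ((∑ i, ∑ j, ∑ c, gUp G ε X i j * pd j φ X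
            * (pd i (fun Y => mult (gUp G ε Y) b 1 c) X * pd c φ X))
          - 1 / 2 * (∑ i, (pd i (volDensity G ε) X / volDensity G ε X * mult (gUp G ε X) b 1 i
              + pd i (fun Y => mult (gUp G ε Y) b 1 i) X))
            * (∑ x, ∑ y, gUp G ε X x y * pd x φ X * pd y φ X)
          - 1 / 2 * ∑ i, ∑ x, ∑ y, mult (gUp G ε X) b 1 i
            * (pd i (fun Y => gUp G ε Y x y) X * pd x φ X * pd y φ X))
        + (2 * φ X * pd 1 φ X + pd 1 (volDensity G ε) X / volDensity G ε X * φ X ^ 2))) := by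
    rw [Finset.sum_congr rfl fun i _ => h1 i, Finset.sum_add_distrib, Finset.sum_ite_eq',
      if_pos (Finset.mem_univ _), sum_pd_current dN (fun i j => hN.symm i j) dμ dw hφ b 1, hbox,
      pd_mul 1 dμ (dw.fun_mul (dφ.fun_pow 2)), pd_mul 1 dw (dφ.fun_pow 2), pd_pow 1 2 dφ]
    have e : ∑ i, (pd i (volDensity G ε) X * mult (gUp G ε X) b 1 i
          + volDensity G ε X * pd i (fun Y => mult (gUp G ε Y) b 1 i) X)
        = volDensity G ε X * ∑ i, (pd i (volDensity G ε) X / volDensity G ε X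
          * mult (gUp G ε X) b 1 i + pd i (fun Y => mult (gUp G ε Y) b 1 i) X) := by
      rw [Finset.mul_sum]
      refine Finset.sum_congr rfl fun i _ => ?_
      field_simp
    have e2 : pd 1 (volDensity G ε) X * (wt q l X * φ X ^ 2) = volDensity G ε X
        * (pd 1 (volDensity G ε) X / volDensity G ε X) * (wt q l X * φ X ^ 2) := by field_simp
    have e3 : ∑ i, pd i (wt q l) X * current (gUp G ε X) b 1 (fun j => pd j φ X) i
        = wt q l X * (q * (-l * current (gUp G ε X) b 1 (fun j => pd j φ X) 0
          + current (gUp G ε X) b 1 (fun j => pd j φ X) 1)) := by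
      simp only [pd_wt, Fin.sum_univ_four]
      simp
      ring
    rw [e, e3, e2, pd_wt, if_neg (by decide), if_pos rfl]
    norm_num only
    ring
  have hcoer := hN.coercive (hS.abs_gUp_le hX) hlam hb hl (hS.elliptic_under hX)
    (fun j => pd j φ X)
  have herr := divergence_error_bound (A := A) (B := B) (D := D) (b := b)
    (m := 2 * A ^ 2 / lam ^ 2) hA0 hb.le (by positivity) (hS.abs_gUp_le hX)
    (dN := fun i x y => pd i (fun Y => gUp G ε Y x y) X) (fun i x y => hS.abs_pd_gUp_le hX x y i)
    (dK := fun i c => pd i (fun Y => mult (gUp G ε Y) b 1 c) X)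
    (fun i c => hS.abs_pd_mult_le hX hb.le i c)
    (dμ := fun i => pd i (volDensity G ε) X / volDensity G ε X)
    (fun i => hS.abs_pd_volDensity_le hX i) ha hω (fun j => pd j φ X) (φ X) (box G ε φ X) _ rfl
  rw [hsum]
  refine mul_le_mul_of_nonneg_left ?_ (mul_nonneg hμ.le (wt_pos q l X).le)
  -- The term q φ² appears with coefficient 1. Since the coercivity constant is at least 1, both
  -- parts share the factor q / c.
  have hc : 1 ≤ coerConst lam A b := by
    unfold coerConst
    have : 0 ≤ (1 + 4 * A ^ 2) * (1 / b + 2 / lam) := by positivity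
    linarith
  have hc0 : 0 < coerConst lam A b := by linarith
  have h2 : q / coerConst lam A b * ∑ i, pd i φ X ^ 2
      ≤ q * (-l * current (gUp G ε X) b 1 (fun j => pd j φ X) 0
          + current (gUp G ε X) b 1 (fun j => pd j φ X) 1) := by
    rw [div_mul_eq_mul_div, mul_div_assoc]
    refine mul_le_mul_of_nonneg_left ?_ hq
    rw [div_le_iff₀' hc0]
    exact hcoer
  have h3 : q / coerConst lam A b * φ X ^ 2 ≤ q * φ X ^ 2 :=
    mul_le_mul_of_nonneg_right (div_le_self hq hc) (sq_nonneg _)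
  have h4 := add_le_add (add_le_add h2 h3) herr
  refine le_trans (le_of_eq ?_) h4
  unfold errConst
  ring

end

/-! ### Integration over the boundary -/

/-- The closed tangential cell. -/
def tanCellc (T : ℝ) : Set (Fin 3 → ℝ) :=
  {Y | (0 ≤ Y 0 ∧ Y 0 ≤ T) ∧ Y 1 ^ 2 + Y 2 ^ 2 ≤ 1}

theorem tanCell_subset_tanCellc (T : ℝ) : tanCell T ⊆ tanCellc T := fun _ h =>
  ⟨⟨h.1.le, h.2.1.le⟩, h.2.2⟩

theorem isCompact_tanCellc (T : ℝ) : IsCompact (tanCellc T) := by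
  refine (isCompact_Icc (a := ![0, -1, -1]) (b := ![T, 1, 1])).of_isClosed_subset ?_ ?_
  · refine IsClosed.inter (IsClosed.inter ?_ ?_) ?_
    · exact isClosed_le continuous_const (continuous_apply 0)
    · exact isClosed_le (continuous_apply 0) continuous_const
    · exact isClosed_le (by fun_prop : Continuous fun Y : Fin 3 → ℝ => Y 1 ^ 2 + Y 2 ^ 2)
        continuous_const
  · intro Y hY
    have h1 : |Y 1| ≤ 1 := (sq_le_one_iff_abs_le_one _).1 (by linarith [hY.2, sq_nonneg (Y 2)])
    have h2 : |Y 2| ≤ 1 := (sq_le_one_iff_abs_le_one _).1 (by linarith [hY.2, sq_nonneg (Y 1)])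
    rw [abs_le] at h1 h2
    constructor <;> intro i <;> fin_cases i
    exacts [hY.1.1, h1.1, h2.1, hY.1.2, h1.2, h2.2]

theorem integrableOn_tanCell {T : ℝ} {F : (Fin 3 → ℝ) → ℝ}
    (hF : ∀ Y ∈ tanCellc T, ContinuousAt F Y) : IntegrableOn F (tanCell T) := by
  have : ContinuousOn F (tanCellc T) := fun Y hY => (hF Y hY).continuousWithinAt
  exact (this.integrableOn_compact (isCompact_tanCellc T)).mono_set (tanCell_subset_tanCellc T)

/-- The point of `𝓘` over a point of the tangential cell. -/
def liftI (Y : Fin 3 → ℝ) : Coord := ![Y 0, 0, Y 1, Y 2]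

/-- The point of `𝓗` over a point of the tangential cell. -/
def liftH (Z : ℝ → S2 → ℝ) (ε : Bool) (Y : Fin 3 → ℝ) : Coord :=
  ![Y 0, Z (Y 0) (stereo ε (Y 1) (Y 2)), Y 1, Y 2]

theorem graphFun_liftH (Z : ℝ → S2 → ℝ) (ε : Bool) (Y : Fin 3 → ℝ) :
    graphFun Z ε (liftH Z ε Y) = 0 :=
  sub_self (Z (Y 0) (stereo ε (Y 1) (Y 2)))

theorem continuous_liftI : Continuous liftI := by
  unfold liftI
  refine continuous_pi fun i => ?_
  fin_cases i
  exacts [continuous_apply 0, continuous_const, continuous_apply 1, continuous_apply 2]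

theorem IsGraph.pd_update {T : ℝ} {ζ : Coord → ℝ} (hζ : IsGraph T ζ) (i : Fin 4) (X : Coord)
    (s : ℝ) : pd i ζ (Function.update X 1 s) = pd i ζ X := by
  have e : (fun Y => ζ (Y + Pi.single 1 (s - X 1))) = ζ := by
    ext Y
    exact hζ.congr_of (by simp) (by simp) (by simp)
  have e2 : Function.update X 1 s = X + Pi.single 1 (s - X 1) := by
    ext j
    by_cases hj : j = 1
    · subst hj; simp
    · simp [hj]
  unfold pd
  rw [e2, ← fderiv_comp_add_right, e]

section

variable {Λ lam A T R : ℝ} {k : ℕ} {G : BondiData} {Z : ℝ → S2 → ℝ}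
  (hS : IsSetting Λ lam A T R k G Z) {ε : Bool} {Y : Fin 3 → ℝ}
include hS

theorem IsSetting.liftI_mem (hY : Y ∈ tanCellc T) : liftI Y ∈ underc T (pullI Z ε) :=
  ⟨hY.1, ⟨le_rfl, (hS.cone.isGraph ε).nonneg (liftI Y) hY.1⟩, hY.2⟩

theorem IsSetting.liftH_mem (hY : Y ∈ tanCellc T) : liftH Z ε Y ∈ underc T (pullI Z ε) :=
  ⟨hY.1, ⟨(hS.cone.isGraph ε).nonneg (liftI Y) hY.1, le_rfl⟩, hY.2⟩

theorem IsSetting.continuousAt_liftH (hY : Y ∈ tanCellc T) : ContinuousAt (liftH Z ε) Y := by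
  have h : ContinuousAt (fun Y' => pullI Z ε (liftI Y')) Y :=
    ContinuousAt.comp (f := liftI) ((hS.cone.isGraph ε).smooth (liftI Y) hY.1).continuousAt
      continuous_liftI.continuousAt
  unfold liftH
  refine continuousAt_pi.2 fun i => ?_
  fin_cases i
  exacts [(continuous_apply 0).continuousAt, h, (continuous_apply 1).continuousAt,
    (continuous_apply 2).continuousAt]

theorem IsSetting.integrableOn_liftI {F : Coord → ℝ}
    (hF : ∀ X ∈ underc T (pullI Z ε), ContinuousAt F X) :
    IntegrableOn (fun Y => F (liftI Y)) (tanCell T) :=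
  integrableOn_tanCell fun _ hY =>
    ContinuousAt.comp (f := liftI) (hF _ (hS.liftI_mem hY)) continuous_liftI.continuousAt

theorem IsSetting.integrableOn_liftH {F : Coord → ℝ}
    (hF : ∀ X ∈ underc T (pullI Z ε), ContinuousAt F X) :
    IntegrableOn (fun Y => F (liftH Z ε Y)) (tanCell T) :=
  integrableOn_tanCell fun _ hY =>
    ContinuousAt.comp (f := liftH Z ε) (hF _ (hS.liftH_mem hY)) (hS.continuousAt_liftH hY)

theorem IsSetting.pd_graphFun_liftH (hY : Y ∈ tanCellc T) {i : Fin 4} (hi : i ≠ 1) :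
    pd i (graphFun Z ε) (liftH Z ε Y) = pd i (pullI Z ε) (liftI Y) := by
  have e : liftH Z ε Y = Function.update (liftI Y) 1 (Z (Y 0) (stereo ε (Y 1) (Y 2))) := by
    ext j; fin_cases j <;> rfl
  have h := hS.cone.pd_pullI (ε := ε) (X := liftH Z ε Y) hY.1 i
  rw [if_neg hi, add_zero] at h
  rw [← h, e, (hS.cone.isGraph ε).pd_update]

theorem IsSetting.differentiableAt_graphFun (hY : Y ∈ tanCellc T) :
    DifferentiableAt ℝ (graphFun Z ε) (liftH Z ε Y) :=
  (hS.cone.smooth ε _ hY.1).differentiableAt (by norm_num)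

/-- The flux through the null hypersurface is controlled by its energy. -/
theorem IsSetting.flux_le (hY : Y ∈ tanCellc T) {b : ℝ} (hb : 0 ≤ b) (q l : ℝ) (φ : Coord → ℝ) :
    weightedCurrent G q l b ε φ 1 (liftH Z ε Y)
        - (pd 0 (pullI Z ε) (liftI Y) * weightedCurrent G q l b ε φ 0 (liftH Z ε Y)
          + pd 2 (pullI Z ε) (liftI Y) * weightedCurrent G q l b ε φ 2 (liftH Z ε Y)
          + pd 3 (pullI Z ε) (liftI Y) * weightedCurrent G q l b ε φ 3 (liftH Z ε Y))
      ≤ (1 + b) * (wt q l (liftH Z ε Y) * energyH G Z ε φ 1 1 (liftH Z ε Y)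
          * volDensity G ε (liftH Z ε Y)) := by
  have hs := hS.cone.underc_slab (hS.liftH_mem (ε := ε) hY)
  have hd := hS.differentiableAt_graphFun (ε := ε) hY
  have hnull := hS.cone.null ε _ hY.1 (graphFun_liftH Z ε Y)
  rw [← hS.pd_graphFun_liftH hY (by decide : (0 : Fin 4) ≠ 1),
    ← hS.pd_graphFun_liftH hY (by decide : (2 : Fin 4) ≠ 1),
    ← hS.pd_graphFun_liftH hY (by decide : (3 : Fin 4) ≠ 1)]
  set X := liftH Z ε Y with hX
  have h1 := hS.ads.energyH_eq_flux hs hd hnull φ b 1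
  have hμ := hS.ads.volDensity_pos hs
  have hw := wt_pos q l X
  have e : weightedCurrent G q l b ε φ 1 X
        - (pd 0 (graphFun Z ε) X * weightedCurrent G q l b ε φ 0 X
          + pd 2 (graphFun Z ε) X * weightedCurrent G q l b ε φ 2 X
          + pd 3 (graphFun Z ε) X * weightedCurrent G q l b ε φ 3 X)
      = volDensity G ε X * wt q l X * (energyH G Z ε φ b 1 X
        - (normalCoeff (gUp G ε X) (fun i => pd i (graphFun Z ε) X) + b) * φ X ^ 2
        + φ X ^ 2) := by
    rw [h1, Fin.sum_univ_four, pd_one_graphFun hd]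
    simp only [weightedCurrent]
    simp
    ring
  obtain ⟨α, β, γ, l₃, l₄, -, -, -, -, -, hl, hE⟩ := hS.ads.energyH_explicit hs hd hnull
  rw [e]
  -- All terms are squares with nonnegative coefficients, as l₁ = (l₃² + l₄²)/2. The factor 1 + b
  -- dominates the coefficient b of the tangential squares, and also the φ² of the correction term.
  have key : energyH G Z ε φ b 1 X
        - (normalCoeff (gUp G ε X) (fun i => pd i (graphFun Z ε) X) + b) * φ X ^ 2
        + φ X ^ 2 ≤ (1 + b) * energyH G Z ε φ 1 1 X := by
    rw [hE φ b 1, hE φ 1 1, hl]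
    set t₁ := (l₃ * pd 1 φ X + α * pd 2 φ X) ^ 2
            + (l₄ * pd 1 φ X + β * pd 2 φ X + γ * pd 3 φ X) ^ 2 with ht₁
    set t₂ := (pd 0 φ X + 1 / 2 * gUp G ε X 1 1 * pd 1 φ X + gUp G ε X 1 2 * pd 2 φ X
              + gUp G ε X 1 3 * pd 3 φ X - l₃ / 2 * α * pd 2 φ X
              - l₄ / 2 * (β * pd 2 φ X + γ * pd 3 φ X)) ^ 2 with ht₂
    set t₃ := (l₃ * (β * pd 2 φ X + γ * pd 3 φ X) - l₄ * α * pd 2 φ X) ^ 2 with ht₃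
    have p₁ : 0 ≤ t₁ := by positivity
    have p₂ : 0 ≤ t₂ := by positivity
    have p₃ : 0 ≤ t₃ := by positivity
    have p₄ : 0 ≤ (l₃ ^ 2 + l₄ ^ 2) / 2 * φ X ^ 2 := by positivity
    have p₅ : 0 ≤ b * t₂ := by positivity
    have p₆ : 0 ≤ b * t₃ := by positivity
    have p₇ : 0 ≤ b * ((l₃ ^ 2 + l₄ ^ 2) / 2 * φ X ^ 2) := by positivity
    have p₈ : 0 ≤ b * φ X ^ 2 := by positivity
    linarith
  calc _ ≤ volDensity G ε X * wt q l X * ((1 + b) * energyH G Z ε φ 1 1 X) :=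
        mul_le_mul_of_nonneg_left key (by positivity)
    _ = _ := by ring

/-- The flux through infinity controls the transversal derivative. -/
theorem IsSetting.flux_infty_ge (hY : Y ∈ tanCellc T) (q l : ℝ) (φ : Coord → ℝ) :
    (Λ ^ 2 / 144) * (wt q l (liftI Y) * pd 1 φ (liftI Y) ^ 2 * volDensity G ε (liftI Y))
      - (3 - Λ / 24) * (wt q l (liftI Y) * (pd 0 φ (liftI Y) ^ 2 + pd 2 φ (liftI Y) ^ 2
        + pd 3 φ (liftI Y) ^ 2) * volDensity G ε (liftI Y))
      ≤ weightedCurrent G q l (-Λ / 12) ε φ 1 (liftI Y) := by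
  have hs : chart ε (liftI Y) ∈ slab T R := hS.cone.underc_slab (hS.liftI_mem (ε := ε) hY)
  obtain ⟨h11, h12, h13, h23, h22, h33⟩ :=
    hS.ads.gUp_infty hS.R_pos (ε := ε) (X := liftI Y) hY.1 rfl
  have hμ := hS.ads.volDensity_pos hs
  have hw := wt_pos q l (liftI Y)
  -- On the closed unit disk the conformal factor is at most 2, so g^{22} = g^{33} ≤ 1 at infinity.
  have hcf : conf (liftI Y) ^ 2 / 4 ≤ 1 := by
    have h1 : conf (liftI Y) = 1 + Y 1 ^ 2 + Y 2 ^ 2 := rfl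
    have h2 := conf_pos (liftI Y)
    have h3 : conf (liftI Y) ≤ 2 := by rw [h1]; linarith [hY.2]
    nlinarith
  have hcur := (hS.ads.isBondiInv hs).current_one (-Λ / 12) (fun j => pd j φ (liftI Y))
  have hΛ := hS.Λ_neg
  have e : weightedCurrent G q l (-Λ / 12) ε φ 1 (liftI Y)
      = volDensity G ε (liftI Y) * wt q l (liftI Y)
        * (current (gUp G ε (liftI Y)) (-Λ / 12) 1 (fun j => pd j φ (liftI Y)) 1
          + φ (liftI Y) ^ 2) := by
    unfold weightedCurrent
    rw [if_pos rfl]; ring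
  rw [e, hcur, h11, h12, h13, h22, h33, h23]
  set X := liftI Y
  -- With W = -Λ/3 and b = -Λ/12 the coefficient of (∂_zφ)² is Λ²/36 - Λ²/72 = Λ²/72. Completing the
  -- square 2∂_τφ - (Λ/12)∂_zφ uses one half of it and costs 3 (∂_τφ)². The angular term costs
  -- -Λ/24.
  have key : Λ ^ 2 / 144 * pd 1 φ X ^ 2
      - (3 - Λ / 24) * (pd 0 φ X ^ 2 + pd 2 φ X ^ 2 + pd 3 φ X ^ 2)
      ≤ (pd 0 φ X + 1 / 2 * (-Λ / 3) * pd 1 φ X + 0 * pd 2 φ X + 0 * pd 3 φ X) ^ 2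
        - 1 / 2 * (-Λ / 3) * (-Λ / 12) * pd 1 φ X ^ 2
        - 1 / 2 * (1 / 2 * (-Λ / 3) - (-Λ / 12)) * (conf X ^ 2 / 4 * pd 2 φ X ^ 2
          + 2 * 0 * pd 2 φ X * pd 3 φ X + conf X ^ 2 / 4 * pd 3 φ X ^ 2) + φ X ^ 2 := by
    set t := conf X ^ 2 / 4
    have a1 : -Λ / 24 * (t * (pd 2 φ X ^ 2 + pd 3 φ X ^ 2))
        ≤ -Λ / 24 * (1 * (pd 2 φ X ^ 2 + pd 3 φ X ^ 2)) := by
      refine mul_le_mul_of_nonneg_left ?_ (by linarith)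
      exact mul_le_mul_of_nonneg_right hcf (by positivity)
    have a2 : 0 ≤ -Λ * pd 0 φ X ^ 2 := mul_nonneg (by linarith) (sq_nonneg _)
    linarith [sq_nonneg (2 * pd 0 φ X - Λ / 12 * pd 1 φ X), sq_nonneg (φ X), sq_nonneg (pd 0 φ X),
      sq_nonneg (pd 2 φ X), sq_nonneg (pd 3 φ X)]
  calc _ = volDensity G ε X * wt q l X * (Λ ^ 2 / 144 * pd 1 φ X ^ 2
      - (3 - Λ / 24) * (pd 0 φ X ^ 2 + pd 2 φ X ^ 2 + pd 3 φ X ^ 2)) := by ring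
    _ ≤ _ := mul_le_mul_of_nonneg_left key (by positivity)

end

/-! ### The weighted energy estimate -/

section

variable {Λ lam A T R : ℝ} {k : ℕ} {G : BondiData} {Z : ℝ → S2 → ℝ}
  (hS : IsSetting Λ lam A T R k G Z)
include hS

theorem IsSetting.continuousAt_box {ε : Bool} {X : Coord} (hX : X ∈ underc T (pullI Z ε))
    {φ : Coord → ℝ} (hφ : ContDiffAt ℝ 2 φ X) : ContinuousAt (box G ε φ) X := by
  have hs := hS.cone.underc_slab hX
  have hμ := hS.contDiffAt_volDensity_two hs
  unfold box
  refine (hμ.continuousAt.inv₀ (hS.ads.volDensity_pos hs).ne').mul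
    (tendsto_finsetSum _ fun i _ => tendsto_finsetSum _ fun j _ => ?_)
  refine continuousAt_pd ?_ i
  exact ((hμ.of_le (by norm_num)).mul ((hS.contDiffAt_gUp_two hs i j).of_le (by norm_num))).mul
    (contDiffAt_pd (n := 1) (by exact_mod_cast hφ) j)

/-- The energy density on the null hypersurface extends to a continuous function. -/
theorem IsSetting.integrableOn_energyH {ε : Bool} {φ : Coord → ℝ}
    (hφ : ∀ X ∈ underc T (pullI Z ε), ContDiffAt ℝ 2 φ X) (q l : ℝ) :
    IntegrableOn (fun Y => wt q l (liftH Z ε Y) * energyH G Z ε φ 1 1 (liftH Z ε Y)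
      * volDensity G ε (liftH Z ε Y)) (tanCell T) := by
  have hc : IntegrableOn (fun Y => wt q l (liftH Z ε Y) *
      (-(∑ i, pd i (graphFun Z ε) (liftH Z ε Y)
        * current (gUp G ε (liftH Z ε Y)) 1 1 (fun j => pd j φ (liftH Z ε Y)) i)
        + (1 * normalCoeff (gUp G ε (liftH Z ε Y)) (fun i => pd i (graphFun Z ε) (liftH Z ε Y)) + 1)
          * φ (liftH Z ε Y) ^ 2) * volDensity G ε (liftH Z ε Y)) (tanCell T) := by
    refine hS.integrableOn_liftH (ε := ε) (F := fun X => wt q l X *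
      (-(∑ i, pd i (graphFun Z ε) X * current (gUp G ε X) 1 1 (fun j => pd j φ X) i)
        + (1 * normalCoeff (gUp G ε X) (fun i => pd i (graphFun Z ε) X) + 1) * φ X ^ 2)
          * volDensity G ε X) fun X hX => ?_
    have hs := hS.cone.underc_slab hX
    have hg : ∀ i, ContinuousAt (pd i (graphFun Z ε)) X := fun i =>
      continuousAt_pd ((hS.cone.smooth ε X hX.1).of_le (by norm_num)) i
    have hN : ∀ i j, ContinuousAt (fun X => gUp G ε X i j) X := fun i j =>
      (hS.contDiffAt_gUp_two hs i j).continuousAt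
    have hn : ContinuousAt (fun X => normalCoeff (gUp G ε X) fun i => pd i (graphFun Z ε) X) X := by
      unfold normalCoeff
      exact (((hg 0).sub (continuousAt_const.mul (hN 1 1))).add ((hN 1 2).mul (hg 2))).add
        ((hN 1 3).mul (hg 3))
    exact ((contDiff_wt q l).continuous.continuousAt.mul
      ((ContinuousAt.neg (tendsto_finsetSum _ fun i _ =>
        ((hg i).mul (hS.contDiffAt_current hs (hφ X hX) 1 1 i).continuousAt))).add
        (((continuousAt_const.mul hn).add continuousAt_const).mul
          ((hφ X hX).continuousAt.pow 2)))).mul (hS.contDiffAt_volDensity_two hs).continuousAt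
  refine hc.congr_fun (fun Y hY => ?_) (measurableSet_tanCell T)
  have hY' := tanCell_subset_tanCellc T hY
  beta_reduce
  rw [hS.ads.energyH_eq_flux (hS.cone.underc_slab (hS.liftH_mem hY'))
    (hS.differentiableAt_graphFun hY') (hS.cone.null ε _ hY'.1 (graphFun_liftH Z ε Y))]

end

/-! ### The basic estimate -/

section

variable {Λ lam A T R : ℝ} {k : ℕ} {G : BondiData} {Z : ℝ → S2 → ℝ}
  (hS : IsSetting Λ lam A T R k G Z)
include hS

theorem IsSetting.intM2_congr {F F' : Bool → Coord → ℝ}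
    (h : ∀ ε, ∀ X ∈ under T (pullI Z ε), F ε X = F' ε X) :
    intM2 G T R Z F = intM2 G T R Z F' := by
  rw [hS.cone.intM2_eq, hS.cone.intM2_eq]
  refine Finset.sum_congr rfl fun ε _ => ?_
  exact setIntegral_congr_fun (hS.cone.isGraph ε).measurableSet_under
    fun X hX => by simp only [h ε X hX]

theorem IsSetting.integrableOn_volDensity {ε : Bool} {F : Coord → ℝ}
    (hF : ∀ X ∈ underc T (pullI Z ε), ContinuousAt F X) :
    IntegrableOn (fun X => F X * volDensity G ε X) (under T (pullI Z ε)) :=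
  (hS.cone.isGraph ε).integrableOn_under fun X hX =>
    (hF X hX).mul (hS.contDiffAt_volDensity_two (hS.cone.underc_slab hX)).continuousAt

theorem IsSetting.integrableOn_liftI_volDensity {ε : Bool} {F : Coord → ℝ}
    (hF : ∀ X ∈ underc T (pullI Z ε), ContinuousAt F X) :
    IntegrableOn (fun Y => F (liftI Y) * volDensity G ε (liftI Y)) (tanCell T) :=
  hS.integrableOn_liftI (ε := ε) (F := fun X => F X * volDensity G ε X) fun X hX =>
    (hF X hX).mul (hS.contDiffAt_volDensity_two (hS.cone.underc_slab hX)).continuousAt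

theorem IsSetting.energyH_nonneg {ε : Bool} {Y : Fin 3 → ℝ} (hY : Y ∈ tanCellc T)
    (φ : Coord → ℝ) : 0 ≤ energyH G Z ε φ 1 1 (liftH Z ε Y) := by
  obtain ⟨α, β, γ, l₃, l₄, -, -, -, -, -, hl, hE⟩ :=
    hS.ads.energyH_explicit (hS.cone.underc_slab (hS.liftH_mem hY))
      (hS.differentiableAt_graphFun hY) (hS.cone.null ε _ hY.1 (graphFun_liftH Z ε Y))
  rw [hE, hl]
  positivity

theorem IsSetting.intM2_nonneg {F : Bool → Coord → ℝ}
    (h : ∀ ε, ∀ X ∈ under T (pullI Z ε), 0 ≤ F ε X) : 0 ≤ intM2 G T R Z F := by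
  rw [hS.cone.intM2_eq]
  exact Finset.sum_nonneg fun ε _ => setIntegral_nonneg (hS.cone.isGraph ε).measurableSet_under
    fun X hX => mul_nonneg (h ε X hX) (hS.ads.volDensity_pos (hS.slab_of_under hX)).le

theorem IsSetting.intI_nonneg {F : Bool → Coord → ℝ}
    (h : ∀ ε, ∀ Y ∈ tanCell T, 0 ≤ F ε (liftI Y)) : 0 ≤ intI G T F :=
  Finset.sum_nonneg fun ε _ => setIntegral_nonneg (measurableSet_tanCell T)
    fun Y hY => mul_nonneg (h ε Y hY) (hS.ads.volDensity_pos (hS.cone.underc_slab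
      (hS.liftI_mem (ε := ε) (tanCell_subset_tanCellc T hY)))).le

theorem IsSetting.intH_nonneg {F : Bool → Coord → ℝ}
    (h : ∀ ε, ∀ Y ∈ tanCell T, 0 ≤ F ε (liftH Z ε Y)) : 0 ≤ intH G T Z F :=
  Finset.sum_nonneg fun ε _ => setIntegral_nonneg (measurableSet_tanCell T)
    fun Y hY => mul_nonneg (h ε Y hY) (hS.ads.volDensity_pos (hS.cone.underc_slab
      (hS.liftH_mem (ε := ε) (tanCell_subset_tanCellc T hY)))).le

/-- The component J⁰ is minus a sum of squares, and the correction term has no τ-component. -/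
theorem IsSetting.weightedCurrent_zero_nonpos {ε : Bool} {X : Coord}
    (hX : X ∈ underc T (pullI Z ε)) {b : ℝ} (hb : 0 ≤ b) (q l : ℝ) (φ : Coord → ℝ) :
    weightedCurrent G q l b ε φ 0 X ≤ 0 := by
  have hs := hS.cone.underc_slab hX
  have hμ := hS.ads.volDensity_pos hs
  have hw := wt_pos q l X
  have hN := hS.ads.isBondiInv hs
  unfold weightedCurrent
  rw [if_neg (by decide), add_zero, hN.current_zero]
  have h1 := hN.angular_nonneg (pd 2 φ X) (pd 3 φ X)
  have h2 : 0 ≤ b * pd 1 φ X ^ 2 := by positivity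
  exact mul_nonpos_of_nonneg_of_nonpos (by positivity) (by linarith)

theorem IsSetting.weightedCurrent_circle {X : Coord} (hX : X ∈ under T (pullI Z true))
    (hr : X 2 ^ 2 + X 3 ^ 2 = 1) {φ : Bool → Coord → ℝ} (hφ : Compat φ)
    (hd : ∀ X ∈ underc T (pullI Z true), ContDiffAt ℝ 2 (φ true) X) (q l b : ℝ) :
    X 2 * weightedCurrent G q l b true (φ true) 2 X + X 3 * weightedCurrent G q l b true (φ true) 3 X
      + (X 2 * weightedCurrent G q l b false (φ false) 2 X
        + X 3 * weightedCurrent G q l b false (φ false) 3 X) = 0 := by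
  obtain ⟨h1, h2⟩ := hS.ads.current_circle (hS.slab_of_under hX) hr hφ
    ((hd X (under_subset_underc _ _ hX)).differentiableAt (by norm_num)) b 1
  unfold weightedCurrent
  rw [if_neg (by decide), if_neg (by decide), if_neg (by decide), if_neg (by decide), ← h2]
  linear_combination (volDensity G true X * wt q l X) * h1

end

/-- The constants are fixed before T, R and all functions. On 𝓘 the full gradient is bounded by its
tangential part, because the flux there controls the transversal derivative. -/
theorem basic_estimate (Λ lam A B D : ℝ) (hΛ : Λ < 0) (hlam : 0 < lam) :
    ∃ M q₀ : ℝ, 0 < M ∧ 0 < q₀ ∧ ∀ (T R : ℝ) (k : ℕ) (G : BondiData) (Z : ℝ → S2 → ℝ),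
      IsSetting Λ lam A T R k G Z →
      ∀ (a : Bool → Coord → Fin 4 → ℝ) (ω : Bool → Coord → ℝ),
        (∀ ε, ∀ X ∈ underc T (pullI Z ε), ∀ i, ContinuousAt (fun Y => a ε Y i) X) →
        (∀ ε, ∀ X ∈ underc T (pullI Z ε), ContinuousAt (ω ε) X) →
        (∀ ε, ∀ X ∈ under T (pullI Z ε), ∀ i, |a ε X i| ≤ B) →
        (∀ ε, ∀ X ∈ under T (pullI Z ε), |ω ε X| ≤ D) →
        ∀ φ : Bool → Coord → ℝ, Compat φ →
        (∀ ε, ∀ X ∈ underc T (pullI Z ε), ContDiffAt ℝ 2 (φ ε) X) →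
        ∀ F : Bool → Coord → ℝ, (∀ ε, ∀ X ∈ under T (pullI Z ε),
          F ε X = box G ε (φ ε) X + (∑ i, a ε X i * pd i (φ ε) X) + ω ε X * φ ε X) →
        ∀ q : ℝ, q₀ ≤ q →
        q * intM2 G T R Z (fun ε X => wt q (|A| + 1) X
            * ((∑ i, pd i (φ ε) X ^ 2) + φ ε X ^ 2))
          + intI G T (fun ε X => wt q (|A| + 1) X * ∑ i, pd i (φ ε) X ^ 2)
        ≤ M * (intH G T Z (fun ε X => wt q (|A| + 1) X * energyH G Z ε (φ ε) 1 1 X)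
          + intI G T (fun ε X => wt q (|A| + 1) X
            * (pd 0 (φ ε) X ^ 2 + pd 2 (φ ε) X ^ 2 + pd 3 (φ ε) X ^ 2))
          + intM2 G T R Z (fun ε X => wt q (|A| + 1) X * F ε X ^ 2)) := by
  -- A quarter of the boundary value -Λ/3 of W. Any positive b below W/2 leaves a positive
  -- coefficient of (∂_zφ)² in the flux at infinity.
  set b := -Λ / 12 with hbdef
  have hb : 0 < b := by rw [hbdef]; linarith
  set c := coerConst lam A b with hc
  set E := errConst lam A B D b with hE
  have hc0 : 0 < c := by rw [hc, coerConst]; positivity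
  set α := min (1 / (2 * c)) (Λ ^ 2 / 144) with hα
  have hα0 : 0 < α := lt_min (by positivity) (by have := sq_pos_of_neg hΛ; positivity)
  set M₁ := 4 + 2 * b with hM₁
  -- The summand 1 in the first constant pays for the tangential part of the gradient on 𝓘. The
  -- second constant ensures that half of q / c outweighs the error constant.
  refine ⟨M₁ / α + 1, |2 * c * E| + 1, by positivity, by positivity, ?_⟩
  intro T R k G Z hS a ω hac hωc ha hω φ hφ hφ2 F hF q hq
  set l := |A| + 1 with hl
  have hq0 : 0 ≤ q := le_trans (by positivity) hq
  have hqc : q / (2 * c) ≤ q / c - E := by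
    have h1 : 2 * c * E ≤ q := (le_abs_self _).trans (by linarith)
    have h2 : E ≤ q / (2 * c) := by rw [le_div_iff₀ (by positivity)]; linarith
    have h3 : q / c = q / (2 * c) + q / (2 * c) := by field_simp; ring
    linarith
  have hw : ∀ X, ContinuousAt (wt q l) X := fun X => (contDiff_wt q l).continuous.continuousAt
  have hpc : ∀ ε i, ∀ X ∈ underc T (pullI Z ε), ContinuousAt (pd i (φ ε)) X := fun ε i X hX =>
    continuousAt_pd ((hφ2 ε X hX).of_le (by norm_num)) i
  have hφc : ∀ ε, ∀ X ∈ underc T (pullI Z ε), ContinuousAt (φ ε) X := fun ε X hX =>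
    (hφ2 ε X hX).continuousAt
  -- The source is known only in the open region. Its expression through φ is continuous up to the
  -- boundary and therefore integrable.
  rw [hS.intM2_congr (F := fun ε X => wt q l X * F ε X ^ 2) (F' := fun ε X => wt q l X
    * (box G ε (φ ε) X + (∑ i, a ε X i * pd i (φ ε) X) + ω ε X * φ ε X) ^ 2)
    (fun ε X hX => by simp only [hF ε X hX])]
  have hFc : ∀ ε, ∀ X ∈ underc T (pullI Z ε), ContinuousAt (fun X => wt q l X
      * (box G ε (φ ε) X + (∑ i, a ε X i * pd i (φ ε) X) + ω ε X * φ ε X) ^ 2) X :=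
    fun ε X hX => (hw X).mul ((((hS.continuousAt_box hX (hφ2 ε X hX)).add
      (tendsto_finsetSum _ fun i _ => (hac ε X hX i).mul (hpc ε i X hX))).add
        ((hωc ε X hX).mul (hφc ε X hX))).pow 2)
  have hPc : ∀ ε, ∀ X ∈ underc T (pullI Z ε), ContinuousAt (fun X => wt q l X
      * ((∑ i, pd i (φ ε) X ^ 2) + φ ε X ^ 2)) X :=
    fun ε X hX => (hw X).mul ((tendsto_finsetSum _ fun i _ => (hpc ε i X hX).pow 2).add
      ((hφc ε X hX).pow 2))
  have h1c : ∀ ε, ∀ X ∈ underc T (pullI Z ε), ContinuousAt (fun X => wt q l X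
      * pd 1 (φ ε) X ^ 2) X := fun ε X hX => (hw X).mul ((hpc ε 1 X hX).pow 2)
  have h3c : ∀ ε, ∀ X ∈ underc T (pullI Z ε), ContinuousAt (fun X => wt q l X
      * (pd 0 (φ ε) X ^ 2 + pd 2 (φ ε) X ^ 2 + pd 3 (φ ε) X ^ 2)) X := fun ε X hX =>
    (hw X).mul ((((hpc ε 0 X hX).pow 2).add ((hpc ε 2 X hX).pow 2)).add ((hpc ε 3 X hX).pow 2))
  have hJ1 : ∀ ε i, ∀ X ∈ underc T (pullI Z ε),
      ContDiffAt ℝ 1 (weightedCurrent G q l b ε (φ ε) i) X := fun ε i X hX =>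
    hS.contDiffAt_weightedCurrent (hS.cone.underc_slab hX) (hφ2 ε X hX) q l b i
  have hdiv := sum_integral_div_le hS.T_pos.le (fun ε => hS.cone.isGraph ε)
    (J := fun ε i => weightedCurrent G q l b ε (φ ε) i) hJ1
    (fun ε X hX => hS.weightedCurrent_zero_nonpos hX hb.le q l (φ ε))
    (fun X hX => (compat_pull fun p => Z p.1 p.2.2).eq_on_circle hX)
    (fun X hX hr => hS.weightedCurrent_circle hX hr hφ (hφ2 true) q l b)
  have hleft : ∀ ε, (q / c - E) * (∫ X in under T (pullI Z ε), wt q l X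
        * ((∑ i, pd i (φ ε) X ^ 2) + φ ε X ^ 2) * volDensity G ε X)
      - (∫ X in under T (pullI Z ε), wt q l X * (box G ε (φ ε) X + (∑ i, a ε X i * pd i (φ ε) X)
        + ω ε X * φ ε X) ^ 2 * volDensity G ε X)
      ≤ ∫ X in under T (pullI Z ε), ∑ i, pd i (weightedCurrent G q l b ε (φ ε) i) X := by
    intro ε
    have i1 := hS.integrableOn_volDensity (hPc ε)
    have i2 := hS.integrableOn_volDensity (hFc ε)
    rw [← integral_const_mul, ← integral_sub (i1.const_mul _) i2]
    refine setIntegral_mono_on ((i1.const_mul _).sub i2) ?_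
      (hS.cone.isGraph ε).measurableSet_under fun X hX => ?_
    · exact (hS.cone.isGraph ε).integrableOn_under fun X hX =>
        tendsto_finsetSum _ fun i _ => continuousAt_pd (hJ1 ε i X hX) i
    · have := hS.div_weightedCurrent_ge hX (hφ2 ε X (under_subset_underc _ _ hX)) hb
        (by rw [hl]; linarith [le_abs_self A] : A + 1 ≤ l) hq0 (ha ε X hX) (hω ε X hX)
      refine le_trans (le_of_eq ?_) this
      ring
  have hright : ∀ ε, ∫ Y in tanCell T,
        ((weightedCurrent G q l b ε (φ ε) 1 (liftH Z ε Y)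
          - (pd 0 (pullI Z ε) (liftI Y) * weightedCurrent G q l b ε (φ ε) 0 (liftH Z ε Y)
            + pd 2 (pullI Z ε) (liftI Y) * weightedCurrent G q l b ε (φ ε) 2 (liftH Z ε Y)
            + pd 3 (pullI Z ε) (liftI Y) * weightedCurrent G q l b ε (φ ε) 3 (liftH Z ε Y)))
          - weightedCurrent G q l b ε (φ ε) 1 (liftI Y))
      ≤ (1 + b) * (∫ Y in tanCell T, wt q l (liftH Z ε Y) * energyH G Z ε (φ ε) 1 1 (liftH Z ε Y)
          * volDensity G ε (liftH Z ε Y))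
        - (Λ ^ 2 / 144 * (∫ Y in tanCell T, wt q l (liftI Y) * pd 1 (φ ε) (liftI Y) ^ 2
            * volDensity G ε (liftI Y))
          - (3 - Λ / 24) * ∫ Y in tanCell T, wt q l (liftI Y) * (pd 0 (φ ε) (liftI Y) ^ 2
            + pd 2 (φ ε) (liftI Y) ^ 2 + pd 3 (φ ε) (liftI Y) ^ 2) * volDensity G ε (liftI Y)) := by
    intro ε
    have i1 := hS.integrableOn_energyH (hφ2 ε) q l
    have i2 := hS.integrableOn_liftI_volDensity (h1c ε)
    have i3 := hS.integrableOn_liftI_volDensity (h3c ε)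
    have i4 : IntegrableOn (fun Y => Λ ^ 2 / 144 * (wt q l (liftI Y) * pd 1 (φ ε) (liftI Y) ^ 2
        * volDensity G ε (liftI Y)) - (3 - Λ / 24) * (wt q l (liftI Y) * (pd 0 (φ ε) (liftI Y) ^ 2
          + pd 2 (φ ε) (liftI Y) ^ 2 + pd 3 (φ ε) (liftI Y) ^ 2) * volDensity G ε (liftI Y)))
        (tanCell T) := (i2.const_mul _).sub (i3.const_mul _)
    rw [← integral_const_mul, ← integral_const_mul, ← integral_const_mul,
      ← integral_sub (i2.const_mul _) (i3.const_mul _),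
      ← integral_sub (i1.const_mul _) i4]
    refine setIntegral_mono_on ?_ ((i1.const_mul _).sub i4)
      (measurableSet_tanCell T) fun Y hY => ?_
    · have c1 : ∀ i, IntegrableOn (fun Y => weightedCurrent G q l b ε (φ ε) i (liftI Y))
          (tanCell T) := fun i =>
        hS.integrableOn_liftI (ε := ε) fun X hX => (hJ1 ε i X hX).continuousAt
      have c2 : ∀ i, IntegrableOn (fun Y => weightedCurrent G q l b ε (φ ε) i (liftH Z ε Y))
          (tanCell T) := fun i =>
        hS.integrableOn_liftH (ε := ε) fun X hX => (hJ1 ε i X hX).continuousAt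
      have c3 : ∀ i, IntegrableOn (fun Y => pd i (pullI Z ε) (liftI Y)
          * weightedCurrent G q l b ε (φ ε) i (liftH Z ε Y)) (tanCell T) := fun i => by
        refine integrableOn_tanCell fun Y hY => ContinuousAt.mul ?_ ?_
        · exact ContinuousAt.comp (f := liftI) (continuousAt_pd
            (((hS.cone.isGraph ε).smooth (liftI Y) hY.1).of_le (by norm_num)) i)
            continuous_liftI.continuousAt
        · exact ContinuousAt.comp (f := liftH Z ε) (hJ1 ε i _ (hS.liftH_mem hY)).continuousAt
            (hS.continuousAt_liftH hY)
      exact ((c2 1).sub (((c3 0).add (c3 2)).add (c3 3))).sub (c1 1)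
    · have hY' := tanCell_subset_tanCellc T hY
      exact sub_le_sub (hS.flux_le hY' hb.le q l (φ ε)) (hS.flux_infty_ge hY' q l (φ ε))
  have hI : ∀ ε, ∫ Y in tanCell T, wt q l (liftI Y) * (∑ i, pd i (φ ε) (liftI Y) ^ 2)
        * volDensity G ε (liftI Y)
      = (∫ Y in tanCell T, wt q l (liftI Y) * pd 1 (φ ε) (liftI Y) ^ 2 * volDensity G ε (liftI Y))
        + ∫ Y in tanCell T, wt q l (liftI Y) * (pd 0 (φ ε) (liftI Y) ^ 2
            + pd 2 (φ ε) (liftI Y) ^ 2 + pd 3 (φ ε) (liftI Y) ^ 2) * volDensity G ε (liftI Y) := by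
    intro ε
    rw [← integral_add (hS.integrableOn_liftI_volDensity (h1c ε))
      (hS.integrableOn_liftI_volDensity (h3c ε))]
    refine integral_congr_ae (Eventually.of_forall fun Y => ?_)
    simp only [Fin.sum_univ_four]; ring
  have e1 := hS.cone.intM2_eq fun ε X => wt q l X * ((∑ i, pd i (φ ε) X ^ 2) + φ ε X ^ 2)
  have e2 := hS.cone.intM2_eq fun ε X => wt q l X
      * (box G ε (φ ε) X + (∑ i, a ε X i * pd i (φ ε) X) + ω ε X * φ ε X) ^ 2
  have e3 : intI G T (fun ε X => wt q l X * ∑ i, pd i (φ ε) X ^ 2)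
      = intI G T (fun ε X => wt q l X * pd 1 (φ ε) X ^ 2)
        + intI G T (fun ε X => wt q l X
          * (pd 0 (φ ε) X ^ 2 + pd 2 (φ ε) X ^ 2 + pd 3 (φ ε) X ^ 2)) :=
    (Finset.sum_congr rfl fun ε _ => hI ε).trans Finset.sum_add_distrib
  have n1 : 0 ≤ intM2 G T R Z fun ε X => wt q l X * ((∑ i, pd i (φ ε) X ^ 2) + φ ε X ^ 2) :=
    hS.intM2_nonneg fun ε X _ => mul_nonneg (wt_pos q l X).le (add_nonneg
        (Finset.sum_nonneg fun i _ => sq_nonneg _) (sq_nonneg _))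
  have n2 : 0 ≤ intM2 G T R Z fun ε X => wt q l X
      * (box G ε (φ ε) X + (∑ i, a ε X i * pd i (φ ε) X) + ω ε X * φ ε X) ^ 2 :=
    hS.intM2_nonneg fun ε X _ => mul_nonneg (wt_pos q l X).le (sq_nonneg _)
  have n3 : 0 ≤ intI G T fun ε X => wt q l X * pd 1 (φ ε) X ^ 2 :=
    hS.intI_nonneg fun ε Y _ => mul_nonneg (wt_pos q l _).le (sq_nonneg _)
  have n4 : 0 ≤ intI G T fun ε X => wt q l X
      * (pd 0 (φ ε) X ^ 2 + pd 2 (φ ε) X ^ 2 + pd 3 (φ ε) X ^ 2) :=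
    hS.intI_nonneg fun ε Y _ => mul_nonneg (wt_pos q l _).le (by positivity)
  have n5 : 0 ≤ intH G T Z fun ε X => wt q l X * energyH G Z ε (φ ε) 1 1 X :=
    hS.intH_nonneg fun ε Y hY => mul_nonneg (wt_pos q l _).le
      (hS.energyH_nonneg (tanCell_subset_tanCellc T hY) (φ ε))
  have main := (Finset.sum_le_sum fun ε _ => hleft ε).trans
    (hdiv.trans (Finset.sum_le_sum fun ε (_ : ε ∈ Finset.univ) => hright ε))
  simp only [Finset.sum_sub_distrib, ← Finset.mul_sum] at main
  rw [← e1, ← e2] at main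
  rw [e3]
  change (q / c - E) * _ - _ ≤ (1 + b) * intH G T Z (fun ε X => wt q l X
    * energyH G Z ε (φ ε) 1 1 X) - (Λ ^ 2 / 144 * intI G T (fun ε X => wt q l X
      * pd 1 (φ ε) X ^ 2) - (3 - Λ / 24) * intI G T (fun ε X => wt q l X
      * (pd 0 (φ ε) X ^ 2 + pd 2 (φ ε) X ^ 2 + pd 3 (φ ε) X ^ 2))) at main
  set I₁ := intM2 G T R Z fun ε X => wt q l X * ((∑ i, pd i (φ ε) X ^ 2) + φ ε X ^ 2)
  set I₂ := intM2 G T R Z fun ε X => wt q l X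
      * (box G ε (φ ε) X + (∑ i, a ε X i * pd i (φ ε) X) + ω ε X * φ ε X) ^ 2
  set J₁ := intI G T fun ε X => wt q l X * pd 1 (φ ε) X ^ 2
  set J₂ := intI G T fun ε X => wt q l X
      * (pd 0 (φ ε) X ^ 2 + pd 2 (φ ε) X ^ 2 + pd 3 (φ ε) X ^ 2)
  set H := intH G T Z fun ε X => wt q l X * energyH G Z ε (φ ε) 1 1 X
  clear_value I₁ I₂ J₁ J₂ H
  have b1 := mul_le_mul_of_nonneg_right hqc n1
  have b2 : α * (q * I₁) ≤ q / (2 * c) * I₁ := by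
    have := mul_le_mul_of_nonneg_right (min_le_left (1 / (2 * c)) (Λ ^ 2 / 144))
      (mul_nonneg hq0 n1)
    calc α * (q * I₁) ≤ 1 / (2 * c) * (q * I₁) := this
      _ = _ := by ring
  have b3 : α * J₁ ≤ Λ ^ 2 / 144 * J₁ := mul_le_mul_of_nonneg_right (min_le_right _ _) n3
  have b4 : -Λ / 24 * J₂ = b / 2 * J₂ := by rw [hbdef]; ring
  have p1 : 0 ≤ b * I₂ := by positivity
  have p2 : 0 ≤ b * J₂ := by positivity
  have p3 : 0 ≤ b * H := by positivity
  -- The coefficients on the right are 1 + b, 3 + b/2 and 1, all at most M₁ = 4 + 2b.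
  have key : α * (q * I₁ + J₁) ≤ M₁ * (H + J₂ + I₂) := by
    rw [hM₁]
    linarith
  have key2 : q * I₁ + J₁ ≤ M₁ / α * (H + J₂ + I₂) := by
    rw [div_mul_eq_mul_div, le_div_iff₀ hα0]; linarith
  linarith

/-! ### Iterated coordinate derivatives -/

/-- `u` is of class `C^n` at all points of `O`. -/
def CDOn (O : Set Coord) (n : ℕ) (u : Coord → ℝ) : Prop := ∀ X ∈ O, ContDiffAt ℝ n u X

/-- The iterated coordinate derivative along a word. -/
def pdl (l : List (Fin 4)) (u : Coord → ℝ) : Coord → ℝ := l.foldr pd u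

theorem pdl_append (l l' : List (Fin 4)) (u : Coord → ℝ) : pdl (l ++ l') u = pdl l (pdl l' u) :=
  List.foldr_append

/-- The words of length `n`. -/
def words (κ : Type) [Fintype κ] [DecidableEq κ] (n : ℕ) : Finset (List κ) :=
  (Finset.univ : Finset (Fin n → κ)).image List.ofFn

theorem mem_words {κ : Type} [Fintype κ] [DecidableEq κ] {n : ℕ} {l : List κ} :
    l ∈ words κ n ↔ l.length = n := by
  unfold words
  constructor
  · intro h
    obtain ⟨f, -, rfl⟩ := Finset.mem_image.1 h
    simp
  · rintro rfl
    exact Finset.mem_image.2 ⟨l.get, Finset.mem_univ _, List.ofFn_get l⟩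

section

variable {O B : Set Coord}

theorem CDOn.mono {n m : ℕ} {u : Coord → ℝ} (h : CDOn O n u) (hm : m ≤ n) : CDOn O m u :=
  fun X hX => (h X hX).of_le (by exact_mod_cast hm)

theorem CDOn.pd {n : ℕ} {u : Coord → ℝ} (h : CDOn O (n + 1) u) (i : Fin 4) :
    CDOn O n (pd i u) := fun X hX => contDiffAt_pd (h X hX) i

theorem CDOn.pdl {n : ℕ} {u : Coord → ℝ} (l : List (Fin 4)) (h : CDOn O (n + l.length) u) :
    CDOn O n (pdl l u) := by
  induction l generalizing n with
  | nil => exact h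
  | cons i l ih =>
    exact CDOn.pd (ih (n := n + 1) (h.mono (by simp; omega))) i

theorem CDOn.differentiableAt {n : ℕ} {u : Coord → ℝ} (h : CDOn O (n + 1) u) {X : Coord}
    (hX : X ∈ O) : DifferentiableAt ℝ u X :=
  (h X hX).differentiableAt (by simp)

theorem CDOn.add {n : ℕ} {u v : Coord → ℝ} (hu : CDOn O n u) (hv : CDOn O n v) :
    CDOn O n fun X => u X + v X := fun X hX => (hu X hX).add (hv X hX)

theorem CDOn.mul {n : ℕ} {u v : Coord → ℝ} (hu : CDOn O n u) (hv : CDOn O n v) :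
    CDOn O n fun X => u X * v X := fun X hX => (hu X hX).mul (hv X hX)

theorem CDOn.sum {ι : Type*} {s : Finset ι} {n : ℕ} {u : ι → Coord → ℝ}
    (hu : ∀ a ∈ s, CDOn O n (u a)) : CDOn O n fun X => ∑ a ∈ s, u a X := fun X hX =>
  ContDiffAt.sum fun a ha => hu a ha X hX

theorem eventuallyEq_of_isOpen (hO : IsOpen O) {u v : Coord → ℝ} (h : ∀ X ∈ O, u X = v X)
    {X : Coord} (hX : X ∈ O) : u =ᶠ[𝓝 X] v := by
  filter_upwards [hO.mem_nhds hX] with Y hY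
  exact h Y hY

theorem CDOn.congr (hO : IsOpen O) {n : ℕ} {u v : Coord → ℝ} (hu : CDOn O n u)
    (h : ∀ X ∈ O, v X = u X) : CDOn O n v := fun X hX =>
  (hu X hX).congr_of_eventuallyEq (eventuallyEq_of_isOpen hO h hX)

theorem pd_eq_of_isOpen (hO : IsOpen O) {u v : Coord → ℝ} (h : ∀ X ∈ O, u X = v X) (i : Fin 4) :
    ∀ X ∈ O, pd i u X = pd i v X := fun _ hX => pd_congr (eventuallyEq_of_isOpen hO h hX) i

theorem pdl_eq_of_isOpen (hO : IsOpen O) {u v : Coord → ℝ} (h : ∀ X ∈ O, u X = v X)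
    (l : List (Fin 4)) : ∀ X ∈ O, pdl l u X = pdl l v X := by
  induction l with
  | nil => exact h
  | cons i l ih => exact pd_eq_of_isOpen hO ih i

/-- Symmetry of second derivatives, applied to adjacent letters. The set has to be open because the
equalities are differentiated further. -/
theorem pdl_perm (hO : IsOpen O) {u : Coord → ℝ} {l l' : List (Fin 4)} (h : l.Perm l')
    (hu : CDOn O l.length u) : ∀ X ∈ O, pdl l u X = pdl l' u X := by
  induction h with
  | nil => exact fun _ _ => rfl
  | cons i h ih => exact pd_eq_of_isOpen hO (ih (hu.mono (by simp))) i
  | swap i j l =>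
    intro X hX
    have h2 : CDOn O 2 (pdl l u) := CDOn.pdl l (hu.mono (by simp; omega))
    exact pd_comm (h2 X hX) j i
  | trans h1 h2 ih1 ih2 =>
    intro X hX
    rw [ih1 hu X hX, ih2 (by rwa [← h1.length_eq]) X hX]

/-- The word that belongs to a multi-index. -/
def wordOf (α : Fin 4 → ℕ) : List (Fin 4) :=
  List.replicate (α 0) 0 ++ (List.replicate (α 1) 1 ++ (List.replicate (α 2) 2
    ++ List.replicate (α 3) 3))

theorem pdl_replicate (n : ℕ) (i : Fin 4) (u : Coord → ℝ) :
    pdl (List.replicate n i) u = (pd i)^[n] u := by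
  induction n with
  | zero => rfl
  | succ n ih =>
    rw [Function.iterate_succ_apply', ← ih]; rfl

theorem mpd_eq_pdl (α : Fin 4 → ℕ) (u : Coord → ℝ) : mpd α u = pdl (wordOf α) u := by
  simp only [mpd, wordOf, pdl_append, pdl_replicate]

theorem mem_multi {α : Fin 4 → ℕ} {n : ℕ} : α ∈ multi n ↔ α 0 + α 1 + α 2 + α 3 = n := by
  simp [multi, Fin.sum_univ_four]

theorem length_wordOf (α : Fin 4 → ℕ) : (wordOf α).length = α 0 + α 1 + α 2 + α 3 := by
  simp [wordOf]; ring

theorem count_wordOf (α : Fin 4 → ℕ) (i : Fin 4) : (wordOf α).count i = α i := by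
  fin_cases i <;> simp [wordOf, List.count_replicate]

theorem perm_wordOf (l : List (Fin 4)) : l.Perm (wordOf fun i => l.count i) := by
  rw [List.perm_iff_count]
  intro i
  rw [count_wordOf]

theorem count_mem_multi (l : List (Fin 4)) : (fun i => l.count i) ∈ multi l.length := by
  rw [mem_multi]
  exact (length_wordOf fun i => l.count i).symm.trans (perm_wordOf l).length_eq.symm

/-- Words are suited to induction on the order. Sorting the letters leads back to the multi-indices
in which norms and hypotheses are formulated. -/
theorem pdl_eq_mpd (hO : IsOpen O) {u : Coord → ℝ} {l : List (Fin 4)} (hu : CDOn O l.length u) :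
    ∀ X ∈ O, pdl l u X = mpd (fun i => l.count i) u X := by
  rw [mpd_eq_pdl]
  exact pdl_perm hO (perm_wordOf l) hu

/-! ### Bounds for coefficients -/

/-- The derivatives of `c` up to order `r` exist on `O` and are bounded by `K` on `B`. -/
def CB (O B : Set Coord) : ℕ → ℝ → (Coord → ℝ) → Prop
  | 0, K, c => ∀ X ∈ B, |c X| ≤ K
  | r + 1, K, c => (∀ X ∈ B, |c X| ≤ K) ∧ (∀ X ∈ O, DifferentiableAt ℝ c X) ∧
      ∀ i, CB O B r K (pd i c)

theorem CB.bound {r : ℕ} {K : ℝ} {c : Coord → ℝ} (h : CB O B r K c) : ∀ X ∈ B, |c X| ≤ K := by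
  cases r with
  | zero => exact h
  | succ r => exact h.1

theorem CB.mono {r : ℕ} {K K' : ℝ} {c : Coord → ℝ} (h : CB O B r K c) (hK : K ≤ K') :
    CB O B r K' c := by
  induction r generalizing c with
  | zero => exact fun X hX => (h X hX).trans hK
  | succ r ih => exact ⟨fun X hX => (h.1 X hX).trans hK, h.2.1, fun i => ih (h.2.2 i)⟩

theorem CB.of_succ {r : ℕ} {K : ℝ} {c : Coord → ℝ} (h : CB O B (r + 1) K c) : CB O B r K c := by
  induction r generalizing c with
  | zero => exact h.1
  | succ r ih => exact ⟨h.1, h.2.1, fun i => ih (h.2.2 i)⟩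

theorem CB.of_le {r s : ℕ} {K : ℝ} {c : Coord → ℝ} (h : CB O B r K c) (hs : s ≤ r) :
    CB O B s K c := by
  induction r with
  | zero => rwa [Nat.le_zero.1 hs]
  | succ r ih =>
    rcases Nat.lt_or_ge r s with h1 | h1
    · rwa [le_antisymm hs h1]
    · exact ih h.of_succ h1

theorem CB.congr (hO : IsOpen O) (hB : B ⊆ O) {r : ℕ} {K : ℝ} {c c' : Coord → ℝ}
    (h : CB O B r K c) (he : ∀ X ∈ O, c' X = c X) : CB O B r K c' := by
  induction r generalizing c c' with
  | zero => exact fun X hX => by rw [he X (hB hX)]; exact h X hX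
  | succ r ih =>
    exact ⟨fun X hX => by rw [he X (hB hX)]; exact h.1 X hX,
      fun X hX => (h.2.1 X hX).congr_of_eventuallyEq (eventuallyEq_of_isOpen hO he hX),
      fun i => ih (h.2.2 i) (pd_eq_of_isOpen hO he i)⟩

theorem CB.zero {r : ℕ} : CB O B r 0 fun _ => 0 := by
  induction r with
  | zero => exact fun X _ => by simp
  | succ r ih =>
    refine ⟨fun X _ => by simp, fun X _ => differentiableAt_const _, fun i => ?_⟩
    rw [pd_const]; exact ih

theorem CB.const (r : ℕ) (c : ℝ) : CB O B r |c| fun _ => c := by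
  cases r with
  | zero => exact fun X _ => le_rfl
  | succ r =>
    refine ⟨fun X _ => le_rfl, fun X _ => differentiableAt_const _, fun i => ?_⟩
    rw [pd_const]; exact CB.zero.mono (abs_nonneg c)

theorem CB.add (hO : IsOpen O) (hB : B ⊆ O) {r : ℕ} {K K' : ℝ} {c c' : Coord → ℝ}
    (h : CB O B r K c) (h' : CB O B r K' c') : CB O B r (K + K') fun X => c X + c' X := by
  induction r generalizing c c' with
  | zero => exact fun X hX => (abs_add_le _ _).trans (add_le_add (h X hX) (h' X hX))
  | succ r ih =>
    exact ⟨fun X hX => (abs_add_le _ _).trans (add_le_add (h.1 X hX) (h'.1 X hX)),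
      fun X hX => (h.2.1 X hX).fun_add (h'.2.1 X hX),
      fun i => (ih (h.2.2 i) (h'.2.2 i)).congr hO hB fun X hX =>
        pd_add i (h.2.1 X hX) (h'.2.1 X hX)⟩

/-- The product rule. Every order of differentiation doubles the number of terms, whence the power
of 2. -/
theorem CB.mul (hO : IsOpen O) (hB : B ⊆ O) {r : ℕ} {K K' : ℝ} (hK : 0 ≤ K) (hK' : 0 ≤ K')
    {c c' : Coord → ℝ} (h : CB O B r K c) (h' : CB O B r K' c') :
    CB O B r (2 ^ r * (K * K')) fun X => c X * c' X := by
  have hb : ∀ {r : ℕ} {c c' : Coord → ℝ}, CB O B r K c → CB O B r K' c' →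
      ∀ X ∈ B, |c X * c' X| ≤ 2 ^ r * (K * K') := fun {r c c'} h h' X hX => by
    rw [abs_mul]
    calc |c X| * |c' X| ≤ K * K' := mul_le_mul (h.bound X hX) (h'.bound X hX) (abs_nonneg _) hK
      _ ≤ 2 ^ r * (K * K') := le_mul_of_one_le_left (by positivity) (one_le_pow₀ (by norm_num))
  induction r generalizing c c' with
  | zero => exact hb (r := 0) h h'
  | succ r ih =>
    refine ⟨hb h h', fun X hX => (h.2.1 X hX).fun_mul (h'.2.1 X hX), fun i => ?_⟩
    have := (ih (h.2.2 i) h'.of_succ).add hO hB (ih h.of_succ (h'.2.2 i))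
    refine (this.congr hO hB fun X hX => pd_mul i (h.2.1 X hX) (h'.2.1 X hX)).mono (le_of_eq ?_)
    ring

theorem CB.sum (hO : IsOpen O) (hB : B ⊆ O) {ι : Type*} [DecidableEq ι] (s : Finset ι) {r : ℕ}
    {K : ℝ} {c : ι → Coord → ℝ} (h : ∀ a ∈ s, CB O B r K (c a)) :
    CB O B r (s.card * K) fun X => ∑ a ∈ s, c a X := by
  induction s using Finset.induction_on with
  | empty => simpa using CB.zero
  | insert a s ha ih =>
    simp only [Finset.sum_insert ha, Finset.card_insert_of_notMem ha]
    refine ((h a (Finset.mem_insert_self a s)).add hO hB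
      (ih fun b hb => h b (Finset.mem_insert_of_mem hb))).mono (le_of_eq ?_)
    push_cast; ring

/-- Induction through (1/c)' = -c' (1/c)². Nonvanishing on the open set gives differentiability, and
the lower bound δ is needed on B only. -/
theorem CB.inv (r : ℕ) {K δ : ℝ} (hK : 0 ≤ K) (hδ : 0 < δ) :
    ∃ K', 0 ≤ K' ∧ ∀ O B : Set Coord, IsOpen O → B ⊆ O → ∀ c : Coord → ℝ, CB O B r K c →
      (∀ X ∈ O, c X ≠ 0) → (∀ X ∈ B, δ ≤ c X) → CB O B r K' fun X => (c X)⁻¹ := by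
  have hb : ∀ (B : Set Coord) (c : Coord → ℝ), (∀ X ∈ B, δ ≤ c X) → ∀ X ∈ B, |(c X)⁻¹| ≤ δ⁻¹ :=
    fun B c h X hX => by
      rw [abs_of_pos (inv_pos.2 (hδ.trans_le (h X hX)))]
      exact inv_anti₀ hδ (h X hX)
  induction r with
  | zero => exact ⟨δ⁻¹, by positivity, fun _ B _ _ c _ _ h => hb B c h⟩
  | succ r ih =>
    obtain ⟨K', hK', H⟩ := ih
    refine ⟨δ⁻¹ + 2 ^ r * (|(-1)| * (2 ^ r * (K * (2 ^ r * (K' * K'))))), by positivity, ?_⟩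
    intro O B hO hB c h h0 hd
    have hi := H O B hO hB c h.of_succ h0 hd
    refine ⟨fun X hX => (hb B c hd X hX).trans (le_add_of_nonneg_right (by positivity)),
      fun X hX => (h.2.1 X hX).fun_inv (h0 X hX), fun i => ?_⟩
    have h1 := (h.2.2 i).mul hO hB hK (by positivity) (hi.mul hO hB hK' hK' hi)
    have h2 := (CB.const (O := O) (B := B) r (-1)).mul hO hB (abs_nonneg _) (by positivity) h1
    refine (h2.mono (le_add_of_nonneg_left (by positivity))).congr hO hB fun X hX => ?_
    have hdi : DifferentiableAt ℝ c X := h.2.1 X hX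
    rw [pd_comp (f := fun x => x⁻¹) i (hasDerivAt_inv (h0 X hX)) hdi]
    have := h0 X hX
    field_simp

theorem CB.of_pdl {r : ℕ} {K : ℝ} {c : Coord → ℝ} (hc : CDOn O r c)
    (h : ∀ l : List (Fin 4), l.length ≤ r → ∀ X ∈ B, |pdl l c X| ≤ K) : CB O B r K c := by
  induction r generalizing c with
  | zero => exact h [] le_rfl
  | succ r ih =>
    refine ⟨h [] (Nat.zero_le _), fun X hX => hc.differentiableAt hX, fun i => ih (hc.pd i) ?_⟩
    intro l hl
    have := h (l ++ [i]) (by simpa using hl)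
    rwa [pdl_append] at this

theorem CB.of_mpd (hO : IsOpen O) (hB : B ⊆ O) {r : ℕ} {K : ℝ} {c : Coord → ℝ} (hc : CDOn O r c)
    (h : ∀ X ∈ B, ∀ n ≤ r, ∀ α ∈ multi n, |mpd α c X| ≤ K) : CB O B r K c :=
  CB.of_pdl hc fun l hl X hX => by
    rw [pdl_eq_mpd hO (hc.mono hl) X (hB hX)]
    exact h X hX l.length hl _ (count_mem_multi l)

/-! ### Differential operators -/

/-- `e` is a sum of `N` terms `c ∂^l u`, where `l` has length at most `n`; the derivatives of the
coefficients up to order `r` are bounded by `K`, and the coefficients of the terms of order `n`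
are bounded by `K₀`. -/
inductive Op (O B : Set Coord) (u : Coord → ℝ) (K₀ K : ℝ) (n r : ℕ) : ℕ → (Coord → ℝ) → Prop
  | nil {N : ℕ} {e : Coord → ℝ} : (∀ X ∈ O, e X = 0) → Op O B u K₀ K n r N e
  | cons {N : ℕ} {e e' c : Coord → ℝ} {l : List (Fin 4)} : l.length ≤ n → CB O B r K c →
      (l.length = n → ∀ X ∈ B, |c X| ≤ K₀) → Op O B u K₀ K n r N e' →
      (∀ X ∈ O, e X = c X * pdl l u X + e' X) → Op O B u K₀ K n r (N + 1) e

variable {u : Coord → ℝ} {K₀ K : ℝ} {n r N : ℕ} {e : Coord → ℝ}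

theorem Op.mono {K₀' K' : ℝ} {r' N' : ℕ} (h : Op O B u K₀ K n r N e) (h0 : K₀ ≤ K₀') (hK : K ≤ K')
    (hr : r' ≤ r) (hN : N ≤ N') : Op O B u K₀' K' n r' N' e := by
  induction h generalizing N' with
  | nil h => exact .nil h
  | cons hl hc ht _ he ih =>
    obtain ⟨N'', rfl⟩ : ∃ N'', N' = N'' + 1 := ⟨N' - 1, by omega⟩
    exact .cons hl ((hc.mono hK).of_le hr) (fun h X hX => (ht h X hX).trans h0)
      (ih (by omega)) he

/-- All terms have order below n', so there is no leading term and its bound may be chosen at will.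
-/
theorem Op.of_lt {n' : ℕ} (K₀' : ℝ) (h : Op O B u K₀ K n r N e) (hn : n < n') :
    Op O B u K₀' K n' r N e := by
  induction h with
  | nil h => exact .nil h
  | cons hl hc ht _ he ih =>
    exact .cons (hl.trans hn.le) hc (fun h => absurd h (by omega)) ih he

theorem Op.congr {e' : Coord → ℝ} (h : Op O B u K₀ K n r N e) (he : ∀ X ∈ O, e' X = e X) :
    Op O B u K₀ K n r N e' := by
  cases h with
  | nil h => exact .nil fun X hX => (he X hX).trans (h X hX)
  | cons hl hc ht h h' => exact .cons hl hc ht h fun X hX => (he X hX).trans (h' X hX)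

theorem Op.self : Op O B u 1 1 0 r 1 u :=
  .cons (l := []) (c := fun _ => 1) (e' := fun _ => 0) le_rfl
    ((CB.const r 1).mono (by simp)) (fun _ X _ => by simp) (.nil fun _ _ => rfl)
    fun X _ => by simp [pdl]

theorem Op.add {e' : Coord → ℝ} {N' : ℕ} (h : Op O B u K₀ K n r N e)
    (h' : Op O B u K₀ K n r N' e') : Op O B u K₀ K n r (N + N') fun X => e X + e' X := by
  induction h with
  | nil h =>
    exact (h'.mono le_rfl le_rfl le_rfl (Nat.le_add_left _ _)).congr fun X hX => by
      rw [h X hX, zero_add]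
  | @cons N e e'' c l hl hc ht _ he ih =>
    rw [Nat.add_right_comm]
    exact .cons hl hc ht ih fun X hX => by rw [he X hX, add_assoc]

theorem Op.sum {ι : Type*} [DecidableEq ι] (s : Finset ι) {e : ι → Coord → ℝ}
    (h : ∀ a ∈ s, Op O B u K₀ K n r N (e a)) :
    Op O B u K₀ K n r (s.card * N) fun X => ∑ a ∈ s, e a X := by
  induction s using Finset.induction_on with
  | empty => exact .nil fun X _ => by simp
  | insert a s ha ih =>
    simp only [Finset.sum_insert ha, Finset.card_insert_of_notMem ha]
    rw [Nat.add_mul, one_mul, Nat.add_comm]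
    exact (h a (Finset.mem_insert_self a s)).add
      (ih fun b hb => h b (Finset.mem_insert_of_mem hb))

/-- The leading bound is multiplied by a bound K₁ of c alone, and not by one of its derivatives.
Thereby the leading constants remain independent of the higher norms. -/
theorem Op.mul (hO : IsOpen O) (hB : B ⊆ O) {K' K₁ : ℝ} (hK : 0 ≤ K) (hK' : 0 ≤ K')
    {c : Coord → ℝ} (hc : CB O B r K' c) (hc1 : ∀ X ∈ B, |c X| ≤ K₁)
    (h : Op O B u K₀ K n r N e) :
    Op O B u (K₁ * K₀) (2 ^ r * (K' * K)) n r N fun X => c X * e X := by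
  induction h with
  | nil h => exact .nil fun X hX => by rw [h X hX, mul_zero]
  | cons hl hc' ht _ he ih =>
    refine .cons hl (hc.mul hO hB hK' hK hc') (fun h X hX => ?_) ih fun X hX => by
      rw [he X hX]; ring
    rw [abs_mul]
    exact mul_le_mul (hc1 X hX) (ht h X hX) (abs_nonneg _) ((abs_nonneg _).trans (hc1 X hX))

theorem Op.differentiableAt (hO : IsOpen O) (hu : CDOn O (n + 1) u)
    (h : Op O B u K₀ K n (r + 1) N e) : ∀ X ∈ O, DifferentiableAt ℝ e X := by
  induction h with
  | nil h =>
    exact fun X hX => (differentiableAt_const 0).congr_of_eventuallyEq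
      (eventuallyEq_of_isOpen hO h hX)
  | @cons N e e' c l hl hc ht _ he ih =>
    intro X hX
    have h1 : CDOn O 1 (pdl l u) := CDOn.pdl l (hu.mono (by omega))
    exact (((hc.2.1 X hX).fun_mul (CDOn.differentiableAt (n := 0) h1 hX)).fun_add
      (ih X hX)).congr_of_eventuallyEq (eventuallyEq_of_isOpen hO he hX)

/-- The terms of top order keep their coefficients. Differentiated coefficients appear only in lower
order and use up one of the r available derivatives. -/
theorem Op.pd (hO : IsOpen O) (hu : CDOn O (n + 1) u) (i : Fin 4)
    (h : Op O B u K₀ K n (r + 1) N e) : Op O B u K₀ K (n + 1) r (2 * N) (pd i e) := by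
  induction h with
  | nil h =>
    exact .nil fun X hX => by rw [pd_eq_of_isOpen hO h i X hX, pd_const]
  | @cons N e e' c l hl hc ht h' he ih =>
    have h1 : CDOn O 1 (pdl l u) := CDOn.pdl l (hu.mono (by omega))
    have hdl : ∀ X ∈ O, DifferentiableAt ℝ (pdl l u) X := fun X hX =>
      CDOn.differentiableAt (n := 0) h1 hX
    refine .cons (N := 2 * N + 1) (l := l) (e' := fun X => c X * pdl (i :: l) u X
        + NullTimelike.pd i e' X) (hl.trans (Nat.le_succ n)) (hc.2.2 i)
      (fun h => absurd h (by omega)) (.cons (l := i :: l) (Nat.succ_le_succ hl) hc.of_succ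
        (fun h => ht (Nat.succ.inj h)) ih fun X _ => rfl) fun X hX => ?_
    rw [pd_eq_of_isOpen hO he i X hX, pd_add i ((hc.2.1 X hX).fun_mul (hdl X hX))
      (h'.differentiableAt hO hu X hX), pd_mul i (hc.2.1 X hX) (hdl X hX), add_assoc]
    rfl

theorem Op.abs_le (hB : B ⊆ O) (h0 : 0 ≤ K₀) (hK : 0 ≤ K) (h : Op O B u K₀ K n r N e) :
    ∀ X ∈ B, |e X| ≤ N * (K₀ * ∑ l ∈ words (Fin 4) n, |pdl l u X|
      + K * ∑ m ∈ Finset.range n, ∑ l ∈ words (Fin 4) m, |pdl l u X|) := by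
  intro X hX
  have p1 : ∀ m, 0 ≤ ∑ l ∈ words (Fin 4) m, |pdl l u X| := fun m =>
    Finset.sum_nonneg fun _ _ => abs_nonneg _
  have p2 : 0 ≤ ∑ m ∈ Finset.range n, ∑ l ∈ words (Fin 4) m, |pdl l u X| :=
    Finset.sum_nonneg fun m _ => p1 m
  have p3 := mul_nonneg h0 (p1 n)
  have p4 := mul_nonneg hK p2
  induction h with
  | nil h =>
    rw [h X (hB hX), abs_zero]; positivity
  | @cons N e e' c l hl hc ht h' he ih =>
    rw [he X (hB hX)]
    push_cast
    rw [add_mul, one_mul, add_comm (c X * _)]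
    refine (abs_add_le _ _).trans (add_le_add ih ?_)
    rw [abs_mul]
    rcases hl.lt_or_eq with h1 | h1
    · refine le_add_of_nonneg_of_le p3 (mul_le_mul (hc.bound X hX) ?_ (abs_nonneg _) hK)
      refine (Finset.single_le_sum (f := fun l => |pdl l u X|) (fun _ _ => abs_nonneg _)
        (mem_words.2 rfl)).trans ?_
      exact Finset.single_le_sum (f := fun m => ∑ l ∈ words (Fin 4) m, |pdl l u X|)
        (fun m _ => p1 m) (Finset.mem_range.2 h1)
    · refine le_add_of_le_of_nonneg (mul_le_mul (ht h1 X hX) ?_ (abs_nonneg _) h0) p4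
      exact Finset.single_le_sum (f := fun l => |pdl l u X|) (fun _ _ => abs_nonneg _)
        (mem_words.2 h1)

end

/-! ### A global frame -/

/-- The components in the two charts of `∂_τ`, `∂_z` and of the gradients of the three Cartesian
coordinate functions on the sphere (up to normalization). -/
def frameCoef (ε : Bool) (a : Fin 5) (j : Fin 4) (X : Coord) : ℝ :=
  match a, j with
  | 0, 0 => 1
  | 1, 1 => 1
  | 2, 2 => 1 / 2 * (1 + -1 * (X 2 * X 2) + X 3 * X 3)
  | 2, 3 => -1 * (X 2 * X 3)
  | 3, 2 => -1 * (X 2 * X 3)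
  | 3, 3 => 1 / 2 * (1 + X 2 * X 2 + -1 * (X 3 * X 3))
  | 4, 2 => poleSign ε * X 2
  | 4, 3 => poleSign ε * X 3
  | _, _ => 0

/-- The derivative along a vector field of the frame. -/
def fr (ε : Bool) (a : Fin 5) (u : Coord → ℝ) (X : Coord) : ℝ := ∑ j, frameCoef ε a j X * pd j u X

/-- The iterated derivative along a word in the frame. -/
def frs (ε : Bool) (w : List (Fin 5)) (u : Coord → ℝ) : Coord → ℝ := w.foldr (fr ε) u

theorem frs_append (ε : Bool) (w w' : List (Fin 5)) (u : Coord → ℝ) :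
    frs ε (w ++ w') u = frs ε w (frs ε w' u) := List.foldr_append

theorem fr_one (ε : Bool) (u : Coord → ℝ) : fr ε 1 u = pd 1 u := by
  ext X; simp [fr, frameCoef, Fin.sum_univ_four]

/-- The coefficients of the coordinate vector fields in the frame. -/
def coframeCoef (ε : Bool) (j : Fin 4) (a : Fin 5) (X : Coord) : ℝ :=
  match j, a with
  | 0, 0 => 1
  | 1, 1 => 1
  | 2, 2 => 2 * (conf X)⁻¹
  | 2, 4 => 2 * (conf X)⁻¹ * (poleSign ε * X 2)
  | 3, 3 => 2 * (conf X)⁻¹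
  | 3, 4 => 2 * (conf X)⁻¹ * (poleSign ε * X 3)
  | _, _ => 0

/-- The three gradients span the tangent planes of the sphere everywhere. They are linearly
dependent, and this is one smooth choice of coefficients. The fields ∂_z and the others do not mix.
-/
theorem pd_eq_sum_fr (ε : Bool) (j : Fin 4) (u : Coord → ℝ) (X : Coord) :
    pd j u X = ∑ a, coframeCoef ε j a X * fr ε a u X := by
  have hc : (conf X) ≠ 0 := (conf_pos X).ne'
  have hp : poleSign ε * poleSign ε = 1 := by rw [← sq]; exact poleSign_sq ε
  have e2 : (2 * (conf X)⁻¹) * conf X = 2 := by field_simp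
  have ec : conf X = 1 + X 2 ^ 2 + X 3 ^ 2 := rfl
  set t := 2 * (conf X)⁻¹ with ht
  rw [ec] at e2
  fin_cases j <;>
    simp [Fin.sum_univ_five, coframeCoef, fr, frameCoef, Fin.sum_univ_four]
  · rw [← ht]
    linear_combination (-1 / 2 * pd 2 u X) * e2
      - t * X 2 * (X 2 * pd 2 u X + X 3 * pd 3 u X) * hp
  · rw [← ht]
    linear_combination (-1 / 2 * pd 3 u X) * e2
      - t * X 3 * (X 2 * pd 2 u X + X 3 * pd 3 u X) * hp

theorem isOpen_ne_zero : IsOpen {Y : Coord | Y 2 ^ 2 + Y 3 ^ 2 ≠ 0} :=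
  isOpen_ne_fun (by fun_prop) continuous_const

theorem inversion_ne_zero {X : Coord} (h : X 2 ^ 2 + X 3 ^ 2 ≠ 0) :
    inversion X 2 ^ 2 + inversion X 3 ^ 2 ≠ 0 := by
  have : inversion X 2 ^ 2 + inversion X 3 ^ 2 = 1 / (X 2 ^ 2 + X 3 ^ 2) := by
    simp [inversion]; field_simp
  rw [this]; positivity

theorem inversion_inversion {X : Coord} (h : X 2 ^ 2 + X 3 ^ 2 ≠ 0) :
    inversion (inversion X) = X := by
  have e : inversion X 2 ^ 2 + inversion X 3 ^ 2 = 1 / (X 2 ^ 2 + X 3 ^ 2) := by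
    simp [inversion]; field_simp
  ext i
  unfold inversion at e ⊢
  fin_cases i
  · rfl
  · rfl
  all_goals simp [div_pow] at e ⊢; rw [e]; field_simp

theorem Compat.differentiableAt {u : Bool → Coord → ℝ} (hu : Compat u) (ε : Bool) {X : Coord}
    (h : X 2 ^ 2 + X 3 ^ 2 ≠ 0) (hd : DifferentiableAt ℝ (u ε) X) :
    DifferentiableAt ℝ (u (!ε)) (inversion X) := by
  have hev : u (!ε) =ᶠ[𝓝 (inversion X)] fun Y => u ε (inversion Y) := by
    filter_upwards [isOpen_ne_zero.mem_nhds (inversion_ne_zero h)] with Y hY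
    have := hu (!ε) Y hY
    rwa [Bool.not_not] at this
  refine DifferentiableAt.congr_of_eventuallyEq ?_ hev
  have h1 : DifferentiableAt ℝ inversion (inversion X) := differentiableAt_pi.2 fun j =>
    (contDiffAt_inversion (n := 1) (inversion_ne_zero h) j).differentiableAt (by norm_num)
  exact DifferentiableAt.comp (g := u ε) (inversion X) (by rwa [inversion_inversion h]) h1

/-- The frame consists of vector fields defined on the whole sphere, so the derivative of a scalar
is again a scalar. Coordinate derivatives do not have this property. -/
theorem Compat.fr {u : Bool → Coord → ℝ} (hu : Compat u) (a : Fin 5) :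
    Compat fun ε => fr ε a (u ε) := by
  intro ε X h
  have key : ∀ i, pd i (u ε) X
      = ∑ j, pd j (u (!ε)) (inversion X) * pd i (fun Y => inversion Y j) X := by
    intro i
    by_cases hd : DifferentiableAt ℝ (u (!ε)) (inversion X)
    · exact hu.pd_eq ε h hd i
    -- Differentiability in one chart is equivalent to differentiability in the other. Without it
    -- all derivatives have the default value 0 on both sides.
    · have hd' : ¬ DifferentiableAt ℝ (u ε) X := fun h' => hd (hu.differentiableAt ε h h')
      simp [pd, fderiv_zero_of_not_differentiableAt hd, fderiv_zero_of_not_differentiableAt hd']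
  have hs : poleSign (!ε) = -poleSign ε := by cases ε <;> simp [poleSign]
  simp only [NullTimelike.fr, key, Fin.sum_univ_four, pd_inversion h]
  fin_cases a <;> simp [frameCoef, inversion, hs] <;> field_simp <;> ring

theorem Compat.frs {u : Bool → Coord → ℝ} (hu : Compat u) (w : List (Fin 5)) :
    Compat fun ε => frs ε w (u ε) := by
  induction w with
  | nil => exact hu
  | cons a w ih => exact ih.fr a

/-! ### Functions with bounded derivatives on the disk -/

/-- All derivatives of `c` are bounded on the unit disk. -/
def DiscBounded (c : Coord → ℝ) : Prop :=
  ∀ r : ℕ, ∃ K : ℝ, 0 ≤ K ∧ ∀ O B : Set Coord, IsOpen O → B ⊆ O →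
    (∀ X ∈ B, X 2 ^ 2 + X 3 ^ 2 ≤ 1) → CB O B r K c

theorem DiscBounded.const (c : ℝ) : DiscBounded fun _ => c := fun r =>
  ⟨|c|, abs_nonneg c, fun _ _ _ _ _ => CB.const r c⟩

theorem DiscBounded.add {c c' : Coord → ℝ} (h : DiscBounded c) (h' : DiscBounded c') :
    DiscBounded fun X => c X + c' X := fun r => by
  obtain ⟨K, hK, H⟩ := h r
  obtain ⟨K', hK', H'⟩ := h' r
  exact ⟨K + K', by positivity, fun O B hO hB hd => (H O B hO hB hd).add hO hB (H' O B hO hB hd)⟩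

theorem DiscBounded.mul {c c' : Coord → ℝ} (h : DiscBounded c) (h' : DiscBounded c') :
    DiscBounded fun X => c X * c' X := fun r => by
  obtain ⟨K, hK, H⟩ := h r
  obtain ⟨K', hK', H'⟩ := h' r
  exact ⟨2 ^ r * (K * K'), by positivity,
    fun O B hO hB hd => (H O B hO hB hd).mul hO hB hK hK' (H' O B hO hB hd)⟩

theorem DiscBounded.coord {j : Fin 4} (hj : j = 2 ∨ j = 3) : DiscBounded fun X => X j := fun r => by
  refine ⟨1, zero_le_one, fun O B hO hB hd => ?_⟩
  have hb : ∀ X ∈ B, |X j| ≤ 1 := fun X hX => by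
    have := hd X hX
    rcases hj with rfl | rfl
    · exact (sq_le_one_iff_abs_le_one _).1 (by linarith [sq_nonneg (X 3)])
    · exact (sq_le_one_iff_abs_le_one _).1 (by linarith [sq_nonneg (X 2)])
  cases r with
  | zero => exact hb
  | succ r =>
    refine ⟨hb, fun X _ => by fun_prop, fun i => ?_⟩
    have e : pd i (fun Y : Coord => Y j) = fun _ => if j = i then 1 else 0 := by
      ext X; exact pd_coord i j X
    rw [e]
    exact (CB.const r _).mono (by split_ifs <;> simp)

theorem DiscBounded.inv_conf : DiscBounded fun X => (conf X)⁻¹ := fun r => by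
  have h : DiscBounded conf :=
    ((DiscBounded.const 1).add ((DiscBounded.coord (Or.inl rfl)).mul
      (DiscBounded.coord (Or.inl rfl)))).add ((DiscBounded.coord (Or.inr rfl)).mul
      (DiscBounded.coord (Or.inr rfl))) |> fun h => by
        convert h using 2 with X
        simp [conf]; ring
  obtain ⟨K, hK, H⟩ := h r
  obtain ⟨K', hK', H'⟩ := CB.inv r hK one_pos
  refine ⟨K', hK', fun O B hO hB hd => H' O B hO hB conf (H O B hO hB hd)
    (fun X _ => (conf_pos X).ne') fun X _ => ?_⟩
  have : conf X = 1 + X 2 ^ 2 + X 3 ^ 2 := rfl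
  rw [this]
  linarith [sq_nonneg (X 2), sq_nonneg (X 3)]

theorem discBounded_frameCoef (ε : Bool) (a : Fin 5) (j : Fin 4) :
    DiscBounded (frameCoef ε a j) := by
  have c := DiscBounded.const
  have x := DiscBounded.coord (j := 2) (Or.inl rfl)
  have y := DiscBounded.coord (j := 3) (Or.inr rfl)
  fin_cases a <;> fin_cases j
  all_goals first
    | exact c 0
    | exact c 1
    | exact (c (1 / 2)).mul (((c 1).add ((c (-1)).mul (x.mul x))).add (y.mul y))
    | exact (c (-1)).mul (x.mul y)
    | exact (c (1 / 2)).mul (((c 1).add (x.mul x)).add ((c (-1)).mul (y.mul y)))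
    | exact (c (poleSign ε)).mul x
    | exact (c (poleSign ε)).mul y

theorem discBounded_coframeCoef (ε : Bool) (j : Fin 4) (a : Fin 5) :
    DiscBounded (coframeCoef ε j a) := by
  have c := DiscBounded.const
  have x := DiscBounded.coord (j := 2) (Or.inl rfl)
  have y := DiscBounded.coord (j := 3) (Or.inr rfl)
  have i := (c 2).mul DiscBounded.inv_conf
  fin_cases j <;> fin_cases a
  all_goals first
    | exact c 0
    | exact c 1
    | exact i
    | exact i.mul ((c (poleSign ε)).mul x)
    | exact i.mul ((c (poleSign ε)).mul y)

theorem DiscBounded.uniform {ι : Type*} [Fintype ι] {c : ι → Coord → ℝ}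
    (h : ∀ a, DiscBounded (c a)) (r : ℕ) : ∃ K : ℝ, 0 ≤ K ∧ ∀ O B : Set Coord, IsOpen O → B ⊆ O →
    (∀ X ∈ B, X 2 ^ 2 + X 3 ^ 2 ≤ 1) → ∀ a, CB O B r K (c a) := by
  choose K hK H using fun a => h a r
  exact ⟨∑ a, K a, Finset.sum_nonneg fun a _ => hK a, fun O B hO hB hd a =>
    (H a O B hO hB hd).mono (Finset.single_le_sum (fun a _ => hK a) (Finset.mem_univ a))⟩

theorem contDiff_frameCoef (ε : Bool) (a : Fin 5) (j : Fin 4) {n : WithTop ℕ∞} :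
    ContDiff ℝ n (frameCoef ε a j) := by
  unfold frameCoef
  fin_cases a <;> fin_cases j <;> fun_prop

section

variable {O B : Set Coord}

theorem CDOn.fr {n : ℕ} {u : Coord → ℝ} (h : CDOn O (n + 1) u) (ε : Bool) (a : Fin 5) :
    CDOn O n (fr ε a u) :=
  CDOn.sum fun j _ => CDOn.mul (fun _ _ => (contDiff_frameCoef ε a j).contDiffAt) (h.pd j)

theorem CDOn.frs {n : ℕ} {u : Coord → ℝ} (ε : Bool) (w : List (Fin 5))
    (h : CDOn O (n + w.length) u) : CDOn O n (frs ε w u) := by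
  induction w generalizing n with
  | nil => exact h
  | cons a w ih => exact CDOn.fr (ih (n := n + 1) (h.mono (by simp; omega))) ε a

theorem fr_eq_of_isOpen (hO : IsOpen O) {u v : Coord → ℝ} (h : ∀ X ∈ O, u X = v X) (ε : Bool)
    (a : Fin 5) : ∀ X ∈ O, fr ε a u X = fr ε a v X := fun X hX =>
  Finset.sum_congr rfl fun j _ => by rw [pd_eq_of_isOpen hO h j X hX]

theorem frs_eq_of_isOpen (hO : IsOpen O) {u v : Coord → ℝ} (h : ∀ X ∈ O, u X = v X) (ε : Bool)
    (w : List (Fin 5)) : ∀ X ∈ O, frs ε w u X = frs ε w v X := by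
  induction w with
  | nil => exact h
  | cons a w ih => exact fr_eq_of_isOpen hO ih ε a

theorem pd_one_frameCoef (ε : Bool) (a : Fin 5) (j : Fin 4) : pd 1 (frameCoef ε a j) = 0 := by
  ext X
  have h : ∀ s : ℝ, frameCoef ε a j (X + s • Pi.single 1 1) = frameCoef ε a j X := fun s => by
    unfold frameCoef; simp
  have hd : DifferentiableAt ℝ (frameCoef ε a j) X :=
    (contDiff_frameCoef (n := 1) ε a j).contDiffAt.differentiableAt (by norm_num)
  have h1 : HasLineDerivAt ℝ (frameCoef ε a j) (fderiv ℝ (frameCoef ε a j) X (Pi.single 1 1)) X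
      (Pi.single 1 1) := hd.hasFDerivAt.hasLineDerivAt _
  have h2 : HasLineDerivAt ℝ (frameCoef ε a j) 0 X (Pi.single 1 1) := by
    unfold HasLineDerivAt
    simp only [h]
    exact hasDerivAt_const _ _
  exact h1.unique h2

theorem pd_fr {u : Coord → ℝ} {X : Coord} (hu : ContDiffAt ℝ 2 u X) (ε : Bool) (a : Fin 5)
    (i : Fin 4) : pd i (fr ε a u) X
      = ∑ j, (pd i (frameCoef ε a j) X * pd j u X + frameCoef ε a j X * pd i (pd j u) X) := by
  have hc : ∀ j, DifferentiableAt ℝ (frameCoef ε a j) X := fun j =>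
    (contDiff_frameCoef (n := 1) ε a j).contDiffAt.differentiableAt (by norm_num)
  have hp : ∀ j, DifferentiableAt ℝ (pd j u) X := ContDiffAt.differentiableAt_pd hu
  unfold fr
  rw [pd_sum _ i fun j _ => (hc j).fun_mul (hp j)]
  exact Finset.sum_congr rfl fun j _ => pd_mul i (hc j) (hp j)

theorem pd_one_fr {u : Coord → ℝ} {X : Coord} (hu : ContDiffAt ℝ 2 u X) (ε : Bool) (a : Fin 5) :
    pd 1 (fr ε a u) X = fr ε a (pd 1 u) X := by
  rw [pd_fr hu]
  refine Finset.sum_congr rfl fun j _ => ?_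
  rw [pd_one_frameCoef, pd_comm hu]; simp

/-- The derivative `∂_z` commutes with the frame. -/
theorem frs_eq_pd_one (hO : IsOpen O) (ε : Bool) {w : List (Fin 5)} (hw : 1 ∈ w) {u : Coord → ℝ}
    (hu : CDOn O w.length u) : ∀ X ∈ O, frs ε w u X = pd 1 (frs ε (w.erase 1) u) X := by
  induction w with
  | nil => simp at hw
  | cons a w ih =>
    intro X hX
    -- Either the outermost letter is ∂_z itself, or ∂_z is taken from the rest of the word and
    -- moved past the letter a.
    by_cases ha : a = 1
    · subst ha
      rw [List.erase_cons_head, ← fr_one ε]; rfl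
    · rw [List.erase_cons_tail (by simpa using ha)]
      have hw' : 1 ∈ w := by simpa [Ne.symm ha] using hw
      have hlen : (w.erase 1).length + 1 = w.length := by
        rw [List.length_erase_of_mem hw']
        have := List.length_pos_of_mem hw'; omega
      have h2 : CDOn O 2 (frs ε (w.erase 1) u) :=
        CDOn.frs ε _ (hu.mono (by simp only [List.length_cons]; omega))
      have e : frs ε (a :: w.erase 1) u = fr ε a (frs ε (w.erase 1) u) := rfl
      rw [e, pd_one_fr (h2 X hX)]
      exact fr_eq_of_isOpen hO (ih hw' (hu.mono (by simp))) ε a X hX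

end

/-! ### Comparison of coordinate derivatives and frame derivatives -/

/-- The sum of the absolute values of the coordinate derivatives up to order `n`. -/
def cs (n : ℕ) (u : Coord → ℝ) (X : Coord) : ℝ :=
  ∑ m ∈ Finset.range (n + 1), ∑ l ∈ words (Fin 4) m, |pdl l u X|

/-- The sum of the absolute values of the frame derivatives up to order `n`. -/
def fs (ε : Bool) (n : ℕ) (u : Coord → ℝ) (X : Coord) : ℝ :=
  ∑ m ∈ Finset.range (n + 1), ∑ w ∈ words (Fin 5) m, |frs ε w u X|

theorem abs_frs_le_fs (ε : Bool) {w : List (Fin 5)} {n : ℕ} (hw : w.length ≤ n) (u : Coord → ℝ)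
    (X : Coord) : |frs ε w u X| ≤ fs ε n u X :=
  (Finset.single_le_sum (f := fun l => |frs ε l u X|) (fun _ _ => abs_nonneg _)
    (mem_words.2 rfl)).trans (Finset.single_le_sum
      (f := fun m => ∑ l ∈ words (Fin 5) m, |frs ε l u X|)
      (fun _ _ => Finset.sum_nonneg fun _ _ => abs_nonneg _)
      (Finset.mem_range.2 (Nat.lt_succ_of_le hw)))

theorem fs_nonneg (ε : Bool) (n : ℕ) (u : Coord → ℝ) (X : Coord) : 0 ≤ fs ε n u X :=
  Finset.sum_nonneg fun _ _ => Finset.sum_nonneg fun _ _ => abs_nonneg _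

theorem fs_mono (ε : Bool) {m n : ℕ} (h : m ≤ n) (u : Coord → ℝ) (X : Coord) :
    fs ε m u X ≤ fs ε n u X :=
  Finset.sum_le_sum_of_subset_of_nonneg (Finset.range_subset_range.2 (by omega))
    fun _ _ _ => Finset.sum_nonneg fun _ _ => abs_nonneg _

theorem contDiff_coframeCoef (ε : Bool) (j : Fin 4) (a : Fin 5) {n : WithTop ℕ∞} :
    ContDiff ℝ n (coframeCoef ε j a) := by
  have hc : ContDiff ℝ n fun X => (conf X)⁻¹ :=
    ContDiff.inv (by unfold conf; fun_prop) fun X => (conf_pos X).ne'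
  unfold coframeCoef
  fin_cases j <;> fin_cases a <;> fun_prop

section

variable {O B : Set Coord} {u : Coord → ℝ} {K₀ K : ℝ} {n r N : ℕ} {e : Coord → ℝ}

theorem Op.pdl (hO : IsOpen O) (l : List (Fin 4)) (hu : CDOn O (n + l.length) u)
    (h : Op O B u K₀ K n (r + l.length) N e) :
    Op O B u K₀ K (n + l.length) r (2 ^ l.length * N) (pdl l e) := by
  induction l generalizing r with
  | nil => simpa [NullTimelike.pdl] using h
  | cons i l ih =>
    have h1 := ih (r := r + 1) (hu.mono (by simp)) (by
      convert h using 1; simp only [List.length_cons]; omega)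
    have := h1.pd hO (hu.mono (by simp only [List.length_cons]; omega)) i
    have e1 : 2 ^ (i :: l).length * N = 2 * (2 ^ l.length * N) := by
      rw [List.length_cons, pow_succ]; ring
    rw [e1]
    exact this

theorem Op.abs_le_cs (hB : B ⊆ O) (h0 : 0 ≤ K₀) (hK : 0 ≤ K) (h : Op O B u K₀ K n r N e) :
    ∀ X ∈ B, |e X| ≤ N * (K₀ + K) * cs n u X := by
  intro X hX
  refine (h.abs_le hB h0 hK X hX).trans ?_
  rw [mul_assoc]
  refine mul_le_mul_of_nonneg_left ?_ (Nat.cast_nonneg N)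
  unfold cs
  rw [Finset.sum_range_succ]
  have p1 : ∀ m, 0 ≤ ∑ l ∈ words (Fin 4) m, |NullTimelike.pdl l u X| := fun m =>
    Finset.sum_nonneg fun _ _ => abs_nonneg _
  have p2 : 0 ≤ ∑ m ∈ Finset.range n, ∑ l ∈ words (Fin 4) m, |NullTimelike.pdl l u X| :=
    Finset.sum_nonneg fun m _ => p1 m
  have p3 := mul_nonneg h0 p2
  have p4 := mul_nonneg hK (p1 n)
  linarith

/-- The factor 8 counts four components, each with twice as many terms after the product rule. -/
theorem Op.fr (hO : IsOpen O) (hB : B ⊆ O) {ε : Bool} {Kf : ℝ} (hKf : 0 ≤ Kf) (hK : 0 ≤ K)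
    (hf : ∀ a j, CB O B r Kf (frameCoef ε a j)) (hu : CDOn O (n + 1) u)
    (h : Op O B u K₀ K n (r + 1) N e) (a : Fin 5) :
    Op O B u (Kf * K₀) (2 ^ r * (Kf * K)) (n + 1) r (8 * N) (fr ε a e) := by
  have := Op.sum (Finset.univ : Finset (Fin 4)) fun j _ =>
    (h.pd hO hu j).mul hO hB hK hKf (hf a j) (hf a j).bound
  convert this using 1
  · simp; ring
  · rfl

end

theorem exists_frameBound (r : ℕ) : ∃ Kf : ℝ, 0 ≤ Kf ∧ ∀ O B : Set Coord, IsOpen O → B ⊆ O →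
    (∀ X ∈ B, X 2 ^ 2 + X 3 ^ 2 ≤ 1) → ∀ ε a j, CB O B r Kf (frameCoef ε a j) := by
  obtain ⟨Kf, h0, H⟩ := DiscBounded.uniform (ι := Bool × Fin 5 × Fin 4)
    (c := fun p => frameCoef p.1 p.2.1 p.2.2) (fun p => discBounded_frameCoef _ _ _) r
  exact ⟨Kf, h0, fun O B hO hB hd ε a j => H O B hO hB hd (ε, a, j)⟩

theorem exists_coframeBound (r : ℕ) : ∃ Kf : ℝ, 0 ≤ Kf ∧ ∀ O B : Set Coord, IsOpen O → B ⊆ O →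
    (∀ X ∈ B, X 2 ^ 2 + X 3 ^ 2 ≤ 1) → ∀ ε j a, CB O B r Kf (coframeCoef ε j a) := by
  obtain ⟨Kf, h0, H⟩ := DiscBounded.uniform (ι := Bool × Fin 4 × Fin 5)
    (c := fun p => coframeCoef p.1 p.2.1 p.2.2) (fun p => discBounded_coframeCoef _ _ _) r
  exact ⟨Kf, h0, fun O B hO hB hd ε a j => H O B hO hB hd (ε, a, j)⟩

/-- Frame derivatives are differential operators with bounded coefficients. -/
theorem exists_op_frs (m r : ℕ) : ∃ (N : ℕ) (K₀ K : ℝ), 0 ≤ K₀ ∧ 0 ≤ K ∧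
    ∀ O B : Set Coord, IsOpen O → B ⊆ O → (∀ X ∈ B, X 2 ^ 2 + X 3 ^ 2 ≤ 1) →
    ∀ (ε : Bool) (u : Coord → ℝ) (w : List (Fin 5)), w.length = m → CDOn O m u →
    Op O B u K₀ K m r N (frs ε w u) := by
  induction m generalizing r with
  | zero =>
    refine ⟨1, 1, 1, zero_le_one, zero_le_one, fun O B _ _ _ ε u w hw _ => ?_⟩
    rw [List.length_eq_zero_iff.1 hw]
    exact Op.self
  | succ m ih =>
    obtain ⟨N, K₀, K, h0, hK, H⟩ := ih (r + 1)
    obtain ⟨Kf, hf0, hf⟩ := exists_frameBound r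
    refine ⟨8 * N, Kf * K₀, 2 ^ r * (Kf * K), by positivity, by positivity, ?_⟩
    intro O B hO hB hd ε u w hw hu
    obtain ⟨a, w, rfl⟩ := List.exists_cons_of_length_eq_add_one hw
    exact (H O B hO hB hd ε u w (by simpa using hw) (hu.mono (Nat.le_succ m))).fr hO hB hf0 hK
      (hf O B hO hB hd ε) hu a

theorem exists_pdl_frs_le (m i : ℕ) : ∃ C : ℝ, 0 ≤ C ∧
    ∀ O B : Set Coord, IsOpen O → B ⊆ O → (∀ X ∈ B, X 2 ^ 2 + X 3 ^ 2 ≤ 1) →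
    ∀ (ε : Bool) (u : Coord → ℝ) (w : List (Fin 5)) (l : List (Fin 4)), w.length = m →
    l.length = i → CDOn O (m + i) u → ∀ X ∈ B, |pdl l (frs ε w u) X| ≤ C * cs (m + i) u X := by
  obtain ⟨N, K₀, K, h0, hK, H⟩ := exists_op_frs m i
  refine ⟨(2 ^ i * N : ℕ) * (K₀ + K), by positivity, ?_⟩
  intro O B hO hB hd ε u w l hw hl hu
  subst hl
  exact (((H O B hO hB hd ε u w hw (hu.mono (by omega))).mono (r' := 0 + l.length) le_rfl le_rfl
    (by omega) le_rfl).pdl hO l hu).abs_le_cs hB h0 hK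

theorem pdl_sum {O : Set Coord} (hO : IsOpen O) {ι : Type*} (s : Finset ι) {u : ι → Coord → ℝ}
    (l : List (Fin 4)) (hu : ∀ a ∈ s, CDOn O l.length (u a)) :
    ∀ X ∈ O, pdl l (fun Y => ∑ a ∈ s, u a Y) X = ∑ a ∈ s, pdl l (u a) X := by
  induction l with
  | nil => exact fun _ _ => rfl
  | cons i l ih =>
    intro X hX
    have h1 := pd_eq_of_isOpen hO (ih fun a ha => (hu a ha).mono (by simp)) i X hX
    refine h1.trans ?_
    change _ = ∑ a ∈ s, pd i (pdl l (u a)) X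
    exact pd_sum s i fun a ha => CDOn.differentiableAt (n := 0)
      (CDOn.pdl l ((hu a ha).mono (by simp; omega))) hX

/-- Coordinate derivatives are controlled by frame derivatives. -/
theorem exists_pdl_le_fs (n : ℕ) : ∃ C : ℝ, 0 ≤ C ∧
    ∀ O B : Set Coord, IsOpen O → B ⊆ O → (∀ X ∈ B, X 2 ^ 2 + X 3 ^ 2 ≤ 1) →
    ∀ (ε : Bool) (u : Coord → ℝ) (l : List (Fin 4)), l.length ≤ n → CDOn O n u →
    ∀ X ∈ B, |pdl l u X| ≤ C * fs ε n u X := by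
  induction n with
  | zero =>
    refine ⟨1, zero_le_one, fun O B _ _ _ ε u l hl _ X _ => ?_⟩
    rw [List.length_eq_zero_iff.1 (Nat.le_zero.1 hl), one_mul]
    exact abs_frs_le_fs ε (w := []) le_rfl u X
  | succ n ih =>
    obtain ⟨C, hC, H⟩ := ih
    obtain ⟨Kf, hf0, hf⟩ := exists_coframeBound n
    obtain ⟨W, hW⟩ : ∃ W : ℝ, W = ∑ m ∈ Finset.range (n + 1), ((words (Fin 4) m).card : ℝ) :=
      ⟨_, rfl⟩
    obtain ⟨W', hW'⟩ : ∃ W : ℝ, W = ∑ m ∈ Finset.range (n + 1), ((words (Fin 5) m).card : ℝ) :=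
      ⟨_, rfl⟩
    have hW0 : 0 ≤ W := hW ▸ Finset.sum_nonneg fun _ _ => Nat.cast_nonneg _
    have hW0' : 0 ≤ W' := hW' ▸ Finset.sum_nonneg fun _ _ => Nat.cast_nonneg _
    obtain ⟨C₁, hC₁⟩ : ∃ C₁ : ℝ, C₁ = (2 ^ n * 1 : ℕ) * (Kf * 1 + 2 ^ n * (Kf * 1)) := ⟨_, rfl⟩
    have hC₁0 : 0 ≤ C₁ := by rw [hC₁]; positivity
    refine ⟨C + 5 * (C₁ * (W * (C * W'))), by positivity, ?_⟩
    intro O B hO hB hd ε u l hl hu X hX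
    have hfs := fs_nonneg ε (n + 1) u X
    rcases hl.lt_or_eq with h1 | h1
    · refine (H O B hO hB hd ε u l (by omega) (hu.mono (by omega)) X hX).trans ?_
      exact mul_le_mul (le_add_of_nonneg_right (by positivity)) (fs_mono ε (Nat.le_succ n) u X)
        (fs_nonneg _ _ _ _) (by positivity)
    -- The innermost coordinate derivative is expressed in the frame. The remaining word of length n
    -- then acts on first frame derivatives, where the induction hypothesis applies.
    · obtain ⟨l', j, rfl⟩ : ∃ l' j, l = l' ++ [j] := by
        refine ⟨l.dropLast, l.getLast (by rintro rfl; simp at h1), ?_⟩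
        rw [List.dropLast_append_getLast]
      have hl' : l'.length = n := by simpa using h1
      have hua : ∀ a, CDOn O n (fr ε a u) := fun a => hu.fr ε a
      have e : pd j u = fun Y => ∑ a, coframeCoef ε j a Y * fr ε a u Y :=
        funext fun Y => pd_eq_sum_fr ε j u Y
      rw [pdl_append]
      change |pdl l' (pd j u) X| ≤ _
      rw [e, pdl_sum hO _ _ (fun a _ => by
        rw [hl']
        exact CDOn.mul (fun _ _ => (contDiff_coframeCoef ε j a).contDiffAt) (hua a)) X (hB hX)]
      have key : ∀ a, |pdl l' (fun Y => coframeCoef ε j a Y * fr ε a u Y) X|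
          ≤ C₁ * (W * (C * W')) * fs ε (n + 1) u X := by
        intro a
        have o1 : Op O B (fr ε a u) (Kf * 1) (2 ^ n * (Kf * 1)) 0 n 1
            (fun Y => coframeCoef ε j a Y * fr ε a u Y) :=
          Op.self.mul hO hB zero_le_one hf0 (hf O B hO hB hd ε j a) (hf O B hO hB hd ε j a).bound
        have o2 := (Op.pdl (r := 0) hO l' (by rw [hl', zero_add]; exact hua a)
          (by rw [hl', zero_add]; exact o1)).abs_le_cs hB (by positivity) (by positivity) X hX
        rw [hl', zero_add, ← hC₁] at o2
        refine o2.trans ?_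
        rw [mul_assoc]
        refine mul_le_mul_of_nonneg_left ?_ hC₁0
        have f1 : fs ε n (fr ε a u) X ≤ W' * fs ε (n + 1) u X := by
          rw [hW', Finset.sum_mul]
          refine Finset.sum_le_sum fun m hm => ?_
          rw [← nsmul_eq_mul]
          refine Finset.sum_le_card_nsmul _ _ _ fun w hw => ?_
          have : frs ε w (fr ε a u) = frs ε (w ++ [a]) u := (frs_append ε w [a] u).symm
          rw [this]
          refine abs_frs_le_fs ε ?_ u X
          have := mem_words.1 hw
          have := Finset.mem_range.1 hm
          simp; omega
        have f2 : cs n (fr ε a u) X ≤ W * (C * fs ε n (fr ε a u) X) := by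
          rw [hW, Finset.sum_mul]
          refine Finset.sum_le_sum fun m hm => ?_
          rw [← nsmul_eq_mul]
          refine Finset.sum_le_card_nsmul _ _ _ fun l hl => ?_
          refine H O B hO hB hd ε _ l ?_ (hua a) X hX
          have := mem_words.1 hl
          have := Finset.mem_range.1 hm
          omega
        calc cs n (fr ε a u) X ≤ W * (C * fs ε n (fr ε a u) X) := f2
          _ ≤ W * (C * (W' * fs ε (n + 1) u X)) := by gcongr
          _ = _ := by ring
      calc |∑ a, pdl l' (fun Y => coframeCoef ε j a Y * fr ε a u Y) X|
          ≤ ∑ a, |pdl l' (fun Y => coframeCoef ε j a Y * fr ε a u Y) X| :=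
            Finset.abs_sum_le_sum_abs _ _
        _ ≤ ∑ _a : Fin 5, C₁ * (W * (C * W')) * fs ε (n + 1) u X :=
            Finset.sum_le_sum fun a _ => key a
        _ = 5 * (C₁ * (W * (C * W'))) * fs ε (n + 1) u X := by simp; ring
        _ ≤ _ := by
            refine mul_le_mul_of_nonneg_right (le_add_of_nonneg_left hC) hfs

/-! ### Commutators with a second order operator -/

/-- The operator `g^{ij} ∂_i ∂_j + b^j ∂_j + ω`. -/
def waveOp (g : Fin 4 → Fin 4 → Coord → ℝ) (b : Fin 4 → Coord → ℝ) (ω u : Coord → ℝ)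
    (X : Coord) : ℝ :=
  ∑ i, ∑ j, g i j X * pd i (pd j u) X + ∑ j, b j X * pd j u X + ω X * u X

/-- The commutator of the wave operator with a vector field of the frame. -/
def waveComm (ε : Bool) (a : Fin 5) (g : Fin 4 → Fin 4 → Coord → ℝ) (b : Fin 4 → Coord → ℝ)
    (ω u : Coord → ℝ) (X : Coord) : ℝ :=
  ∑ c, (∑ i, ∑ j, ((g i j X * pd i (pd j (frameCoef ε a c)) X) * pd c u X
        + ((g i j X * pd j (frameCoef ε a c) X) * pd i (pd c u) X
          + ((g i j X * pd i (frameCoef ε a c) X) * pd j (pd c u) X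
            + -(frameCoef ε a c X * pd c (g i j) X * pd i (pd j u) X))))
      + (∑ j, ((b j X * pd j (frameCoef ε a c) X) * pd c u X
          + -(frameCoef ε a c X * pd c (b j) X * pd j u X))
        + -(frameCoef ε a c X * pd c ω X * u X)))

theorem pd_neg (i : Fin 4) (u : Coord → ℝ) : pd i (fun Y => -u Y) = fun X => -pd i u X := by
  ext X
  simp [pd, fderiv_fun_neg]

section

variable {O B : Set Coord}

theorem CB.neg {r : ℕ} {K : ℝ} {c : Coord → ℝ} (h : CB O B r K c) :
    CB O B r K fun X => -c X := by
  induction r generalizing c with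
  | zero => exact fun X hX => by rw [abs_neg]; exact h X hX
  | succ r ih =>
    refine ⟨fun X hX => by rw [abs_neg]; exact h.1 X hX, fun X hX => (h.2.1 X hX).fun_neg,
      fun i => ?_⟩
    rw [pd_neg]
    exact ih (h.2.2 i)

theorem Op.neg {u : Coord → ℝ} {K₀ K : ℝ} {n r N : ℕ} {e : Coord → ℝ}
    (h : Op O B u K₀ K n r N e) : Op O B u K₀ K n r N fun X => -e X := by
  induction h with
  | nil h => exact .nil fun X hX => by rw [h X hX, neg_zero]
  | cons hl hc ht _ he ih =>
    exact .cons hl hc.neg (fun h X hX => by rw [abs_neg]; exact ht h X hX) ih fun X hX => by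
      rw [he X hX]; ring

theorem CDOn.waveOp {g : Fin 4 → Fin 4 → Coord → ℝ} {b : Fin 4 → Coord → ℝ} {ω u : Coord → ℝ}
    {n : ℕ} (hg : ∀ i j, CDOn O n (g i j)) (hb : ∀ j, CDOn O n (b j)) (hω : CDOn O n ω)
    (hu : CDOn O (n + 2) u) : CDOn O n (waveOp g b ω u) :=
  CDOn.add (CDOn.add (CDOn.sum fun i _ => CDOn.sum fun j _ => (hg i j).mul ((hu.pd j).pd i))
    (CDOn.sum fun j _ => (hb j).mul ((hu.pd j).mono (by omega))))
    (hω.mul (hu.mono (by omega)))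

theorem pd_pd_fr (hO : IsOpen O) {u : Coord → ℝ} (hu : CDOn O 3 u) (ε : Bool) (a : Fin 5)
    (i j : Fin 4) : ∀ X ∈ O, pd i (pd j (fr ε a u)) X
      = ∑ c, (pd i (pd j (frameCoef ε a c)) X * pd c u X
        + (pd j (frameCoef ε a c) X * pd i (pd c u) X
          + (pd i (frameCoef ε a c) X * pd j (pd c u) X
            + frameCoef ε a c X * pd i (pd j (pd c u)) X))) := by
  intro X hX
  have h1 : ∀ Y ∈ O, pd j (fr ε a u) Y = ∑ c, (pd j (frameCoef ε a c) Y * pd c u Y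
      + frameCoef ε a c Y * pd j (pd c u) Y) := fun Y hY =>
    pd_fr ((hu.mono (by norm_num : 2 ≤ 3)) Y hY) ε a j
  have d0 : ∀ c, DifferentiableAt ℝ (frameCoef ε a c) X := fun c =>
    (contDiff_frameCoef (n := 1) ε a c).contDiffAt.differentiableAt (by norm_num)
  have d1 : ∀ c, DifferentiableAt ℝ (pd j (frameCoef ε a c)) X := fun c =>
    ContDiffAt.differentiableAt_pd (contDiff_frameCoef (n := 2) ε a c).contDiffAt j
  have d2 : ∀ c, DifferentiableAt ℝ (pd c u) X := fun c =>
    CDOn.differentiableAt (n := 1) (hu.pd (n := 2) c) hX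
  have d3 : ∀ c, DifferentiableAt ℝ (pd j (pd c u)) X := fun c =>
    CDOn.differentiableAt (n := 0) ((hu.pd (n := 2) c).pd (n := 1) j) hX
  rw [pd_eq_of_isOpen hO h1 i X hX,
    pd_sum _ i fun c _ => ((d1 c).fun_mul (d2 c)).fun_add ((d0 c).fun_mul (d3 c))]
  refine Finset.sum_congr rfl fun c _ => ?_
  rw [pd_add i ((d1 c).fun_mul (d2 c)) ((d0 c).fun_mul (d3 c)), pd_mul i (d1 c) (d2 c),
    pd_mul i (d0 c) (d3 c)]
  ring

theorem pd_waveOp {g : Fin 4 → Fin 4 → Coord → ℝ} {b : Fin 4 → Coord → ℝ} {ω u : Coord → ℝ}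
    {X : Coord} (hg : ∀ i j, DifferentiableAt ℝ (g i j) X) (hb : ∀ j, DifferentiableAt ℝ (b j) X)
    (hω : DifferentiableAt ℝ ω X) (h0 : DifferentiableAt ℝ u X)
    (h1 : ∀ j, DifferentiableAt ℝ (pd j u) X) (h2 : ∀ i j, DifferentiableAt ℝ (pd i (pd j u)) X)
    (c : Fin 4) : pd c (waveOp g b ω u) X
      = ∑ i, ∑ j, (pd c (g i j) X * pd i (pd j u) X + g i j X * pd c (pd i (pd j u)) X)
        + ∑ j, (pd c (b j) X * pd j u X + b j X * pd c (pd j u) X)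
        + (pd c ω X * u X + ω X * pd c u X) := by
  have e1 : ∀ i j, DifferentiableAt ℝ (fun Y => g i j Y * pd i (pd j u) Y) X := fun i j =>
    (hg i j).fun_mul (h2 i j)
  have e2 : ∀ j, DifferentiableAt ℝ (fun Y => b j Y * pd j u Y) X := fun j =>
    (hb j).fun_mul (h1 j)
  have e3 : DifferentiableAt ℝ (fun Y => ∑ i, ∑ j, g i j Y * pd i (pd j u) Y) X :=
    DifferentiableAt.fun_sum fun i _ => DifferentiableAt.fun_sum fun j _ => e1 i j
  have e4 : DifferentiableAt ℝ (fun Y => ∑ j, b j Y * pd j u Y) X :=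
    DifferentiableAt.fun_sum fun j _ => e2 j
  unfold waveOp
  rw [pd_add c (e3.fun_add e4) (hω.fun_mul h0), pd_add c e3 e4, pd_mul c hω h0,
    pd_sum _ c fun i _ => DifferentiableAt.fun_sum fun j _ => e1 i j, pd_sum _ c fun j _ => e2 j]
  congr 2
  · refine Finset.sum_congr rfl fun i _ => ?_
    rw [pd_sum _ c fun j _ => e1 i j]
    exact Finset.sum_congr rfl fun j _ => pd_mul c (hg i j) (h2 i j)
  · exact Finset.sum_congr rfl fun j _ => pd_mul c (hb j) (h1 j)

/-- The third derivatives of u occur on both sides with the same coefficients and cancel, so the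
commutator has order two. -/
theorem waveOp_fr (hO : IsOpen O) {g : Fin 4 → Fin 4 → Coord → ℝ} {b : Fin 4 → Coord → ℝ}
    {ω u : Coord → ℝ} (hg : ∀ i j, CDOn O 1 (g i j)) (hb : ∀ j, CDOn O 1 (b j))
    (hω : CDOn O 1 ω) (hu : CDOn O 3 u) (ε : Bool) (a : Fin 5) :
    ∀ X ∈ O, waveOp g b ω (fr ε a u) X
      = waveComm ε a g b ω u X + fr ε a (waveOp g b ω u) X := by
  intro X hX
  have hu2 : ∀ c, CDOn O 2 (pd c u) := fun c => hu.pd c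
  have e : fr ε a (waveOp g b ω u) X = ∑ c, frameCoef ε a c X *
      (∑ i, ∑ j, (pd c (g i j) X * pd i (pd j u) X + g i j X * pd i (pd j (pd c u)) X)
        + ∑ j, (pd c (b j) X * pd j u X + b j X * pd j (pd c u) X)
        + (pd c ω X * u X + ω X * pd c u X)) := by
    unfold fr
    refine Finset.sum_congr rfl fun c _ => ?_
    rw [pd_waveOp (fun i j => CDOn.differentiableAt (n := 0) (hg i j) hX)
      (fun j => CDOn.differentiableAt (n := 0) (hb j) hX)
      (CDOn.differentiableAt (n := 0) hω hX) (CDOn.differentiableAt (n := 2) hu hX)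
      (fun j => CDOn.differentiableAt (n := 1) (hu2 j) hX)
      (fun i j => CDOn.differentiableAt (n := 0) ((hu2 j).pd i) hX)]
    have h2 : ∀ j, pd c (pd j u) X = pd j (pd c u) X := fun j =>
      pd_comm (hu.mono (by norm_num : 2 ≤ 3) X hX) c j
    have h3 : ∀ i j, pd c (pd i (pd j u)) X = pd i (pd j (pd c u)) X := fun i j => by
      rw [pd_comm (hu2 j X hX) c i]
      exact pd_eq_of_isOpen hO (fun Y hY => pd_comm (hu.mono (by norm_num : 2 ≤ 3) Y hY) c j) i X hX
    simp only [h2, h3]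
  rw [e]
  unfold waveComm
  rw [← Finset.sum_add_distrib]
  have p1 : ∀ j, pd j (fr ε a u) X = ∑ c, (pd j (frameCoef ε a c) X * pd c u X
      + frameCoef ε a c X * pd j (pd c u) X) := fun j =>
    pd_fr ((hu.mono (by norm_num : 2 ≤ 3)) X hX) ε a j
  have s1 : ∑ i, ∑ j, g i j X * pd i (pd j (fr ε a u)) X
      = ∑ c, ∑ i, ∑ j, g i j X * (pd i (pd j (frameCoef ε a c)) X * pd c u X
        + (pd j (frameCoef ε a c) X * pd i (pd c u) X
          + (pd i (frameCoef ε a c) X * pd j (pd c u) X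
            + frameCoef ε a c X * pd i (pd j (pd c u)) X))) := by
    simp only [pd_pd_fr hO hu ε a _ _ X hX, Finset.mul_sum]
    rw [Finset.sum_comm' (t' := Finset.univ) (s' := fun _ => Finset.univ) (by simp)]
    conv_rhs => rw [Finset.sum_comm]
    rw [Finset.sum_comm]
    refine Finset.sum_congr rfl fun i _ => ?_
    rw [Finset.sum_comm]
  have s2 : ∑ j, b j X * pd j (fr ε a u) X = ∑ c, ∑ j, b j X * (pd j (frameCoef ε a c) X * pd c u X
      + frameCoef ε a c X * pd j (pd c u) X) := by
    simp only [p1, Finset.mul_sum]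
    rw [Finset.sum_comm]
  have s3 : ω X * fr ε a u X = ∑ c, ω X * (frameCoef ε a c X * pd c u X) := by
    rw [fr, Finset.mul_sum]
  have s0 : waveOp g b ω (fr ε a u) X = ∑ i, ∑ j, g i j X * pd i (pd j (fr ε a u)) X
      + ∑ j, b j X * pd j (fr ε a u) X + ω X * fr ε a u X := rfl
  rw [s0, s1, s2, s3, ← Finset.sum_add_distrib, ← Finset.sum_add_distrib]
  refine Finset.sum_congr rfl fun c _ => ?_
  have t1 : ∑ i, ∑ j, ((g i j X * pd i (pd j (frameCoef ε a c)) X) * pd c u X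
        + ((g i j X * pd j (frameCoef ε a c) X) * pd i (pd c u) X
          + ((g i j X * pd i (frameCoef ε a c) X) * pd j (pd c u) X
            + -(frameCoef ε a c X * pd c (g i j) X * pd i (pd j u) X))))
      + frameCoef ε a c X *
        ∑ i, ∑ j, (pd c (g i j) X * pd i (pd j u) X + g i j X * pd i (pd j (pd c u)) X)
      = ∑ i, ∑ j, g i j X * (pd i (pd j (frameCoef ε a c)) X * pd c u X
        + (pd j (frameCoef ε a c) X * pd i (pd c u) X
          + (pd i (frameCoef ε a c) X * pd j (pd c u) X
            + frameCoef ε a c X * pd i (pd j (pd c u)) X))) := by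
    simp only [Finset.mul_sum]
    rw [← Finset.sum_add_distrib]
    refine Finset.sum_congr rfl fun i _ => ?_
    rw [← Finset.sum_add_distrib]
    exact Finset.sum_congr rfl fun j _ => by ring
  have t2 : ∑ j, ((b j X * pd j (frameCoef ε a c) X) * pd c u X
          + -(frameCoef ε a c X * pd c (b j) X * pd j u X))
      + frameCoef ε a c X * ∑ j, (pd c (b j) X * pd j u X + b j X * pd j (pd c u) X)
      = ∑ j, b j X * (pd j (frameCoef ε a c) X * pd c u X
        + frameCoef ε a c X * pd j (pd c u) X) := by
    rw [Finset.mul_sum, ← Finset.sum_add_distrib]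
    exact Finset.sum_congr rfl fun j _ => by ring
  rw [← t1, ← t2]
  ring

/-- Second derivatives of u come only with g ∂(frame) or (frame) ∂g, whose size is at most Kf · A.
The lower order coefficients and the second derivatives of the frame enter only terms of lower
order. -/
theorem op_waveComm (hO : IsOpen O) (hB : B ⊆ O) {ε : Bool} {a : Fin 5}
    {g : Fin 4 → Fin 4 → Coord → ℝ} {b : Fin 4 → Coord → ℝ} {ω v u : Coord → ℝ}
    {K₀ K Kg Kf A : ℝ} {n r N : ℕ} (hK : 0 ≤ K) (hKg : 0 ≤ Kg) (hKf : 0 ≤ Kf)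
    (hf : ∀ c, CB O B (r + 2) Kf (frameCoef ε a c))
    (hg : ∀ i j, CB O B (r + 1) Kg (g i j)) (hb : ∀ j, CB O B (r + 1) Kg (b j))
    (hω : CB O B (r + 1) Kg ω) (hA : ∀ i j, ∀ X ∈ B, |g i j X| ≤ A)
    (hA' : ∀ i j c, ∀ X ∈ B, |pd c (g i j) X| ≤ A)
    (hv : CDOn O (n + 2) v) (h : Op O B v K₀ K n (r + 2) N u) :
    Op O B v (Kf * A * K₀) (2 ^ r * (2 ^ r * (Kg * Kf) * K)) (n + 2) r (1168 * N)
      (waveComm ε a g b ω u) := by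
  have d1 : ∀ i, Op O B v K₀ K (n + 1) (r + 1) (2 * N) (pd i u) := fun i =>
    h.pd hO (hv.mono (by omega)) i
  have d2 : ∀ i j, Op O B v K₀ K (n + 2) r (4 * N) (pd i (pd j u)) := fun i j =>
    ((d1 j).pd hO hv i).mono le_rfl le_rfl le_rfl (by omega)
  have prod : ∀ {c c' : Coord → ℝ}, CB O B r Kg c → CB O B r Kf c' →
      CB O B r (2 ^ r * (Kg * Kf)) fun X => c X * c' X := fun hc hc' => hc.mul hO hB hKg hKf hc'
  have prod' : ∀ {c c' : Coord → ℝ}, CB O B r Kf c → CB O B r Kg c' →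
      CB O B r (2 ^ r * (Kg * Kf)) fun X => c X * c' X := fun hc hc' =>
    (hc.mul hO hB hKf hKg hc').mono (by rw [mul_comm Kf])
  -- Products with second derivatives of u: the leading bound Kf · A is recorded.
  have top : ∀ {c e : Coord → ℝ}, CB O B r (2 ^ r * (Kg * Kf)) c → (∀ X ∈ B, |c X| ≤ Kf * A) →
      Op O B v K₀ K (n + 2) r (4 * N) e →
      Op O B v (Kf * A * K₀) (2 ^ r * (2 ^ r * (Kg * Kf) * K)) (n + 2) r (4 * N)
        fun X => c X * e X := fun hc h1 he => he.mul hO hB hK (by positivity) hc h1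
  -- Products with at most one derivative of u: only the crude bound of the coefficients is needed.
  have low : ∀ {c e : Coord → ℝ} {n' N' : ℕ}, CB O B r (2 ^ r * (Kg * Kf)) c → n' < n + 2 →
      N' ≤ 4 * N → Op O B v K₀ K n' r N' e →
      Op O B v (Kf * A * K₀) (2 ^ r * (2 ^ r * (Kg * Kf) * K)) (n + 2) r (4 * N)
        fun X => c X * e X := fun hc hn hN he =>
    ((he.mul hO hB hK (by positivity) hc hc.bound).of_lt _ hn).mono le_rfl le_rfl le_rfl hN
  have f0 : ∀ c, CB O B r Kf (frameCoef ε a c) := fun c => (hf c).of_le (by omega)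
  have f1 : ∀ c j, CB O B r Kf (pd j (frameCoef ε a c)) := fun c j => ((hf c).2.2 j).of_succ
  have f2 : ∀ c i j, CB O B r Kf (pd i (pd j (frameCoef ε a c))) := fun c i j =>
    ((hf c).2.2 j).2.2 i
  have d1' : ∀ i, Op O B v K₀ K (n + 1) r (2 * N) (pd i u) := fun i =>
    (d1 i).mono le_rfl le_rfl (Nat.le_succ r) le_rfl
  have hgf : ∀ c i j i', ∀ X ∈ B, |g i j X * pd i' (frameCoef ε a c) X| ≤ Kf * A :=
    fun c i j i' X hX => by
      rw [abs_mul, mul_comm]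
      exact mul_le_mul ((f1 c i').bound X hX) (hA i j X hX) (abs_nonneg _) hKf
  have hfg : ∀ c i j, ∀ X ∈ B, |frameCoef ε a c X * pd c (g i j) X| ≤ Kf * A :=
    fun c i j X hX => by
      rw [abs_mul]
      exact mul_le_mul ((f0 c).bound X hX) (hA' i j c X hX) (abs_nonneg _) hKf
  have main := Op.sum (Finset.univ : Finset (Fin 4)) fun c _ =>
    (Op.sum (Finset.univ : Finset (Fin 4)) fun i _ => Op.sum (Finset.univ : Finset (Fin 4)) fun j _ =>
      (low (prod (hg i j).of_succ (f2 c i j)) (by omega) (by omega) (d1' c)).add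
        ((top (prod (hg i j).of_succ (f1 c j)) (hgf c i j j) (d2 i c)).add
          ((top (prod (hg i j).of_succ (f1 c i)) (hgf c i j i) (d2 j c)).add
            (top (prod' (f0 c) ((hg i j).2.2 c)) (hfg c i j) (d2 i j)).neg))).add
    ((Op.sum (Finset.univ : Finset (Fin 4)) fun j _ =>
        (low (prod (hb j).of_succ (f1 c j)) (by omega) (by omega) (d1' c)).add
          (low (prod' (f0 c) ((hb j).2.2 c)) (by omega) (by omega) (d1' j)).neg).add
      (low (prod' (f0 c) (hω.2.2 c)) (by omega) (by omega)
        (h.mono le_rfl le_rfl (by omega) le_rfl) (n' := n)).neg)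
  -- The count is 1168 = 4 (16 · 16 + 4 · 8 + 4): for each c, sixteen pairs with four products, four
  -- indices with two products, and one product with ω, each product having 4N terms.
  refine (main.mono le_rfl le_rfl le_rfl (le_of_eq ?_)).congr fun X _ => rfl
  simp only [Finset.card_univ, Fintype.card_fin]
  ring

end

/-- The commutator of the wave operator with a frame derivative. -/
theorem exists_op_commutator (s : ℕ) (A : ℝ) (hA0 : 0 ≤ A) (m : ℕ) (hm : m ≤ s) :
    ∃ (N : ℕ) (K₀ : ℝ), 0 ≤ K₀ ∧ ∀ Kg : ℝ, 0 ≤ Kg → ∃ K : ℝ, 0 ≤ K ∧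
    ∀ O B : Set Coord, IsOpen O → B ⊆ O → (∀ X ∈ B, X 2 ^ 2 + X 3 ^ 2 ≤ 1) →
    ∀ (ε : Bool) (g : Fin 4 → Fin 4 → Coord → ℝ) (b : Fin 4 → Coord → ℝ) (ω v : Coord → ℝ),
    (∀ i j, CDOn O s (g i j)) → (∀ j, CDOn O s (b j)) → CDOn O s ω →
    (∀ i j, CB O B s Kg (g i j)) → (∀ j, CB O B s Kg (b j)) → CB O B s Kg ω →
    (∀ i j, ∀ X ∈ B, |g i j X| ≤ A) → (∀ i j c, ∀ X ∈ B, |pd c (g i j) X| ≤ A) →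
    CDOn O (s + 2) v → ∀ w : List (Fin 5), w.length = m →
    Op O B v K₀ K (m + 1) (s - m) N
      (fun X => waveOp g b ω (frs ε w v) X - frs ε w (waveOp g b ω v) X) := by
  induction m with
  | zero =>
    refine ⟨0, 0, le_rfl, fun Kg _ => ⟨0, le_rfl, ?_⟩⟩
    intro O B _ _ _ ε g b ω v _ _ _ _ _ _ _ _ _ w hw
    rw [List.length_eq_zero_iff.1 hw]
    exact .nil fun X _ => sub_self _
  | succ m ih =>
    obtain ⟨N, K₀, h0, H⟩ := ih (by omega)
    obtain ⟨r, hr⟩ : ∃ r, s = m + 1 + r := ⟨s - (m + 1), by omega⟩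
    obtain ⟨Kf, hf0, hf⟩ := exists_frameBound (r + 2)
    obtain ⟨N', K₀', K', h0', hK', H'⟩ := exists_op_frs m (r + 2)
    -- The leading constant contains only A and bounds of the frame, and it is fixed before Kg is
    -- introduced.
    refine ⟨1168 * N' + 8 * N, Kf * A * K₀' + Kf * K₀, by positivity, fun Kg hKg => ?_⟩
    obtain ⟨K, hK, H⟩ := H Kg hKg
    refine ⟨2 ^ r * (2 ^ r * (Kg * Kf) * K') + 2 ^ r * (Kf * K), by positivity, ?_⟩
    intro O B hO hB hd ε g b ω v hg hb hω cg cb cω hA hA' hv w hw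
    obtain ⟨a, w, rfl⟩ := List.exists_cons_of_length_eq_add_one hw
    have hw' : w.length = m := by simpa using hw
    have o1 := H O B hO hB hd ε g b ω v hg hb hω cg cb cω hA hA' hv w hw'
    have e1 : s - m = r + 1 := by omega
    have e2 : s - (m + 1) = r := by omega
    rw [e1] at o1
    rw [e2]
    have o2 := o1.fr hO hB hf0 hK (fun a j => (hf O B hO hB hd ε a j).of_le (by omega))
      (hv.mono (by omega)) a
    have o3 := op_waveComm hO hB hK' hKg hf0 (hf O B hO hB hd ε a)
      (fun i j => (cg i j).of_le (by omega)) (fun j => (cb j).of_le (by omega))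
      (cω.of_le (by omega)) hA hA' (hv.mono (by omega))
      (H' O B hO hB hd ε v w hw' (hv.mono (by omega)))
    have hφ : CDOn O 3 (frs ε w v) := CDOn.frs ε w (hv.mono (by omega))
    have hF : CDOn O 1 (frs ε w (waveOp g b ω v)) :=
      CDOn.frs ε w ((CDOn.waveOp hg hb hω hv).mono (by omega))
    have hL : CDOn O 1 (waveOp g b ω (frs ε w v)) :=
      CDOn.waveOp (fun i j => (hg i j).mono (by omega)) (fun j => (hb j).mono (by omega))
        (hω.mono (by omega)) hφ
    have n1 : 0 ≤ 2 ^ r * (2 ^ r * (Kg * Kf) * K') := by positivity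
    have n2 : 0 ≤ 2 ^ r * (Kf * K) := by positivity
    have n3 : 0 ≤ Kf * A * K₀' := by positivity
    have n4 : 0 ≤ Kf * K₀ := by positivity
    -- The Leibniz rule for commutators: [P, X_a X_w] = [P, X_a] X_w + X_a [P, X_w].
    refine ((o3.mono (le_add_of_nonneg_right n4) (le_add_of_nonneg_right n2) le_rfl le_rfl).add
      (o2.mono (le_add_of_nonneg_left n3) (le_add_of_nonneg_left n1) le_rfl le_rfl)).congr
      fun X hX => ?_
    change waveOp g b ω (fr ε a (frs ε w v)) X - fr ε a (frs ε w (waveOp g b ω v)) X = _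
    rw [waveOp_fr hO (fun i j => (hg i j).mono (by omega)) (fun j => (hb j).mono (by omega))
      (hω.mono (by omega)) hφ ε a X hX]
    unfold fr
    rw [add_sub_assoc, ← Finset.sum_sub_distrib]
    congr 1
    refine Finset.sum_congr rfl fun j _ => ?_
    rw [pd_sub j (CDOn.differentiableAt (n := 0) hL hX) (CDOn.differentiableAt (n := 0) hF hX)]
    ring

/-! ### The wave equation in coordinates -/

/-- A solution of the wave equation with all the hypotheses on the coefficients. -/
structure IsSolution (Λ lam A B D A' B' D' T R : ℝ) (s : ℕ) (G : BondiData) (Z : ℝ → S2 → ℝ)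
    (a : VField) (ω v f : ST → ℝ) (ψ : ℝ → S2 → ℝ) : Prop where
  setting : IsSetting Λ lam A T R (s + 1) G Z
  metric : ∀ i j, CBound T R Z (s + 1) A' (fun ε X => gUp G ε X i j)
  a_smooth : ∀ i, IsCUpTo T R Z s (fun ε X => a.comp ε X i)
  a_bound : ∀ i, CBound T R Z 0 B (fun ε X => a.comp ε X i)
  a_bounds : ∀ i, CBound T R Z s B' (fun ε X => a.comp ε X i)
  ω_smooth : IsCUpTo T R Z s (pull ω)
  ω_bound : CBound T R Z 0 D (pull ω)
  ω_bounds : CBound T R Z s D' (pull ω)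
  v_smooth : IsCUpTo T R Z (s + 2) (pull v)
  wave : SolvesWave G T R Z a ω v f
  dirichlet : ∀ τ ∈ Set.Icc 0 T, ∀ y, v (τ, 0, y) = ψ τ y

/-- The coefficients of the derivatives of first order. -/
def firstCoef (G : BondiData) (a : VField) (ε : Bool) (j : Fin 4) (X : Coord) : ℝ :=
  ∑ i, (pd i (fun Y => gUp G ε Y i j) X
    + -(1 / 2 * (pd i (upDet G ε) X * ((upDet G ε X)⁻¹ * gUp G ε X i j)))) + a.comp ε X j

/-- The wave operator with the terms of lower order. -/
def fullOp (G : BondiData) (a : VField) (ω : ST → ℝ) (ε : Bool) (u : Coord → ℝ) : Coord → ℝ :=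
  waveOp (fun i j Y => gUp G ε Y i j) (firstCoef G a ε) (pull ω ε) u

/-- The logarithmic derivative of the density is replaced by that of `upDet`. The coefficients
become rational in g^{ij} and its first derivatives, with a denominator bounded from below. -/
theorem IsSetting.fullOp_eq {Λ lam A T R : ℝ} {k : ℕ} {G : BondiData} {Z : ℝ → S2 → ℝ}
    (hS : IsSetting Λ lam A T R k G Z) {ε : Bool} {X : Coord} (hX : X ∈ region T R Z ε)
    {u : Coord → ℝ} (hu : ContDiffAt ℝ 2 u X) (a : VField) (ω : ST → ℝ) :
    box G ε u X + (∑ i, a.comp ε X i * pd i u X) + pull ω ε X * u X = fullOp G a ω ε u X := by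
  have hs := region_slab hX
  have hμ := (hS.ads.volDensity_pos hs).ne'
  have hd := (hS.upDet_pos hs).ne'
  have dμ := hS.differentiableAt_volDensity hs
  have dN := hS.differentiableAt_gUp hs
  have du := ContDiffAt.differentiableAt_pd hu
  have e : ∀ i j, (volDensity G ε X)⁻¹ * pd i (fun Y => volDensity G ε Y * gUp G ε Y i j * pd j u Y) X
      = gUp G ε X i j * pd i (pd j u) X + (pd i (fun Y => gUp G ε Y i j) X
        + -(1 / 2 * (pd i (upDet G ε) X * ((upDet G ε X)⁻¹ * gUp G ε X i j)))) * pd j u X := by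
    intro i j
    have h1 := hS.pd_volDensity_div hX i
    have h2 : pd i (volDensity G ε) X
        = volDensity G ε X * (-(pd i (upDet G ε) X) / (2 * upDet G ε X)) := by
      rw [← h1]; field_simp
    rw [pd_mul i (dμ.fun_mul (dN i j)) (du j), pd_mul i dμ (dN i j), h2]
    field_simp
    ring
  unfold box fullOp waveOp firstCoef
  simp only [Finset.mul_sum, e, Finset.sum_add_distrib, add_mul, Finset.sum_mul]
  rw [Finset.sum_comm (f := fun i j => pd i (fun Y => gUp G ε Y i j) X * pd j u X),
    Finset.sum_comm (f := fun i j => -(1 / 2 * (pd i (upDet G ε) X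
      * ((upDet G ε X)⁻¹ * gUp G ε X i j))) * pd j u X)]
  ring

theorem CB.of_CBound {T R : ℝ} {Z : ℝ → S2 → ℝ} {G : BondiData} (hZ : IsRegularNullCone G T R Z)
    {r : ℕ} {K : ℝ} {u : Bool → Coord → ℝ} {ε : Bool} (hu : CDOn (region T R Z ε) r (u ε))
    (h : CBound T R Z r K u) : CB (region T R Z ε) (under T (pullI Z ε)) r |K| (u ε) :=
  (CB.of_mpd (hZ.isOpen_region ε) (hZ.under_subset_region ε) hu fun X hX n hn α hα =>
    h ε X (hZ.under_subset_region ε hX) hX.2.2 n hn α hα).mono (le_abs_self K)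

theorem region_closed {T R : ℝ} {Z : ℝ → S2 → ℝ} {ε : Bool} :
    ∀ X ∈ region T R Z ε, chart ε X ∈ M2closed T R Z := fun X hX =>
  ⟨region_slab hX, le_of_lt (show X 1 < Z (X 0) (stereo ε (X 2) (X 3)) from hX.2)⟩

theorem IsCUpTo.cdOn {T R : ℝ} {Z : ℝ → S2 → ℝ} {m : ℕ} {u : Bool → Coord → ℝ}
    (h : IsCUpTo T R Z m u) {ε : Bool} {O : Set Coord}
    (hO : ∀ X ∈ O, chart ε X ∈ M2closed T R Z) : CDOn O m (u ε) := fun X hX => h ε X (hO X hX)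

section

variable {Λ lam A B D A' B' D' T R : ℝ} {s : ℕ} {G : BondiData} {Z : ℝ → S2 → ℝ}
  {a : VField} {ω v f : ST → ℝ} {ψ : ℝ → S2 → ℝ}
  (hP : IsSolution Λ lam A B D A' B' D' T R s G Z a ω v f ψ) {ε : Bool} {O : Set Coord}
include hP

theorem IsSolution.cdOn_gUp (hO : ∀ X ∈ O, chart ε X ∈ M2closed T R Z) (i j : Fin 4) :
    CDOn O (s + 1) (fun Y => gUp G ε Y i j) := fun X hX =>
  hP.setting.ads.contDiffAt_gUp (hO X hX).1 i j

theorem IsSolution.cdOn_upDet (hO : ∀ X ∈ O, chart ε X ∈ M2closed T R Z) :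
    CDOn O (s + 1) (upDet G ε) := fun X hX =>
  ((hP.cdOn_gUp hO 2 2 X hX).mul (hP.cdOn_gUp hO 3 3 X hX)).sub ((hP.cdOn_gUp hO 2 3 X hX).pow 2)

theorem IsSolution.cdOn_firstCoef (hO : ∀ X ∈ O, chart ε X ∈ M2closed T R Z) (j : Fin 4) :
    CDOn O s (firstCoef G a ε j) := fun X hX => by
  have hd := (hP.setting.upDet_pos (hO X hX).1).ne'
  have hinv : ContDiffAt ℝ s (fun Y => (upDet G ε Y)⁻¹) X :=
    ContDiffAt.inv ((hP.cdOn_upDet hO).mono (Nat.le_succ s) X hX) hd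
  refine ContDiffAt.add (ContDiffAt.sum fun i _ => ((hP.cdOn_gUp hO i j).pd i X hX).add
    (contDiffAt_const.mul (((hP.cdOn_upDet hO).pd i X hX).mul (hinv.mul ?_))).neg)
    (hP.a_smooth j ε X (hO X hX))
  exact (hP.cdOn_gUp hO i j).mono (Nat.le_succ s) X hX

theorem IsSolution.cdOn_v (hO : ∀ X ∈ O, chart ε X ∈ M2closed T R Z) :
    CDOn O (s + 2) (pull v ε) := hP.v_smooth.cdOn hO

theorem IsSolution.eq_fullOp {X : Coord} (hX : X ∈ region T R Z ε) :
    pull f ε X = fullOp G a ω ε (pull v ε) X := by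
  rw [← hP.setting.fullOp_eq hX ((hP.cdOn_v region_closed).mono (by omega : 2 ≤ s + 2) X hX) a ω]
  exact (hP.wave ε X hX).symm

theorem IsSolution.cdOn_fullOp (hO : ∀ X ∈ O, chart ε X ∈ M2closed T R Z) :
    CDOn O s (fullOp G a ω ε (pull v ε)) :=
  CDOn.waveOp (fun i j => (hP.cdOn_gUp hO i j).mono (Nat.le_succ s)) (hP.cdOn_firstCoef hO)
    (hP.ω_smooth.cdOn hO) (hP.cdOn_v hO)

/-- No regularity of f is assumed. The equation expresses it by v and the coefficients. -/
theorem IsSolution.cdOn_f : CDOn (region T R Z ε) s (pull f ε) :=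
  (hP.cdOn_fullOp region_closed).congr (hP.setting.cone.isOpen_region ε) fun _ hX => hP.eq_fullOp hX

end

/-- One constant for all coefficients, depending only on lam, s and the bounds A', B', D'. The lower
bound lam² of `upDet` permits the division. -/
theorem exists_coefBound (lam A' B' D' : ℝ) (s : ℕ) (hlam : 0 < lam) : ∃ Kg : ℝ, 0 ≤ Kg ∧
    ∀ (Λ A B D T R : ℝ) (G : BondiData) (Z : ℝ → S2 → ℝ) (a : VField) (ω v f : ST → ℝ)
      (ψ : ℝ → S2 → ℝ), IsSolution Λ lam A B D A' B' D' T R s G Z a ω v f ψ → ∀ ε,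
      (∀ i j, CB (region T R Z ε) (under T (pullI Z ε)) s Kg fun Y => gUp G ε Y i j) ∧
      (∀ j, CB (region T R Z ε) (under T (pullI Z ε)) s Kg (firstCoef G a ε j)) ∧
      CB (region T R Z ε) (under T (pullI Z ε)) s Kg (pull ω ε) := by
  set Kd : ℝ := 2 ^ (s + 1) * (|A'| * |A'|) + 2 ^ (s + 1) * (|A'| * |A'|) with hKd
  have hKd0 : 0 ≤ Kd := by positivity
  obtain ⟨Ki, hKi0, Hi⟩ := CB.inv s hKd0 (by positivity : 0 < lam ^ 2)
  set Kb : ℝ := 4 * (|A'| + 2 ^ s * (|1 / 2| * (2 ^ s * (Kd * (2 ^ s * (Ki * |A'|)))))) + |B'|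
    with hKb
  have hKb0 : 0 ≤ Kb := by positivity
  refine ⟨|A'| + Kb + |D'|, by positivity, ?_⟩
  intro Λ A B D T R G Z a ω v f ψ hP ε
  have hZ := hP.setting.cone
  have hO := hZ.isOpen_region ε
  have hB := hZ.under_subset_region ε
  -- One derivative more than in the conclusion, since the first order coefficients contain
  -- derivatives of g^{ij}.
  have cg : ∀ i j, CB (region T R Z ε) (under T (pullI Z ε)) (s + 1) |A'| fun Y => gUp G ε Y i j :=
    fun i j => CB.of_CBound hZ (hP.cdOn_gUp region_closed i j) (hP.metric i j)
  have cd : CB (region T R Z ε) (under T (pullI Z ε)) (s + 1) Kd (upDet G ε) := by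
    have h := ((cg 2 2).mul hO hB (abs_nonneg _) (abs_nonneg _) (cg 3 3)).add hO hB
      ((cg 2 3).mul hO hB (abs_nonneg _) (abs_nonneg _) (cg 2 3)).neg
    refine h.congr hO hB fun X _ => ?_
    unfold upDet
    ring
  have ci := Hi _ _ hO hB (upDet G ε) cd.of_succ
    (fun X hX => (hP.setting.upDet_pos (region_slab hX)).ne') fun X hX => hP.setting.le_upDet hX
  have ca : ∀ j, CB (region T R Z ε) (under T (pullI Z ε)) s |B'| fun Y => a.comp ε Y j := fun j =>
    CB.of_CBound hZ ((hP.a_smooth j).cdOn region_closed) (hP.a_bounds j)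
  have cω : CB (region T R Z ε) (under T (pullI Z ε)) s |D'| (pull ω ε) :=
    CB.of_CBound hZ (hP.ω_smooth.cdOn region_closed) hP.ω_bounds
  refine ⟨fun i j => (cg i j).of_succ.mono (by linarith [abs_nonneg D']), fun j => ?_,
    cω.mono (by linarith [abs_nonneg A'])⟩
  have h1 := CB.sum hO hB (Finset.univ : Finset (Fin 4)) fun i _ => ((cg i j).2.2 i).add hO hB
    ((CB.const s (1 / 2 : ℝ)).mul hO hB (abs_nonneg _) (by positivity)
      ((cd.2.2 i).mul hO hB hKd0 (by positivity)
        (ci.mul hO hB hKi0 (abs_nonneg _) (cg i j).of_succ))).neg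
  refine ((h1.add hO hB (ca j)).mono ?_).congr hO hB fun X _ => rfl
  have e : ((Finset.univ : Finset (Fin 4)).card : ℝ) = 4 := by simp
  rw [e, hKb]
  linarith [abs_nonneg A', abs_nonneg D']

/-! ### Pointwise bounds for the source terms -/

theorem sq_sum_abs_le {ι : Type*} (s : Finset ι) (x : ι → ℝ) :
    (∑ i ∈ s, |x i|) ^ 2 ≤ s.card * ∑ i ∈ s, x i ^ 2 := by
  have := sq_sum_le_card_mul_sum_sq (s := s) (f := fun i => |x i|)
  simpa only [sq_abs] using this

/-- The sum of the squares of the coordinate derivatives of order `n`. -/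
def sqs (n : ℕ) (u : Coord → ℝ) (X : Coord) : ℝ := ∑ l ∈ words (Fin 4) n, pdl l u X ^ 2

/-- The sum of the squares of the frame derivatives of order `n`. -/
def fqs (ε : Bool) (n : ℕ) (u : Coord → ℝ) (X : Coord) : ℝ := ∑ w ∈ words (Fin 5) n, frs ε w u X ^ 2

theorem sqs_nonneg (n : ℕ) (u : Coord → ℝ) (X : Coord) : 0 ≤ sqs n u X :=
  Finset.sum_nonneg fun _ _ => sq_nonneg _

theorem fqs_nonneg (ε : Bool) (n : ℕ) (u : Coord → ℝ) (X : Coord) : 0 ≤ fqs ε n u X :=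
  Finset.sum_nonneg fun _ _ => sq_nonneg _

theorem exists_cs_sq_le (n : ℕ) : ∃ C : ℝ, 0 ≤ C ∧ ∀ (u : Coord → ℝ) (X : Coord),
    cs n u X ^ 2 ≤ C * ∑ m ∈ Finset.range (n + 1), sqs m u X := by
  refine ⟨((Finset.range (n + 1)).sigma fun m => words (Fin 4) m).card, by positivity,
    fun u X => ?_⟩
  unfold cs sqs
  rw [Finset.sum_sigma', Finset.sum_sigma']
  exact sq_sum_abs_le _ _

theorem exists_fs_sq_le (n : ℕ) : ∃ C : ℝ, 0 ≤ C ∧ ∀ (ε : Bool) (u : Coord → ℝ) (X : Coord),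
    fs ε n u X ^ 2 ≤ C * ∑ m ∈ Finset.range (n + 1), fqs ε m u X := by
  refine ⟨((Finset.range (n + 1)).sigma fun m => words (Fin 5) m).card, by positivity,
    fun ε u X => ?_⟩
  unfold fs fqs
  rw [Finset.sum_sigma', Finset.sum_sigma']
  exact sq_sum_abs_le _ _

theorem exists_sqs_le_fqs (n : ℕ) : ∃ C : ℝ, 0 ≤ C ∧
    ∀ O B : Set Coord, IsOpen O → B ⊆ O → (∀ X ∈ B, X 2 ^ 2 + X 3 ^ 2 ≤ 1) →
    ∀ (ε : Bool) (u : Coord → ℝ), CDOn O n u → ∀ X ∈ B, ∀ l : List (Fin 4), l.length ≤ n →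
    pdl l u X ^ 2 ≤ C * ∑ m ∈ Finset.range (n + 1), fqs ε m u X := by
  obtain ⟨C₁, h1, H₁⟩ := exists_pdl_le_fs n
  obtain ⟨C₂, h2, H₂⟩ := exists_fs_sq_le n
  refine ⟨C₁ ^ 2 * C₂, by positivity, fun O B hO hB hd ε u hu X hX l hl => ?_⟩
  rw [← sq_abs]
  calc |pdl l u X| ^ 2 ≤ (C₁ * fs ε n u X) ^ 2 :=
        pow_le_pow_left₀ (abs_nonneg _) (H₁ O B hO hB hd ε u l hl hu X hX) 2
    _ = C₁ ^ 2 * fs ε n u X ^ 2 := by ring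
    _ ≤ C₁ ^ 2 * (C₂ * ∑ m ∈ Finset.range (n + 1), fqs ε m u X) :=
        mul_le_mul_of_nonneg_left (H₂ ε u X) (sq_nonneg _)
    _ = _ := by ring

theorem exists_frs_sq_le (m i : ℕ) : ∃ C : ℝ, 0 ≤ C ∧
    ∀ O B : Set Coord, IsOpen O → B ⊆ O → (∀ X ∈ B, X 2 ^ 2 + X 3 ^ 2 ≤ 1) →
    ∀ (ε : Bool) (u : Coord → ℝ) (w : List (Fin 5)) (l : List (Fin 4)), w.length = m →
    l.length = i → CDOn O (m + i) u → ∀ X ∈ B,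
    pdl l (frs ε w u) X ^ 2 ≤ C * ∑ n ∈ Finset.range (m + i + 1), sqs n u X := by
  obtain ⟨C₁, h1, H₁⟩ := exists_pdl_frs_le m i
  obtain ⟨C₂, h2, H₂⟩ := exists_cs_sq_le (m + i)
  refine ⟨C₁ ^ 2 * C₂, by positivity, fun O B hO hB hd ε u w l hw hl hu X hX => ?_⟩
  rw [← sq_abs]
  calc |pdl l (frs ε w u) X| ^ 2 ≤ (C₁ * cs (m + i) u X) ^ 2 :=
        pow_le_pow_left₀ (abs_nonneg _) (H₁ O B hO hB hd ε u w l hw hl hu X hX) 2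
    _ = C₁ ^ 2 * cs (m + i) u X ^ 2 := by ring
    _ ≤ C₁ ^ 2 * (C₂ * ∑ n ∈ Finset.range (m + i + 1), sqs n u X) :=
        mul_le_mul_of_nonneg_left (H₂ u X) (sq_nonneg _)
    _ = _ := by ring

/-- The square of an operator of order `n + 1`, with the leading term separated. -/
theorem exists_op_sq_le (n N : ℕ) (K₀ : ℝ) (hK0 : 0 ≤ K₀) : ∃ C₀ : ℝ, 0 ≤ C₀ ∧ ∀ K : ℝ, 0 ≤ K →
    ∃ C : ℝ, 0 ≤ C ∧ ∀ O B : Set Coord, B ⊆ O → ∀ (u e : Coord → ℝ) (r : ℕ),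
    Op O B u K₀ K (n + 1) r N e → ∀ X ∈ B,
    e X ^ 2 ≤ C₀ * sqs (n + 1) u X + C * ∑ m ∈ Finset.range (n + 1), sqs m u X := by
  obtain ⟨C₁, h1, H₁⟩ := exists_cs_sq_le n
  refine ⟨2 * ((N : ℝ) * K₀) ^ 2 * (words (Fin 4) (n + 1)).card, by positivity, fun K hK =>
    ⟨2 * ((N : ℝ) * K) ^ 2 * C₁, by positivity, fun O B hB u e r h X hX => ?_⟩⟩
  have h2 := h.abs_le hB hK0 hK X hX
  change |e X| ≤ (N : ℝ) * (K₀ * ∑ l ∈ words (Fin 4) (n + 1), |pdl l u X| + K * cs n u X) at h2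
  set P := ∑ l ∈ words (Fin 4) (n + 1), |pdl l u X|
  have hPs : P ^ 2 ≤ (words (Fin 4) (n + 1)).card * sqs (n + 1) u X := sq_sum_abs_le _ _
  rw [← sq_abs]
  calc |e X| ^ 2 ≤ ((N : ℝ) * (K₀ * P + K * cs n u X)) ^ 2 :=
        pow_le_pow_left₀ (abs_nonneg _) h2 2
    _ ≤ 2 * ((N : ℝ) * K₀) ^ 2 * P ^ 2 + 2 * ((N : ℝ) * K) ^ 2 * cs n u X ^ 2 := by
        linarith [sq_nonneg ((N : ℝ) * K₀ * P - (N : ℝ) * K * cs n u X)]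
    _ ≤ 2 * ((N : ℝ) * K₀) ^ 2 * ((words (Fin 4) (n + 1)).card * sqs (n + 1) u X)
        + 2 * ((N : ℝ) * K) ^ 2 * (C₁ * ∑ m ∈ Finset.range (n + 1), sqs m u X) := by
        gcongr
        exact H₁ u X
    _ = _ := by ring

/-! ### Comparison of weighted integrals -/

/-- A pointwise comparison, integrated and summed over the two hemispheres. It serves the region,
the boundary at infinity and the null hypersurface alike. -/
theorem sum_setIntegral_le {α ι : Type*} [MeasurableSpace α] {μ : Measure α} {S : Bool → Set α}
    (hS : ∀ ε, MeasurableSet (S ε)) (s : Finset ι) (c : ι → ℝ) {F : Bool → α → ℝ}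
    {W : ι → Bool → α → ℝ} (hF : ∀ ε, IntegrableOn (F ε) (S ε) μ)
    (hW : ∀ i ∈ s, ∀ ε, IntegrableOn (W i ε) (S ε) μ)
    (h : ∀ ε, ∀ x ∈ S ε, F ε x ≤ ∑ i ∈ s, c i * W i ε x) :
    ∑ ε, ∫ x in S ε, F ε x ∂μ ≤ ∑ i ∈ s, c i * ∑ ε, ∫ x in S ε, W i ε x ∂μ := by
  simp only [Finset.mul_sum]
  rw [Finset.sum_comm]
  refine Finset.sum_le_sum fun ε _ => ?_
  have hi : ∀ i ∈ s, IntegrableOn (fun x => c i * W i ε x) (S ε) μ := fun i hi =>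
    (hW i hi ε).const_mul (c i)
  calc ∫ x in S ε, F ε x ∂μ ≤ ∫ x in S ε, ∑ i ∈ s, c i * W i ε x ∂μ :=
        setIntegral_mono_on (hF ε) (integrable_finsetSum _ hi) (hS ε) (h ε)
    _ = _ := by
        rw [integral_finsetSum _ hi]
        exact Finset.sum_congr rfl fun i _ => integral_const_mul _ _

/-- The weighted integral of `u` over the region can be computed. -/
def IntegrableM2 (G : BondiData) (T : ℝ) (Z : ℝ → S2 → ℝ) (q l : ℝ) (u : Bool → Coord → ℝ) :
    Prop :=
  ∀ ε, IntegrableOn (fun X => wt q l X * u ε X * volDensity G ε X) (under T (pullI Z ε))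

/-- The weighted integral of `u` over the boundary at infinity can be computed. -/
def IntegrableI (G : BondiData) (T q l : ℝ) (u : Bool → Coord → ℝ) : Prop :=
  ∀ ε, IntegrableOn (fun Y => wt q l (liftI Y) * u ε (liftI Y) * volDensity G ε (liftI Y))
    (tanCell T)

section

variable {Λ lam A T R : ℝ} {k : ℕ} {G : BondiData} {Z : ℝ → S2 → ℝ}
  (hS : IsSetting Λ lam A T R k G Z)
include hS

theorem IsSetting.integrableM2 {u : Bool → Coord → ℝ}
    (hu : ∀ ε, ∀ X ∈ underc T (pullI Z ε), ContinuousAt (u ε) X) (q l : ℝ) :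
    IntegrableM2 G T Z q l u := fun ε =>
  hS.integrableOn_volDensity (F := fun X => wt q l X * u ε X) fun X hX =>
    (contDiff_wt q l).continuous.continuousAt.mul (hu ε X hX)

theorem IsSetting.integrableM2_congr {u u' : Bool → Coord → ℝ} {q l : ℝ}
    (h : ∀ ε, ∀ X ∈ under T (pullI Z ε), u ε X = u' ε X) (hu : IntegrableM2 G T Z q l u) :
    IntegrableM2 G T Z q l u' := fun ε =>
  (hu ε).congr_fun (fun X hX => by simp only [h ε X hX]) (hS.cone.isGraph ε).measurableSet_under

theorem IsSetting.integrableI {u : Bool → Coord → ℝ}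
    (hu : ∀ ε, ∀ X ∈ underc T (pullI Z ε), ContinuousAt (u ε) X) (q l : ℝ) :
    IntegrableI G T q l u := fun ε =>
  hS.integrableOn_liftI_volDensity (ε := ε) (F := fun X => wt q l X * u ε X) fun X hX =>
    (contDiff_wt q l).continuous.continuousAt.mul (hu ε X hX)

theorem IsSetting.intM2_le_sum {ι : Type*} (s : Finset ι) (c : ι → ℝ) {q l : ℝ}
    {F : Bool → Coord → ℝ} {W : ι → Bool → Coord → ℝ} (hF : IntegrableM2 G T Z q l F)
    (hW : ∀ i ∈ s, IntegrableM2 G T Z q l (W i))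
    (h : ∀ ε, ∀ X ∈ under T (pullI Z ε), F ε X ≤ ∑ i ∈ s, c i * W i ε X) :
    intM2 G T R Z (fun ε X => wt q l X * F ε X)
      ≤ ∑ i ∈ s, c i * intM2 G T R Z (fun ε X => wt q l X * W i ε X) := by
  simp only [hS.cone.intM2_eq]
  refine sum_setIntegral_le (fun ε => (hS.cone.isGraph ε).measurableSet_under) s c hF hW
    fun ε X hX => ?_
  have hρ : 0 ≤ wt q l X * volDensity G ε X :=
    mul_nonneg (wt_pos q l X).le (hS.ads.volDensity_pos (hS.slab_of_under hX)).le
  calc wt q l X * F ε X * volDensity G ε X = wt q l X * volDensity G ε X * F ε X := by ring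
    _ ≤ wt q l X * volDensity G ε X * ∑ i ∈ s, c i * W i ε X :=
        mul_le_mul_of_nonneg_left (h ε X hX) hρ
    _ = _ := by
        rw [Finset.mul_sum]
        exact Finset.sum_congr rfl fun i _ => by ring

theorem IsSetting.intI_le_sum {ι : Type*} (s : Finset ι) (c : ι → ℝ) {q l : ℝ}
    {F : Bool → Coord → ℝ} {W : ι → Bool → Coord → ℝ} (hF : IntegrableI G T q l F)
    (hW : ∀ i ∈ s, IntegrableI G T q l (W i))
    (h : ∀ ε, ∀ Y ∈ tanCell T, F ε (liftI Y) ≤ ∑ i ∈ s, c i * W i ε (liftI Y)) :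
    intI G T (fun ε X => wt q l X * F ε X)
      ≤ ∑ i ∈ s, c i * intI G T (fun ε X => wt q l X * W i ε X) := by
  refine sum_setIntegral_le (fun _ => measurableSet_tanCell T) s c hF hW fun ε Y hY => ?_
  have hρ : 0 ≤ wt q l (liftI Y) * volDensity G ε (liftI Y) :=
    mul_nonneg (wt_pos q l _).le (hS.ads.volDensity_pos (hS.cone.underc_slab
      (hS.liftI_mem (ε := ε) (tanCell_subset_tanCellc T hY)))).le
  calc wt q l (liftI Y) * F ε (liftI Y) * volDensity G ε (liftI Y)
      = wt q l (liftI Y) * volDensity G ε (liftI Y) * F ε (liftI Y) := by ring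
    _ ≤ wt q l (liftI Y) * volDensity G ε (liftI Y) * ∑ i ∈ s, c i * W i ε (liftI Y) :=
        mul_le_mul_of_nonneg_left (h ε Y hY) hρ
    _ = ∑ i ∈ s, c i * (wt q l (liftI Y) * W i ε (liftI Y) * volDensity G ε (liftI Y)) := by
        rw [Finset.mul_sum]
        exact Finset.sum_congr rfl fun i _ => by ring

theorem IsSetting.intH_energyH_le_sum {ι : Type*} (s : Finset ι) (c : ι → ℝ) {q l : ℝ}
    {φ : Bool → Coord → ℝ} {χ : ι → Bool → Coord → ℝ}
    (hφ : ∀ ε, ∀ X ∈ underc T (pullI Z ε), ContDiffAt ℝ 2 (φ ε) X)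
    (hχ : ∀ i ∈ s, ∀ ε, ∀ X ∈ underc T (pullI Z ε), ContDiffAt ℝ 2 (χ i ε) X)
    (h : ∀ ε, ∀ Y ∈ tanCell T, energyH G Z ε (φ ε) 1 1 (liftH Z ε Y)
      ≤ ∑ i ∈ s, c i * energyH G Z ε (χ i ε) 1 1 (liftH Z ε Y)) :
    intH G T Z (fun ε X => wt q l X * energyH G Z ε (φ ε) 1 1 X)
      ≤ ∑ i ∈ s, c i * intH G T Z (fun ε X => wt q l X * energyH G Z ε (χ i ε) 1 1 X) := by
  refine sum_setIntegral_le (fun _ => measurableSet_tanCell T) s c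
    (fun ε => hS.integrableOn_energyH (hφ ε) q l)
    (fun i hi ε => hS.integrableOn_energyH (hχ i hi ε) q l) fun ε Y hY => ?_
  have hρ : 0 ≤ wt q l (liftH Z ε Y) * volDensity G ε (liftH Z ε Y) :=
    mul_nonneg (wt_pos q l _).le (hS.ads.volDensity_pos (hS.cone.underc_slab
      (hS.liftH_mem (ε := ε) (tanCell_subset_tanCellc T hY)))).le
  calc wt q l (liftH Z ε Y) * energyH G Z ε (φ ε) 1 1 (liftH Z ε Y) * volDensity G ε (liftH Z ε Y)
      = wt q l (liftH Z ε Y) * volDensity G ε (liftH Z ε Y)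
        * energyH G Z ε (φ ε) 1 1 (liftH Z ε Y) := by ring
    _ ≤ wt q l (liftH Z ε Y) * volDensity G ε (liftH Z ε Y)
        * ∑ i ∈ s, c i * energyH G Z ε (χ i ε) 1 1 (liftH Z ε Y) :=
        mul_le_mul_of_nonneg_left (h ε Y hY) hρ
    _ = ∑ i ∈ s, c i * (wt q l (liftH Z ε Y) * energyH G Z ε (χ i ε) 1 1 (liftH Z ε Y)
        * volDensity G ε (liftH Z ε Y)) := by
        rw [Finset.mul_sum]
        exact Finset.sum_congr rfl fun i _ => by ring

end

/-! ### Energy densities of the frame derivatives -/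

/-- The sum of the squares of the gradients of the frame derivatives of order `n`. -/
def gdens (ε : Bool) (n : ℕ) (u : Coord → ℝ) (X : Coord) : ℝ :=
  ∑ w ∈ words (Fin 5) n, ∑ i, pd i (frs ε w u) X ^ 2

/-- The energy density of the frame derivatives of order `n`. -/
def dens (ε : Bool) (n : ℕ) (u : Coord → ℝ) (X : Coord) : ℝ :=
  ∑ w ∈ words (Fin 5) n, ((∑ i, pd i (frs ε w u) X ^ 2) + frs ε w u X ^ 2)

theorem gdens_nonneg (ε : Bool) (n : ℕ) (u : Coord → ℝ) (X : Coord) : 0 ≤ gdens ε n u X :=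
  Finset.sum_nonneg fun _ _ => Finset.sum_nonneg fun _ _ => sq_nonneg _

theorem dens_eq (ε : Bool) (n : ℕ) (u : Coord → ℝ) (X : Coord) :
    dens ε n u X = gdens ε n u X + fqs ε n u X := Finset.sum_add_distrib

theorem dens_nonneg (ε : Bool) (n : ℕ) (u : Coord → ℝ) (X : Coord) : 0 ≤ dens ε n u X :=
  dens_eq ε n u X ▸ add_nonneg (gdens_nonneg ε n u X) (fqs_nonneg ε n u X)

theorem words_zero {κ : Type} [Fintype κ] [DecidableEq κ] : words κ 0 = {[]} := by
  ext l
  rw [mem_words, List.length_eq_zero_iff, Finset.mem_singleton]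

theorem fqs_zero (ε : Bool) (u : Coord → ℝ) (X : Coord) : fqs ε 0 u X = u X ^ 2 := by
  unfold fqs
  rw [words_zero, Finset.sum_singleton]
  rfl

theorem exists_fqs_succ_le (n : ℕ) : ∃ C : ℝ, 0 ≤ C ∧ ∀ (ε : Bool) (u : Coord → ℝ) (X : Coord),
    X 2 ^ 2 + X 3 ^ 2 ≤ 1 → fqs ε (n + 1) u X ≤ C * gdens ε n u X := by
  obtain ⟨Kf, h0, hf⟩ := exists_frameBound 0
  refine ⟨(words (Fin 5) (n + 1)).card * (4 * Kf ^ 2), by positivity, fun ε u X hX => ?_⟩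
  have hb : ∀ a j, |frameCoef ε a j X| ≤ Kf := fun a j =>
    (hf univ {X | X 2 ^ 2 + X 3 ^ 2 ≤ 1} isOpen_univ (subset_univ _) (fun _ h => h) ε a j).bound X hX
  unfold fqs
  rw [mul_assoc, ← nsmul_eq_mul]
  refine Finset.sum_le_card_nsmul _ _ _ fun w hw => ?_
  obtain ⟨a, w, rfl⟩ := List.exists_cons_of_length_eq_add_one (mem_words.1 hw)
  have hw' : w ∈ words (Fin 5) n := mem_words.2 (by simpa using mem_words.1 hw)
  calc frs ε (a :: w) u X ^ 2 = (∑ j, frameCoef ε a j X * pd j (frs ε w u) X) ^ 2 := rfl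
    _ ≤ (∑ j, frameCoef ε a j X ^ 2) * ∑ j, pd j (frs ε w u) X ^ 2 :=
        Finset.sum_mul_sq_le_sq_mul_sq _ _ _
    _ ≤ (∑ _j : Fin 4, Kf ^ 2) * ∑ j, pd j (frs ε w u) X ^ 2 := by
        refine mul_le_mul_of_nonneg_right (Finset.sum_le_sum fun j _ => ?_)
          (Finset.sum_nonneg fun _ _ => sq_nonneg _)
        exact sq_le_sq' (abs_le.1 (hb a j)).1 (abs_le.1 (hb a j)).2
    _ = 4 * Kf ^ 2 * ∑ j, pd j (frs ε w u) X ^ 2 := by simp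
    _ ≤ 4 * Kf ^ 2 * gdens ε n u X := by
        refine mul_le_mul_of_nonneg_left ?_ (by positivity)
        exact Finset.single_le_sum (f := fun w => ∑ j, pd j (frs ε w u) X ^ 2)
          (fun _ _ => Finset.sum_nonneg fun _ _ => sq_nonneg _) hw'

/-- Every frame word of positive length is bounded by a gradient of a shorter one. Only the value of
u itself is not covered, and at infinity it is part of the Dirichlet data. -/
theorem exists_pdl_sq_le_gdens (p : ℕ) : ∃ C : ℝ, 0 ≤ C ∧
    ∀ O B : Set Coord, IsOpen O → B ⊆ O → (∀ X ∈ B, X 2 ^ 2 + X 3 ^ 2 ≤ 1) →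
    ∀ (ε : Bool) (u : Coord → ℝ), CDOn O p u → ∀ X ∈ B, ∀ l : List (Fin 4), l.length ≤ p →
    pdl l u X ^ 2 ≤ C * (u X ^ 2 + ∑ n ∈ Finset.range p, gdens ε n u X) := by
  obtain ⟨C₁, h1, H₁⟩ := exists_sqs_le_fqs p
  choose C₂ h2 H₂ using exists_fqs_succ_le
  have hs : 0 ≤ ∑ n ∈ Finset.range p, C₂ n := Finset.sum_nonneg fun n _ => h2 n
  refine ⟨C₁ * (1 + ∑ n ∈ Finset.range p, C₂ n), by positivity, ?_⟩
  intro O B hO hB hd ε u hu X hX l hl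
  refine (H₁ O B hO hB hd ε u hu X hX l hl).trans ?_
  rw [mul_assoc]
  refine mul_le_mul_of_nonneg_left ?_ h1
  rw [Finset.sum_range_succ', fqs_zero]
  set g := ∑ n ∈ Finset.range p, gdens ε n u X
  have hg : 0 ≤ g := Finset.sum_nonneg fun n _ => gdens_nonneg ε n u X
  have h3 : ∑ n ∈ Finset.range p, fqs ε (n + 1) u X ≤ (∑ n ∈ Finset.range p, C₂ n) * g := by
    rw [Finset.sum_mul]
    refine Finset.sum_le_sum fun n hn => (H₂ n ε u X (hd X hX)).trans
      (mul_le_mul_of_nonneg_left ?_ (h2 n))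
    exact Finset.single_le_sum (f := fun n => gdens ε n u X) (fun n _ => gdens_nonneg ε n u X) hn
  have h4 : 0 ≤ (∑ n ∈ Finset.range p, C₂ n) * u X ^ 2 := mul_nonneg hs (sq_nonneg _)
  linarith

theorem exists_pdl_sq_le_dens (p : ℕ) : ∃ C : ℝ, 0 ≤ C ∧
    ∀ O B : Set Coord, IsOpen O → B ⊆ O → (∀ X ∈ B, X 2 ^ 2 + X 3 ^ 2 ≤ 1) →
    ∀ (ε : Bool) (u : Coord → ℝ), CDOn O (p + 1) u → ∀ X ∈ B, ∀ l : List (Fin 4),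
    l.length ≤ p + 1 → pdl l u X ^ 2 ≤ C * ∑ n ∈ Finset.range (p + 1), dens ε n u X := by
  obtain ⟨C, h, H⟩ := exists_pdl_sq_le_gdens (p + 1)
  refine ⟨C, h, fun O B hO hB hd ε u hu X hX l hl => (H O B hO hB hd ε u hu X hX l hl).trans
    (mul_le_mul_of_nonneg_left ?_ h)⟩
  simp only [dens_eq, Finset.sum_add_distrib]
  have := Finset.single_le_sum (f := fun n => fqs ε n u X) (s := Finset.range (p + 1))
    (fun n _ => fqs_nonneg ε n u X) (Finset.mem_range.2 (Nat.succ_pos p))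
  simp only [fqs_zero] at this
  linarith

theorem exists_sum_sqs_le (p : ℕ) : ∃ C : ℝ, 0 ≤ C ∧
    ∀ O B : Set Coord, IsOpen O → B ⊆ O → (∀ X ∈ B, X 2 ^ 2 + X 3 ^ 2 ≤ 1) →
    ∀ (ε : Bool) (u : Coord → ℝ), CDOn O (p + 1) u → ∀ X ∈ B,
    ∑ n ∈ Finset.range (p + 2), sqs n u X ≤ C * ∑ n ∈ Finset.range (p + 1), dens ε n u X := by
  obtain ⟨C, h, H⟩ := exists_pdl_sq_le_dens p
  refine ⟨((Finset.range (p + 2)).sigma fun n => words (Fin 4) n).card * C, by positivity, ?_⟩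
  intro O B hO hB hd ε u hu X hX
  unfold sqs
  rw [Finset.sum_sigma', mul_assoc, ← nsmul_eq_mul]
  refine Finset.sum_le_card_nsmul _ _ _ fun x hx => H O B hO hB hd ε u hu X hX x.2 ?_
  rw [Finset.mem_sigma, mem_words, Finset.mem_range] at hx
  omega

/-- The source term of the equation for a frame derivative of order `m`. -/
theorem exists_source_le (lam A : ℝ) (hlam : 0 < lam) (s m : ℕ) (hm : m ≤ s) :
    ∃ c₀ : ℝ, 0 ≤ c₀ ∧ ∀ A' B' D' : ℝ, ∃ C : ℝ, 0 ≤ C ∧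
    ∀ (Λ B D T R : ℝ) (G : BondiData) (Z : ℝ → S2 → ℝ) (a : VField) (ω v f : ST → ℝ)
      (ψ : ℝ → S2 → ℝ), IsSolution Λ lam A B D A' B' D' T R s G Z a ω v f ψ → ∀ ε,
    ∀ w : List (Fin 5), w.length = m → ∀ X ∈ under T (pullI Z ε),
    fullOp G a ω ε (frs ε w (pull v ε)) X ^ 2
      ≤ C * ∑ n ∈ Finset.range (m + 1), sqs n (pull f ε) X + c₀ * dens ε m (pull v ε) X
        + C * ∑ n ∈ Finset.range m, dens ε n (pull v ε) X := by
  cases m with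
  | zero =>
    -- For the empty word there is no commutator, and the equation itself identifies the source with
    -- f.
    refine ⟨0, le_rfl, fun _ _ _ => ⟨1, zero_le_one, ?_⟩⟩
    intro Λ B D T R G Z a ω v f ψ hP ε w hw X hX
    rw [List.length_eq_zero_iff.1 hw]
    simp only [zero_add, Finset.range_one, Finset.sum_singleton, Finset.range_zero,
      Finset.sum_empty, mul_zero, add_zero, one_mul, zero_mul, sqs, words_zero]
    change fullOp G a ω ε (pull v ε) X ^ 2 ≤ pull f ε X ^ 2
    rw [hP.eq_fullOp (hP.setting.cone.under_subset_region ε hX)]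
  | succ m =>
    obtain ⟨N, K₀, hK0, H⟩ := exists_op_commutator s |A| (abs_nonneg A) (m + 1) hm
    obtain ⟨C₀, h0, H₀⟩ := exists_op_sq_le (m + 1) N K₀ hK0
    obtain ⟨C₁, h1, H₁⟩ := exists_sum_sqs_le (m + 1)
    obtain ⟨C₂, h2, H₂⟩ := exists_sum_sqs_le m
    obtain ⟨C₃, h3, H₃⟩ := exists_frs_sq_le (m + 1) 0
    -- The coefficient of the energy of order m + 1 comes from the leading part of the commutator.
    -- It is chosen before A', B', D' enter.
    refine ⟨2 * (C₀ * C₁), by positivity, fun A' B' D' => ?_⟩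
    obtain ⟨Kg, hKg, Hg⟩ := exists_coefBound lam A' B' D' s hlam
    obtain ⟨K, hK, H⟩ := H Kg hKg
    obtain ⟨C₄, h4, H₄⟩ := H₀ K hK
    refine ⟨2 * C₃ + 2 * (C₀ * C₁) + 2 * (C₄ * C₂), by positivity, ?_⟩
    intro Λ B D T R G Z a ω v f ψ hP ε w hw X hX
    have hZ := hP.setting.cone
    have hO := hZ.isOpen_region ε
    have hB := hZ.under_subset_region ε
    have hd : ∀ X ∈ under T (pullI Z ε), X 2 ^ 2 + X 3 ^ 2 ≤ 1 := fun X hX => hX.2.2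
    obtain ⟨cg, cb, cω⟩ := Hg _ _ _ _ _ _ _ _ _ _ _ _ _ hP ε
    have hv : CDOn (region T R Z ε) (s + 2) (pull v ε) := hP.cdOn_v region_closed
    have op := H (region T R Z ε) (under T (pullI Z ε)) hO hB hd ε (fun i j Y => gUp G ε Y i j)
      (firstCoef G a ε) (pull ω ε) (pull v ε) (fun i j => (hP.cdOn_gUp region_closed i j).mono (Nat.le_succ s))
      (hP.cdOn_firstCoef region_closed) (hP.ω_smooth.cdOn region_closed) cg cb cω
      (fun i j X hX => (hP.setting.abs_gUp_le hX i j).trans (le_abs_self A))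
      (fun i j c X hX => (hP.setting.abs_pd_gUp_le hX i j c).trans (le_abs_self A)) hv w hw
    have e1 := H₄ _ _ hB _ _ _ op X hX
    have e2 := H₁ _ _ hO hB hd ε _ (hv.mono (by omega)) X hX
    have e3 := H₂ _ _ hO hB hd ε _ (hv.mono (by omega)) X hX
    have e4 := H₃ _ _ hO hB hd ε (pull f ε) w [] hw rfl
      (hP.cdOn_f.mono (by omega)) X hX
    have e5 : frs ε w (waveOp (fun i j Y => gUp G ε Y i j) (firstCoef G a ε) (pull ω ε)
        (pull v ε)) X = frs ε w (pull f ε) X :=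
      (frs_eq_of_isOpen hO (fun Y hY => hP.eq_fullOp hY) ε w X (hB hX)).symm
    rw [e5] at e1
    rw [add_zero] at e4
    change frs ε w (pull f ε) X ^ 2 ≤ _ at e4
    change waveOp (fun i j Y => gUp G ε Y i j) (firstCoef G a ε) (pull ω ε)
      (frs ε w (pull v ε)) X ^ 2 ≤ _
    set x := waveOp (fun i j Y => gUp G ε Y i j) (firstCoef G a ε) (pull ω ε)
      (frs ε w (pull v ε)) X
    set y := frs ε w (pull f ε) X
    -- Here x is the operator applied to X_w v and y = X_w f, so x - y is the commutator. The bound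
    -- follows from x² ≤ 2y² + 2(x - y)².
    have e6 : sqs (m + 1 + 1) (pull v ε) X ≤ ∑ n ∈ Finset.range (m + 1 + 2), sqs n (pull v ε) X :=
      Finset.single_le_sum (f := fun n => sqs n (pull v ε) X) (fun n _ => sqs_nonneg _ _ _)
        (Finset.mem_range.2 (by omega))
    rw [Finset.sum_range_succ (fun n => dens ε n (pull v ε) X)] at e2
    obtain ⟨F, hF⟩ : ∃ F, F = ∑ n ∈ Finset.range (m + 1 + 1), sqs n (pull f ε) X := ⟨_, rfl⟩
    obtain ⟨d, hd'⟩ : ∃ d, d = dens ε (m + 1) (pull v ε) X := ⟨_, rfl⟩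
    obtain ⟨S, hS'⟩ : ∃ S, S = ∑ n ∈ Finset.range (m + 1), dens ε n (pull v ε) X := ⟨_, rfl⟩
    have hF0 : 0 ≤ F := hF ▸ Finset.sum_nonneg fun n _ => sqs_nonneg _ _ _
    have hS0 : 0 ≤ S := hS' ▸ Finset.sum_nonneg fun n _ => dens_nonneg _ _ _ _
    rw [← hd', ← hS'] at e2
    rw [← hS'] at e3
    rw [← hF] at e4
    rw [← hF, ← hd', ← hS']
    have e7 : (x - y) ^ 2 ≤ C₀ * (C₁ * (S + d)) + C₄ * (C₂ * S) := by
      refine e1.trans (add_le_add (mul_le_mul_of_nonneg_left (e6.trans e2) h0)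
        (mul_le_mul_of_nonneg_left e3 h4))
    have p1 : 0 ≤ C₃ * S := mul_nonneg h3 hS0
    have p2 : 0 ≤ C₀ * C₁ * F := by positivity
    have p3 : 0 ≤ C₄ * C₂ * F := by positivity
    linarith [sq_nonneg (x - 2 * y)]

/-! ### The energy of the frame derivatives on the null hypersurface -/

/-- A quadratic form in the derivatives of first order and the value of a function. -/
def quadE (c : Fin 4 → ℝ) (L : Fin 4 → Fin 4 → ℝ) (κ : ℝ) (φ : Coord → ℝ) (X : Coord) : ℝ :=
  ∑ r, c r * (∑ i, L r i * pd i φ X) ^ 2 + κ * φ X ^ 2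

section

variable {c : Fin 4 → ℝ} {L : Fin 4 → Fin 4 → ℝ} {κ : ℝ} {X : Coord}

theorem quadE_nonneg (hc : ∀ r, 0 ≤ c r) (hκ : 0 ≤ κ) (φ : Coord → ℝ) :
    0 ≤ quadE c L κ φ X :=
  add_nonneg (Finset.sum_nonneg fun r _ => mul_nonneg (hc r) (sq_nonneg _))
    (mul_nonneg hκ (sq_nonneg _))

theorem quadE_congr {u v : Coord → ℝ} (h : u =ᶠ[𝓝 X] v) : quadE c L κ u X = quadE c L κ v X := by
  unfold quadE
  simp only [pd_congr h, h.eq_of_nhds]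

theorem quadE_zero : quadE c L κ (fun _ => 0) X = 0 := by
  unfold quadE
  simp [pd_const]

theorem quadE_add_le (hc : ∀ r, 0 ≤ c r) (hκ : 0 ≤ κ) {u v : Coord → ℝ}
    (hu : DifferentiableAt ℝ u X) (hv : DifferentiableAt ℝ v X) :
    quadE c L κ (fun Y => u Y + v Y) X ≤ 2 * quadE c L κ u X + 2 * quadE c L κ v X := by
  have h1 : ∀ r, c r * (∑ i, L r i * pd i (fun Y => u Y + v Y) X) ^ 2
      ≤ 2 * (c r * (∑ i, L r i * pd i u X) ^ 2) + 2 * (c r * (∑ i, L r i * pd i v X) ^ 2) := by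
    intro r
    simp only [pd_add _ hu hv, mul_add, Finset.sum_add_distrib]
    have := mul_nonneg (hc r) (sq_nonneg (∑ i, L r i * pd i u X - ∑ i, L r i * pd i v X))
    linarith
  have h2 := Finset.sum_le_sum fun r (_ : r ∈ Finset.univ) => h1 r
  rw [Finset.sum_add_distrib, ← Finset.mul_sum, ← Finset.mul_sum] at h2
  unfold quadE
  have := mul_nonneg hκ (sq_nonneg (u X - v X))
  linarith

/-- The derivative of the factor b contributes u² (L b)², and the hypothesis L² ≤ C κ lets the term
κ u² of the same form absorb it. No bound of L itself is needed. -/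
theorem quadE_mul_le (hc : ∀ r, 0 ≤ c r) (hc1 : ∀ r, c r ≤ 1) (hκ : 0 ≤ κ) {C : ℝ} (hC : 0 ≤ C)
    (hL : ∀ r i, L r i ^ 2 ≤ C * κ) {u b : Coord → ℝ}
    (hu : DifferentiableAt ℝ u X) (hb : DifferentiableAt ℝ b X) {K : ℝ} (hK : |b X| ≤ K)
    (hK' : ∀ i, |pd i b X| ≤ K) :
    quadE c L κ (fun Y => b Y * u Y) X ≤ (2 + 128 * C) * K ^ 2 * quadE c L κ u X := by
  have hbK : b X ^ 2 ≤ K ^ 2 := sq_le_sq' (abs_le.1 hK).1 (abs_le.1 hK).2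
  have hb2 : ∀ r, (∑ i, L r i * pd i b X) ^ 2 ≤ 16 * C * κ * K ^ 2 := by
    intro r
    calc (∑ i, L r i * pd i b X) ^ 2 ≤ (∑ i, L r i ^ 2) * ∑ i, pd i b X ^ 2 :=
          Finset.sum_mul_sq_le_sq_mul_sq _ _ _
      _ ≤ (∑ _i : Fin 4, C * κ) * ∑ _i : Fin 4, K ^ 2 := by
          refine mul_le_mul (Finset.sum_le_sum fun i _ => hL r i) (Finset.sum_le_sum fun i _ => ?_)
            (Finset.sum_nonneg fun _ _ => sq_nonneg _)
            (Finset.sum_nonneg fun _ _ => mul_nonneg hC hκ)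
          exact sq_le_sq' (abs_le.1 (hK' i)).1 (abs_le.1 (hK' i)).2
      _ = 16 * C * κ * K ^ 2 := by simp; ring
  have h1 : ∀ r, c r * (∑ i, L r i * pd i (fun Y => b Y * u Y) X) ^ 2
      ≤ 2 * K ^ 2 * (c r * (∑ i, L r i * pd i u X) ^ 2) + 32 * C * κ * K ^ 2 * u X ^ 2 := by
    intro r
    have e : ∑ i, L r i * pd i (fun Y => b Y * u Y) X
        = u X * (∑ i, L r i * pd i b X) + b X * ∑ i, L r i * pd i u X := by
      simp only [pd_mul _ hb hu, Finset.mul_sum, ← Finset.sum_add_distrib]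
      exact Finset.sum_congr rfl fun i _ => by ring
    rw [e]
    set p := ∑ i, L r i * pd i b X
    set s := ∑ i, L r i * pd i u X
    have h2 : (u X * p + b X * s) ^ 2 ≤ 2 * (u X ^ 2 * p ^ 2) + 2 * (b X ^ 2 * s ^ 2) := by
      linarith [sq_nonneg (u X * p - b X * s)]
    have h3 : u X ^ 2 * p ^ 2 ≤ u X ^ 2 * (16 * C * κ * K ^ 2) :=
      mul_le_mul_of_nonneg_left (hb2 r) (sq_nonneg _)
    have h4 : b X ^ 2 * s ^ 2 ≤ K ^ 2 * s ^ 2 := mul_le_mul_of_nonneg_right hbK (sq_nonneg _)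
    have h5 : c r * (u X ^ 2 * (16 * C * κ * K ^ 2)) ≤ 1 * (u X ^ 2 * (16 * C * κ * K ^ 2)) :=
      mul_le_mul_of_nonneg_right (hc1 r) (by positivity)
    have h6 := mul_le_mul_of_nonneg_left (h2.trans (add_le_add
      (mul_le_mul_of_nonneg_left h3 zero_le_two) (mul_le_mul_of_nonneg_left h4 zero_le_two))) (hc r)
    linarith
  have h2 := Finset.sum_le_sum fun r (_ : r ∈ Finset.univ) => h1 r
  rw [Finset.sum_add_distrib, ← Finset.mul_sum, Finset.sum_const, Finset.card_univ,
    Fintype.card_fin, nsmul_eq_mul] at h2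
  unfold quadE
  have h3 : κ * (b X * u X) ^ 2 ≤ K ^ 2 * (κ * u X ^ 2) := by
    have := mul_le_mul_of_nonneg_right hbK (by positivity : 0 ≤ κ * u X ^ 2)
    linarith
  have h4 : 0 ≤ K ^ 2 * (κ * u X ^ 2) := by positivity
  have h5 : 0 ≤ C * K ^ 2 * ∑ r, c r * (∑ i, L r i * pd i u X) ^ 2 :=
    mul_nonneg (by positivity) (Finset.sum_nonneg fun r _ => mul_nonneg (hc r) (sq_nonneg _))
  push_cast at h2
  linarith

/-- The quadratic form of an operator applied to a function. -/
theorem quadE_op_le (hc : ∀ r, 0 ≤ c r) (hc1 : ∀ r, c r ≤ 1) (hκ : 0 ≤ κ) {C : ℝ} (hC : 0 ≤ C)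
    (hL : ∀ r i, L r i ^ 2 ≤ C * κ) {O B : Set Coord} (hO : IsOpen O) (hB : B ⊆ O) (hX : X ∈ B)
    {u e : Coord → ℝ} {K₀ K : ℝ} {n N : ℕ} (hu : CDOn O (n + 1) u)
    (h : Op O B u K₀ K n 1 N e) :
    quadE c L κ e X ≤ 4 ^ N * ((2 + 128 * C) * K ^ 2)
      * ∑ j ∈ Finset.range (n + 1), ∑ l ∈ words (Fin 4) j, quadE c L κ (pdl l u) X := by
  have hn : ∀ l : List (Fin 4), 0 ≤ quadE c L κ (pdl l u) X := fun l => quadE_nonneg hc hκ _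
  obtain ⟨S, hS⟩ : ∃ S, S = ∑ j ∈ Finset.range (n + 1), ∑ l ∈ words (Fin 4) j,
    quadE c L κ (pdl l u) X := ⟨_, rfl⟩
  have hS0 : 0 ≤ S := hS ▸ Finset.sum_nonneg fun j _ => Finset.sum_nonneg fun l _ => hn l
  have hSl : ∀ l : List (Fin 4), l.length ≤ n → quadE c L κ (pdl l u) X ≤ S := fun l hl => hS ▸
    (Finset.single_le_sum (f := fun l => quadE c L κ (pdl l u) X) (fun l _ => hn l)
      (mem_words.2 rfl)).trans (Finset.single_le_sum (f := fun j => ∑ l ∈ words (Fin 4) j,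
        quadE c L κ (pdl l u) X) (fun j _ => Finset.sum_nonneg fun l _ => hn l)
        (Finset.mem_range.2 (by omega)))
  rw [← hS]
  induction h with
  | nil h =>
    rw [quadE_congr (eventuallyEq_of_isOpen hO h (hB hX)), quadE_zero]
    positivity
  | @cons N e e' b l hl hb _ h' he ih =>
    have du : DifferentiableAt ℝ (pdl l u) X :=
      CDOn.differentiableAt (n := 0) (CDOn.pdl l (hu.mono (by omega))) (hB hX)
    have db : DifferentiableAt ℝ b X := hb.2.1 X (hB hX)
    have de : DifferentiableAt ℝ e' X := h'.differentiableAt (r := 0) hO hu X (hB hX)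
    rw [quadE_congr (eventuallyEq_of_isOpen hO he (hB hX))]
    refine (quadE_add_le hc hκ (db.fun_mul du) de).trans ?_
    have h1 := (quadE_mul_le hc hc1 hκ hC hL du db (hb.1 X hX)
      (fun i => (hb.2.2 i) X hX)).trans (mul_le_mul_of_nonneg_left (hSl l hl) (by positivity))
    have h2 : (1 : ℝ) ≤ 4 ^ N := one_le_pow₀ (by norm_num)
    have h3 : 0 ≤ (2 + 128 * C) * K ^ 2 * S := by positivity
    have h4 := mul_le_mul_of_nonneg_right h2 h3
    rw [pow_succ]
    linarith

end

/-- The slopes l₃, l₄ of the null hypersurface are not bounded by the hypotheses. The squares of the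
coefficients are nevertheless at most a constant times κ = l₁ + l₂ = (l₃² + l₄²)/2 + 1, and the
constant depends on A only. -/
theorem energyH_form {Λ lam A T R : ℝ} {k : ℕ} {G : BondiData} {Z : ℝ → S2 → ℝ}
    (hS : IsSetting Λ lam A T R k G Z) {ε : Bool} {Y : Fin 3 → ℝ} (hY : Y ∈ tanCell T) :
    ∃ (c : Fin 4 → ℝ) (L : Fin 4 → Fin 4 → ℝ) (κ : ℝ), (∀ r, 0 ≤ c r) ∧ (∀ r, c r ≤ 1) ∧ 0 ≤ κ ∧
      (∀ r i, L r i ^ 2 ≤ (2 + 8 * |A| + 3 * |A| ^ 2) * κ) ∧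
      ∀ φ : Coord → ℝ, energyH G Z ε φ 1 1 (liftH Z ε Y) = quadE c L κ φ (liftH Z ε Y) := by
  have hY' := tanCell_subset_tanCellc T hY
  have hm : liftH Z ε Y ∈ underc T (pullI Z ε) := hS.liftH_mem hY'
  have hs := hS.cone.underc_slab hm
  obtain ⟨X, hX⟩ : ∃ X, X = liftH Z ε Y := ⟨_, rfl⟩
  have h0 : (liftH Z ε Y) 0 ∈ Ioo 0 T := ⟨hY.1, hY.2.1⟩
  -- The bound A is assumed in the open region and passes to 𝓗 by continuity. Positivity of Z puts
  -- the point into the closure.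
  have hcl := (hS.cone.isGraph ε).mem_closure_under hm h0
    (hS.cone.pos hS.ads hS.Λ_neg hS.R_pos h0)
  have hA : ∀ i j, |gUp G ε (liftH Z ε Y) i j| ≤ |A| := fun i j =>
    le_of_mem_closure hcl (hS.differentiableAt_gUp hs i j).continuousAt.abs
      fun X hX => (hS.abs_gUp_le hX i j).trans (le_abs_self A)
  obtain ⟨α, β, γ, l₃, l₄, e22, -, e33, -, -, hn, hE⟩ :=
    hS.ads.energyH_explicit hs (hS.differentiableAt_graphFun hY')
      (hS.cone.null ε _ hY'.1 (graphFun_liftH Z ε Y))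
  rw [← hX] at hA e22 e33 hn hE ⊢
  have a22 := (le_abs_self _).trans (hA 2 2)
  have a33 := (le_abs_self _).trans (hA 3 3)
  rw [e22] at a22
  rw [e33] at a33
  obtain ⟨M, hM⟩ : ∃ M, M = |A| := ⟨_, rfl⟩
  have hM0 : 0 ≤ M := hM ▸ abs_nonneg A
  have sqA : ∀ i j, gUp G ε X i j ^ 2 ≤ M ^ 2 := fun i j => by
    rw [hM]; exact sq_le_sq' (abs_le.1 (hA i j)).1 (abs_le.1 (hA i j)).2
  rw [← hM] at a22 a33 ⊢
  obtain ⟨g1, hg1⟩ : ∃ g, g = gUp G ε X 1 1 := ⟨_, rfl⟩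
  obtain ⟨g2, hg2⟩ : ∃ g, g = gUp G ε X 1 2 := ⟨_, rfl⟩
  obtain ⟨g3, hg3⟩ : ∃ g, g = gUp G ε X 1 3 := ⟨_, rfl⟩
  have s1 := sqA 1 1
  have s2 := sqA 1 2
  have s3 := sqA 1 3
  simp only [hn, ← hg1, ← hg2, ← hg3] at hE s1 s2 s3
  -- The four squares in the explicit energy density, for b₁ = b₂ = 1, with their weights.
  refine ⟨![1 / 2, 1 / 2, 1, 1 / 4],
    ![![0, l₃, α, 0], ![0, l₄, β, γ],
      ![1, 1 / 2 * g1, g2 - l₃ / 2 * α - l₄ / 2 * β, g3 - l₄ / 2 * γ],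
      ![0, 0, l₃ * β - l₄ * α, l₃ * γ]], (l₃ ^ 2 + l₄ ^ 2) / 2 + 1, ?_, ?_, by positivity, ?_, ?_⟩
  · intro r; fin_cases r <;> norm_num
  · intro r; fin_cases r <;> norm_num
  · have hα : α ^ 2 ≤ M := by linarith [sq_nonneg β]
    have hβ : β ^ 2 ≤ M := by linarith [sq_nonneg α]
    have t1 := mul_le_mul_of_nonneg_left hα (sq_nonneg l₃)
    have t2 := mul_le_mul_of_nonneg_left hβ (sq_nonneg l₃)
    have t3 := mul_le_mul_of_nonneg_left a33 (sq_nonneg l₃)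
    have t4 := mul_le_mul_of_nonneg_left hα (sq_nonneg l₄)
    have t5 := mul_le_mul_of_nonneg_left hβ (sq_nonneg l₄)
    have t6 := mul_le_mul_of_nonneg_left a33 (sq_nonneg l₄)
    have n1 : 0 ≤ l₃ ^ 2 * M := by positivity
    have n2 : 0 ≤ l₄ ^ 2 * M := by positivity
    have n3 : 0 ≤ l₃ ^ 2 * M ^ 2 := by positivity
    have n4 : 0 ≤ l₄ ^ 2 * M ^ 2 := by positivity
    have n5 : 0 ≤ M ^ 2 := by positivity
    have n6 : 0 ≤ l₃ ^ 2 := sq_nonneg _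
    have n7 : 0 ≤ l₄ ^ 2 := sq_nonneg _
    have k1 := sq_nonneg (l₃ * β + l₄ * α)
    have k2 := sq_nonneg (g3 + l₄ / 2 * γ)
    have k3 := sq_nonneg (g2 + l₃ / 2 * α)
    have k4 := sq_nonneg (g2 + l₄ / 2 * β)
    have k5 := sq_nonneg (l₃ / 2 * α - l₄ / 2 * β)
    intro r i
    fin_cases r <;> fin_cases i <;> simp <;> linarith
  · intro φ
    rw [hE]
    unfold quadE
    simp [Fin.sum_univ_four]
    ring

theorem isOpen_contDiffAt (n : ℕ) (u : Coord → ℝ) : IsOpen {X | ContDiffAt ℝ n u X} :=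
  isOpen_iff_mem_nhds.2 fun _ hX => ContDiffAt.eventually hX (by simp)

/-- A frame derivative is an operator with universal smooth coefficients, so the preceding
comparison of quadratic forms applies at each point of 𝓗 separately. -/
theorem exists_energyH_frs_le (A : ℝ) (m : ℕ) : ∃ C : ℝ, 0 ≤ C ∧
    ∀ (Λ lam T R : ℝ) (k : ℕ) (G : BondiData) (Z : ℝ → S2 → ℝ), IsSetting Λ lam A T R k G Z →
    ∀ (ε : Bool) (u : Coord → ℝ) (w : List (Fin 5)), w.length = m →
    (∀ X ∈ underc T (pullI Z ε), ContDiffAt ℝ (m + 1 : ℕ) u X) → ∀ Y ∈ tanCell T,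
    energyH G Z ε (frs ε w u) 1 1 (liftH Z ε Y)
      ≤ C * ∑ j ∈ Finset.range (m + 1), ∑ α ∈ multi j, energyH G Z ε (mpd α u) 1 1 (liftH Z ε Y) := by
  obtain ⟨N, K₀, K, -, -, H⟩ := exists_op_frs m 1
  refine ⟨4 ^ N * ((2 + 128 * (2 + 8 * |A| + 3 * |A| ^ 2)) * K ^ 2)
    * ∑ j ∈ Finset.range (m + 1), ((words (Fin 4) j).card : ℝ), by positivity, ?_⟩
  intro Λ lam T R k G Z hS ε u w hw hu Y hY
  obtain ⟨c, L, κ, hc, hc1, hκ, hL, hE⟩ := energyH_form hS (ε := ε) hY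
  simp only [hE]
  have hO := isOpen_contDiffAt (m + 1) u
  have hX : liftH Z ε Y ∈ {X | ContDiffAt ℝ (m + 1 : ℕ) u X} :=
    hu _ (hS.liftH_mem (tanCell_subset_tanCellc T hY))
  have hcd : CDOn {X | ContDiffAt ℝ (m + 1 : ℕ) u X} (m + 1) u := fun _ h => h
  -- The coefficient bounds are needed at a single point. The open set on which u is sufficiently
  -- regular contains it.
  have op := H _ {liftH Z ε Y} hO (singleton_subset_iff.2 hX)
    (fun X h => by rw [mem_singleton_iff.1 h]; exact hY.2.2) ε u w hw (hcd.mono (Nat.le_succ m))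
  refine (quadE_op_le hc hc1 hκ (by positivity) hL hO (singleton_subset_iff.2 hX) rfl hcd op).trans ?_
  refine le_trans ?_ (mul_assoc _ _ _).symm.le
  refine mul_le_mul_of_nonneg_left ?_ (by positivity)
  have hn : ∀ φ : Coord → ℝ, 0 ≤ quadE c L κ φ (liftH Z ε Y) := fun _ => quadE_nonneg hc hκ _
  rw [Finset.sum_mul]
  refine Finset.sum_le_sum fun j hj => ?_
  rw [← nsmul_eq_mul]
  refine Finset.sum_le_card_nsmul _ _ _ fun l hl => ?_
  have hlj := mem_words.1 hl
  have hj' := Finset.mem_range.1 hj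
  rw [quadE_congr (eventuallyEq_of_isOpen hO (pdl_eq_mpd hO (hcd.mono (by omega))) hX)]
  have h1 : (fun i => l.count i) ∈ multi j := hlj ▸ count_mem_multi l
  exact (Finset.single_le_sum (f := fun α => quadE c L κ (mpd α u) (liftH Z ε Y))
    (fun _ _ => hn _) h1).trans (Finset.single_le_sum (f := fun j => ∑ α ∈ multi j,
      quadE c L κ (mpd α u) (liftH Z ε Y)) (fun _ _ => Finset.sum_nonneg fun _ _ => hn _) hj)

/-! ### Derivatives along the boundary at infinity -/

/-- The boundary `z = 0`, for `0 < τ < T`, in the coordinates of a chart. -/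
def infty (T : ℝ) : Set Coord := {X | X 1 = 0 ∧ X 0 ∈ Ioo 0 T}

theorem liftI_infty {T : ℝ} {Y : Fin 3 → ℝ} (hY : Y ∈ tanCell T) : liftI Y ∈ infty T :=
  ⟨rfl, hY.1, hY.2.1⟩

/-- A derivative along 𝓘 depends only on the values there. The derivative is computed along a line
that stays in 𝓘 for small parameters. -/
theorem pd_eq_of_infty {T : ℝ} {u u' : Coord → ℝ} (h : ∀ X ∈ infty T, u X = u' X) {X : Coord}
    (hX : X ∈ infty T) (hu : DifferentiableAt ℝ u X) (hu' : DifferentiableAt ℝ u' X) {i : Fin 4}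
    (hi : i ≠ 1) : pd i u X = pd i u' X := by
  have key : ∀ f : Coord → ℝ, DifferentiableAt ℝ f X →
      HasDerivAt (fun t : ℝ => f (X + t • Pi.single i 1)) (pd i f X) 0 := by
    intro f hf
    have h1 : HasDerivAt (fun t : ℝ => X + t • (Pi.single i 1 : Coord)) (Pi.single i 1) 0 := by
      simpa using ((hasDerivAt_id (0 : ℝ)).smul_const (Pi.single i 1 : Coord)).const_add X
    have h2 : HasFDerivAt f (fderiv ℝ f X) (X + (0 : ℝ) • (Pi.single i 1 : Coord)) := by
      simpa using hf.hasFDerivAt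
    exact h2.comp_hasDerivAt 0 h1
  refine (key u hu).unique ((key u' hu').congr_of_eventuallyEq ?_)
  have hc : ContinuousAt (fun t : ℝ => (X + t • (Pi.single i 1 : Coord)) 0) 0 := by fun_prop
  have h0 : ∀ᶠ t : ℝ in 𝓝 0, (X + t • (Pi.single i 1 : Coord)) 0 ∈ Ioo 0 T :=
    hc.preimage_mem_nhds (by simpa using Ioo_mem_nhds hX.2.1 hX.2.2)
  filter_upwards [h0] with t ht
  refine h _ ⟨?_, ht⟩
  simp [hX.1, Ne.symm hi]

theorem frameCoef_one {ε : Bool} {a : Fin 5} (ha : a ≠ 1) (X : Coord) : frameCoef ε a 1 X = 0 := by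
  fin_cases a <;> simp_all [frameCoef]

theorem coframeCoef_one {ε : Bool} {j : Fin 4} (hj : j ≠ 1) (X : Coord) :
    coframeCoef ε j 1 X = 0 := by
  fin_cases j <;> simp_all [coframeCoef]

theorem frs_eq_of_infty {T : ℝ} {u u' : Coord → ℝ} (h : ∀ X ∈ infty T, u X = u' X) (ε : Bool)
    {w : List (Fin 5)} (hw : 1 ∉ w) (hu : CDOn (infty T) w.length u)
    (hu' : CDOn (infty T) w.length u') : ∀ X ∈ infty T, frs ε w u X = frs ε w u' X := by
  induction w with
  | nil => exact h
  | cons a w ih =>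
    rw [List.mem_cons, not_or] at hw
    intro X hX
    have ih' := ih hw.2 (hu.mono (Nat.le_succ _)) (hu'.mono (Nat.le_succ _))
    change ∑ j, frameCoef ε a j X * pd j (frs ε w u) X
      = ∑ j, frameCoef ε a j X * pd j (frs ε w u') X
    refine Finset.sum_congr rfl fun j _ => ?_
    by_cases hj : j = 1
    · rw [hj, frameCoef_one (Ne.symm hw.1), zero_mul, zero_mul]
    · have d : ∀ f : Coord → ℝ, CDOn (infty T) (w.length + 1) f →
          DifferentiableAt ℝ (frs ε w f) X := fun f hf =>
        CDOn.differentiableAt (n := 0) (CDOn.frs ε w (hf.mono (by omega))) hX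
      have e := pd_eq_of_infty ih' hX (d u hu) (d u' hu') hj
      exact congrArg _ e

theorem pdl_eq_of_infty {T : ℝ} {u u' : Coord → ℝ} (h : ∀ X ∈ infty T, u X = u' X)
    {l : List (Fin 4)} (hl : 1 ∉ l) (hu : CDOn (infty T) l.length u)
    (hu' : CDOn (infty T) l.length u') : ∀ X ∈ infty T, pdl l u X = pdl l u' X := by
  induction l with
  | nil => exact h
  | cons i l ih =>
    rw [List.mem_cons, not_or] at hl
    intro X hX
    have d : ∀ f : Coord → ℝ, CDOn (infty T) (l.length + 1) f →
        DifferentiableAt ℝ (pdl l f) X := fun f hf =>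
      CDOn.differentiableAt (n := 0) (CDOn.pdl l (hf.mono (by omega))) hX
    exact pd_eq_of_infty (ih hl.2 (hu.mono (Nat.le_succ _)) (hu'.mono (Nat.le_succ _))) hX
      (d u hu) (d u' hu') (Ne.symm hl.1)

/-! ### Functions that do not depend on z -/

theorem pd_update_of_indep {u : Coord → ℝ} (hu : ∀ X s, u (Function.update X 1 s) = u X)
    (i : Fin 4) (X : Coord) (s : ℝ) : pd i u (Function.update X 1 s) = pd i u X := by
  have e : ∀ Y : Coord, u (Y + Pi.single 1 (s - X 1)) = u Y := fun Y => by
    rw [← hu Y (Y 1 + (s - X 1))]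
    congr 1
    ext j
    by_cases hj : j = 1
    · subst hj; simp
    · simp [hj]
  have e2 : Function.update X 1 s = X + Pi.single 1 (s - X 1) := by
    ext j
    by_cases hj : j = 1
    · subst hj; simp
    · simp [hj]
  have e3 := fderiv_comp_add_right (𝕜 := ℝ) (f := u) (x := X) (Pi.single 1 (s - X 1))
  simp only [e] at e3
  unfold pd
  rw [e2, ← e3]

theorem pd_one_of_indep {u : Coord → ℝ} (hu : ∀ X s, u (Function.update X 1 s) = u X) :
    pd 1 u = fun _ => 0 := by
  ext X
  by_cases hd : DifferentiableAt ℝ u X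
  · have h1 : HasDerivAt (fun t : ℝ => X + t • (Pi.single 1 1 : Coord)) (Pi.single 1 1) 0 := by
      simpa using ((hasDerivAt_id (0 : ℝ)).smul_const (Pi.single 1 1 : Coord)).const_add X
    have h2 : HasFDerivAt u (fderiv ℝ u X) (X + (0 : ℝ) • (Pi.single 1 1 : Coord)) := by
      simpa using hd.hasFDerivAt
    have h3 := h2.comp_hasDerivAt 0 h1
    have h4 : (u ∘ fun t : ℝ => X + t • (Pi.single 1 1 : Coord)) = fun _ => u X := by
      ext t
      rw [Function.comp_apply, ← hu X (X 1 + t)]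
      congr 1
      ext j
      by_cases hj : j = 1
      · subst hj; simp
      · simp [hj]
    rw [h4] at h3
    exact h3.unique (hasDerivAt_const _ _)
  -- At points without differentiability the derivative has the default value 0.
  · unfold pd
    rw [fderiv_zero_of_not_differentiableAt hd]
    rfl

theorem pdl_update_of_indep {u : Coord → ℝ} (hu : ∀ X s, u (Function.update X 1 s) = u X)
    (l : List (Fin 4)) : ∀ X s, pdl l u (Function.update X 1 s) = pdl l u X := by
  induction l with
  | nil => exact hu
  | cons i l ih => exact pd_update_of_indep ih i

theorem pdl_eq_zero_of_indep {u : Coord → ℝ} (hu : ∀ X s, u (Function.update X 1 s) = u X)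
    {l : List (Fin 4)} (hl : 1 ∈ l) : pdl l u = fun _ => 0 := by
  induction l with
  | nil => simp at hl
  | cons i l ih =>
    change pd i (pdl l u) = _
    by_cases h : 1 ∈ l
    · rw [ih h, pd_const]
    · have : (1 : Fin 4) = i := (List.mem_cons.1 hl).resolve_right h
      rw [← this]
      exact pd_one_of_indep (pdl_update_of_indep hu l)

/-- Words containing ∂_z give zero, and sorting turns the remaining ones into tangential
multi-indices. -/
theorem sqs_le_of_indep {O : Set Coord} (hO : IsOpen O) {u : Coord → ℝ}
    (hu : ∀ X s, u (Function.update X 1 s) = u X) {n : ℕ} (hc : CDOn O n u) {X : Coord}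
    (hX : X ∈ O) :
    sqs n u X ≤ (words (Fin 4) n).card * ∑ α ∈ multiTan n, mpd α u X ^ 2 := by
  unfold sqs
  rw [← nsmul_eq_mul]
  refine Finset.sum_le_card_nsmul _ _ _ fun l hl => ?_
  by_cases h : 1 ∈ l
  · rw [pdl_eq_zero_of_indep hu h]
    simpa using Finset.sum_nonneg fun α _ => sq_nonneg (mpd α u X)
  · have hln := mem_words.1 hl
    subst hln
    rw [pdl_eq_mpd hO hc X hX]
    refine Finset.single_le_sum (f := fun α => mpd α u X ^ 2) (fun _ _ => sq_nonneg _) ?_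
    exact Finset.mem_filter.2 ⟨count_mem_multi l, List.count_eq_zero_of_not_mem h⟩

/-- The squares of the derivatives tangential to the boundary at infinity. -/
def tdens (φ : Coord → ℝ) (X : Coord) : ℝ := pd 0 φ X ^ 2 + pd 2 φ X ^ 2 + pd 3 φ X ^ 2

/-- A frame derivative that contains a `z`-derivative. -/
theorem exists_tdens_le_of_mem (m : ℕ) : ∃ K : ℝ, 0 ≤ K ∧ ∀ O : Set Coord, IsOpen O →
    ∀ (ε : Bool) (u : Coord → ℝ), CDOn O (m + 1) u → ∀ w : List (Fin 5), w.length = m → 1 ∈ w →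
    ∀ X ∈ O, X 2 ^ 2 + X 3 ^ 2 ≤ 1 → tdens (frs ε w u) X
      ≤ K * ∑ w' ∈ (words (Fin 5) m).filter fun w' => w'.count 1 + 1 = w.count 1,
          ∑ i, pd i (frs ε w' u) X ^ 2 := by
  obtain ⟨Kf, h0, hf⟩ := exists_coframeBound 0
  refine ⟨3 * ((4 * Kf ^ 2) * 4), by positivity, fun O hO ε u hu w hw h1 X hX hd => ?_⟩
  have hb : ∀ j a, |coframeCoef ε j a X| ≤ Kf := fun j a =>
    (hf univ {X | X 2 ^ 2 + X 3 ^ 2 ≤ 1} isOpen_univ (subset_univ _) (fun _ h => h) ε j a).bound X hd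
  obtain ⟨S, hS⟩ : ∃ S, S = ∑ w' ∈ (words (Fin 5) m).filter fun w' => w'.count 1 + 1 = w.count 1,
    ∑ i, pd i (frs ε w' u) X ^ 2 := ⟨_, rfl⟩
  -- As ∂_z commutes with the frame, X_a X_w u is the z-derivative of the word in which one letter
  -- ∂_z of w is removed and a is put in front. That word has the same length and one ∂_z fewer.
  have key : ∀ a : Fin 5, a ≠ 1 → fr ε a (frs ε w u) X ^ 2 ≤ S := by
    intro a ha
    have e : fr ε a (frs ε w u) X = pd 1 (frs ε (a :: w.erase 1) u) X := by
      have h2 := frs_eq_pd_one hO ε (List.mem_cons_of_mem a h1)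
        (hu.mono (by simp [hw])) X hX
      rw [List.erase_cons_tail (by simpa using ha)] at h2
      exact h2
    have hcount : (w.erase 1).count 1 + 1 = w.count 1 := by
      rw [List.count_erase_self]
      have := List.count_pos_iff.2 h1
      omega
    have hlen : (w.erase 1).length + 1 = m := by
      rw [List.length_erase_of_mem h1, hw]
      have := List.length_pos_of_mem h1
      omega
    have hmem : (a :: w.erase 1) ∈ (words (Fin 5) m).filter fun w' => w'.count 1 + 1 = w.count 1 := by
      refine Finset.mem_filter.2 ⟨mem_words.2 (by simpa using hlen), ?_⟩
      rw [List.count_cons_of_ne ha]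
      exact hcount
    rw [e, hS]
    exact (Finset.single_le_sum (f := fun i => pd i (frs ε (a :: w.erase 1) u) X ^ 2)
      (fun _ _ => sq_nonneg _) (Finset.mem_univ 1)).trans
      (Finset.single_le_sum (f := fun w' => ∑ i, pd i (frs ε w' u) X ^ 2)
        (fun _ _ => Finset.sum_nonneg fun _ _ => sq_nonneg _) hmem)
  -- The tangential coordinate vectors are combinations of the frame fields other than ∂_z, so the
  -- preceding bound covers all tangential derivatives.
  have hp : ∀ j : Fin 4, j ≠ 1 → pd j (frs ε w u) X ^ 2 ≤ (4 * Kf ^ 2) * (4 * S) := by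
    intro j hj
    have e : pd j (frs ε w u) X
        = ∑ a ∈ Finset.univ.erase (1 : Fin 5), coframeCoef ε j a X * fr ε a (frs ε w u) X := by
      rw [pd_eq_sum_fr ε j, ← Finset.add_sum_erase _ _ (Finset.mem_univ (1 : Fin 5)),
        coframeCoef_one hj, zero_mul, zero_add]
    rw [e]
    calc _ ≤ (∑ a ∈ Finset.univ.erase (1 : Fin 5), coframeCoef ε j a X ^ 2)
          * ∑ a ∈ Finset.univ.erase (1 : Fin 5), fr ε a (frs ε w u) X ^ 2 :=
          Finset.sum_mul_sq_le_sq_mul_sq _ _ _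
      _ ≤ (∑ _a ∈ Finset.univ.erase (1 : Fin 5), Kf ^ 2)
          * ∑ _a ∈ Finset.univ.erase (1 : Fin 5), S := by
          refine mul_le_mul (Finset.sum_le_sum fun a _ => ?_) (Finset.sum_le_sum fun a ha => ?_)
            (Finset.sum_nonneg fun _ _ => sq_nonneg _)
            (Finset.sum_nonneg fun _ _ => sq_nonneg _)
          · exact sq_le_sq' (abs_le.1 (hb j a)).1 (abs_le.1 (hb j a)).2
          · exact key a (Finset.ne_of_mem_erase ha)
      _ = (4 * Kf ^ 2) * (4 * S) := by simp
  rw [← hS]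
  unfold tdens
  linarith [hp 0 (by decide), hp 2 (by decide), hp 3 (by decide)]

section

variable {Λ lam A B D A' B' D' T R : ℝ} {s : ℕ} {G : BondiData} {Z : ℝ → S2 → ℝ}
  {a : VField} {ω v f : ST → ℝ} {ψ : ℝ → S2 → ℝ}
  (hP : IsSolution Λ lam A B D A' B' D' T R s G Z a ω v f ψ) {ε : Bool}
include hP

theorem IsSolution.infty_closed {X : Coord} (hX : X ∈ infty T) : chart ε X ∈ M2closed T R Z := by
  refine ⟨chart_zero_mem_slab hP.setting.R_pos ⟨hX.2.1.le, hX.2.2.le⟩ hX.1, ?_⟩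
  change X 1 ≤ Z (X 0) (stereo ε (X 2) (X 3))
  rw [hX.1]
  exact (hP.setting.cone.pos hP.setting.ads hP.setting.Λ_neg hP.setting.R_pos hX.2 (ε := ε)).le

theorem IsSolution.cdOn_v_infty : CDOn (infty T) (s + 2) (pull v ε) := fun X hX =>
  hP.v_smooth ε X (hP.infty_closed hX)

theorem IsSolution.pull_eq_pullI {X : Coord} (hX : X ∈ infty T) :
    pull v ε X = pullI ψ ε X := by
  change v (X 0, X 1, stereo ε (X 2) (X 3)) = _
  rw [hX.1]
  exact hP.dirichlet _ ⟨hX.2.1.le, hX.2.2.le⟩ _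

/-- The boundary data inherit their regularity from v: near the given point they coincide with v at
z = 0, extended independently of z. -/
theorem IsSolution.cdOn_pullI : CDOn {X : Coord | X 0 ∈ Ioo 0 T} (s + 2) (pullI ψ ε) := by
  intro X hX
  have e : pullI ψ ε =ᶠ[𝓝 X] fun Y => pull v ε ![Y 0, 0, Y 2, Y 3] := by
    have hc : ContinuousAt (fun Y : Coord => Y 0) X := (continuous_apply 0).continuousAt
    filter_upwards [hc.preimage_mem_nhds (Ioo_mem_nhds hX.1 hX.2)] with Y hY
    exact (hP.pull_eq_pullI (ε := ε) (X := ![Y 0, 0, Y 2, Y 3]) ⟨rfl, hY⟩).symm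
  refine ContDiffAt.congr_of_eventuallyEq ?_ e
  have h1 : ContDiffAt ℝ (s + 2 : ℕ) (pull v ε) ![X 0, 0, X 2, X 3] :=
    hP.cdOn_v_infty (ε := ε) _ ⟨rfl, hX⟩
  have h2 : ContDiffAt ℝ (s + 2 : ℕ) (fun Y : Coord => (![Y 0, 0, Y 2, Y 3] : Coord)) X := by
    refine contDiffAt_pi.2 fun i => ?_
    fin_cases i
    · exact (contDiff_apply ℝ ℝ (0 : Fin 4)).contDiffAt
    · exact contDiffAt_const
    · exact (contDiff_apply ℝ ℝ (2 : Fin 4)).contDiffAt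
    · exact (contDiff_apply ℝ ℝ (3 : Fin 4)).contDiffAt
  exact ContDiffAt.comp (g := pull v ε) X h1 h2

theorem IsSolution.cdOn_pullI_infty : CDOn (infty T) (s + 2) (pullI ψ ε) := fun X hX =>
  hP.cdOn_pullI X hX.2

theorem IsSolution.mpd_pullI {n : ℕ} (hn : n ≤ s + 2) {α : Fin 4 → ℕ} (hα : α ∈ multiTan n) {X : Coord}
    (hX : X ∈ infty T) : mpd α (pull v ε) X = mpd α (pullI ψ ε) X := by
  obtain ⟨h1, h2⟩ := Finset.mem_filter.1 hα
  have hl : (wordOf α).length ≤ s + 2 := by rw [length_wordOf, mem_multi.1 h1]; exact hn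
  rw [mpd_eq_pdl, mpd_eq_pdl]
  refine pdl_eq_of_infty (fun X hX => hP.pull_eq_pullI hX) ?_ (hP.cdOn_v_infty.mono hl)
    (hP.cdOn_pullI_infty.mono hl) X hX
  exact List.count_eq_zero.1 ((count_wordOf α 1).trans h2)

end

/-- A frame derivative that contains no `z`-derivative. -/
theorem exists_tdens_le_of_notMem (m : ℕ) : ∃ C : ℝ, 0 ≤ C ∧
    ∀ (Λ lam A B D A' B' D' T R : ℝ) (s : ℕ) (G : BondiData) (Z : ℝ → S2 → ℝ) (a : VField)
      (ω v f : ST → ℝ) (ψ : ℝ → S2 → ℝ), IsSolution Λ lam A B D A' B' D' T R s G Z a ω v f ψ →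
    m ≤ s → ∀ (ε : Bool) (w : List (Fin 5)), w.length = m → 1 ∉ w → ∀ Y ∈ tanCell T,
    tdens (frs ε w (pull v ε)) (liftI Y) ≤ C * ∑ n ∈ Finset.range (m + 2),
      ∑ α ∈ multiTan n, mpd α (pullI ψ ε) (liftI Y) ^ 2 := by
  obtain ⟨C, h0, H⟩ := exists_frs_sq_le m 1
  refine ⟨3 * (C * ∑ n ∈ Finset.range (m + 2), ((words (Fin 4) n).card : ℝ)), by positivity, ?_⟩
  intro Λ lam A B D A' B' D' T R s G Z a ω v f ψ hP hm ε w hw h1 Y hY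
  have hX : liftI Y ∈ infty T := liftI_infty hY
  have hO : IsOpen {X : Coord | X 0 ∈ Ioo 0 T} := isOpen_Ioo.preimage (continuous_apply 0)
  have hc : CDOn {X : Coord | X 0 ∈ Ioo 0 T} (s + 2) (pullI ψ ε) := hP.cdOn_pullI
  have hi : ∀ X s, pullI ψ ε (Function.update X 1 s) = pullI ψ ε X := fun X s => by
    simp [pullI]
  obtain ⟨S, hS⟩ : ∃ S, S = ∑ n ∈ Finset.range (m + 2),
    ∑ α ∈ multiTan n, mpd α (pullI ψ ε) (liftI Y) ^ 2 := ⟨_, rfl⟩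
  have h2 : ∑ n ∈ Finset.range (m + 2), sqs n (pullI ψ ε) (liftI Y)
      ≤ (∑ n ∈ Finset.range (m + 2), ((words (Fin 4) n).card : ℝ)) * S := by
    rw [Finset.sum_mul, hS]
    refine Finset.sum_le_sum fun n hn => (sqs_le_of_indep hO hi (hc.mono ?_) hX.2).trans
      (mul_le_mul_of_nonneg_left ?_ (by positivity))
    · have := Finset.mem_range.1 hn; omega
    · exact Finset.single_le_sum (f := fun n => ∑ α ∈ multiTan n, mpd α (pullI ψ ε) (liftI Y) ^ 2)
        (fun _ _ => Finset.sum_nonneg fun _ _ => sq_nonneg _) hn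
  have h3 : ∀ j : Fin 4, j ≠ 1 → pd j (frs ε w (pull v ε)) (liftI Y) ^ 2
      ≤ C * ((∑ n ∈ Finset.range (m + 2), ((words (Fin 4) n).card : ℝ)) * S) := by
    intro j hj
    have dd : ∀ u : Coord → ℝ, CDOn (infty T) (s + 2) u →
        DifferentiableAt ℝ (frs ε w u) (liftI Y) := fun u hu =>
      CDOn.differentiableAt (n := 0) (CDOn.frs ε w (hu.mono (by omega))) hX
    rw [pd_eq_of_infty (frs_eq_of_infty (fun X hX => hP.pull_eq_pullI hX) ε h1
      (hP.cdOn_v_infty.mono (by omega)) (hP.cdOn_pullI_infty.mono (by omega))) hX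
      (dd _ hP.cdOn_v_infty) (dd _ hP.cdOn_pullI_infty) hj]
    refine (H _ {liftI Y} hO (singleton_subset_iff.2 hX.2)
      (fun X h => by rw [mem_singleton_iff.1 h]; exact hY.2.2) ε (pullI ψ ε) w [j] hw rfl
      (hc.mono (by omega)) _ rfl).trans (mul_le_mul_of_nonneg_left h2 h0)
  rw [← hS]
  unfold tdens
  linarith [h3 0 (by decide), h3 2 (by decide), h3 3 (by decide)]

/-! ### The estimate for the frame derivatives -/

/-- The sum of the squares of the coordinate derivatives of order `n` of a scalar function. -/
def mdens (n : ℕ) (u : Coord → ℝ) (X : Coord) : ℝ := ∑ α ∈ multi n, mpd α u X ^ 2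

/-- The sum of the squares of the tangential derivatives of order `n`. -/
def tandens (n : ℕ) (u : Coord → ℝ) (X : Coord) : ℝ := ∑ α ∈ multiTan n, mpd α u X ^ 2

/-- The energies on the null hypersurface. -/
def energyTot (G : BondiData) (T : ℝ) (Z : ℝ → S2 → ℝ) (q l : ℝ) (s : ℕ) (v : ST → ℝ) : ℝ :=
  ∑ n ∈ Finset.range (s + 1), ∑ α ∈ multi n,
    intH G T Z fun ε X => wt q l X * energyH G Z ε (pullD α v ε) 1 1 X

/-- The boundary data at infinity. -/
def dirichletTot (G : BondiData) (T q l : ℝ) (s : ℕ) (ψ : ℝ → S2 → ℝ) : ℝ :=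
  ∑ n ∈ Finset.range (s + 2), intI G T fun ε X => wt q l X * tandens n (pullI ψ ε) X

/-- The source terms. -/
def sourceTot (G : BondiData) (T R : ℝ) (Z : ℝ → S2 → ℝ) (q l : ℝ) (s : ℕ) (f : ST → ℝ) : ℝ :=
  ∑ n ∈ Finset.range (s + 1), intM2 G T R Z fun ε X => wt q l X * mdens n (pull f ε) X

/-- All the data. -/
def dataTot (G : BondiData) (T R : ℝ) (Z : ℝ → S2 → ℝ) (q l : ℝ) (s : ℕ) (v f : ST → ℝ)
    (ψ : ℝ → S2 → ℝ) : ℝ :=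
  energyTot G T Z q l s v + dirichletTot G T q l s ψ + sourceTot G T R Z q l s f

/-- The energy of the frame derivatives of order `n`. -/
def densTot (G : BondiData) (T R : ℝ) (Z : ℝ → S2 → ℝ) (q l : ℝ) (n : ℕ) (v : ST → ℝ) : ℝ :=
  intM2 G T R Z fun ε X => wt q l X * dens ε n (pull v ε) X

/-- The gradients at infinity of the frame derivatives of order `n`. -/
def gdensTot (G : BondiData) (T q l : ℝ) (n : ℕ) (v : ST → ℝ) : ℝ :=
  intI G T fun ε X => wt q l X * gdens ε n (pull v ε) X

/-! ### Integrability and positivity of the integrated quantities -/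

theorem mdens_nonneg (n : ℕ) (u : Coord → ℝ) (X : Coord) : 0 ≤ mdens n u X :=
  Finset.sum_nonneg fun _ _ => sq_nonneg _

theorem tandens_nonneg (n : ℕ) (u : Coord → ℝ) (X : Coord) : 0 ≤ tandens n u X :=
  Finset.sum_nonneg fun _ _ => sq_nonneg _

theorem sqs_le_mdens {O : Set Coord} (hO : IsOpen O) {u : Coord → ℝ} {n : ℕ} (hc : CDOn O n u)
    {X : Coord} (hX : X ∈ O) : sqs n u X ≤ (words (Fin 4) n).card * mdens n u X := by
  unfold sqs
  rw [← nsmul_eq_mul]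
  refine Finset.sum_le_card_nsmul _ _ _ fun l hl => ?_
  have hln := mem_words.1 hl
  subst hln
  rw [pdl_eq_mpd hO hc X hX]
  exact Finset.single_le_sum (f := fun α => mpd α u X ^ 2) (fun _ _ => sq_nonneg _)
    (count_mem_multi l)

theorem CDOn.continuousAt {O : Set Coord} {n : ℕ} {u : Coord → ℝ} (h : CDOn O n u) {X : Coord}
    (hX : X ∈ O) : ContinuousAt u X := (h X hX).continuousAt

section

variable {Λ lam A B D A' B' D' T R : ℝ} {s : ℕ} {G : BondiData} {Z : ℝ → S2 → ℝ}
  {a : VField} {ω v f : ST → ℝ} {ψ : ℝ → S2 → ℝ}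
  (hP : IsSolution Λ lam A B D A' B' D' T R s G Z a ω v f ψ) {ε : Bool}
include hP

theorem IsSolution.underc_closed : ∀ X ∈ underc T (pullI Z ε), chart ε X ∈ M2closed T R Z :=
  fun _ hX => hP.setting.cone.underc_subset hX

theorem IsSolution.cdOn_frs {n : ℕ} {w : List (Fin 5)} (hw : n + w.length ≤ s + 2) :
    CDOn (underc T (pullI Z ε)) n (frs ε w (pull v ε)) :=
  CDOn.frs ε w ((hP.cdOn_v hP.underc_closed).mono hw)

theorem IsSolution.continuousAt_pd_frs {w : List (Fin 5)} (hw : w.length ≤ s + 1) (i : Fin 4)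
    {X : Coord} (hX : X ∈ underc T (pullI Z ε)) :
    ContinuousAt (pd i (frs ε w (pull v ε))) X :=
  CDOn.continuousAt (n := 0)
    (CDOn.pd (hP.cdOn_frs (n := 0 + 1) (by omega : 0 + 1 + w.length ≤ s + 2)) i) hX

theorem IsSolution.continuousAt_grad {w : List (Fin 5)} (hw : w.length ≤ s + 1)
    {X : Coord} (hX : X ∈ underc T (pullI Z ε)) :
    ContinuousAt (fun X => ∑ i, pd i (frs ε w (pull v ε)) X ^ 2) X :=
  tendsto_finsetSum _ fun i _ => (hP.continuousAt_pd_frs hw i hX).pow 2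

theorem IsSolution.continuousAt_energy {w : List (Fin 5)} (hw : w.length ≤ s + 1)
    {X : Coord} (hX : X ∈ underc T (pullI Z ε)) :
    ContinuousAt (fun X => (∑ i, pd i (frs ε w (pull v ε)) X ^ 2) + frs ε w (pull v ε) X ^ 2) X :=
  (hP.continuousAt_grad hw hX).add
    ((CDOn.continuousAt (hP.cdOn_frs (n := 0) (by omega)) hX).pow 2)

theorem IsSolution.integrableM2_dens {n : ℕ} (hn : n ≤ s + 1) (q l : ℝ) :
    IntegrableM2 G T Z q l fun ε X => dens ε n (pull v ε) X :=
  hP.setting.integrableM2 (fun ε X hX => tendsto_finsetSum _ fun w hw =>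
    hP.continuousAt_energy (by rw [mem_words.1 hw]; exact hn) hX) q l

theorem IsSolution.integrableI_gdens {n : ℕ} (hn : n ≤ s + 1) (q l : ℝ) :
    IntegrableI G T q l fun ε X => gdens ε n (pull v ε) X :=
  hP.setting.integrableI (fun ε X hX => tendsto_finsetSum _ fun w hw =>
    hP.continuousAt_grad (by rw [mem_words.1 hw]; exact hn) hX) q l

theorem IsSolution.continuousAt_mpd {n : ℕ} (hn : n ≤ s + 2) {α : Fin 4 → ℕ} (hα : α ∈ multi n)
    {X : Coord} (hX : X ∈ underc T (pullI Z ε)) : ContinuousAt (mpd α (pull v ε)) X := by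
  rw [mpd_eq_pdl]
  exact CDOn.continuousAt (n := 0) (CDOn.pdl (wordOf α) ((hP.cdOn_v hP.underc_closed).mono
    (by rw [length_wordOf, mem_multi.1 hα]; omega))) hX

theorem IsSolution.integrableI_tandens {n : ℕ} (hn : n ≤ s + 2) (q l : ℝ) :
    IntegrableI G T q l fun ε X => tandens n (pullI ψ ε) X := by
  have h := hP.setting.integrableI (u := fun ε X => tandens n (pull v ε) X)
    (fun ε X hX => tendsto_finsetSum _ fun α hα =>
      (hP.continuousAt_mpd hn (Finset.mem_filter.1 hα).1 hX).pow 2) q l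
  refine fun ε => (h ε).congr_fun (fun Y hY => ?_) (measurableSet_tanCell T)
  have e : tandens n (pull v ε) (liftI Y) = tandens n (pullI ψ ε) (liftI Y) :=
    Finset.sum_congr rfl fun α hα => by rw [hP.mpd_pullI hn hα (liftI_infty hY)]
  simp only [e]

theorem IsSolution.pdl_f (l : List (Fin 4)) {X : Coord} (hX : X ∈ under T (pullI Z ε)) :
    pdl l (fullOp G a ω ε (pull v ε)) X = pdl l (pull f ε) X :=
  (pdl_eq_of_isOpen (hP.setting.cone.isOpen_region ε) (fun _ hX => hP.eq_fullOp hX) l X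
    (hP.setting.cone.under_subset_region ε hX)).symm

theorem IsSolution.continuousAt_pdl_fullOp {l : List (Fin 4)} (hl : l.length ≤ s) {X : Coord}
    (hX : X ∈ underc T (pullI Z ε)) :
    ContinuousAt (pdl l (fullOp G a ω ε (pull v ε))) X :=
  CDOn.continuousAt (n := 0) (CDOn.pdl l ((hP.cdOn_fullOp hP.underc_closed).mono (by omega))) hX

/-- The function f is controlled only in the open region. There its derivatives agree with those of
the operator applied to v, which are continuous up to the boundary. -/
theorem IsSolution.integrableM2_sqs {n : ℕ} (hn : n ≤ s) (q l : ℝ) :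
    IntegrableM2 G T Z q l fun ε X => sqs n (pull f ε) X :=
  hP.setting.integrableM2_congr (u := fun ε X => sqs n (fullOp G a ω ε (pull v ε)) X)
    (fun ε X hX => Finset.sum_congr rfl fun l _ => by rw [hP.pdl_f l hX])
    (hP.setting.integrableM2 (fun ε X hX => tendsto_finsetSum _ fun l hl =>
      (hP.continuousAt_pdl_fullOp (by rw [mem_words.1 hl]; exact hn) hX).pow 2) q l)

theorem IsSolution.mdens_f {n : ℕ} {X : Coord} (hX : X ∈ under T (pullI Z ε)) :
    ∑ α ∈ multi n, pdl (wordOf α) (fullOp G a ω ε (pull v ε)) X ^ 2 = mdens n (pull f ε) X := by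
  unfold mdens
  refine Finset.sum_congr rfl fun α _ => ?_
  rw [mpd_eq_pdl, hP.pdl_f _ hX]

theorem IsSolution.continuousAt_mdens_fullOp {n : ℕ} (hn : n ≤ s) {X : Coord}
    (hX : X ∈ underc T (pullI Z ε)) :
    ContinuousAt (fun X => ∑ α ∈ multi n, pdl (wordOf α) (fullOp G a ω ε (pull v ε)) X ^ 2) X := by
  refine tendsto_finsetSum _ fun α hα => ContinuousAt.pow ?_ 2
  have h : (wordOf α).length ≤ s := by rw [length_wordOf, mem_multi.1 hα]; exact hn
  exact hP.continuousAt_pdl_fullOp h hX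

theorem IsSolution.integrableM2_mdens {n : ℕ} (hn : n ≤ s) (q l : ℝ) :
    IntegrableM2 G T Z q l fun ε X => mdens n (pull f ε) X :=
  hP.setting.integrableM2_congr (fun _ _ hX => hP.mdens_f hX)
    (hP.setting.integrableM2 (fun _ _ hX => hP.continuousAt_mdens_fullOp hn hX) q l)

theorem IsSolution.energyTot_term_nonneg (q l : ℝ) (φ : Bool → Coord → ℝ) :
    0 ≤ intH G T Z fun ε X => wt q l X * energyH G Z ε (φ ε) 1 1 X :=
  hP.setting.intH_nonneg fun _ _ hY => mul_nonneg (wt_pos q l _).le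
    (hP.setting.energyH_nonneg (tanCell_subset_tanCellc T hY) _)

theorem IsSolution.intM2_wt_nonneg {q l : ℝ} {u : Bool → Coord → ℝ} (hu : ∀ ε X, 0 ≤ u ε X) :
    0 ≤ intM2 G T R Z fun ε X => wt q l X * u ε X :=
  hP.setting.intM2_nonneg fun ε X _ => mul_nonneg (wt_pos q l X).le (hu ε X)

theorem IsSolution.intI_wt_nonneg {q l : ℝ} {u : Bool → Coord → ℝ} (hu : ∀ ε X, 0 ≤ u ε X) :
    0 ≤ intI G T fun ε X => wt q l X * u ε X :=
  hP.setting.intI_nonneg fun ε _ _ => mul_nonneg (wt_pos q l _).le (hu ε _)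

theorem IsSolution.energyTot_nonneg (q l : ℝ) : 0 ≤ energyTot G T Z q l s v :=
  Finset.sum_nonneg fun _ _ => Finset.sum_nonneg fun α _ => hP.energyTot_term_nonneg q l (pullD α v)

theorem IsSolution.dirichletTot_nonneg (q l : ℝ) : 0 ≤ dirichletTot G T q l s ψ :=
  Finset.sum_nonneg fun _ _ => hP.intI_wt_nonneg fun _ _ => tandens_nonneg _ _ _

theorem IsSolution.sourceTot_nonneg (q l : ℝ) : 0 ≤ sourceTot G T R Z q l s f :=
  Finset.sum_nonneg fun _ _ => hP.intM2_wt_nonneg fun _ _ => mdens_nonneg _ _ _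

theorem IsSolution.densTot_nonneg (q l : ℝ) (n : ℕ) : 0 ≤ densTot G T R Z q l n v :=
  hP.intM2_wt_nonneg fun _ _ => dens_nonneg _ _ _ _

theorem IsSolution.gdensTot_nonneg (q l : ℝ) (n : ℕ) : 0 ≤ gdensTot G T q l n v :=
  hP.intI_wt_nonneg fun _ _ => gdens_nonneg _ _ _ _

theorem IsSolution.intM2_sum_sqs_le {m : ℕ} (hm : m ≤ s) (q l : ℝ) :
    intM2 G T R Z (fun ε X => wt q l X * ∑ n ∈ Finset.range (m + 1), sqs n (pull f ε) X)
      ≤ (∑ n ∈ Finset.range (s + 1), ((words (Fin 4) n).card : ℝ)) * sourceTot G T R Z q l s f := by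
  have hn : ∀ n, 0 ≤ intM2 G T R Z fun ε X => wt q l X * mdens n (pull f ε) X := fun n =>
    hP.intM2_wt_nonneg fun _ _ => mdens_nonneg _ _ _
  have hms : ∀ n ∈ Finset.range (m + 1), n ≤ s := fun n hn => by
    have := Finset.mem_range.1 hn; omega
  refine (hP.setting.intM2_le_sum (Finset.range (m + 1)) (fun n => ((words (Fin 4) n).card : ℝ))
    (W := fun n ε X => mdens n (pull f ε) X) ?_
    (fun n hn => hP.integrableM2_mdens (hms n hn) q l) fun ε X hX => Finset.sum_le_sum fun n hn =>
      sqs_le_mdens (hP.setting.cone.isOpen_region ε) (hP.cdOn_f.mono (hms n hn))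
        (hP.setting.cone.under_subset_region ε hX)).trans ?_
  · intro ε
    have h : IntegrableOn (fun X => ∑ n ∈ Finset.range (m + 1),
        wt q l X * sqs n (pull f ε) X * volDensity G ε X) (under T (pullI Z ε)) :=
      integrable_finsetSum _ fun n hn => hP.integrableM2_sqs (hms n hn) q l ε
    simpa only [Finset.mul_sum, Finset.sum_mul] using h
  · calc _ ≤ ∑ n ∈ Finset.range (s + 1), ((words (Fin 4) n).card : ℝ)
          * intM2 G T R Z (fun ε X => wt q l X * mdens n (pull f ε) X) :=
        Finset.sum_le_sum_of_subset_of_nonneg (Finset.range_mono (by omega))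
          fun n _ _ => mul_nonneg (Nat.cast_nonneg _) (hn n)
      _ ≤ _ := by
        rw [Finset.sum_mul]
        exact Finset.sum_le_sum fun n h => mul_le_mul_of_nonneg_left
          (Finset.single_le_sum (f := fun n => intM2 G T R Z fun ε X =>
            wt q l X * mdens n (pull f ε) X) (fun n _ => hn n) h) (Nat.cast_nonneg _)

theorem IsSolution.intM2_sum_dens_le {m : ℕ} (hm : m ≤ s + 1) (q l : ℝ) :
    intM2 G T R Z (fun ε X => wt q l X * ∑ n ∈ Finset.range m, dens ε n (pull v ε) X)
      ≤ ∑ n ∈ Finset.range m, densTot G T R Z q l n v := by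
  have hms : ∀ n ∈ Finset.range m, n ≤ s + 1 := fun n hn => by
    have := Finset.mem_range.1 hn; omega
  refine (hP.setting.intM2_le_sum (Finset.range m) (fun _ => 1)
    (W := fun n ε X => dens ε n (pull v ε) X) ?_
    (fun n hn => hP.integrableM2_dens (hms n hn) q l) fun ε X _ => by simp).trans
    (le_of_eq (by simp [densTot]))
  intro ε
  have h : IntegrableOn (fun X => ∑ n ∈ Finset.range m,
      wt q l X * dens ε n (pull v ε) X * volDensity G ε X) (under T (pullI Z ε)) :=
    integrable_finsetSum _ fun n hn => hP.integrableM2_dens (hms n hn) q l ε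
  simpa only [Finset.mul_sum, Finset.sum_mul] using h

end

/-- Elimination of the `z`-derivatives from the boundary terms at infinity. -/
theorem exists_word_bound (m : ℕ) {M K : ℝ} (hM : 0 ≤ M) (hK : 0 ≤ K) (j : ℕ) :
    ∃ P : ℝ, 0 ≤ P ∧ ∀ (S I t : List (Fin 5) → ℝ) (Y q : ℝ), 0 ≤ Y → 0 ≤ q → (∀ w, 0 ≤ S w) →
    (∀ w, w.length = m → q * S w + I w ≤ M * (Y + t w)) →
    (∀ w, w.length = m → 1 ∉ w → t w ≤ Y) →
    (∀ w, w.length = m → 1 ∈ w → t w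
      ≤ K * ∑ w' ∈ (words (Fin 5) m).filter fun w' => w'.count 1 + 1 = w.count 1, I w') →
    ∀ w, w.length = m → w.count 1 = j → q * S w + I w ≤ P * Y := by
  induction j with
  | zero =>
    -- For words without ∂_z the boundary term is itself bounded by Y.
    refine ⟨2 * M, by positivity, fun S I t Y q hY hq hS h1 h2 h3 w hw hj => ?_⟩
    have := mul_le_mul_of_nonneg_left (h2 w hw (List.count_eq_zero.1 hj)) hM
    linarith [h1 w hw]
  | succ j ih =>
    obtain ⟨P, hP, H⟩ := ih
    -- The boundary term is bounded by the quantities I of words with one ∂_z fewer. The estimate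
    -- for those words bounds each of them by P Y, since the interior term is nonnegative.
    refine ⟨M * (1 + K * ((words (Fin 5) m).card * P)), by positivity,
      fun S I t Y q hY hq hS h1 h2 h3 w hw hj => ?_⟩
    have hm : 1 ∈ w := List.count_pos_iff.1 (by omega)
    have h4 : ∑ w' ∈ (words (Fin 5) m).filter (fun w' => w'.count 1 + 1 = w.count 1), I w'
        ≤ (words (Fin 5) m).card * (P * Y) := by
      calc _ ≤ ∑ _w' ∈ (words (Fin 5) m).filter (fun w' => w'.count 1 + 1 = w.count 1), P * Y := by
            refine Finset.sum_le_sum fun w' hw' => ?_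
            obtain ⟨h5, h6⟩ := Finset.mem_filter.1 hw'
            have h7 := H S I t Y q hY hq hS h1 h2 h3 w' (mem_words.1 h5) (by omega)
            linarith [mul_nonneg hq (hS w')]
        _ ≤ _ := by
            rw [Finset.sum_const, nsmul_eq_mul]
            refine mul_le_mul_of_nonneg_right ?_ (by positivity)
            exact_mod_cast Finset.card_filter_le _ _
    have h5 := mul_le_mul_of_nonneg_left ((h3 w hw hm).trans (mul_le_mul_of_nonneg_left h4 hK)) hM
    linarith [h1 w hw]

theorem exists_intH_frs_le (A : ℝ) (m : ℕ) : ∃ C : ℝ, 0 ≤ C ∧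
    ∀ (Λ lam B D A' B' D' T R : ℝ) (s : ℕ) (G : BondiData) (Z : ℝ → S2 → ℝ) (a : VField)
      (ω v f : ST → ℝ) (ψ : ℝ → S2 → ℝ), IsSolution Λ lam A B D A' B' D' T R s G Z a ω v f ψ →
    m ≤ s → ∀ (w : List (Fin 5)), w.length = m → ∀ q l : ℝ,
    intH G T Z (fun ε X => wt q l X * energyH G Z ε (frs ε w (pull v ε)) 1 1 X)
      ≤ C * energyTot G T Z q l s v := by
  obtain ⟨C, h0, H⟩ := exists_energyH_frs_le A m
  refine ⟨C, h0, ?_⟩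
  intro Λ lam B D A' B' D' T R s G Z a ω v f ψ hP hm w hw q l
  have hS := hP.setting
  refine (hS.intH_energyH_le_sum ((Finset.range (m + 1)).sigma fun n => multi n) (fun _ => C)
    (φ := fun ε => frs ε w (pull v ε)) (χ := fun x ε => pullD x.2 v ε)
    (fun ε X hX => hP.cdOn_frs (n := 2) (by omega) X hX) (fun x hx ε X hX => ?_)
    fun ε Y hY => ?_).trans ?_
  · obtain ⟨h1, h2⟩ := Finset.mem_sigma.1 hx
    have h3 := Finset.mem_range.1 h1
    unfold pullD
    rw [mpd_eq_pdl]
    refine CDOn.pdl (n := 2) (wordOf x.2) ((hP.cdOn_v hP.underc_closed).mono ?_) X hX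
    rw [length_wordOf, mem_multi.1 h2]
    omega
  · refine (H _ _ _ _ _ _ _ hS ε (pull v ε) w hw (fun X hX =>
      (hP.cdOn_v hP.underc_closed).mono (by omega : m + 1 ≤ s + 2) X hX) Y hY).trans (le_of_eq ?_)
    rw [Finset.sum_sigma', Finset.mul_sum]
    rfl
  · rw [← Finset.mul_sum]
    refine mul_le_mul_of_nonneg_left ?_ h0
    rw [Finset.sum_sigma (f := fun x : (_ : ℕ) × (Fin 4 → ℕ) => intH G T Z fun ε X =>
      wt q l X * energyH G Z ε (pullD x.2 v ε) 1 1 X)]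
    exact Finset.sum_le_sum_of_subset_of_nonneg (Finset.range_mono (by omega)) fun n _ _ =>
      Finset.sum_nonneg fun α _ => hP.energyTot_term_nonneg q l (pullD α v)

theorem exists_intM2_source_le (lam A : ℝ) (hlam : 0 < lam) (s m : ℕ) (hm : m ≤ s) :
    ∃ c₀ : ℝ, 0 ≤ c₀ ∧ ∀ A' B' D' : ℝ, ∃ C : ℝ, 0 ≤ C ∧
    ∀ (Λ B D T R : ℝ) (G : BondiData) (Z : ℝ → S2 → ℝ) (a : VField) (ω v f : ST → ℝ)
      (ψ : ℝ → S2 → ℝ), IsSolution Λ lam A B D A' B' D' T R s G Z a ω v f ψ →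
    ∀ w : List (Fin 5), w.length = m → ∀ q l : ℝ,
    intM2 G T R Z (fun ε X => wt q l X * (box G ε (frs ε w (pull v ε)) X
        + (∑ i, a.comp ε X i * pd i (frs ε w (pull v ε)) X)
        + pull ω ε X * frs ε w (pull v ε) X) ^ 2)
      ≤ C * sourceTot G T R Z q l s f + c₀ * densTot G T R Z q l m v
        + C * ∑ n ∈ Finset.range m, densTot G T R Z q l n v := by
  obtain ⟨c₀, hc₀, H⟩ := exists_source_le lam A hlam s m hm
  refine ⟨c₀, hc₀, fun A' B' D' => ?_⟩
  obtain ⟨C, hC, H⟩ := H A' B' D'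
  refine ⟨C * (∑ n ∈ Finset.range (s + 1), ((words (Fin 4) n).card : ℝ)) + C, by positivity, ?_⟩
  intro Λ B D T R G Z a ω v f ψ hP w hw q l
  have hS := hP.setting
  have i0 : IntegrableM2 G T Z q l fun ε X =>
      ∑ n ∈ Finset.range (m + 1), sqs n (pull f ε) X := by
    intro ε
    have h : IntegrableOn (fun X => ∑ n ∈ Finset.range (m + 1),
        wt q l X * sqs n (pull f ε) X * volDensity G ε X) (under T (pullI Z ε)) :=
      integrable_finsetSum _ fun n hn =>
        hP.integrableM2_sqs (by have := Finset.mem_range.1 hn; omega) q l ε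
    simpa only [Finset.mul_sum, Finset.sum_mul] using h
  have i1 : IntegrableM2 G T Z q l fun ε X => dens ε m (pull v ε) X :=
    hP.integrableM2_dens (by omega) q l
  have i2 : IntegrableM2 G T Z q l fun ε X =>
      ∑ n ∈ Finset.range m, dens ε n (pull v ε) X := by
    intro ε
    have h : IntegrableOn (fun X => ∑ n ∈ Finset.range m,
        wt q l X * dens ε n (pull v ε) X * volDensity G ε X) (under T (pullI Z ε)) :=
      integrable_finsetSum _ fun n hn =>
        hP.integrableM2_dens (by have := Finset.mem_range.1 hn; omega) q l ε
    simpa only [Finset.mul_sum, Finset.sum_mul] using h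
  have h := hS.intM2_le_sum (q := q) (l := l) (Finset.univ : Finset (Fin 3)) ![C, c₀, C]
    (F := fun ε X => (box G ε (frs ε w (pull v ε)) X
        + (∑ i, a.comp ε X i * pd i (frs ε w (pull v ε)) X)
        + pull ω ε X * frs ε w (pull v ε) X) ^ 2)
    (W := ![fun ε X => ∑ n ∈ Finset.range (m + 1), sqs n (pull f ε) X,
      fun ε X => dens ε m (pull v ε) X, fun ε X => ∑ n ∈ Finset.range m, dens ε n (pull v ε) X])
    (hS.integrableM2 (fun ε X hX => ?_) q l) (fun i _ => ?_) fun ε X hX => ?_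
  · simp only [Fin.sum_univ_three, Matrix.cons_val_zero, Matrix.cons_val_one, Matrix.cons_val] at h
    refine h.trans ?_
    have h1 := mul_le_mul_of_nonneg_left (hP.intM2_sum_sqs_le hm q l) hC
    have h2 := mul_le_mul_of_nonneg_left (hP.intM2_sum_dens_le (by omega : m ≤ s + 1) q l) hC
    have h3 := mul_nonneg hC (hP.sourceTot_nonneg q l)
    have h4 : 0 ≤ C * (∑ n ∈ Finset.range (s + 1), ((words (Fin 4) n).card : ℝ))
        * ∑ n ∈ Finset.range m, densTot G T R Z q l n v :=
      mul_nonneg (by positivity) (Finset.sum_nonneg fun n _ => hP.densTot_nonneg q l n)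
    change _ + c₀ * densTot G T R Z q l m v + _ ≤ _
    linarith
  · refine ContinuousAt.pow (((hS.continuousAt_box hX
      (hP.cdOn_frs (n := 2) (by omega) X hX)).add (tendsto_finsetSum _ fun i _ =>
        ContinuousAt.mul ?_ (hP.continuousAt_pd_frs (by omega) i hX))).add (ContinuousAt.mul ?_ ?_)) 2
    · exact (hP.a_smooth i ε X (hP.underc_closed X hX)).continuousAt
    · exact (hP.ω_smooth ε X (hP.underc_closed X hX)).continuousAt
    · exact (hP.cdOn_frs (n := 0) (by omega)).continuousAt hX
  · fin_cases i
    exacts [i0, i1, i2]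
  · simp only [Fin.sum_univ_three, Matrix.cons_val_zero, Matrix.cons_val_one, Matrix.cons_val]
    have hr := hS.cone.under_subset_region ε hX
    rw [hS.fullOp_eq hr (CDOn.frs (n := 2) ε w ((hP.cdOn_v region_closed).mono (by omega)) X hr) a ω]
    exact H _ _ _ _ _ _ _ _ _ _ _ _ hP ε w hw X hX

/-! ### Induction on the order -/

/-- The basic estimate for every word of length m, summed after the elimination of the z-derivatives
at infinity. The constant c₀ of the energy of the same order precedes A', B', D', so that q can be
chosen afterwards to absorb it. -/
theorem exists_order_estimate (Λ lam A B D : ℝ) (hΛ : Λ < 0) (hlam : 0 < lam) (s m : ℕ)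
    (hm : m ≤ s) : ∃ q₁ c₀ : ℝ, 0 < q₁ ∧ 0 ≤ c₀ ∧ ∀ A' B' D' : ℝ, ∃ C : ℝ, 0 ≤ C ∧
    ∀ (T R : ℝ) (G : BondiData) (Z : ℝ → S2 → ℝ) (a : VField) (ω v f : ST → ℝ)
      (ψ : ℝ → S2 → ℝ), IsSolution Λ lam A B D A' B' D' T R s G Z a ω v f ψ → ∀ q : ℝ, q₁ ≤ q →
    q * densTot G T R Z q (|A| + 1) m v + gdensTot G T q (|A| + 1) m v
      ≤ C * dataTot G T R Z q (|A| + 1) s v f ψ + c₀ * densTot G T R Z q (|A| + 1) m v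
        + C * ∑ n ∈ Finset.range m, densTot G T R Z q (|A| + 1) n v := by
  obtain ⟨M, q₁, hM, hq₁, HB⟩ := basic_estimate Λ lam A B D hΛ hlam
  obtain ⟨K, hK, HK⟩ := exists_tdens_le_of_mem m
  choose P hP0 HP using exists_word_bound m hM.le hK
  obtain ⟨c, hc, HF⟩ := exists_intM2_source_le lam A hlam s m hm
  obtain ⟨C₁, h1, H₁⟩ := exists_intH_frs_le A m
  obtain ⟨C₃, h3, H₃⟩ := exists_tdens_le_of_notMem m
  obtain ⟨Q, hQ⟩ : ∃ Q, Q = (words (Fin 5) m).card * ∑ j ∈ Finset.range (m + 1), P j := ⟨_, rfl⟩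
  have hQ0 : 0 ≤ Q := hQ ▸ mul_nonneg (Nat.cast_nonneg _) (Finset.sum_nonneg fun j _ => hP0 j)
  refine ⟨q₁, Q * c, hq₁, by positivity, fun A' B' D' => ?_⟩
  obtain ⟨C₂, h2, HF⟩ := HF A' B' D'
  refine ⟨Q * (C₁ + C₂ + C₃), by positivity, ?_⟩
  intro T R G Z a ω v f ψ hP q hq
  have hS := hP.setting
  have hq0 : 0 ≤ q := hq₁.le.trans hq
  obtain ⟨l, hl⟩ : ∃ l, l = |A| + 1 := ⟨_, rfl⟩
  rw [← hl] at HB ⊢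
  obtain ⟨E, hE⟩ : ∃ E, E = energyTot G T Z q l s v := ⟨_, rfl⟩
  obtain ⟨N, hN⟩ : ∃ N, N = dirichletTot G T q l s ψ := ⟨_, rfl⟩
  obtain ⟨F, hF⟩ : ∃ F, F = sourceTot G T R Z q l s f := ⟨_, rfl⟩
  obtain ⟨d, hd⟩ : ∃ d, d = densTot G T R Z q l m v := ⟨_, rfl⟩
  obtain ⟨S₀, hS₀⟩ : ∃ S, S = ∑ n ∈ Finset.range m, densTot G T R Z q l n v := ⟨_, rfl⟩
  have hE0 : 0 ≤ E := hE ▸ hP.energyTot_nonneg q l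
  have hN0 : 0 ≤ N := hN ▸ hP.dirichletTot_nonneg q l
  have hF0 : 0 ≤ F := hF ▸ hP.sourceTot_nonneg q l
  have hd0 : 0 ≤ d := hd ▸ hP.densTot_nonneg q l m
  have hS₀0 : 0 ≤ S₀ := hS₀ ▸ Finset.sum_nonneg fun n _ => hP.densTot_nonneg q l n
  -- Everything on the right except the tangential boundary terms of words that contain ∂_z.
  obtain ⟨Y, hY⟩ : ∃ Y, Y = C₁ * E + C₃ * N + C₂ * F + c * d + C₂ * S₀ := ⟨_, rfl⟩
  have hY0 : 0 ≤ Y := by rw [hY]; positivity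
  have key := fun j => HP j
    (fun w => intM2 G T R Z fun ε X => wt q l X
      * ((∑ i, pd i (frs ε w (pull v ε)) X ^ 2) + frs ε w (pull v ε) X ^ 2))
    (fun w => intI G T fun ε X => wt q l X * ∑ i, pd i (frs ε w (pull v ε)) X ^ 2)
    (fun w => intI G T fun ε X => wt q l X * tdens (frs ε w (pull v ε)) X) Y q hY0 hq0
    (fun w => hP.intM2_wt_nonneg fun _ _ => add_nonneg
      (Finset.sum_nonneg fun _ _ => sq_nonneg _) (sq_nonneg _)) ?_ ?_ ?_
  · have hw : ∀ w ∈ words (Fin 5) m,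
        q * (intM2 G T R Z fun ε X => wt q l X
            * ((∑ i, pd i (frs ε w (pull v ε)) X ^ 2) + frs ε w (pull v ε) X ^ 2))
          + (intI G T fun ε X => wt q l X * ∑ i, pd i (frs ε w (pull v ε)) X ^ 2)
        ≤ (∑ j ∈ Finset.range (m + 1), P j) * Y := by
      intro w hw
      have hwm := mem_words.1 hw
      refine (key (w.count 1) w hwm rfl).trans (mul_le_mul_of_nonneg_right ?_ hY0)
      refine Finset.single_le_sum (f := P) (fun j _ => hP0 j) (Finset.mem_range.2 ?_)
      have := List.count_le_length (a := (1 : Fin 5)) (l := w)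
      omega
    have hsum := Finset.sum_le_sum hw
    rw [Finset.sum_add_distrib, ← Finset.mul_sum, Finset.sum_const, nsmul_eq_mul, ← mul_assoc,
      ← hQ] at hsum
    have s1 : d ≤ ∑ w ∈ words (Fin 5) m, intM2 G T R Z fun ε X => wt q l X
        * ((∑ i, pd i (frs ε w (pull v ε)) X ^ 2) + frs ε w (pull v ε) X ^ 2) := by
      have := hS.intM2_le_sum (words (Fin 5) m) (fun _ => 1) (hP.integrableM2_dens (n := m) (by omega) q l)
        (W := fun w ε X => (∑ i, pd i (frs ε w (pull v ε)) X ^ 2) + frs ε w (pull v ε) X ^ 2)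
        (fun w hw => hS.integrableM2 (fun ε X hX => hP.continuousAt_energy
          (by rw [mem_words.1 hw]; omega) hX) q l) fun ε X _ => by simp [dens]
      simpa only [one_mul, hd, densTot] using this
    have s2 : gdensTot G T q l m v ≤ ∑ w ∈ words (Fin 5) m, intI G T fun ε X => wt q l X
        * ∑ i, pd i (frs ε w (pull v ε)) X ^ 2 := by
      have := hS.intI_le_sum (words (Fin 5) m) (fun _ => 1) (hP.integrableI_gdens (n := m) (by omega) q l)
        (W := fun w ε X => ∑ i, pd i (frs ε w (pull v ε)) X ^ 2)
        (fun w hw => hS.integrableI (fun ε X hX => hP.continuousAt_grad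
          (by rw [mem_words.1 hw]; omega) hX) q l) fun ε X _ => by simp [gdens]
      simpa only [one_mul, gdensTot] using this
    have s3 := mul_le_mul_of_nonneg_left s1 hq0
    unfold dataTot
    rw [← hE, ← hN, ← hF, ← hd, ← hS₀]
    have s4 : Q * Y ≤ Q * (C₁ + C₂ + C₃) * (E + N + F) + Q * c * d
        + Q * (C₁ + C₂ + C₃) * S₀ := by
      have t1 : 0 ≤ Q * (C₁ * (N + F + S₀) + C₂ * (E + N) + C₃ * (E + F + S₀)) := by positivity
      rw [hY]
      linarith
    linarith
  -- First hypothesis of the elimination: the basic estimate for X_w v, which is a scalar on the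
  -- sphere.
  · intro w hw
    have hb := HB T R (s + 1) G Z hS (fun ε X i => a.comp ε X i) (pull ω)
      (fun ε X hX i => (hP.a_smooth i ε X (hP.underc_closed X hX)).continuousAt)
      (fun ε X hX => (hP.ω_smooth ε X (hP.underc_closed X hX)).continuousAt)
      (fun ε X hX i => ?_) (fun ε X hX => ?_) (fun ε => frs ε w (pull v ε))
      (Compat.frs (compat_pull v) w) (fun ε X hX => hP.cdOn_frs (n := 2) (by omega) X hX)
      _ (fun ε X _ => rfl) q hq
    · refine hb.trans (mul_le_mul_of_nonneg_left ?_ hM.le)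
      have e1 := H₁ _ _ _ _ _ _ _ _ _ _ _ _ _ _ _ _ _ hP hm w hw q l
      have e2 := HF _ _ _ _ _ _ _ _ _ _ _ _ hP w hw q l
      rw [← hE] at e1
      rw [← hF, ← hd, ← hS₀] at e2
      have e3 : 0 ≤ C₃ * N := by positivity
      have e4 := add_le_add (add_le_add e1 (le_refl (intI G T fun ε X =>
        wt q l X * tdens (frs ε w (pull v ε)) X))) e2
      refine e4.trans ?_
      rw [hY]
      linarith
    · have := hP.a_bound i ε X
        (hS.cone.under_subset_region ε hX) hX.2.2 0 le_rfl 0 (by rw [multi_zero]; simp)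
      rwa [mpd_zero] at this
    · have := hP.ω_bound ε X
        (hS.cone.under_subset_region ε hX) hX.2.2 0 le_rfl 0 (by rw [multi_zero]; simp)
      rwa [mpd_zero] at this
  -- Second hypothesis: without ∂_z the boundary terms are derivatives of the Dirichlet data.
  · intro w hw h1
    have e1 := hS.intI_le_sum (q := q) (l := l) (Finset.range (m + 2)) (fun _ => C₃)
      (F := fun ε X => tdens (frs ε w (pull v ε)) X)
      (W := fun n ε X => tandens n (pullI ψ ε) X)
      (hS.integrableI (fun ε X hX => ?_) q l)
      (fun n hn => hP.integrableI_tandens (by have := Finset.mem_range.1 hn; omega) q l)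
      fun ε Y hY => by
        rw [← Finset.mul_sum]
        exact H₃ _ _ _ _ _ _ _ _ _ _ _ _ _ _ _ _ _ _ hP hm ε w hw h1 Y hY
    · refine e1.trans ?_
      have e2 : ∑ n ∈ Finset.range (m + 2), intI G T (fun ε X => wt q l X * tandens n (pullI ψ ε) X)
          ≤ N := by
        rw [hN]
        exact Finset.sum_le_sum_of_subset_of_nonneg (Finset.range_mono (by omega)) fun n _ _ =>
          hP.intI_wt_nonneg fun _ _ => tandens_nonneg _ _ _
      rw [← Finset.mul_sum, hY]
      have e3 := mul_le_mul_of_nonneg_left e2 h3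
      have e4 : 0 ≤ C₁ * E + C₂ * F + c * d + C₂ * S₀ := by positivity
      linarith
    · have hw' : w.length ≤ s + 1 := by omega
      exact (((hP.continuousAt_pd_frs hw' 0 hX).pow 2).add
        ((hP.continuousAt_pd_frs hw' 2 hX).pow 2)).add ((hP.continuousAt_pd_frs hw' 3 hX).pow 2)
  -- Third hypothesis: with ∂_z they are gradients of words with one ∂_z fewer.
  · intro w hw h1
    have e1 := hS.intI_le_sum (q := q) (l := l)
      ((words (Fin 5) m).filter fun w' => w'.count 1 + 1 = w.count 1) (fun _ => K)
      (F := fun ε X => tdens (frs ε w (pull v ε)) X)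
      (W := fun w' ε X => ∑ i, pd i (frs ε w' (pull v ε)) X ^ 2)
      (hS.integrableI (fun ε X hX => ?_) q l)
      (fun w' hw' => hS.integrableI (fun ε X hX => hP.continuousAt_grad
        (by rw [mem_words.1 (Finset.mem_filter.1 hw').1]; omega) hX) q l)
      fun ε Y hY => by
        rw [← Finset.mul_sum]
        exact HK _ (isOpen_contDiffAt (m + 1) (pull v ε)) ε (pull v ε) (fun _ h => h) w hw h1 _
          (hP.cdOn_v_infty.mono (by omega : m + 1 ≤ s + 2) _ (liftI_infty hY)) hY.2.2
    · rwa [← Finset.mul_sum] at e1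
    · have hw' : w.length ≤ s + 1 := by omega
      exact (((hP.continuousAt_pd_frs hw' 0 hX).pow 2).add
        ((hP.continuousAt_pd_frs hw' 2 hX).pow 2)).add ((hP.continuousAt_pd_frs hw' 3 hX).pow 2)

/-- The estimate for all frame derivatives. -/
theorem exists_frame_estimate (Λ lam A B D : ℝ) (hΛ : Λ < 0) (hlam : 0 < lam) (s m : ℕ)
    (hm : m ≤ s) : ∃ q₀ : ℝ, 1 ≤ q₀ ∧ ∀ A' B' D' : ℝ, ∃ C : ℝ, 0 ≤ C ∧
    ∀ (T R : ℝ) (G : BondiData) (Z : ℝ → S2 → ℝ) (a : VField) (ω v f : ST → ℝ)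
      (ψ : ℝ → S2 → ℝ), IsSolution Λ lam A B D A' B' D' T R s G Z a ω v f ψ → ∀ q : ℝ, q₀ ≤ q →
    ∀ n ≤ m, q * densTot G T R Z q (|A| + 1) n v + gdensTot G T q (|A| + 1) n v
      ≤ C * dataTot G T R Z q (|A| + 1) s v f ψ := by
  have step : ∀ m ≤ s, ∃ q₀ : ℝ, 1 ≤ q₀ ∧ ∀ A' B' D' : ℝ, ∃ C : ℝ, 0 ≤ C ∧
      ∀ (T R : ℝ) (G : BondiData) (Z : ℝ → S2 → ℝ) (a : VField) (ω v f : ST → ℝ)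
        (ψ : ℝ → S2 → ℝ), IsSolution Λ lam A B D A' B' D' T R s G Z a ω v f ψ → ∀ q : ℝ, q₀ ≤ q →
      q * densTot G T R Z q (|A| + 1) m v + gdensTot G T q (|A| + 1) m v
        ≤ C * (dataTot G T R Z q (|A| + 1) s v f ψ
          + ∑ n ∈ Finset.range m, q * densTot G T R Z q (|A| + 1) n v) := by
    intro m hm
    obtain ⟨q₁, c₀, hq₁, hc₀, H⟩ := exists_order_estimate Λ lam A B D hΛ hlam s m hm
    -- For q ≥ 2 c₀ the energy of order m on the right is at most half of that on the left.
    refine ⟨q₁ + 2 * c₀ + 1, by linarith, fun A' B' D' => ?_⟩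
    obtain ⟨C, hC, H⟩ := H A' B' D'
    refine ⟨2 * C, by positivity, fun T R G Z a ω v f ψ hP q hq => ?_⟩
    have h := H T R G Z a ω v f ψ hP q (by linarith)
    have h1 := mul_le_mul_of_nonneg_right (by linarith : 2 * c₀ ≤ q)
      (hP.densTot_nonneg q (|A| + 1) m)
    have h2 := hP.gdensTot_nonneg q (|A| + 1) m
    -- Since q ≥ 1, the lower orders may carry the factor q, in which form the induction bounds
    -- them. Their constant C therefore imposes no condition on q.
    have h3 : ∑ n ∈ Finset.range m, densTot G T R Z q (|A| + 1) n v
        ≤ ∑ n ∈ Finset.range m, q * densTot G T R Z q (|A| + 1) n v :=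
      Finset.sum_le_sum fun n _ =>
        le_mul_of_one_le_left (hP.densTot_nonneg q _ n) (by linarith)
    have h4 := mul_le_mul_of_nonneg_left h3 hC
    linarith
  induction m with
  | zero =>
    obtain ⟨q₀, hq₀, H⟩ := step 0 hm
    refine ⟨q₀, hq₀, fun A' B' D' => ?_⟩
    obtain ⟨C, hC, H⟩ := H A' B' D'
    refine ⟨C, hC, fun T R G Z a ω v f ψ hP q hq n hn => ?_⟩
    rw [Nat.le_zero.1 hn]
    simpa using H T R G Z a ω v f ψ hP q hq
  | succ m ih =>
    obtain ⟨q₁, hq₁, H₁⟩ := ih (by omega)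
    obtain ⟨q₂, hq₂, H₂⟩ := step (m + 1) hm
    refine ⟨max q₁ q₂, hq₁.trans (le_max_left _ _), fun A' B' D' => ?_⟩
    obtain ⟨C₁, hC₁, H₁⟩ := H₁ A' B' D'
    obtain ⟨C₂, hC₂, H₂⟩ := H₂ A' B' D'
    refine ⟨C₁ + C₂ * (1 + (m + 1) * C₁), by positivity, fun T R G Z a ω v f ψ hP q hq n hn => ?_⟩
    have hD : 0 ≤ dataTot G T R Z q (|A| + 1) s v f ψ := add_nonneg (add_nonneg
      (hP.energyTot_nonneg q _) (hP.dirichletTot_nonneg q _)) (hP.sourceTot_nonneg q _)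
    have i1 := H₁ T R G Z a ω v f ψ hP q ((le_max_left _ _).trans hq)
    have i2 := H₂ T R G Z a ω v f ψ hP q ((le_max_right _ _).trans hq)
    have p1 : 0 ≤ C₂ * (1 + (m + 1) * C₁) * dataTot G T R Z q (|A| + 1) s v f ψ :=
      mul_nonneg (by positivity) hD
    have p2 := mul_nonneg hC₁ hD
    rcases Nat.le_succ_iff.1 hn with hn | rfl
    · linarith [i1 n hn]
    -- The top order: all lower orders are replaced by the data through the induction hypothesis.
    · have h3 : ∑ n ∈ Finset.range (m + 1), q * densTot G T R Z q (|A| + 1) n v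
          ≤ (m + 1) * (C₁ * dataTot G T R Z q (|A| + 1) s v f ψ) := by
        have := Finset.sum_le_card_nsmul (Finset.range (m + 1))
          (fun n => q * densTot G T R Z q (|A| + 1) n v) _ fun n hn =>
            (le_add_of_nonneg_right (hP.gdensTot_nonneg q (|A| + 1) n)).trans
              (i1 n (by have := Finset.mem_range.1 hn; omega))
        rw [Finset.card_range, nsmul_eq_mul] at this
        exact_mod_cast this
      have h4 := mul_le_mul_of_nonneg_left h3 hC₂
      linarith

/-! ### Norms -/

/-- No signs are required, because the square root of a negative number has the value 0. -/
theorem sqrt_add_le_add_sqrt (x y : ℝ) : √(x + y) ≤ √x + √y := by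
  have hx := Real.sqrt_nonneg x
  have hy := Real.sqrt_nonneg y
  have h1 : x ≤ √x ^ 2 := (Real.sqrt_le_left hx).1 le_rfl
  rw [Real.sqrt_le_left (add_nonneg hx hy)]
  have h2 : y ≤ √y ^ 2 := (Real.sqrt_le_left hy).1 le_rfl
  nlinarith [mul_nonneg hx hy]

theorem sqrt_sum_le_sum_sqrt {ι : Type*} (s : Finset ι) (x : ι → ℝ) :
    √(∑ i ∈ s, x i) ≤ ∑ i ∈ s, √(x i) := by
  classical
  induction s using Finset.induction_on with
  | empty => simp
  | insert a s ha ih =>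
    rw [Finset.sum_insert ha, Finset.sum_insert ha]
    exact (sqrt_add_le_add_sqrt _ _).trans (by linarith)

theorem sqrt_dataTot_le (G : BondiData) (T R : ℝ) (Z : ℝ → S2 → ℝ) (q l : ℝ) (s : ℕ)
    (v f : ST → ℝ) (ψ : ℝ → S2 → ℝ) : √(dataTot G T R Z q l s v f ψ)
      ≤ (∑ n ∈ Finset.range (s + 1), ∑ α ∈ multi n, nullEnergy G T Z q l (pullD α v))
        + normI G T q l (s + 1) (pullI ψ) + normM2 G T R Z q l s (pull f) := by
  have h1 : √(energyTot G T Z q l s v)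
      ≤ ∑ n ∈ Finset.range (s + 1), ∑ α ∈ multi n, nullEnergy G T Z q l (pullD α v) :=
    (sqrt_sum_le_sum_sqrt _ _).trans (Finset.sum_le_sum fun n _ => sqrt_sum_le_sum_sqrt _ _)
  have h2 : √(dirichletTot G T q l s ψ) ≤ normI G T q l (s + 1) (pullI ψ) :=
    sqrt_sum_le_sum_sqrt _ _
  have h3 : √(sourceTot G T R Z q l s f) ≤ normM2 G T R Z q l s (pull f) :=
    sqrt_sum_le_sum_sqrt _ _
  unfold dataTot
  refine (sqrt_add_le_add_sqrt _ _).trans ?_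
  linarith [sqrt_add_le_add_sqrt (energyTot G T Z q l s v) (dirichletTot G T q l s ψ)]

theorem exists_mdens_le_densTot (s j : ℕ) (hj : j ≤ 1) : ∃ C : ℝ, 0 ≤ C ∧
    ∀ (Λ lam A B D A' B' D' T R : ℝ) (G : BondiData) (Z : ℝ → S2 → ℝ) (a : VField)
      (ω v f : ST → ℝ) (ψ : ℝ → S2 → ℝ), IsSolution Λ lam A B D A' B' D' T R s G Z a ω v f ψ →
    ∀ α ∈ multi s, ∀ q l : ℝ, intM2 G T R Z (fun ε X => wt q l X * mdens j (pullD α v ε) X)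
      ≤ C * ∑ n ∈ Finset.range (s + 1), densTot G T R Z q l n v := by
  obtain ⟨C, hC, H⟩ := exists_pdl_sq_le_dens s
  refine ⟨(multi j).card * C, by positivity, ?_⟩
  intro Λ lam A B D A' B' D' T R G Z a ω v f ψ hP α hα q l
  have hl : ∀ β ∈ multi j, (wordOf β ++ wordOf α).length ≤ s + 1 := fun β hβ => by
    rw [List.length_append, length_wordOf, length_wordOf, mem_multi.1 hα, mem_multi.1 hβ]
    omega
  have e : ∀ (ε : Bool) (X : Coord), mdens j (pullD α v ε) X
      = ∑ β ∈ multi j, pdl (wordOf β ++ wordOf α) (pull v ε) X ^ 2 := fun ε X => by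
    unfold mdens pullD
    refine Finset.sum_congr rfl fun β _ => ?_
    rw [mpd_eq_pdl β, mpd_eq_pdl α, pdl_append]
  simp only [e]
  rw [Finset.mul_sum]
  refine hP.setting.intM2_le_sum (Finset.range (s + 1)) (fun _ => (multi j).card * C)
    (F := fun ε X => ∑ β ∈ multi j, pdl (wordOf β ++ wordOf α) (pull v ε) X ^ 2)
    (W := fun n ε X => dens ε n (pull v ε) X)
    (hP.setting.integrableM2 (fun ε X hX => tendsto_finsetSum _ fun β hβ => ?_) q l)
    (fun n hn => hP.integrableM2_dens (by have := Finset.mem_range.1 hn; omega) q l)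
    fun ε X hX => ?_
  · refine ContinuousAt.pow (CDOn.continuousAt (n := 0) (CDOn.pdl _
      ((hP.cdOn_v hP.underc_closed).mono ?_)) hX) 2
    have := hl β hβ
    omega
  · rw [← Finset.mul_sum, mul_assoc, ← nsmul_eq_mul]
    exact Finset.sum_le_card_nsmul _ _ _ fun β hβ => H _ _ (hP.setting.cone.isOpen_region ε)
      (hP.setting.cone.under_subset_region ε) (fun X hX => hX.2.2) ε (pull v ε)
      ((hP.cdOn_v region_closed).mono (by omega)) X hX _ (hl β hβ)

/-- On 𝓘 only gradients of frame derivatives are estimated. The value of v there is the Dirichlet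
datum, which supplies the missing term of order zero. -/
theorem exists_tandens_le_gdensTot (s : ℕ) : ∃ C : ℝ, 0 ≤ C ∧
    ∀ (Λ lam A B D A' B' D' T R : ℝ) (G : BondiData) (Z : ℝ → S2 → ℝ) (a : VField)
      (ω v f : ST → ℝ) (ψ : ℝ → S2 → ℝ), IsSolution Λ lam A B D A' B' D' T R s G Z a ω v f ψ →
    ∀ α ∈ multi (s + 1), ∀ q l : ℝ, intI G T (fun ε X => wt q l X * tandens 0 (pullD α v ε) X)
      ≤ C * (dirichletTot G T q l s ψ + ∑ n ∈ Finset.range (s + 1), gdensTot G T q l n v) := by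
  obtain ⟨C, hC, H⟩ := exists_pdl_sq_le_gdens (s + 1)
  refine ⟨(multiTan 0).card * C, by positivity, ?_⟩
  intro Λ lam A B D A' B' D' T R G Z a ω v f ψ hP α hα q l
  have hl : ∀ β ∈ multiTan 0, (wordOf β ++ wordOf α).length ≤ s + 1 := fun β hβ => by
    rw [List.length_append, length_wordOf, length_wordOf, mem_multi.1 hα,
      mem_multi.1 (Finset.mem_filter.1 hβ).1]
    omega
  have e : ∀ (ε : Bool) (X : Coord), tandens 0 (pullD α v ε) X
      = ∑ β ∈ multiTan 0, pdl (wordOf β ++ wordOf α) (pull v ε) X ^ 2 := fun ε X => by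
    unfold tandens pullD
    refine Finset.sum_congr rfl fun β _ => ?_
    rw [mpd_eq_pdl β, mpd_eq_pdl α, pdl_append]
  have h0 : (0 : Fin 4 → ℕ) ∈ multiTan 0 := Finset.mem_filter.2 ⟨by rw [multi_zero]; simp, rfl⟩
  simp only [e]
  -- Index 0 stands for the Dirichlet datum, and index n + 1 for the gradients of order n.
  have h := hP.setting.intI_le_sum (q := q) (l := l) (Finset.range (s + 2))
    (fun _ => (multiTan 0).card * C)
    (F := fun ε X => ∑ β ∈ multiTan 0, pdl (wordOf β ++ wordOf α) (pull v ε) X ^ 2)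
    (W := fun n ε X => Nat.casesOn n (tandens 0 (pullI ψ ε) X) fun n => gdens ε n (pull v ε) X)
    (hP.setting.integrableI (fun ε X hX => tendsto_finsetSum _ fun β hβ => ?_) q l)
    (fun n hn => ?_) fun ε Y hY => ?_
  · refine h.trans ?_
    rw [← Finset.mul_sum, Finset.sum_range_succ']
    refine mul_le_mul_of_nonneg_left ?_ (by positivity)
    rw [add_comm]
    refine add_le_add ?_ le_rfl
    exact Finset.single_le_sum (f := fun n => intI G T fun ε X => wt q l X
      * tandens n (pullI ψ ε) X) (fun n _ => hP.intI_wt_nonneg fun _ _ => tandens_nonneg _ _ _)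
      (Finset.mem_range.2 (Nat.succ_pos _))
  · refine ContinuousAt.pow (CDOn.continuousAt (n := 0) (CDOn.pdl _
      ((hP.cdOn_v hP.underc_closed).mono ?_)) hX) 2
    have := hl β hβ
    omega
  · have hn' := Finset.mem_range.1 hn
    cases n with
    | zero => exact hP.integrableI_tandens (by omega) q l
    | succ n => exact hP.integrableI_gdens (by omega) q l
  · rw [← Finset.mul_sum, mul_assoc, ← nsmul_eq_mul, Finset.sum_range_succ']
    refine Finset.sum_le_card_nsmul _ _ _ fun β hβ => ?_
    have hi := liftI_infty hY
    refine (H _ {liftI Y} (isOpen_contDiffAt (s + 1) (pull v ε)) (singleton_subset_iff.2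
      (hP.cdOn_v_infty.mono (by omega : s + 1 ≤ s + 2) _ hi))
      (fun X h => by rw [mem_singleton_iff.1 h]; exact hY.2.2) ε (pull v ε) (fun _ h => h) _ rfl _
      (hl β hβ)).trans (mul_le_mul_of_nonneg_left ?_ hC)
    rw [add_comm]
    refine add_le_add le_rfl ?_
    rw [hP.pull_eq_pullI hi]
    have := Finset.single_le_sum (f := fun β => mpd β (pullI ψ ε) (liftI Y) ^ 2)
      (fun _ _ => sq_nonneg _) h0
    rwa [mpd_zero] at this

/-- The estimate of higher order for the solutions of the wave equation. -/
theorem exists_higher_estimate (Λ lam A B D : ℝ) (hΛ : Λ < 0) (hlam : 0 < lam) (s : ℕ) :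
    ∃ q₀ : ℝ, 1 ≤ q₀ ∧ ∀ A' B' D' : ℝ, ∃ C : ℝ, 0 < C ∧
    ∀ (T R : ℝ) (G : BondiData) (Z : ℝ → S2 → ℝ) (a : VField) (ω v f : ST → ℝ)
      (ψ : ℝ → S2 → ℝ), IsSolution Λ lam A B D A' B' D' T R s G Z a ω v f ψ → ∀ q : ℝ, q₀ ≤ q →
    (∑ α ∈ multi s, √q * normM2 G T R Z q (|A| + 1) 1 (pullD α v))
        + ∑ α ∈ multi (s + 1), normI G T q (|A| + 1) 0 (pullD α v)
      ≤ C * √(dataTot G T R Z q (|A| + 1) s v f ψ) := by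
  obtain ⟨q₀, hq₀, H⟩ := exists_frame_estimate Λ lam A B D hΛ hlam s s le_rfl
  obtain ⟨C₀, h0, H₀⟩ := exists_mdens_le_densTot s 0 zero_le_one
  obtain ⟨C₁, h1, H₁⟩ := exists_mdens_le_densTot s 1 le_rfl
  obtain ⟨C₂, h2, H₂⟩ := exists_tandens_le_gdensTot s
  refine ⟨q₀, hq₀, fun A' B' D' => ?_⟩
  obtain ⟨C, hC, H⟩ := H A' B' D'
  refine ⟨(multi s).card * (√(C₀ * ((s + 1) * C)) + √(C₁ * ((s + 1) * C)))
    + (multi (s + 1)).card * √(C₂ * (1 + (s + 1) * C)) + 1, by positivity, ?_⟩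
  intro T R G Z a ω v f ψ hP q hq
  have hq0 : 0 ≤ q := by linarith
  obtain ⟨l, hl⟩ : ∃ l, l = |A| + 1 := ⟨_, rfl⟩
  have hn := H T R G Z a ω v f ψ hP q hq
  rw [← hl] at hn ⊢
  obtain ⟨d, hd⟩ : ∃ d, d = dataTot G T R Z q l s v f ψ := ⟨_, rfl⟩
  have hd0 : 0 ≤ d := hd ▸ add_nonneg (add_nonneg
    (hP.energyTot_nonneg q l) (hP.dirichletTot_nonneg q l)) (hP.sourceTot_nonneg q l)
  have hN : dirichletTot G T q l s ψ ≤ d := by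
    rw [hd, dataTot]
    linarith [hP.energyTot_nonneg q l, hP.sourceTot_nonneg q l]
  rw [← hd] at hn ⊢
  have hS : q * ∑ n ∈ Finset.range (s + 1), densTot G T R Z q l n v ≤ (s + 1) * C * d := by
    rw [Finset.mul_sum]
    have := Finset.sum_le_card_nsmul (Finset.range (s + 1))
      (fun n => q * densTot G T R Z q l n v) (C * d) fun n h =>
        (le_add_of_nonneg_right (hP.gdensTot_nonneg q l n)).trans
          (hn n (Nat.lt_succ_iff.1 (Finset.mem_range.1 h)))
    rw [Finset.card_range, nsmul_eq_mul, ← mul_assoc] at this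
    exact_mod_cast this
  have hJ : ∑ n ∈ Finset.range (s + 1), gdensTot G T q l n v ≤ (s + 1) * C * d := by
    have := Finset.sum_le_card_nsmul (Finset.range (s + 1))
      (fun n => gdensTot G T q l n v) (C * d) fun n h =>
        (le_add_of_nonneg_left (mul_nonneg hq0 (hP.densTot_nonneg q l n))).trans
          (hn n (Nat.lt_succ_iff.1 (Finset.mem_range.1 h)))
    rw [Finset.card_range, nsmul_eq_mul, ← mul_assoc] at this
    exact_mod_cast this
  -- The factor q of the interior energies becomes √q in the norms.
  have key : ∀ (c x : ℝ), 0 ≤ c → x ≤ c * ∑ n ∈ Finset.range (s + 1), densTot G T R Z q l n v →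
      √q * √x ≤ √(c * ((s + 1) * C)) * √d := by
    intro c x hc hx
    rw [← Real.sqrt_mul hq0, ← Real.sqrt_mul (by positivity)]
    refine Real.sqrt_le_sqrt ?_
    have t1 := mul_le_mul_of_nonneg_left hx hq0
    have t2 := mul_le_mul_of_nonneg_left hS hc
    linarith
  have hM : ∀ α ∈ multi s, √q * normM2 G T R Z q l 1 (pullD α v)
      ≤ (√(C₀ * ((s + 1) * C)) + √(C₁ * ((s + 1) * C))) * √d := by
    intro α hα
    have e : normM2 G T R Z q l 1 (pullD α v)
        = √(intM2 G T R Z fun ε X => wt q l X * mdens 0 (pullD α v ε) X)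
          + √(intM2 G T R Z fun ε X => wt q l X * mdens 1 (pullD α v ε) X) := by
      unfold normM2
      rw [Finset.sum_range_succ, Finset.sum_range_one]
      rfl
    rw [e, mul_add, add_mul]
    exact add_le_add (key _ _ h0 (H₀ _ _ _ _ _ _ _ _ _ _ _ _ _ _ _ _ _ hP α hα q l))
      (key _ _ h1 (H₁ _ _ _ _ _ _ _ _ _ _ _ _ _ _ _ _ _ hP α hα q l))
  have hI : ∀ α ∈ multi (s + 1), normI G T q l 0 (pullD α v)
      ≤ √(C₂ * (1 + (s + 1) * C)) * √d := by
    intro α hα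
    have e : normI G T q l 0 (pullD α v)
        = √(intI G T fun ε X => wt q l X * tandens 0 (pullD α v ε) X) := by
      unfold normI
      rw [Finset.sum_range_one]
      rfl
    rw [e, ← Real.sqrt_mul (by positivity)]
    refine Real.sqrt_le_sqrt ((H₂ _ _ _ _ _ _ _ _ _ _ _ _ _ _ _ _ _ hP α hα q l).trans ?_)
    have t := mul_le_mul_of_nonneg_left (add_le_add hN hJ) h2
    linarith
  have r1 := Finset.sum_le_card_nsmul _ _ _ hM
  have r2 := Finset.sum_le_card_nsmul _ _ _ hI
  rw [nsmul_eq_mul] at r1 r2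
  linarith [Real.sqrt_nonneg d]

end NullTimelike

end

open NullTimelike in
theorem mainTheorem6 (Λ lam A B D : ℝ) (hΛ : Λ < 0) (hlam : 0 < lam) :
    ∃ l : ℝ, 0 < l ∧ ∀ k : ℕ, 2 ≤ k → ∃ q₀ : ℝ, 0 < q₀ ∧ ∀ A' B' D' : ℝ, ∃ C : ℝ, 0 < C ∧
      ∀ (T R : ℝ) (G : BondiData) (Z : ℝ → S2 → ℝ) (a : VField) (ω v f : ST → ℝ)
        (ψ₂ : ℝ → S2 → ℝ),
        0 < T → 0 < R →
        IsAsymptoticallyAdS G Λ T R k →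
        IsRegularNullCone G T R Z →
        IsElliptic G T R Z lam →
        (∀ i j, CBound T R Z 1 A (fun ε X => gUp G ε X i j)) →
        (∀ i j, CBound T R Z k A' (fun ε X => gUp G ε X i j)) →
        (∀ i, IsCUpTo T R Z (k - 1) (fun ε X => a.comp ε X i)) →
        (∀ i, CBound T R Z 0 B (fun ε X => a.comp ε X i)) →
        (∀ i, CBound T R Z (k - 1) B' (fun ε X => a.comp ε X i)) →
        IsCUpTo T R Z (k - 1) (pull ω) →
        CBound T R Z 0 D (pull ω) →
        CBound T R Z (k - 1) D' (pull ω) →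
        IsCUpTo T R Z (k + 1) (pull v) →
        SolvesWave G T R Z a ω v f →
        (∀ τ ∈ Set.Icc 0 T, ∀ y, v (τ, 0, y) = ψ₂ τ y) →
        ∀ q : ℝ, q₀ ≤ q →
          (∑ α ∈ multi (k - 1), Real.sqrt q * normM2 G T R Z q l 1 (pullD α v))
              + ∑ α ∈ multi k, normI G T q l 0 (pullD α v)
            ≤ C * ((∑ n ∈ Finset.range k, ∑ α ∈ multi n, nullEnergy G T Z q l (pullD α v))
              + normI G T q l k (pullI ψ₂)
              + normM2 G T R Z q l (k - 1) (pull f)) := by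
  -- Large enough for the coercivity condition A + 1 ≤ l, and positive for every sign of A.
  refine ⟨|A| + 1, by positivity, fun k hk => ?_⟩
  -- The number s = k - 1 is the maximal length of the words to which the basic estimate is applied.
  -- The gradient adds the last derivative.
  obtain ⟨s, rfl⟩ : ∃ s, k = s + 1 := ⟨k - 1, by omega⟩
  obtain ⟨q₀, hq₀, H⟩ := exists_higher_estimate Λ lam A B D hΛ hlam s
  refine ⟨q₀, by linarith, fun A' B' D' => ?_⟩
  obtain ⟨C, hC, H⟩ := H A' B' D'
  refine ⟨C, hC, ?_⟩
  intro T R G Z a ω v f ψ₂ hT hR hG hZ hell hg hg' ha hB hB' hω hD hD' hv hwave hψ q hq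
  have hP : IsSolution Λ lam A B D A' B' D' T R s G Z a ω v f ψ₂ :=
    ⟨⟨hΛ, hlam, hT, hR, hk, hG, hZ, hell, hg⟩, hg', ha, hB, hB', hω, hD, hD', hv, hwave, hψ⟩
  exact (H T R G Z a ω v f ψ₂ hP q hq).trans
    (mul_le_mul_of_nonneg_left (sqrt_dataTot_le G T R Z q (|A| + 1) s v f ψ₂) hC.le)
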